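/- Let $k\ge 3$ and let $N$, $N'$ be smooth (Hausdorff, second countable) manifolds of dimension $k+1$. **$Gl(2)$-structures.** Let $V_k$ be the $Gl(2,\mathbb R)$-module of real binary forms of degree $k$, with $Gl(2,\mathbb R)$ acting by linear substitutions. A $Gl(2)$-structure $S$ on $N$ is a smooth field of identifications (frames) $\sigma: V_k\to T_xN$, where the frames at $x$ form one orbit under precomposition with the substitutions $g\in Gl(2,\mathbb R)$ and the module automorphisms $c\in\mathbb R^*$ of $V_k$; equivalently, a smooth field of rational normal curves $C_x\subset \mathbb P(T_xN)$, where $C_x$ consists of the lines $\ell=\mathbb R\,\sigma(\lambda^k)$, $\lambda$ a nonzero linear form. Two structures (or their germs at two points) are equivalent if a (local) diffeomorphism carries frames to frames. $S$ is flat near $x$ if there are local coordinates around $x$ whose coordinate frames belong to $S$ ($V_k\cong\mathbb R^{k+1}$ by coefficients). An infinitesimal symmetry is a smooth vector field whose local flow preserves the structure. **Associated regular pair.** A pair of distributions $\mathcal X\subset\mathcal D$ of ranks $1,2$ on a manifold $M$ is regular (with parameter $k$) if $\mathrm{rk}\,\mathrm{ad}^i_{\mathcal X}\mathcal D=i+2$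 for $1\le i\le k$ and $\mathrm{ad}^k_{\mathcal X}\mathcal D=TM$. The pair associated with $S$ lives on $M=\{(x,\ell): \ell\in C_x\}$, with $q:M\to N$ the projection, $\mathcal X=\ker q_*$ and $\mathcal D_{(x,\ell)}=q_*^{-1}(\ell)$. **Canonical bundle and frame.** A local frame $(X,V)$ of $\mathcal D$ with $X$ spanning $\mathcal X$ is projective–normal if $\mathrm{ad}_X^{k+1}V\in\mathrm{span}(X,V,\mathrm{ad}_XV,\dots,\mathrm{ad}_X^{k-2}V)$. Let $\pi:E\to M$ be the bundle whose fibre over $m$ consists of the pairs $p=(v,j)$ of a nonzero $v\in\mathcal D(m)/\mathcal X(m)$ and a 1-jet $j$ at $m$, along the integral curve of $\mathcal X$, of a nonvanishing section of $\mathcal X$. It is a principal bundle: $c\in Gl(1)$ acts by $v\mapsto cv$, and $\begin{pmatrix}a&b\\0&1\end{pmatrix}\in Aff(1)$ sends the jet of $X$ to that of $fX$ with $f(m)=1/a$, $X(f)(m)=2b/a$. Let $\mathbf G,\mathbf F^0,\mathbf F^1$ be the fundamental vector fields of $(1)\in\mathfrak{gl}(1)$, $\begin{pmatrix}1&0\\0&0\end{pmatrix},\begin{pmatrix}0&1\\0&0\end{pmatrix}\in\mathfrak{aff}(1)$,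 and let $\widetilde{\mathcal X}$ be the line field on $E$ whose line at $p$ is spanned by $ds(X)$ for the sections $s$ of $E$ through $p$ defined by projective–normal frames $(X,V)$. A frame $(\mathbf G,\mathbf F^0,\mathbf F^1,\mathbf X,\mathbf V^0,\dots,\mathbf V^k)$ on $E$ is adapted if, at $p=(v,j)$, $\pi_*\mathbf V^0\equiv v \bmod \mathcal X$, $\pi_*\mathbf X$ is the value of $j$, $\mathbf X\in\widetilde{\mathcal X}$, and $\mathbf V^i=\mathrm{ad}^i_{\mathbf X}\mathbf V^0$ for all $i$. It is canonical if moreover $T^{01}_0=T^{01}_1=T^{01}_2=T^{03}_3=0$, where $[\mathbf V^a,\mathbf V^b]\equiv\sum_r T^{ab}_r\mathbf V^r$ modulo $\mathbf X,\mathbf G,\mathbf F^0,\mathbf F^1$. **Statement.** For every $Gl(2)$-structure $S$ on $N$ (and $S'$ on $N'$): 1. The pair associated with $S$ is regular, and there is exactly one canonical frame on its canonical bundle $E$. 2. $S$ and $S'$ are equivalent if and only if there is a diffeomorphism $E\to E'$ which commutes with the actions of $Gl(1)\oplus Aff(1)$ and carries the canonical frame to the canonical frame. The germs of $S$ at $x$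 and of $S'$ at $x'$ are equivalent if and only if, for some $p\in E$ over $x$ and $p'\in E'$ over $x'$, there is a diffeomorphism from a neighbourhood of $p$ onto a neighbourhood of $p'$ which sends $p$ to $p'$ and carries the canonical frame to the canonical frame. 3. For every $x\in N$, the algebra of germs at $x$ of infinitesimal symmetries of $S$ has dimension $k+5$ if and only if $S$ is flat near $x$. If $N$ is connected and the algebra of infinitesimal symmetries of $S$ defined on all of $N$ has dimension $k+5$, then $S$ is flat near every point. -/

import Mathlib

open Set Filter Topology
open scoped Manifold ContDiff

noncomputable section

/-- A smooth atlas on a bare set `Z`, given by injective coordinate maps `coord i` on pieces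
`source i` covering `Z`, with smooth transition maps and open overlaps. -/
structure CoordAtlas (H : Type*) [NormedAddCommGroup H] [NormedSpace ℝ H] (Z : Type*) where
  Idx : Type*
  source : Idx → Set Z
  coord : Idx → Z → H
  injOn : ∀ i, InjOn (coord i) (source i)
  cover : ∀ z, ∃ i, z ∈ source i
  trans : ∀ i j z, z ∈ source i → z ∈ source j → ∃ g : H → H, ContDiffAt ℝ ∞ g (coord i z) ∧
    ∀ᶠ u in 𝓝 (coord i z), ∃ w, w ∈ source i ∧ w ∈ source j ∧ coord i w = u ∧ coord j w = g u

namespace CoordAtlas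

variable {H : Type*} [NormedAddCommGroup H] [NormedSpace ℝ H] {Z : Type*} (A : CoordAtlas H Z)

/-- The `i`-th chart (the point `z` only witnesses that `Z` is nonempty). -/
def chart (i : A.Idx) (z : Z) : PartialEquiv Z H :=
  haveI : Nonempty Z := ⟨z⟩
  (A.injOn i).bijOn_image.toPartialEquiv (A.coord i) (A.source i) (A.coord i '' A.source i)

theorem chart_symm_apply (i : A.Idx) (z : Z) {w : Z} (hw : w ∈ A.source i) :
    (A.chart i z).symm (A.coord i w) = w :=
  (A.chart i z).left_inv hw

theorem trans_source_iff (i j : A.Idx) (z z' : Z) (u : H) :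
    u ∈ ((A.chart i z).symm.trans (A.chart j z')).source ↔
      ∃ w, w ∈ A.source i ∧ w ∈ A.source j ∧ A.coord i w = u := by
  rw [PartialEquiv.trans_source]
  constructor
  · rintro ⟨⟨w, hw, rfl⟩, h2⟩
    refine ⟨w, hw, ?_, rfl⟩
    have h3 : (A.chart i z).symm (A.coord i w) ∈ A.source j := h2
    rwa [A.chart_symm_apply i z hw] at h3
  · rintro ⟨w, hw, hw', rfl⟩
    refine ⟨⟨w, hw, rfl⟩, ?_⟩
    change (A.chart i z).symm (A.coord i w) ∈ A.source j
    rwa [A.chart_symm_apply i z hw]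

theorem isOpen_trans (i j : A.Idx) (z z' : Z) :
    IsOpen ((A.chart i z).symm.trans (A.chart j z')).source := by
  rw [isOpen_iff_eventually]
  intro u hu
  obtain ⟨w, hi, hj, rfl⟩ := (A.trans_source_iff i j z z' u).1 hu
  obtain ⟨g, -, hg⟩ := A.trans i j w hi hj
  filter_upwards [hg] with v hv
  obtain ⟨w', h1, h2, h3, -⟩ := hv
  exact (A.trans_source_iff i j z z' v).2 ⟨w', h1, h2, h3⟩

theorem contDiffOn_trans (i j : A.Idx) (z z' : Z) :
    ContDiffOn ℝ ∞ ((A.chart i z).symm.trans (A.chart j z'))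
      ((A.chart i z).symm.trans (A.chart j z')).source := by
  intro u hu
  obtain ⟨w, hi, hj, rfl⟩ := (A.trans_source_iff i j z z' u).1 hu
  obtain ⟨g, hg', hg⟩ := A.trans i j w hi hj
  refine (hg'.congr_of_eventuallyEq ?_).contDiffWithinAt
  filter_upwards [hg] with v hv
  obtain ⟨w', h1, h2, rfl, h4⟩ := hv
  change A.coord j ((A.chart i z).symm (A.coord i w')) = _
  rw [A.chart_symm_apply i z h1, h4]

/-- The topology and atlas generated by the coordinate maps. -/
def core : ChartedSpaceCore H Z where
  atlas := {e | ∃ i z, e = A.chart i z}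
  chartAt z := A.chart (A.cover z).choose z
  mem_chart_source := fun z => (A.cover z).choose_spec
  chart_mem_atlas z := ⟨_, _, rfl⟩
  open_source := by
    rintro _ _ ⟨i, z, rfl⟩ ⟨j, z', rfl⟩
    exact A.isOpen_trans i j z z'
  continuousOn_toFun := by
    rintro _ _ ⟨i, z, rfl⟩ ⟨j, z', rfl⟩
    exact (A.contDiffOn_trans i j z z').continuousOn

theorem isManifold_core :
    letI := A.core.toTopologicalSpace
    letI := A.core.toChartedSpace
    IsManifold 𝓘(ℝ, H) ∞ Z := by
  let _ := A.core.toTopologicalSpace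
  let _ := A.core.toChartedSpace
  apply isManifold_of_contDiffOn
  rintro e e' ⟨_, ⟨f, rfl⟩, ⟨_, ⟨⟨i, z, rfl⟩, rfl⟩, he⟩⟩ ⟨_, ⟨f', rfl⟩, ⟨_, ⟨⟨j, z', rfl⟩, rfl⟩, he'⟩⟩
  obtain rfl : e = _ := he
  obtain rfl : e' = _ := he'
  exact (A.contDiffOn_trans i j z z').mono fun u hu => hu.1

end CoordAtlas

section SmoothCoeff

variable {H : Type*} [NormedAddCommGroup H] [NormedSpace ℝ H] [FiniteDimensional ℝ H]
  {M : Type*} [TopologicalSpace M] [ChartedSpace H M] [IsManifold 𝓘(ℝ, H) ∞ M]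

/-- The vector field `X` is smooth at `x`. -/
def SmoothFieldAt (X : ∀ y : M, TangentSpace 𝓘(ℝ, H) y) (x : M) : Prop :=
  ContMDiffAt 𝓘(ℝ, H) 𝓘(ℝ, H).tangent ∞ (fun y => (⟨y, X y⟩ : TangentBundle 𝓘(ℝ, H) M)) x

theorem SmoothFieldAt.coeff {m : ℕ} {x : M} {v : Fin m → ∀ y : M, TangentSpace 𝓘(ℝ, H) y}
    {w : ∀ y : M, TangentSpace 𝓘(ℝ, H) y} {c : M → Fin m → ℝ}
    (hv : ∀ i, SmoothFieldAt (v i) x) (hw : SmoothFieldAt w x)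
    (hli : LinearIndependent ℝ (fun i => v i x))
    (hc : ∀ᶠ y in 𝓝 x, w y = ∑ i, c y i • v i y) (i : Fin m) :
    ContMDiffAt 𝓘(ℝ, H) 𝓘(ℝ, ℝ) ∞ (fun y => c y i) x := by
  set e := trivializationAt H (TangentSpace 𝓘(ℝ, H)) x with he
  have hx : x ∈ e.baseSet := FiberBundle.mem_baseSet_trivializationAt' x
  let τ : M → (∀ y : M, TangentSpace 𝓘(ℝ, H) y) → H := fun y u => (e ⟨y, u y⟩).2
  have hτv : ∀ j, ContMDiffAt 𝓘(ℝ, H) 𝓘(ℝ, H) ∞ (fun y => τ y (v j)) x := fun j =>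
    (Bundle.contMDiffAt_section (IB := 𝓘(ℝ, H)) x).1 (hv j)
  have hτw : ContMDiffAt 𝓘(ℝ, H) 𝓘(ℝ, H) ∞ (fun y => τ y w) x :=
    (Bundle.contMDiffAt_section (IB := 𝓘(ℝ, H)) x).1 hw
  have hlin : ∀ y ∈ e.baseSet, ∀ u : TangentSpace 𝓘(ℝ, H) y,
      (e ⟨y, u⟩).2 = e.continuousLinearMapAt ℝ y u := fun y hy u => by
    rw [Bundle.Trivialization.continuousLinearMapAt_apply, e.linearMapAt_apply, if_pos hy]
  have hli' : LinearIndependent ℝ (fun j => τ x (v j)) := by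
    have h1 : (fun j => τ x (v j)) = (e.continuousLinearEquivAt ℝ x hx) ∘ (fun j => v j x) := rfl
    rw [h1]
    exact hli.map' (e.continuousLinearEquivAt ℝ x hx).toLinearEquiv.toLinearMap
      (LinearEquiv.ker _)
  obtain ⟨L0, hL0⟩ := (Fintype.linearCombination ℝ (fun j => τ x (v j))).exists_leftInverse_of_injective
    (by rw [LinearMap.ker_eq_bot]; exact hli'.fintypeLinearCombination_injective)
  let L : H →L[ℝ] (Fin m → ℝ) := LinearMap.toContinuousLinearMap L0
  let A : M → Matrix (Fin m) (Fin m) ℝ := fun y => Matrix.of fun a j => L (τ y (v j)) a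
  let b : M → Fin m → ℝ := fun y => L (τ y w)
  have hA : ∀ a j, ContMDiffAt 𝓘(ℝ, H) 𝓘(ℝ, ℝ) ∞ (fun y => A y a j) x := fun a j => by
    have h1 : ContDiff ℝ ∞ (fun z : H => L z a) := by fun_prop
    exact h1.contMDiff.contMDiffAt.comp x (hτv j)
  have hb : ∀ a, ContMDiffAt 𝓘(ℝ, H) 𝓘(ℝ, ℝ) ∞ (fun y => b y a) x := fun a => by
    have h1 : ContDiff ℝ ∞ (fun z : H => L z a) := by fun_prop
    exact h1.contMDiff.contMDiffAt.comp x hτw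
  have hdet : ∀ B : M → Matrix (Fin m) (Fin m) ℝ,
      (∀ a j, ContMDiffAt 𝓘(ℝ, H) 𝓘(ℝ, ℝ) ∞ (fun y => B y a j) x) →
      ContMDiffAt 𝓘(ℝ, H) 𝓘(ℝ, ℝ) ∞ (fun y => (B y).det) x := by
    intro B hB
    simp only [Matrix.det_apply']
    refine ContMDiffAt.sum fun σ _ => ?_
    refine contMDiffAt_const.mul ?_
    exact contMDiffAt_finsetProd fun a _ => hB _ _
  have hA1 : A x = 1 := by
    ext a j
    have h2 : L0 (τ x (v j)) = Pi.single j 1 := by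
      have := LinearMap.congr_fun hL0 (Pi.single j 1)
      simpa [Fintype.linearCombination_apply_single] using this
    change L0 (τ x (v j)) a = _
    rw [h2, Matrix.one_apply, Pi.single_apply]
  have hne : ∀ᶠ y in 𝓝 x, (A y).det ≠ 0 := by
    refine (hdet A hA).continuousAt.eventually_ne ?_
    rw [hA1]; simp
  have hmain : (fun y => c y i) =ᶠ[𝓝 x] fun y => ((A y).det)⁻¹ * ((A y).updateCol i (b y)).det := by
    filter_upwards [hne, hc, e.open_baseSet.mem_nhds hx] with y h1 h2 h3
    have h4 : b y = (A y).mulVec (c y) := by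
      ext a
      change L (τ y w) a = _
      have h5 : τ y w = ∑ j, c y j • τ y (v j) := by
        change (e ⟨y, w y⟩).2 = ∑ j, c y j • (e ⟨y, v j y⟩).2
        rw [hlin y h3, h2, map_sum]
        refine Finset.sum_congr rfl fun j _ => ?_
        rw [map_smul, hlin y h3]
      rw [h5, map_sum, Matrix.mulVec, dotProduct]
      simp [A, mul_comm]
    have h6 : (A y).cramer (b y) = (A y).det • c y := by
      rw [Matrix.cramer_eq_adjugate_mulVec, h4, Matrix.mulVec_mulVec, Matrix.adjugate_mul,
        Matrix.smul_mulVec, Matrix.one_mulVec]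
    have h7 := congrFun h6 i
    rw [Matrix.cramer_apply] at h7
    rw [h7]
    simp [h1]
  refine ContMDiffAt.congr_of_eventuallyEq ?_ hmain
  refine ContMDiffAt.mul ?_ ?_
  · refine ContDiffAt.comp_contMDiffAt (g := fun t : ℝ => t⁻¹) ?_ (hdet A hA)
    refine contDiffAt_inv ℝ ?_
    rw [hA1]; simp
  · refine hdet _ fun a j => ?_
    simp only [Matrix.updateCol_apply]
    split_ifs
    · exact hb a
    · exact hA a j

end SmoothCoeff

section BinaryForms

variable {k : ℕ}

/-- The value at `(s, t)` of the binary form of degree `k` with coefficient vector `a`. -/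
def formEval (a : Fin (k + 1) → ℝ) (s t : ℝ) : ℝ :=
  ∑ i, a i * s ^ (k - (i : ℕ)) * t ^ (i : ℕ)

/-- Coefficient vector of the `k`-th power `(α s + β t) ^ k` of a linear form. -/
def linearPower (k : ℕ) (α β : ℝ) : Fin (k + 1) → ℝ :=
  fun i => (k.choose i : ℝ) * α ^ (k - (i : ℕ)) * β ^ (i : ℕ)

/-- `A` is the action of `g ∈ GL(2, ℝ)` on binary forms of degree `k` by linear substitution of
the variables. -/
def IsSubstitution (g : Matrix.GeneralLinearGroup (Fin 2) ℝ)
    (A : (Fin (k + 1) → ℝ) →L[ℝ] (Fin (k + 1) → ℝ)) : Prop :=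
  ∀ a s t, formEval (A a) s t =
    formEval a (g.val 0 0 * s + g.val 0 1 * t) (g.val 1 0 * s + g.val 1 1 * t)

theorem formEval_linearPower (α β s t : ℝ) :
    formEval (linearPower k α β) s t = (α * s + β * t) ^ k := by
  rw [add_comm (α * s), add_pow, Finset.sum_range, formEval]
  refine Finset.sum_congr rfl fun i _ => ?_
  simp only [linearPower, mul_pow]
  ring

theorem formEval_injective {a b : Fin (k + 1) → ℝ} (h : ∀ s t, formEval a s t = formEval b s t) :
    a = b := by
  let p : (Fin (k + 1) → ℝ) → Polynomial ℝ := fun a => ∑ i : Fin (k + 1), Polynomial.monomial (i : ℕ) (a i)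
  have hp : ∀ a t, (p a).eval t = formEval a 1 t := fun a t => by
    simp [p, formEval, Polynomial.eval_finsetSum]
  have hab : p a = p b := Polynomial.funext fun t => by rw [hp, hp, h]
  have hco : ∀ a (i : Fin (k + 1)), (p a).coeff i = a i := fun a i => by
    simp [p, Polynomial.finsetSum_coeff, Polynomial.coeff_monomial, Fin.val_inj]
  ext i
  rw [← hco a, ← hco b, hab]

theorem IsSubstitution.linearPower {g : Matrix.GeneralLinearGroup (Fin 2) ℝ}
    {A : (Fin (k + 1) → ℝ) →L[ℝ] (Fin (k + 1) → ℝ)} (h : IsSubstitution g A) (α β : ℝ) :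
    A (linearPower k α β) = linearPower k (α * g.val 0 0 + β * g.val 1 0)
      (α * g.val 0 1 + β * g.val 1 1) :=
  formEval_injective fun s t => by
    rw [h, formEval_linearPower, formEval_linearPower]
    ring

theorem linearPower_of_ne {α : ℝ} (hα : α ≠ 0) (β : ℝ) :
    linearPower k α β = α ^ k • linearPower k 1 (β / α) := by
  ext i
  have hi : (i : ℕ) ≤ k := Nat.lt_succ_iff.1 i.2
  have : α ^ k = α ^ (k - (i : ℕ)) * α ^ (i : ℕ) := by rw [← pow_add, Nat.sub_add_cancel hi]
  simp only [linearPower, Pi.smul_apply, smul_eq_mul, one_pow, div_pow, this]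
  field_simp

theorem linearPower_zero (α β : ℝ) : linearPower k α β 0 = α ^ k := by simp [linearPower]

theorem linearPower_one [NeZero k] (t : ℝ) : linearPower k 1 t ⟨1, Nat.succ_lt_succ (NeZero.pos k)⟩ =
    k * t := by simp [linearPower]

/-- Reversal of coefficients, i.e. exchange of the two variables. -/
def reverseForm (k : ℕ) : (Fin (k + 1) → ℝ) →L[ℝ] (Fin (k + 1) → ℝ) :=
  ContinuousLinearMap.pi fun i => ContinuousLinearMap.proj (Fin.rev i)

theorem isSubstitution_reverseForm : ∃ g, IsSubstitution g (reverseForm k) := by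
  refine ⟨Matrix.GeneralLinearGroup.mkOfDetNeZero !![0, 1; 1, 0] (by simp), fun a s t => ?_⟩
  simp only [formEval, Matrix.GeneralLinearGroup.mkOfDetNeZero]
  rw [← Equiv.sum_comp Fin.revPerm]
  refine Finset.sum_congr rfl fun i _ => ?_
  have hi : (i : ℕ) ≤ k := Nat.lt_succ_iff.1 i.2
  have h1 : k - (k - (i : ℕ)) = i := Nat.sub_sub_self hi
  simp [reverseForm, Fin.val_rev, h1]
  ring

theorem reverseForm_linearPower (α β : ℝ) :
    reverseForm k (linearPower k α β) = linearPower k β α := by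
  ext i
  have hi : (i : ℕ) ≤ k := Nat.lt_succ_iff.1 i.2
  have h1 : k - (k - (i : ℕ)) = i := Nat.sub_sub_self hi
  simp [reverseForm, linearPower, Fin.val_rev, h1, Nat.choose_symm hi]
  ring

end BinaryForms

/-- A `Gl(2)`-structure on a `(k+1)`-manifold `N`: a smooth field of identifications `σ` of the
tangent spaces with the `GL(2, ℝ)`-module of binary forms of degree `k`, i.e. a smooth reduction
of the frame bundle of `N` to the group generated by `GL(2, ℝ)`, acting irreducibly by
substitutions, and the automorphisms `c ≠ 0` of that module. -/
structure GL2Structure (k : ℕ) (N : Type*) [TopologicalSpace N]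
    [ChartedSpace (EuclideanSpace ℝ (Fin (k + 1))) N] [IsManifold (𝓡 (k + 1)) ∞ N] where
  frames : ∀ x : N, Set ((Fin (k + 1) → ℝ) →L[ℝ] TangentSpace (𝓡 (k + 1)) x)
  bijective : ∀ x, ∀ σ ∈ frames x, Function.Bijective σ
  mem_frames_iff : ∀ x, ∀ σ ∈ frames x, ∀ σ', σ' ∈ frames x ↔
    ∃ c : ℝ, c ≠ 0 ∧ ∃ g A, IsSubstitution g A ∧ σ' = c • σ.comp A
  exists_smooth : ∀ x, ∃ σ : ∀ y : N, (Fin (k + 1) → ℝ) →L[ℝ] TangentSpace (𝓡 (k + 1)) y,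
    ∀ᶠ y in 𝓝 x, σ y ∈ frames y ∧ ∀ a, SmoothFieldAt (fun z => σ z a) y

namespace GL2Structure

variable {k : ℕ} {N : Type*} [TopologicalSpace N]
  [ChartedSpace (EuclideanSpace ℝ (Fin (k + 1))) N] [IsManifold (𝓡 (k + 1)) ∞ N]
  (S : GL2Structure k N)

/-- `σ` is a smooth local section of the frame bundle of the structure near `x`. -/
def IsLocalSection (σ : ∀ y : N, (Fin (k + 1) → ℝ) →L[ℝ] TangentSpace (𝓡 (k + 1)) y) (x : N) :
    Prop :=
  ∀ᶠ y in 𝓝 x, σ y ∈ S.frames y ∧ ∀ a, SmoothFieldAt (fun z => σ z a) y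

/-- The rational normal curve of the structure in the projectivized tangent space at `x`: the
lines of `T_x N` which correspond to the `k`-th powers of nonzero linear forms. -/
def curve (x : N) : Set (Submodule ℝ (TangentSpace (𝓡 (k + 1)) x)) :=
  {ℓ | ∃ σ ∈ S.frames x, ∃ α β : ℝ, (α ≠ 0 ∨ β ≠ 0) ∧ ℓ = ℝ ∙ σ (linearPower k α β)}

/-- The total space of the field of rational normal curves (a bundle of projective lines). -/
@[ext]
structure CurveBundle where
  base : N
  line : Submodule ℝ (TangentSpace (𝓡 (k + 1)) base)
  line_mem : line ∈ S.curve base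

namespace CurveBundle

variable {S}

/-- `t` is the affine coordinate of the line `m` with respect to `σ`. -/
def IsAffineCoord (σ : ∀ y : N, (Fin (k + 1) → ℝ) →L[ℝ] TangentSpace (𝓡 (k + 1)) y)
    (m : S.CurveBundle) (t : ℝ) : Prop :=
  m.line = ℝ ∙ σ m.base (linearPower k 1 t)

theorem IsAffineCoord.unique [NeZero k]
    {σ : ∀ y : N, (Fin (k + 1) → ℝ) →L[ℝ] TangentSpace (𝓡 (k + 1)) y}
    {m : S.CurveBundle} {t t' : ℝ} (hσ : σ m.base ∈ S.frames m.base) (h : IsAffineCoord σ m t)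
    (h' : IsAffineCoord σ m t') : t = t' := by
  have h1 : σ m.base (linearPower k 1 t) ∈ (ℝ ∙ σ m.base (linearPower k 1 t')) := by
    rw [← h', h]; exact Submodule.mem_span_singleton_self _
  obtain ⟨c, hc⟩ := Submodule.mem_span_singleton.1 h1
  rw [← map_smul] at hc
  have h2 := (S.bijective _ _ hσ).1 hc
  have h3 := congrFun h2 0
  have h4 := congrFun h2 ⟨1, Nat.succ_lt_succ (NeZero.pos k)⟩
  rw [Pi.smul_apply, linearPower_zero, linearPower_zero] at h3
  rw [Pi.smul_apply, linearPower_one, linearPower_one] at h4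
  have hk : (k : ℝ) ≠ 0 := NeZero.ne _
  simp only [one_pow, smul_eq_mul, mul_one] at h3 h4
  subst h3
  have := mul_left_cancel₀ hk ((one_mul _).symm.trans h4)
  exact this.symm

/-- Coordinates of a point: a chart of the base, and the affine coordinate of the line. -/
def coords (ψ : OpenPartialHomeomorph N (EuclideanSpace ℝ (Fin (k + 1))))
    (σ : ∀ y : N, (Fin (k + 1) → ℝ) →L[ℝ] TangentSpace (𝓡 (k + 1)) y) (m : S.CurveBundle) :
    EuclideanSpace ℝ (Fin (k + 1)) × ℝ :=
  (ψ m.base, Classical.epsilon (IsAffineCoord σ m))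

theorem coords_eq [NeZero k] {ψ : OpenPartialHomeomorph N (EuclideanSpace ℝ (Fin (k + 1)))}
    {σ : ∀ y : N, (Fin (k + 1) → ℝ) →L[ℝ] TangentSpace (𝓡 (k + 1)) y} {m : S.CurveBundle} {t : ℝ}
    (hσ : σ m.base ∈ S.frames m.base) (h : IsAffineCoord σ m t) : coords ψ σ m = (ψ m.base, t) := by
  have h1 : IsAffineCoord σ m (Classical.epsilon (IsAffineCoord σ m)) :=
    Classical.epsilon_spec ⟨t, h⟩
  rw [coords, h1.unique hσ h]

variable (S) in
/-- Domain of the coordinates `coords ψ σ`. -/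
def coordSource (ψ : OpenPartialHomeomorph N (EuclideanSpace ℝ (Fin (k + 1))))
    (σ : ∀ y : N, (Fin (k + 1) → ℝ) →L[ℝ] TangentSpace (𝓡 (k + 1)) y) : Set S.CurveBundle :=
  {m | m.base ∈ ψ.source ∧ S.IsLocalSection σ m.base ∧ ∃ t, IsAffineCoord σ m t}

theorem coords_injOn [NeZero k] (ψ : OpenPartialHomeomorph N (EuclideanSpace ℝ (Fin (k + 1))))
    (σ : ∀ y : N, (Fin (k + 1) → ℝ) →L[ℝ] TangentSpace (𝓡 (k + 1)) y) :
    InjOn (coords ψ σ) (coordSource S ψ σ) := by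
  rintro m ⟨h1, h2, t, h3⟩ m' ⟨h1', h2', t', h3'⟩ h
  rw [coords_eq h2.self_of_nhds.1 h3, coords_eq h2'.self_of_nhds.1 h3', Prod.mk.injEq] at h
  obtain ⟨hb, rfl⟩ := h
  replace hb := ψ.injOn h1 h1' hb
  obtain ⟨x, ℓ, hℓ⟩ := m
  obtain ⟨x', ℓ', hℓ'⟩ := m'
  obtain rfl : x = x' := hb
  have : ℓ = ℓ' := Eq.trans h3 (Eq.symm h3')
  subst this
  rfl

theorem exists_mem_coordSource (m : S.CurveBundle) :
    ∃ σ, m ∈ coordSource S (chartAt _ m.base) σ := by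
  obtain ⟨σ, hσ⟩ := S.exists_smooth m.base
  obtain ⟨σ₀, hσ₀, α, β, hαβ, hm⟩ := m.line_mem
  obtain ⟨c, hc, g, A, hA, rfl⟩ := (S.mem_frames_iff _ _ hσ.self_of_nhds.1 σ₀).1 hσ₀
  have hline : ∀ {d : ℝ} (_ : d ≠ 0) (v : TangentSpace (𝓡 (k + 1)) m.base),
      (ℝ ∙ (d • v)) = ℝ ∙ v := fun hd v => Submodule.span_singleton_smul_eq hd.isUnit v
  have hm' : m.line = ℝ ∙ σ m.base (linearPower k (α * g.val 0 0 + β * g.val 1 0)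
      (α * g.val 0 1 + β * g.val 1 1)) := by
    rw [hm]
    have : (c • (σ m.base).comp A) (linearPower k α β) = c • σ m.base (A (linearPower k α β)) := rfl
    rw [this, hline hc, hA.linearPower]
  by_cases h0 : α * g.val 0 0 + β * g.val 1 0 = 0
  · refine ⟨fun y => (σ y).comp (reverseForm k), mem_chart_source _ _, ?_, 0, ?_⟩
    · filter_upwards [hσ] with y hy
      refine ⟨(S.mem_frames_iff y _ hy.1 _).2 ?_, fun a => hy.2 _⟩
      obtain ⟨g', hg'⟩ := isSubstitution_reverseForm (k := k)
      exact ⟨1, one_ne_zero, g', _, hg', by simp⟩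
    · have h1 : α * g.val 0 1 + β * g.val 1 1 ≠ 0 := by
        intro h1
        have hdet : g.val.det ≠ 0 := g.isUnit.map Matrix.detMonoidHom |>.ne_zero
        rw [Matrix.det_fin_two] at hdet
        rcases hαβ with h | h
        · apply mul_ne_zero h hdet
          linear_combination g.val 1 1 * h0 - g.val 1 0 * h1
        · apply mul_ne_zero h hdet
          linear_combination g.val 0 0 * h1 - g.val 0 1 * h0
      rw [IsAffineCoord, hm', h0, ContinuousLinearMap.comp_apply, ← reverseForm_linearPower,
        linearPower_of_ne h1, map_smul, map_smul, hline (pow_ne_zero _ h1), zero_div]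
  · refine ⟨σ, mem_chart_source _ _, hσ,
      (α * g.val 0 1 + β * g.val 1 1) / (α * g.val 0 0 + β * g.val 1 0), ?_⟩
    rw [IsAffineCoord, hm', linearPower_of_ne h0, map_smul, hline (pow_ne_zero _ h0)]

theorem coords_trans [NeZero k] {ψ ψ' : OpenPartialHomeomorph N (EuclideanSpace ℝ (Fin (k + 1)))}
    (hψ : ψ ∈ atlas _ N) (hψ' : ψ' ∈ atlas _ N)
    {σ σ' : ∀ y : N, (Fin (k + 1) → ℝ) →L[ℝ] TangentSpace (𝓡 (k + 1)) y} {m : S.CurveBundle}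
    (hm : m ∈ coordSource S ψ σ) (hm' : m ∈ coordSource S ψ' σ') :
    ∃ g : EuclideanSpace ℝ (Fin (k + 1)) × ℝ → EuclideanSpace ℝ (Fin (k + 1)) × ℝ,
      ContDiffAt ℝ ∞ g (coords ψ σ m) ∧ ∀ᶠ u in 𝓝 (coords ψ σ m), ∃ w,
        w ∈ coordSource S ψ σ ∧ w ∈ coordSource S ψ' σ' ∧ coords ψ σ w = u ∧
          coords ψ' σ' w = g u := by
  obtain ⟨h1, h2, t, h3⟩ := hm
  obtain ⟨h1', h2', t', h3'⟩ := hm'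
  rw [coords_eq h2.self_of_nhds.1 h3]
  set x := m.base with hx
  -- coefficients of `σ` with respect to `σ'`
  let c : Fin (k + 1) → N → Fin (k + 1) → ℝ := fun i y =>
    Function.invFun (σ' y) (σ y (Pi.single i 1))
  have hc : ∀ i, ∀ᶠ y in 𝓝 x, σ' y (c i y) = σ y (Pi.single i 1) := fun i => by
    filter_upwards [h2'] with y hy
    exact Function.rightInverse_invFun (S.bijective y _ hy.1).2 _
  have hsum : ∀ (y : N) (τ : (Fin (k + 1) → ℝ) →L[ℝ] TangentSpace (𝓡 (k + 1)) y)
      (a : Fin (k + 1) → ℝ), τ a = ∑ i, a i • τ (Pi.single i 1) := fun y τ a => by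
    conv_lhs => rw [pi_eq_sum_univ' a]
    rw [map_sum]
    refine Finset.sum_congr rfl fun i _ => ?_
    rw [map_smul]
  have hcs : ∀ i j, ContMDiffAt (𝓡 (k + 1)) 𝓘(ℝ, ℝ) ∞ (fun y => c i y j) x := fun i j => by
    refine SmoothFieldAt.coeff (v := fun j y => σ' y (Pi.single j 1))
      (w := fun y => σ y (Pi.single i 1)) (fun j => h2'.self_of_nhds.2 _)
      (h2.self_of_nhds.2 _) ?_ ?_ j
    · have h4 := (Pi.basisFun ℝ (Fin (k + 1))).linearIndependent.map' (σ' x).toLinearMap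
        (LinearMap.ker_eq_bot.2 (S.bijective x _ h2'.self_of_nhds.1).1)
      convert! h4 using 2
      simp
    · filter_upwards [hc i] with y hy
      rw [← hy, hsum]
  -- the transition map
  let W : EuclideanSpace ℝ (Fin (k + 1)) × ℝ → Fin (k + 1) → ℝ := fun p j =>
    ∑ i, linearPower k 1 p.2 i * c i (ψ.symm p.1) j
  have hψx : ψ.symm (ψ x) = x := ψ.left_inv h1
  have hsymm : ContMDiffAt (𝓡 (k + 1)) (𝓡 (k + 1)) ∞ ψ.symm (ψ x) :=
    (contMDiffOn_symm_of_mem_maximalAtlas (IsManifold.subset_maximalAtlas hψ)).contMDiffAt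
      (ψ.open_target.mem_nhds (ψ.map_source h1))
  have hpull : ∀ {F : Type} [NormedAddCommGroup F] [NormedSpace ℝ F] (f : N → F),
      ContMDiffAt (𝓡 (k + 1)) 𝓘(ℝ, F) ∞ f x →
      ContDiffAt ℝ ∞ (fun p : EuclideanSpace ℝ (Fin (k + 1)) × ℝ => f (ψ.symm p.1)) (ψ x, t) := by
    intro F _ _ f hf
    have h4 : ContMDiffAt (𝓡 (k + 1)) 𝓘(ℝ, F) ∞ (fun u => f (ψ.symm u)) (ψ x) := by
      refine ContMDiffAt.comp (ψ x) ?_ hsymm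
      rwa [hψx]
    exact ContDiffAt.comp (g := fun u => f (ψ.symm u)) (ψ x, t) (contMDiffAt_iff_contDiffAt.1 h4) contDiffAt_fst
  have hW : ∀ j, ContDiffAt ℝ ∞ (fun p => W p j) (ψ x, t) := fun j => by
    refine ContDiffAt.sum fun i _ => ContDiffAt.mul ?_ (hpull _ (hcs i j))
    simp only [linearPower]
    fun_prop
  have htend : Tendsto (fun p : EuclideanSpace ℝ (Fin (k + 1)) × ℝ => ψ.symm p.1) (𝓝 (ψ x, t))
      (𝓝 x) := by
    have h4 : ContinuousAt ψ.symm (ψ x) := hsymm.continuousAt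
    have h5 : ContinuousAt (fun p : EuclideanSpace ℝ (Fin (k + 1)) × ℝ => ψ.symm p.1) (ψ x, t) :=
      ContinuousAt.comp (g := ψ.symm) h4 continuousAt_fst
    have h6 := h5.tendsto
    rwa [hψx] at h6
  have hWeq : ∀ᶠ p in 𝓝 (ψ x, t), σ' (ψ.symm p.1) (W p) =
      σ (ψ.symm p.1) (linearPower k 1 p.2) := by
    filter_upwards [htend.eventually (eventually_all.2 hc)] with p hp
    rw [hsum _ (σ _)]
    simp only [← hp, ← map_smul, ← map_sum]
    congr 1
    ext j
    simp [W]
  -- `W` is, up to a factor, the power of a linear form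
  have hWpow : ∀ᶠ p in 𝓝 (ψ x, t), W p 0 ≠ 0 →
      W p = W p 0 • linearPower k 1 (W p ⟨1, Nat.succ_lt_succ (NeZero.pos k)⟩ / (k * W p 0)) := by
    filter_upwards [hWeq, htend.eventually h2, htend.eventually h2'] with p hp hp2 hp2' h0
    obtain ⟨d, hd, g, A, hA, hσ⟩ := (S.mem_frames_iff _ _ hp2'.1 _).1 hp2.1
    have h4 : W p = d • A (linearPower k 1 p.2) := by
      apply (S.bijective _ _ hp2'.1).1
      rw [hp, hσ, map_smul]
      rfl
    rw [hA.linearPower] at h4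
    set α := 1 * g.val 0 0 + p.2 * g.val 1 0
    set β := 1 * g.val 0 1 + p.2 * g.val 1 1
    have hα : α ≠ 0 := by
      rintro h5
      apply h0
      rw [h4, Pi.smul_apply, linearPower_zero, h5, zero_pow (NeZero.ne k), smul_zero]
    rw [linearPower_of_ne hα, smul_smul] at h4
    have h6 : W p 0 = d * α ^ k := by
      rw [h4, Pi.smul_apply, linearPower_zero]; simp
    have h7 : W p ⟨1, Nat.succ_lt_succ (NeZero.pos k)⟩ = d * α ^ k * (k * (β / α)) := by
      rw [h4, Pi.smul_apply, linearPower_one]; simp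
    have hk : (k : ℝ) ≠ 0 := NeZero.ne _
    rw [h7, h6]
    have h8 : d * α ^ k * (k * (β / α)) / (k * (d * α ^ k)) = β / α := by
      have : α ^ k ≠ 0 := pow_ne_zero _ hα
      field_simp
    rw [h8, h4]
  have hW0 : W (ψ x, t) 0 ≠ 0 := by
    have h40 : ∀ y, y = x → ∀ a b, σ' y a = σ y b → σ' x a = σ x b := by
      rintro _ rfl _ _ h
      exact h
    have h4 := h40 _ hψx _ _ hWeq.self_of_nhds
    have h5 : σ' x (linearPower k 1 t') ∈ (ℝ ∙ σ x (linearPower k 1 t)) := by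
      have h6 : m.line = ℝ ∙ σ x (linearPower k 1 t) := h3
      have h7 : m.line = ℝ ∙ σ' x (linearPower k 1 t') := h3'
      rw [← h6, h7]; exact Submodule.mem_span_singleton_self _
    obtain ⟨d, hd⟩ := Submodule.mem_span_singleton.1 h5
    rw [← h4, ← map_smul] at hd
    have h6 := congrFun ((S.bijective x _ h2'.self_of_nhds.1).1 hd) 0
    rw [Pi.smul_apply, linearPower_zero, one_pow, smul_eq_mul] at h6
    exact right_ne_zero_of_mul (h6 ▸ one_ne_zero)
  have hW0' : ∀ᶠ p in 𝓝 (ψ x, t), W p 0 ≠ 0 := (hW 0).continuousAt.eventually_ne hW0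
  refine ⟨fun p => (ψ' (ψ.symm p.1), W p ⟨1, Nat.succ_lt_succ (NeZero.pos k)⟩ / (k * W p 0)),
    ContDiffAt.prodMk ?_ ?_, ?_⟩
  · refine hpull ψ' ?_
    exact (contMDiffOn_of_mem_maximalAtlas (IsManifold.subset_maximalAtlas hψ')).contMDiffAt
      (ψ'.open_source.mem_nhds h1')
  · refine (hW _).div (contDiffAt_const.mul (hW 0)) ?_
    exact mul_ne_zero (NeZero.ne _) hW0
  · have htgt : ∀ᶠ p in 𝓝 (ψ x, t), p.1 ∈ ψ.target :=
      continuousAt_fst.eventually_mem (ψ.open_target.mem_nhds (ψ.map_source h1))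
    filter_upwards [hW0', hWpow, hWeq, htgt, htend.eventually h2.eventually_nhds,
      htend.eventually h2'.eventually_nhds, htend.eventually (ψ'.open_source.mem_nhds h1')]
      with p p0 pp pe pt p2 p2' ps
    let w : S.CurveBundle := ⟨ψ.symm p.1, ℝ ∙ σ (ψ.symm p.1) (linearPower k 1 p.2),
      ⟨_, p2.self_of_nhds.1, 1, p.2, Or.inl one_ne_zero, rfl⟩⟩
    have hw : IsAffineCoord σ w p.2 := rfl
    have hw' : IsAffineCoord σ' w (W p ⟨1, Nat.succ_lt_succ (NeZero.pos k)⟩ / (k * W p 0)) := by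
      change (ℝ ∙ σ (ψ.symm p.1) (linearPower k 1 p.2)) = ℝ ∙ σ' (ψ.symm p.1) _
      rw [← pe, pp p0, map_smul, Submodule.span_singleton_smul_eq p0.isUnit]
      have hW1 : ∀ s : ℝ, (W p 0 • linearPower k 1 s) 0 = W p 0 := fun s => by
        rw [Pi.smul_apply, linearPower_zero]; simp
      have hk : (k : ℝ) ≠ 0 := NeZero.ne _
      congr 4
      rw [hW1, Pi.smul_apply, linearPower_one]
      simp only [smul_eq_mul]
      field_simp
    refine ⟨w, ⟨ψ.map_target pt, p2, _, hw⟩, ⟨ps, p2', _, hw'⟩, ?_, ?_⟩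
    · rw [coords_eq p2.self_of_nhds.1 hw]
      exact Prod.ext (ψ.right_inv pt) rfl
    · rw [coords_eq p2'.self_of_nhds.1 hw']

variable (S) in
/-- The smooth atlas of the bundle of rational normal curves. -/
def coordAtlas [NeZero k] : CoordAtlas (EuclideanSpace ℝ (Fin (k + 1)) × ℝ) S.CurveBundle where
  Idx := {ψ : OpenPartialHomeomorph N (EuclideanSpace ℝ (Fin (k + 1))) // ψ ∈ atlas _ N} ×
    (∀ y : N, (Fin (k + 1) → ℝ) →L[ℝ] TangentSpace (𝓡 (k + 1)) y)
  source i := coordSource S i.1.1 i.2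
  coord i := coords i.1.1 i.2
  injOn i := coords_injOn i.1.1 i.2
  cover m := by
    obtain ⟨σ, h⟩ := exists_mem_coordSource m
    exact ⟨(⟨_, chart_mem_atlas _ _⟩, σ), h⟩
  trans i j _ hi hj := coords_trans i.1.2 j.1.2 hi hj

instance [NeZero k] : TopologicalSpace S.CurveBundle := (coordAtlas S).core.toTopologicalSpace

instance [NeZero k] : ChartedSpace (EuclideanSpace ℝ (Fin (k + 1)) × ℝ) S.CurveBundle :=
  (coordAtlas S).core.toChartedSpace

instance [NeZero k] : IsManifold 𝓘(ℝ, EuclideanSpace ℝ (Fin (k + 1)) × ℝ) ∞ S.CurveBundle :=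
  (coordAtlas S).isManifold_core

end CurveBundle

end GL2Structure

section RegularPairs

variable {H : Type*} [NormedAddCommGroup H] [NormedSpace ℝ H]
  {M : Type*} [TopologicalSpace M] [ChartedSpace H M]

/-- The derivative at `x` of the function `f` in the direction of the vector field `X`. -/
def dirDeriv (X : ∀ y : M, TangentSpace 𝓘(ℝ, H) y) (f : M → ℝ) (x : M) : ℝ :=
  mfderiv 𝓘(ℝ, H) 𝓘(ℝ, ℝ) f x (X x)

/-- The iterated Lie brackets `ad_X^i V`. -/
def adField (X V : ∀ y : M, TangentSpace 𝓘(ℝ, H) y) (i : ℕ) : ∀ y : M, TangentSpace 𝓘(ℝ, H) y :=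
  (fun W => VectorField.mlieBracket 𝓘(ℝ, H) X W)^[i] V

/-- Near `x` one has `X' = f X` with `f` smooth, `f x = c₀` and `X(f)(x) = c₁`. -/
def JetRel (x : M) (X X' : ∀ y : M, TangentSpace 𝓘(ℝ, H) y) (c₀ c₁ : ℝ) : Prop :=
  ∃ f : M → ℝ, (∀ᶠ y in 𝓝 x, ContMDiffAt 𝓘(ℝ, H) 𝓘(ℝ, ℝ) ∞ f y ∧ X' y = f y • X y) ∧
    f x = c₀ ∧ dirDeriv X f x = c₁

/-- The 1-jet at `x` of the nonvanishing section `X` of a line distribution, along the integral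
curve of that distribution: the class of the local sections `X' = f X` with `f x = 1` and
`X(f)(x) = 0`. -/
def jetAt (x : M) (X : ∀ y : M, TangentSpace 𝓘(ℝ, H) y) : Set (∀ y : M, TangentSpace 𝓘(ℝ, H) y) :=
  {X' | JetRel x X X' 1 0}


theorem dirDeriv_mul {x : M} {X : ∀ y : M, TangentSpace 𝓘(ℝ, H) y} {f g : M → ℝ}
    (hf : ContMDiffAt 𝓘(ℝ, H) 𝓘(ℝ, ℝ) ∞ f x) (hg : ContMDiffAt 𝓘(ℝ, H) 𝓘(ℝ, ℝ) ∞ g x) :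
    dirDeriv X (fun y => g y * f y) x = g x * dirDeriv X f x + f x * dirDeriv X g x := by
  have h1 := (hf.mdifferentiableAt (by simp)).hasMFDerivAt
  have h2 := (hg.mdifferentiableAt (by simp)).hasMFDerivAt
  have h3 := (h2.mul h1).mfderiv
  unfold dirDeriv
  change mfderiv 𝓘(ℝ, H) 𝓘(ℝ, ℝ) (g * f) x (X x) = _
  rw [h3]
  rfl

theorem dirDeriv_const (x : M) (X : ∀ y : M, TangentSpace 𝓘(ℝ, H) y) (c : ℝ) :
    dirDeriv X (fun _ => c) x = 0 := by
  unfold dirDeriv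
  rw [mfderiv_const]
  rfl

theorem dirDeriv_smul {x : M} {X X' : ∀ y : M, TangentSpace 𝓘(ℝ, H) y} {a : ℝ}
    (h : X' x = a • X x) (g : M → ℝ) : dirDeriv X' g x = a * dirDeriv X g x := by
  unfold dirDeriv
  rw [h, map_smul]
  rfl

theorem dirDeriv_congr {x : M} {f g : M → ℝ} (h : f =ᶠ[𝓝 x] g)
    (X : ∀ y : M, TangentSpace 𝓘(ℝ, H) y) : dirDeriv X f x = dirDeriv X g x := by
  unfold dirDeriv
  rw [h.mfderiv_eq]
  rfl

theorem JetRel.refl (x : M) (X : ∀ y : M, TangentSpace 𝓘(ℝ, H) y) : JetRel x X X 1 0 :=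
  ⟨fun _ => 1, Eventually.of_forall fun _ => ⟨contMDiffAt_const, (one_smul _ _).symm⟩,
    rfl, dirDeriv_const _ _ _⟩

theorem JetRel.comp {x : M} {X X' X'' : ∀ y : M, TangentSpace 𝓘(ℝ, H) y} {a₀ a₁ b₀ b₁ : ℝ}
    (h : JetRel x X X' a₀ a₁) (h' : JetRel x X' X'' b₀ b₁) :
    JetRel x X X'' (b₀ * a₀) (b₁ + b₀ * a₁) := by
  obtain ⟨f, hf, rfl, rfl⟩ := h
  obtain ⟨g, hg, rfl, rfl⟩ := h'
  refine ⟨fun y => g y * f y, ?_, rfl, ?_⟩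
  · filter_upwards [hf, hg] with y h1 h2
    exact ⟨h2.1.mul h1.1, by rw [h2.2, h1.2, smul_smul]⟩
  · rw [dirDeriv_mul hf.self_of_nhds.1 hg.self_of_nhds.1, dirDeriv_smul hf.self_of_nhds.2]
    ring

theorem JetRel.symm {x : M} {X X' : ∀ y : M, TangentSpace 𝓘(ℝ, H) y} {a₀ a₁ : ℝ}
    (h : JetRel x X X' a₀ a₁) (h0 : a₀ ≠ 0) : JetRel x X' X a₀⁻¹ (-a₁ * a₀⁻¹) := by
  obtain ⟨f, hf, rfl, rfl⟩ := h
  have hc : ∀ᶠ y in 𝓝 x, f y ≠ 0 := hf.self_of_nhds.1.continuousAt.eventually_ne h0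
  have hg : ∀ᶠ y in 𝓝 x, ContMDiffAt 𝓘(ℝ, H) 𝓘(ℝ, ℝ) ∞ (fun y => (f y)⁻¹) y := by
    filter_upwards [hf, hc] with y h1 h2
    exact ContDiffAt.comp_contMDiffAt (g := fun t : ℝ => t⁻¹) (contDiffAt_inv ℝ h2) h1.1
  refine ⟨fun y => (f y)⁻¹, ?_, rfl, ?_⟩
  · filter_upwards [hf, hc, hg] with y h1 h2 h3
    exact ⟨h3, by rw [h1.2, smul_smul, inv_mul_cancel₀ h2, one_smul]⟩
  · have h1 : dirDeriv X (fun y => (f y)⁻¹ * f y) x = 0 := by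
      rw [dirDeriv_congr (g := fun _ => 1) (hc.mono fun y hy => inv_mul_cancel₀ hy),
        dirDeriv_const]
    rw [dirDeriv_mul hf.self_of_nhds.1 hg.self_of_nhds] at h1
    rw [dirDeriv_smul hf.self_of_nhds.2]
    linear_combination h1

theorem JetRel.unique {x : M} {X X' : ∀ y : M, TangentSpace 𝓘(ℝ, H) y} {a₀ a₁ b₀ b₁ : ℝ}
    (hX : ∀ᶠ y in 𝓝 x, X y ≠ 0) (h : JetRel x X X' a₀ a₁) (h' : JetRel x X X' b₀ b₁) :
    a₀ = b₀ ∧ a₁ = b₁ := by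
  obtain ⟨f, hf, rfl, rfl⟩ := h
  obtain ⟨g, hg, rfl, rfl⟩ := h'
  have h1 : f =ᶠ[𝓝 x] g := by
    filter_upwards [hf, hg, hX] with y h1 h2 h3
    exact smul_left_injective ℝ h3 (h1.2.symm.trans h2.2)
  exact ⟨h1.self_of_nhds, dirDeriv_congr h1 X⟩

theorem setOf_jetRel_eq {x : M} {X X' : ∀ y : M, TangentSpace 𝓘(ℝ, H) y} {a₀ a₁ b₀ b₁ : ℝ}
    (h0 : a₀ ≠ 0) (h : JetRel x X X' a₀ a₁) :
    {Y | JetRel x X' Y b₀ b₁} = {Y | JetRel x X Y (b₀ * a₀) (b₁ + b₀ * a₁)} := by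
  ext Y
  refine ⟨fun hY => h.comp hY, fun hY => ?_⟩
  have h1 := (h.symm h0).comp hY
  have e0 : b₀ * a₀ * a₀⁻¹ = b₀ := by field_simp
  have e1 : b₁ + b₀ * a₁ + b₀ * a₀ * (-a₁ * a₀⁻¹) = b₁ := by
    field_simp
    ring
  rw [e0, e1] at h1
  exact h1

variable [IsManifold 𝓘(ℝ, H) ∞ M]

theorem exists_jetRel {x : M} {X : ∀ y : M, TangentSpace 𝓘(ℝ, H) y} (hX : X x ≠ 0) (a₀ a₁ : ℝ) :
    ∃ X', JetRel x X X' a₀ a₁ := by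
  have hinv := isInvertible_mfderiv_extChartAt (I := 𝓘(ℝ, H)) (mem_extChartAt_source (I := 𝓘(ℝ, H)) x)
  set D := mfderiv 𝓘(ℝ, H) 𝓘(ℝ, H) (extChartAt 𝓘(ℝ, H) x) x with hD
  have hne : D (X x) ≠ 0 := by
    intro h
    apply hX
    exact hinv.injective (h.trans (map_zero D).symm)
  obtain ⟨ℓ, hℓ⟩ : ∃ ℓ : H →L[ℝ] ℝ, ℓ (D (X x)) = 1 :=
    SeparatingDual.exists_eq_one (R := ℝ) (V := H) hne
  let φ : H → ℝ := fun u => a₀ + a₁ * ℓ (u - extChartAt 𝓘(ℝ, H) x x)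
  have hφ : ContDiff ℝ ∞ φ := by fun_prop
  have hφ' : HasFDerivAt φ (a₁ • ℓ) (extChartAt 𝓘(ℝ, H) x x) :=
    ((ℓ.hasFDerivAt.comp _ (hasFDerivAt_sub_const _)).const_mul a₁).const_add a₀
  have hsm : ∀ᶠ y in 𝓝 x, ContMDiffAt 𝓘(ℝ, H) 𝓘(ℝ, ℝ) ∞
      (fun y => φ (extChartAt 𝓘(ℝ, H) x y)) y := by
    filter_upwards [(chartAt H x).open_source.mem_nhds (mem_chart_source H x)] with y hy
    exact hφ.contMDiff.contMDiffAt.comp y (contMDiffAt_extChartAt' hy)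
  refine ⟨fun y => φ (extChartAt 𝓘(ℝ, H) x y) • X y, fun y => φ (extChartAt 𝓘(ℝ, H) x y),
    hsm.mono fun y hy => ⟨hy, rfl⟩, by simp [φ], ?_⟩
  have h1 := (contMDiffAt_extChartAt (I := 𝓘(ℝ, H)) (n := ∞) (x := x)).mdifferentiableAt
    (by simp) |>.hasMFDerivAt
  have h2 := (hφ'.hasMFDerivAt.comp x h1).mfderiv
  unfold dirDeriv
  change mfderiv 𝓘(ℝ, H) 𝓘(ℝ, ℝ) (φ ∘ extChartAt 𝓘(ℝ, H) x) x (X x) = a₁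
  rw [h2]
  change a₁ * ℓ (D (X x)) = a₁
  rw [hℓ, mul_one]

theorem contMDiffAt_dirDeriv {x : M} {X : ∀ y : M, TangentSpace 𝓘(ℝ, H) y} {f : M → ℝ}
    (hX : SmoothFieldAt X x) (hf : ∀ᶠ y in 𝓝 x, ContMDiffAt 𝓘(ℝ, H) 𝓘(ℝ, ℝ) ∞ f y) :
    ContMDiffAt 𝓘(ℝ, H) 𝓘(ℝ, ℝ) ∞ (dirDeriv X f) x := by
  obtain ⟨U, hU, hUo, hxU⟩ := eventually_nhds_iff.1 hf
  have h1 : ContMDiffOn 𝓘(ℝ, H) 𝓘(ℝ, ℝ) ∞ f U := fun y hy => (hU y hy).contMDiffWithinAt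
  have h2 := h1.contMDiffOn_tangentMapWithin (m := ∞) (by simp) hUo.uniqueMDiffOn
  have h3 : ContMDiffAt 𝓘(ℝ, H).tangent 𝓘(ℝ, ℝ).tangent ∞
      (tangentMapWithin 𝓘(ℝ, H) 𝓘(ℝ, ℝ) f U) (⟨x, X x⟩ : TangentBundle 𝓘(ℝ, H) M) :=
    (h2 _ hxU).contMDiffAt
      ((FiberBundle.continuous_proj H (TangentSpace 𝓘(ℝ, H))).continuousAt.preimage_mem_nhds
        (hUo.mem_nhds hxU))
  have h4 := (contMDiff_snd_tangentBundle_modelSpace ℝ 𝓘(ℝ, ℝ) (n := ∞)).contMDiffAt.comp x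
    (h3.comp x hX)
  refine h4.congr_of_eventuallyEq ?_
  filter_upwards [hUo.mem_nhds hxU] with y hy
  change mfderiv 𝓘(ℝ, H) 𝓘(ℝ, ℝ) f y (X y) = mfderivWithin 𝓘(ℝ, H) 𝓘(ℝ, ℝ) f U y (X y)
  rw [mfderivWithin_of_isOpen hUo hy]


/-- The family of subspaces `D` of the tangent spaces is a (smooth) distribution of rank `r`. -/
def IsDistribution (r : ℕ) (D : ∀ x : M, Submodule ℝ (TangentSpace 𝓘(ℝ, H) x)) : Prop :=
  ∀ x, ∃ v : Fin r → ∀ y : M, TangentSpace 𝓘(ℝ, H) y, ∀ᶠ y in 𝓝 x,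
    (∀ i, SmoothFieldAt (v i) y) ∧ LinearIndependent ℝ (fun i => v i y) ∧
      D y = Submodule.span ℝ (range fun i => v i y)

/-- `X` is a smooth section of `D` near `x`. -/
def IsSectionNear (D : ∀ x : M, Submodule ℝ (TangentSpace 𝓘(ℝ, H) x))
    (X : ∀ y : M, TangentSpace 𝓘(ℝ, H) y) (x : M) : Prop :=
  ∀ᶠ y in 𝓝 x, SmoothFieldAt X y ∧ X y ∈ D y

/-- The Lie bracket `[D, D']` of two distributions. -/
def distBracket (D D' : ∀ x : M, Submodule ℝ (TangentSpace 𝓘(ℝ, H) x)) (x : M) :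
    Submodule ℝ (TangentSpace 𝓘(ℝ, H) x) :=
  Submodule.span ℝ {w | ∃ X Y, IsSectionNear D X x ∧ IsSectionNear D' Y x ∧
    w = VectorField.mlieBracket 𝓘(ℝ, H) X Y x}

variable (H M) in
/-- A pair `(𝒳, 𝒟)` of families of subspaces of the tangent spaces of `M`. -/
structure DistPair where
  line : ∀ x : M, Submodule ℝ (TangentSpace 𝓘(ℝ, H) x)
  plane : ∀ x : M, Submodule ℝ (TangentSpace 𝓘(ℝ, H) x)

namespace DistPair

variable (P : DistPair H M)

/-- The distributions `ad_𝒳^i 𝒟`. -/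
def adPlane (i : ℕ) : ∀ x : M, Submodule ℝ (TangentSpace 𝓘(ℝ, H) x) :=
  (fun D => distBracket P.line D)^[i] P.plane

/-- The pair is regular, with parameter `k`. -/
structure IsRegular (k : ℕ) : Prop where
  line_dist : IsDistribution 1 P.line
  plane_dist : IsDistribution 2 P.plane
  line_le : ∀ x, P.line x ≤ P.plane x
  rank_ad : ∀ i, 1 ≤ i → i ≤ k → ∀ x, Module.finrank ℝ (P.adPlane i x) = i + 2
  ad_eq_top : ∀ x, P.adPlane k x = ⊤

/-- `(X, V)` is, at `y`, a smooth frame of `𝒟` with `X` spanning `𝒳`. -/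
structure IsFrameAt (X V : ∀ y : M, TangentSpace 𝓘(ℝ, H) y) (y : M) : Prop where
  smooth_fst : SmoothFieldAt X y
  smooth_snd : SmoothFieldAt V y
  indep : LinearIndependent ℝ ![X y, V y]
  line_eq : P.line y = ℝ ∙ X y
  plane_eq : P.plane y = Submodule.span ℝ {X y, V y}

/-- `(X, V)` is a smooth local frame of `𝒟` near `x`, with `X` spanning `𝒳`. -/
def IsFrameNear (X V : ∀ y : M, TangentSpace 𝓘(ℝ, H) y) (x : M) : Prop :=
  ∀ᶠ y in 𝓝 x, P.IsFrameAt X V y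

/-- `X` is a projective vector field near `x` and `V` is a corresponding normal vector field. -/
def IsProjectiveNear (k : ℕ) (X V : ∀ y : M, TangentSpace 𝓘(ℝ, H) y) (x : M) : Prop :=
  P.IsFrameNear X V x ∧ ∀ᶠ y in 𝓝 x, adField X V (k + 1) y ∈
    Submodule.span ℝ ({X y} ∪ {w | ∃ i, i + 2 ≤ k ∧ w = adField X V i y})

end DistPair

namespace DistPair

variable {P : DistPair H M}

theorem IsFrameAt.fst_ne_zero {X V : ∀ y : M, TangentSpace 𝓘(ℝ, H) y} {y : M}
    (h : P.IsFrameAt X V y) : X y ≠ 0 := h.indep.ne_zero 0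

theorem IsFrameAt.mkQ_ne_zero {X V : ∀ y : M, TangentSpace 𝓘(ℝ, H) y} {y : M}
    (h : P.IsFrameAt X V y) : (P.line y).mkQ (V y) ≠ 0 := by
  intro h0
  rw [Submodule.mkQ_apply, Submodule.Quotient.mk_eq_zero, h.line_eq] at h0
  obtain ⟨c, hc⟩ := Submodule.mem_span_singleton.1 h0
  have := LinearIndependent.pair_iff.1 h.indep c (-1) (by rw [hc]; simp)
  simpa using this.2

theorem IsFrameAt.mkQ_fst {X V : ∀ y : M, TangentSpace 𝓘(ℝ, H) y} {y : M}
    (h : P.IsFrameAt X V y) : (P.line y).mkQ (X y) = 0 := by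
  rw [Submodule.mkQ_apply, Submodule.Quotient.mk_eq_zero, h.line_eq]
  exact Submodule.mem_span_singleton_self _

/-- Rescaling a frame gives a frame. -/
theorem IsFrameNear.rescale {X V X' : ∀ y : M, TangentSpace 𝓘(ℝ, H) y} {x : M}
    (h : P.IsFrameNear X V x) {c a₀ a₁ : ℝ} (hc : c ≠ 0) (h0 : a₀ ≠ 0)
    (hX' : JetRel x X X' a₀ a₁) : P.IsFrameNear X' (fun y => c • V y) x := by
  obtain ⟨f, hf, rfl, rfl⟩ := hX'
  have hf0 : ∀ᶠ y in 𝓝 x, f y ≠ 0 := hf.self_of_nhds.1.continuousAt.eventually_ne h0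
  filter_upwards [h, hf.eventually_nhds, hf0] with y h1 h2 h3
  have h2y := h2.self_of_nhds
  have hspan : Submodule.span ℝ {X y, V y} = Submodule.span ℝ {X' y, c • V y} := by
    rw [h2y.2, Submodule.span_insert, Submodule.span_insert,
      Submodule.span_singleton_smul_eq h3.isUnit, Submodule.span_singleton_smul_eq hc.isUnit]
  refine ⟨?_, ?_, ?_, ?_, ?_⟩
  · have h4 : SmoothFieldAt (fun z => f z • X z) y := ContMDiffAt.smul_section h2y.1 h1.smooth_fst
    refine ContMDiffAt.congr_of_eventuallyEq h4 ?_
    filter_upwards [h2] with z hz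
    rw [hz.2]
  · exact ContMDiffAt.const_smul_section h1.smooth_snd
  · rw [LinearIndependent.pair_iff, h2y.2]
    intro s t hst
    rw [smul_smul, smul_smul] at hst
    have := LinearIndependent.pair_iff.1 h1.indep _ _ hst
    exact ⟨(mul_eq_zero.1 this.1).resolve_right h3, (mul_eq_zero.1 this.2).resolve_right hc⟩
  · rw [h1.line_eq, h2y.2, Submodule.span_singleton_smul_eq h3.isUnit]
  · rw [h1.plane_eq, hspan]

variable [FiniteDimensional ℝ H]

theorem IsFrameNear.exists_coeff_line {X V W : ∀ y : M, TangentSpace 𝓘(ℝ, H) y} {x : M}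
    (h : P.IsFrameNear X V x) (hW : IsSectionNear P.line W x) :
    ∃ a : M → ℝ, ∀ᶠ y in 𝓝 x, ContMDiffAt 𝓘(ℝ, H) 𝓘(ℝ, ℝ) ∞ a y ∧ W y = a y • X y := by
  have h1 : ∀ y, ∃ a : ℝ, P.IsFrameAt X V y → W y ∈ P.line y → W y = a • X y := fun y => by
    by_cases hy : P.IsFrameAt X V y ∧ W y ∈ P.line y
    · have h2 := hy.2
      rw [hy.1.line_eq] at h2
      obtain ⟨a, ha⟩ := Submodule.mem_span_singleton.1 h2
      exact ⟨a, fun _ _ => ha.symm⟩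
    · exact ⟨0, fun h3 h4 => (hy ⟨h3, h4⟩).elim⟩
  choose a ha using h1
  refine ⟨a, ?_⟩
  filter_upwards [h.eventually_nhds, hW.eventually_nhds] with y hy hy'
  refine ⟨?_, ha y hy.self_of_nhds hy'.self_of_nhds.2⟩
  refine SmoothFieldAt.coeff (m := 1) (v := fun _ => X) (w := W) (c := fun y _ => a y)
    (fun _ => hy.self_of_nhds.smooth_fst) hy'.self_of_nhds.1 ?_ ?_ 0
  · exact LinearIndependent.of_subsingleton 0 hy.self_of_nhds.fst_ne_zero
  · filter_upwards [hy, hy'] with z hz hz'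
    simpa using ha z hz hz'.2

theorem IsFrameNear.exists_coeff_plane {X V W : ∀ y : M, TangentSpace 𝓘(ℝ, H) y} {x : M}
    (h : P.IsFrameNear X V x) (hW : IsSectionNear P.plane W x) :
    ∃ b e : M → ℝ, ∀ᶠ y in 𝓝 x, ContMDiffAt 𝓘(ℝ, H) 𝓘(ℝ, ℝ) ∞ b y ∧
      W y = e y • X y + b y • V y := by
  have h1 : ∀ y, ∃ c : Fin 2 → ℝ, P.IsFrameAt X V y → W y ∈ P.plane y →
      W y = c 0 • X y + c 1 • V y := fun y => by
    by_cases hy : P.IsFrameAt X V y ∧ W y ∈ P.plane y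
    · have h2 := hy.2
      rw [hy.1.plane_eq] at h2
      obtain ⟨a, b, ha⟩ := Submodule.mem_span_pair.1 h2
      exact ⟨![a, b], fun _ _ => by simpa using ha.symm⟩
    · exact ⟨0, fun h3 h4 => (hy ⟨h3, h4⟩).elim⟩
  choose c hc using h1
  refine ⟨fun y => c y 1, fun y => c y 0, ?_⟩
  filter_upwards [h.eventually_nhds, hW.eventually_nhds] with y hy hy'
  refine ⟨?_, hc y hy.self_of_nhds hy'.self_of_nhds.2⟩
  refine SmoothFieldAt.coeff (m := 2) (v := ![X, V]) (w := W) (c := c) ?_ hy'.self_of_nhds.1 ?_ ?_ 1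
  · intro i
    fin_cases i
    · exact hy.self_of_nhds.smooth_fst
    · exact hy.self_of_nhds.smooth_snd
  · convert! hy.self_of_nhds.indep using 1
    ext i : 1
    fin_cases i <;> rfl
  · filter_upwards [hy, hy'] with z hz hz'
    rw [Fin.sum_univ_two]
    exact hc z hz hz'.2

end DistPair

/-- The canonical bundle `E(𝒳, 𝒟)`: a point over `x` is a nonzero element of
`𝒟(x)/𝒳(x) ⊆ T_x M/𝒳(x)` together with the 1-jet at `x` of a nonvanishing section of `𝒳`. -/
@[ext]
structure CanonicalBundle (P : DistPair H M) where
  base : M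
  vec : TangentSpace 𝓘(ℝ, H) base ⧸ P.line base
  jet : Set (∀ y : M, TangentSpace 𝓘(ℝ, H) y)
  exists_frame : ∃ X V, P.IsFrameNear X V base ∧ vec = (P.line base).mkQ (V base) ∧
    jet = jetAt base X

namespace CanonicalBundle

variable {P : DistPair H M}

/-- The point `p` has fibre coordinates `c = (y, x₀, x₁)` with respect to the frame `(X, V)`:
it is given by the class of `y V` and the 1-jet of `f X`, where `f = x₀`, `X(f) = x₁` at the base
point. -/
def IsCoord (X V : ∀ y : M, TangentSpace 𝓘(ℝ, H) y) (p : CanonicalBundle P) (c : ℝ × ℝ × ℝ) :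
    Prop :=
  p.vec = c.1 • (P.line p.base).mkQ (V p.base) ∧ p.jet = {Y | JetRel p.base X Y c.2.1 c.2.2}

/-- The point over `x` with given fibre coordinates. -/
def ofCoord {X V : ∀ y : M, TangentSpace 𝓘(ℝ, H) y} {x : M} (h : P.IsFrameNear X V x)
    (c : ℝ × ℝ × ℝ) (h1 : c.1 ≠ 0) (h2 : c.2.1 ≠ 0) : CanonicalBundle P where
  base := x
  vec := c.1 • (P.line x).mkQ (V x)
  jet := {Y | JetRel x X Y c.2.1 c.2.2}
  exists_frame := by
    obtain ⟨X', hX'⟩ := exists_jetRel h.self_of_nhds.fst_ne_zero c.2.1 c.2.2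
    refine ⟨X', fun y => c.1 • V y, h.rescale h1 h2 hX', (map_smul _ _ _).symm, ?_⟩
    rw [jetAt, setOf_jetRel_eq h2 hX']
    simp

theorem isCoord_ofCoord {X V : ∀ y : M, TangentSpace 𝓘(ℝ, H) y} {x : M} (h : P.IsFrameNear X V x)
    (c : ℝ × ℝ × ℝ) (h1 : c.1 ≠ 0) (h2 : c.2.1 ≠ 0) : IsCoord X V (ofCoord h c h1 h2) c :=
  ⟨rfl, rfl⟩

theorem IsCoord.unique {X V : ∀ y : M, TangentSpace 𝓘(ℝ, H) y} {p : CanonicalBundle P}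
    {c c' : ℝ × ℝ × ℝ} (h : P.IsFrameNear X V p.base) (hc : IsCoord X V p c)
    (hc' : IsCoord X V p c') : c = c' := by
  have h1 : c.1 = c'.1 :=
    smul_left_injective ℝ h.self_of_nhds.mkQ_ne_zero (hc.1.symm.trans hc'.1)
  obtain ⟨X', hX'⟩ := exists_jetRel h.self_of_nhds.fst_ne_zero c.2.1 c.2.2
  have h2 : X' ∈ p.jet := hc.2 ▸ hX'
  rw [hc'.2] at h2
  have h3 := JetRel.unique (h.mono fun y hy => hy.fst_ne_zero) hX' h2
  exact Prod.ext h1 (Prod.ext h3.1 h3.2)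

/-- Coordinates with respect to a chart of the base and a local frame. -/
def coords (ψ : OpenPartialHomeomorph M H) (X V : ∀ y : M, TangentSpace 𝓘(ℝ, H) y)
    (p : CanonicalBundle P) : H × ℝ × ℝ × ℝ :=
  (ψ p.base, Classical.epsilon (IsCoord X V p))

theorem coords_eq {ψ : OpenPartialHomeomorph M H} {X V : ∀ y : M, TangentSpace 𝓘(ℝ, H) y}
    {p : CanonicalBundle P} {c : ℝ × ℝ × ℝ} (h : P.IsFrameNear X V p.base)
    (hc : IsCoord X V p c) : coords ψ X V p = (ψ p.base, c) := by
  have h1 : IsCoord X V p (Classical.epsilon (IsCoord X V p)) := Classical.epsilon_spec ⟨c, hc⟩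
  rw [coords, h1.unique h hc]

variable (P) in
/-- Domain of the coordinates `coords ψ X V`. -/
def coordSource (ψ : OpenPartialHomeomorph M H) (X V : ∀ y : M, TangentSpace 𝓘(ℝ, H) y) :
    Set (CanonicalBundle P) :=
  {p | p.base ∈ ψ.source ∧ P.IsFrameNear X V p.base}

variable [FiniteDimensional ℝ H]

theorem exists_isCoord {X V : ∀ y : M, TangentSpace 𝓘(ℝ, H) y} (p : CanonicalBundle P)
    (h : P.IsFrameNear X V p.base) : ∃ c, IsCoord X V p c ∧ c.1 ≠ 0 ∧ c.2.1 ≠ 0 := by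
  obtain ⟨x, w, J, X', V', hF, hw, hJ⟩ := p
  change P.IsFrameNear X V x at h
  obtain ⟨a, ha⟩ := h.exists_coeff_line (W := X') (hF.mono fun y hy =>
    ⟨hy.smooth_fst, by rw [hy.line_eq]; exact Submodule.mem_span_singleton_self _⟩)
  obtain ⟨b, e, hb⟩ := h.exists_coeff_plane (W := V') (hF.mono fun y hy =>
    ⟨hy.smooth_snd, by rw [hy.plane_eq]; exact Submodule.subset_span (by simp)⟩)
  have ha0 : a x ≠ 0 := by
    intro h0
    apply hF.self_of_nhds.fst_ne_zero
    rw [ha.self_of_nhds.2, h0, zero_smul]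
  have hbx : (P.line x).mkQ (V' x) = b x • (P.line x).mkQ (V x) := by
    rw [hb.self_of_nhds.2, map_add, map_smul, map_smul, h.self_of_nhds.mkQ_fst, smul_zero, zero_add]
  refine ⟨(b x, a x, dirDeriv X a x), ⟨hw.trans hbx, ?_⟩, ?_, ha0⟩
  · change J = {Y | JetRel x X Y (a x) (dirDeriv X a x)}
    rw [hJ, jetAt, setOf_jetRel_eq ha0 (⟨a, ha, rfl, rfl⟩ : JetRel x X X' _ _)]
    simp
  · intro h0
    apply hF.self_of_nhds.mkQ_ne_zero
    rw [hbx]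
    change b x = 0 at h0
    rw [h0, zero_smul]

theorem coords_injOn (ψ : OpenPartialHomeomorph M H) (X V : ∀ y : M, TangentSpace 𝓘(ℝ, H) y) :
    InjOn (coords ψ X V) (coordSource P ψ X V) := by
  rintro p ⟨h1, h2⟩ p' ⟨h1', h2'⟩ h
  obtain ⟨c, hc, -⟩ := exists_isCoord p h2
  obtain ⟨c', hc', -⟩ := exists_isCoord p' h2'
  rw [coords_eq h2 hc, coords_eq h2' hc', Prod.mk.injEq] at h
  obtain ⟨hb, rfl⟩ := h
  replace hb := ψ.injOn h1 h1' hb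
  obtain ⟨x, w, J, hJ⟩ := p
  obtain ⟨x', w', J', hJ'⟩ := p'
  obtain rfl : x = x' := hb
  obtain rfl : w = w' := hc.1.trans hc'.1.symm
  obtain rfl : J = J' := hc.2.trans hc'.2.symm
  rfl

theorem coords_trans {ψ ψ' : OpenPartialHomeomorph M H} (hψ : ψ ∈ atlas _ M) (hψ' : ψ' ∈ atlas _ M)
    {X V X' V' : ∀ y : M, TangentSpace 𝓘(ℝ, H) y} {p : CanonicalBundle P}
    (hp : p ∈ coordSource P ψ X V) (hp' : p ∈ coordSource P ψ' X' V') :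
    ∃ g : H × ℝ × ℝ × ℝ → H × ℝ × ℝ × ℝ, ContDiffAt ℝ ∞ g (coords ψ X V p) ∧
      ∀ᶠ u in 𝓝 (coords ψ X V p), ∃ w, w ∈ coordSource P ψ X V ∧ w ∈ coordSource P ψ' X' V' ∧
        coords ψ X V w = u ∧ coords ψ' X' V' w = g u := by
  obtain ⟨h1, h2⟩ := hp
  obtain ⟨h1', h2'⟩ := hp'
  obtain ⟨c, hc, hc1, hc2⟩ := exists_isCoord p h2
  rw [coords_eq h2 hc]
  set x := p.base with hx
  obtain ⟨a, ha⟩ := h2'.exists_coeff_line (W := X) (h2.mono fun y hy =>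
    ⟨hy.smooth_fst, by rw [hy.line_eq]; exact Submodule.mem_span_singleton_self _⟩)
  obtain ⟨b, e, hb⟩ := h2'.exists_coeff_plane (W := V) (h2.mono fun y hy =>
    ⟨hy.smooth_snd, by rw [hy.plane_eq]; exact Submodule.subset_span (by simp)⟩)
  have hψx : ψ.symm (ψ x) = x := ψ.left_inv h1
  have hsymm : ContMDiffAt 𝓘(ℝ, H) 𝓘(ℝ, H) ∞ ψ.symm (ψ x) :=
    (contMDiffOn_symm_of_mem_maximalAtlas (IsManifold.subset_maximalAtlas hψ)).contMDiffAt
      (ψ.open_target.mem_nhds (ψ.map_source h1))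
  have hpull : ∀ (f : M → H),
      ContMDiffAt 𝓘(ℝ, H) 𝓘(ℝ, H) ∞ f x →
      ContDiffAt ℝ ∞ (fun q : H × ℝ × ℝ × ℝ => f (ψ.symm q.1)) (ψ x, c) := by
    intro f hf
    have h4 : ContMDiffAt 𝓘(ℝ, H) 𝓘(ℝ, H) ∞ (fun u => f (ψ.symm u)) (ψ x) := by
      refine ContMDiffAt.comp (ψ x) ?_ hsymm
      rwa [hψx]
    exact ContDiffAt.comp (g := fun u => f (ψ.symm u)) (ψ x, c) (contMDiffAt_iff_contDiffAt.1 h4)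
      contDiffAt_fst
  have hpull_real : ∀ (f : M → ℝ), ContMDiffAt 𝓘(ℝ, H) 𝓘(ℝ, ℝ) ∞ f x →
      ContDiffAt ℝ ∞ (fun q : H × ℝ × ℝ × ℝ => f (ψ.symm q.1)) (ψ x, c) := by
    intro f hf
    have h4 : ContMDiffAt 𝓘(ℝ, H) 𝓘(ℝ, ℝ) ∞ (fun u => f (ψ.symm u)) (ψ x) := by
      refine ContMDiffAt.comp (ψ x) ?_ hsymm
      rwa [hψx]
    exact ContDiffAt.comp (g := fun u => f (ψ.symm u)) (ψ x, c) (contMDiffAt_iff_contDiffAt.1 h4)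
      contDiffAt_fst
  have htend : Tendsto (fun q : H × ℝ × ℝ × ℝ => ψ.symm q.1) (𝓝 (ψ x, c)) (𝓝 x) := by
    have h4 : ContinuousAt ψ.symm (ψ x) := hsymm.continuousAt
    have h5 : ContinuousAt (fun q : H × ℝ × ℝ × ℝ => ψ.symm q.1) (ψ x, c) :=
      ContinuousAt.comp (g := ψ.symm) h4 continuousAt_fst
    have h6 := h5.tendsto
    rwa [hψx] at h6
  refine ⟨fun q => (ψ' (ψ.symm q.1), q.2.1 * b (ψ.symm q.1), q.2.2.1 * a (ψ.symm q.1),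
    q.2.2.2 + q.2.2.1 * dirDeriv X' a (ψ.symm q.1)), ?_, ?_⟩
  · refine ContDiffAt.prodMk (hpull ψ' ?_) (ContDiffAt.prodMk (ContDiffAt.mul (by fun_prop)
      (hpull_real b hb.self_of_nhds.1)) (ContDiffAt.prodMk (ContDiffAt.mul (by fun_prop)
      (hpull_real a ha.self_of_nhds.1)) (ContDiffAt.add (by fun_prop)
      (ContDiffAt.mul (by fun_prop) (hpull_real _ (contMDiffAt_dirDeriv h2'.self_of_nhds.smooth_fst
        (ha.mono fun y hy => hy.1)))))))
    exact (contMDiffOn_of_mem_maximalAtlas (IsManifold.subset_maximalAtlas hψ')).contMDiffAt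
      (ψ'.open_source.mem_nhds h1')
  · have htgt : ∀ᶠ q : H × ℝ × ℝ × ℝ in 𝓝 (ψ x, c), q.1 ∈ ψ.target :=
      continuousAt_fst.eventually_mem (ψ.open_target.mem_nhds (ψ.map_source h1))
    have hq1 : ∀ᶠ q : H × ℝ × ℝ × ℝ in 𝓝 (ψ x, c), q.2.1 ≠ 0 :=
      ContinuousAt.eventually_ne (by fun_prop) hc1
    have hq2 : ∀ᶠ q : H × ℝ × ℝ × ℝ in 𝓝 (ψ x, c), q.2.2.1 ≠ 0 :=
      ContinuousAt.eventually_ne (by fun_prop) hc2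
    filter_upwards [htgt, hq1, hq2, htend.eventually h2.eventually_nhds,
      htend.eventually h2'.eventually_nhds, htend.eventually (ψ'.open_source.mem_nhds h1'),
      htend.eventually ha.eventually_nhds, htend.eventually hb]
      with q qt q1 q2 p2 p2' ps qa qb
    let w : CanonicalBundle P := ofCoord (P := P) (x := ψ.symm q.1) p2 q.2 q1 q2
    have hw : IsCoord X V w q.2 := isCoord_ofCoord p2 q.2 q1 q2
    have ha0 : a (ψ.symm q.1) ≠ 0 := by
      intro h0
      apply p2.self_of_nhds.fst_ne_zero
      rw [qa.self_of_nhds.2, h0, zero_smul]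
    have hw' : IsCoord X' V' w (q.2.1 * b (ψ.symm q.1), q.2.2.1 * a (ψ.symm q.1),
        q.2.2.2 + q.2.2.1 * dirDeriv X' a (ψ.symm q.1)) := by
      constructor
      · change q.2.1 • (P.line (ψ.symm q.1)).mkQ (V (ψ.symm q.1)) =
          (q.2.1 * b (ψ.symm q.1)) • (P.line (ψ.symm q.1)).mkQ (V' (ψ.symm q.1))
        rw [qb.2, map_add, map_smul, map_smul, p2'.self_of_nhds.mkQ_fst, smul_zero, zero_add,
          smul_smul]
      · exact setOf_jetRel_eq ha0 ⟨a, qa, rfl, rfl⟩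
    refine ⟨w, ⟨ψ.map_target qt, p2⟩, ⟨ps, p2'⟩, ?_, ?_⟩
    · rw [coords_eq (p := w) p2 hw]
      exact Prod.ext (ψ.right_inv qt) rfl
    · rw [coords_eq (p := w) p2' hw']
      rfl

variable (P) in
/-- The smooth atlas of the canonical bundle. -/
def coordAtlas : CoordAtlas (H × ℝ × ℝ × ℝ) (CanonicalBundle P) where
  Idx := {ψ : OpenPartialHomeomorph M H // ψ ∈ atlas _ M} ×
    (∀ y : M, TangentSpace 𝓘(ℝ, H) y) × (∀ y : M, TangentSpace 𝓘(ℝ, H) y)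
  source i := coordSource P i.1.1 i.2.1 i.2.2
  coord i := coords i.1.1 i.2.1 i.2.2
  injOn i := coords_injOn i.1.1 i.2.1 i.2.2
  cover p := by
    obtain ⟨X, V, h, -⟩ := p.exists_frame
    exact ⟨(⟨_, chart_mem_atlas _ _⟩, X, V), mem_chart_source _ _, h⟩
  trans i j _ hi hj := coords_trans i.1.2 j.1.2 hi hj

instance : TopologicalSpace (CanonicalBundle P) := (coordAtlas P).core.toTopologicalSpace

instance : ChartedSpace (H × ℝ × ℝ × ℝ) (CanonicalBundle P) := (coordAtlas P).core.toChartedSpace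

instance : IsManifold 𝓘(ℝ, H × ℝ × ℝ × ℝ) ∞ (CanonicalBundle P) := (coordAtlas P).isManifold_core

end CanonicalBundle

namespace CanonicalBundle

variable {P : DistPair H M}

/-- The right action of the group `Gl(1) ⊕ Aff(1)` on the canonical bundle: `c` multiplies the
vector, and the matrix with rows `(a, b)` and `(0, 1)` sends the 1-jet of `X` to the 1-jet of `f X`,
where `f = 1/a` and `X(f) = 2b/a` at the base point (so that a parameter `t` of `X` with `t = 0` at
that point is replaced by the projective parameter `a t / (b t + 1)`). -/
def act (c a : ℝˣ) (b : ℝ) (p : CanonicalBundle P) : CanonicalBundle P where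
  base := p.base
  vec := (c : ℝ) • p.vec
  jet := {Y | ∃ X ∈ p.jet, JetRel p.base X Y (a : ℝ)⁻¹ (2 * b * (a : ℝ)⁻¹)}
  exists_frame := by
    obtain ⟨X, V, h, hvec, hjet⟩ := p.exists_frame
    have ha : (a : ℝ)⁻¹ ≠ 0 := inv_ne_zero a.ne_zero
    obtain ⟨X', hX'⟩ := exists_jetRel h.self_of_nhds.fst_ne_zero (a : ℝ)⁻¹ (2 * b * (a : ℝ)⁻¹)
    refine ⟨X', fun y => (c : ℝ) • V y, h.rescale c.ne_zero ha hX', ?_, ?_⟩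
    · rw [hvec, map_smul]
    · have h1 : {Y | JetRel p.base X Y (a : ℝ)⁻¹ (2 * b * (a : ℝ)⁻¹)} = jetAt p.base X' := by
        rw [jetAt, setOf_jetRel_eq ha hX']
        simp
      rw [← h1]
      ext Y
      constructor
      · rintro ⟨X₁, hX₁, hY⟩
        rw [hjet] at hX₁
        have h2 := JetRel.comp hX₁ hY
        rwa [mul_one, mul_zero, add_zero] at h2
      · intro hY
        exact ⟨X, hjet ▸ JetRel.refl _ _, hY⟩

variable [FiniteDimensional ℝ H]

/-- The differential at `p` of the projection of the canonical bundle to its base. -/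
def dproj (p : CanonicalBundle P) :
    TangentSpace 𝓘(ℝ, H × ℝ × ℝ × ℝ) p →L[ℝ] TangentSpace 𝓘(ℝ, H) p.base :=
  mfderiv 𝓘(ℝ, H × ℝ × ℝ × ℝ) 𝓘(ℝ, H) (base : CanonicalBundle P → M) p

/-- The velocity at `t = 0` of a curve `γ` with `γ 0 = p`. -/
def velocity (γ : ℝ → CanonicalBundle P) (p : CanonicalBundle P) :
    TangentSpace 𝓘(ℝ, H × ℝ × ℝ × ℝ) p :=
  mfderiv 𝓘(ℝ, ℝ) 𝓘(ℝ, H × ℝ × ℝ × ℝ) γ 0 (1 : ℝ)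

/-- The fundamental vector field `𝐆`, from the generator of `Gl(1)`. -/
def fundG (p : CanonicalBundle P) : TangentSpace 𝓘(ℝ, H × ℝ × ℝ × ℝ) p :=
  velocity (fun t => act (Units.mk0 (Real.exp t) (Real.exp_ne_zero t)) 1 0 p) p

/-- The fundamental vector field `𝐅⁰`, from the dilations in `Aff(1)`. -/
def fundF₀ (p : CanonicalBundle P) : TangentSpace 𝓘(ℝ, H × ℝ × ℝ × ℝ) p :=
  velocity (fun t => act 1 (Units.mk0 (Real.exp t) (Real.exp_ne_zero t)) 0 p) p

/-- The fundamental vector field `𝐅¹`, from the translations in `Aff(1)`. -/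
def fundF₁ (p : CanonicalBundle P) : TangentSpace 𝓘(ℝ, H × ℝ × ℝ × ℝ) p :=
  velocity (fun t => act 1 1 t p) p

/-- `s` is, near `x`, the local section of the canonical bundle given by the frame `(X, V)`. -/
def IsSectionOf (X V : ∀ y : M, TangentSpace 𝓘(ℝ, H) y) (s : M → CanonicalBundle P) (x : M) :
    Prop :=
  ∀ᶠ y in 𝓝 x, (s y).base = y ∧ (s y).vec = (P.line (s y).base).mkQ (V (s y).base) ∧
    (s y).jet = jetAt (s y).base X

/-- The partial connection `𝒳~` on the canonical bundle: the direction at `p` of the curve obtained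
by moving a projective vector field, with a corresponding normal vector field, which together
define `p`, along the integral curve of `𝒳`. -/
def horizontalLine (k : ℕ) (p : CanonicalBundle P) :
    Submodule ℝ (TangentSpace 𝓘(ℝ, H × ℝ × ℝ × ℝ) p) :=
  Submodule.span ℝ {w | ∃ X V s, P.IsProjectiveNear k X V p.base ∧ IsSectionOf X V s p.base ∧
    s p.base = p ∧ w = mfderiv 𝓘(ℝ, H) 𝓘(ℝ, H × ℝ × ℝ × ℝ) s p.base (X p.base)}

variable (P) in
/-- Tuples of vector fields `(𝐆, 𝐅⁰, 𝐅¹, 𝐗, 𝐕⁰, …, 𝐕ᵏ)` on the canonical bundle. -/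
@[ext]
structure FrameTuple (k : ℕ) where
  G : ∀ p : CanonicalBundle P, TangentSpace 𝓘(ℝ, H × ℝ × ℝ × ℝ) p
  F₀ : ∀ p : CanonicalBundle P, TangentSpace 𝓘(ℝ, H × ℝ × ℝ × ℝ) p
  F₁ : ∀ p : CanonicalBundle P, TangentSpace 𝓘(ℝ, H × ℝ × ℝ × ℝ) p
  X : ∀ p : CanonicalBundle P, TangentSpace 𝓘(ℝ, H × ℝ × ℝ × ℝ) p
  V : Fin (k + 1) → ∀ p : CanonicalBundle P, TangentSpace 𝓘(ℝ, H × ℝ × ℝ × ℝ) p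

namespace FrameTuple

variable {k : ℕ} (B : FrameTuple P k)

/-- The members of the tuple as an indexed family. -/
def field : Fin 4 ⊕ Fin (k + 1) → ∀ p : CanonicalBundle P, TangentSpace 𝓘(ℝ, H × ℝ × ℝ × ℝ) p :=
  Sum.elim ![B.G, B.F₀, B.F₁, B.X] B.V

/-- The tuple is an adapted frame. -/
structure IsAdapted : Prop where
  smooth : ∀ i p, SmoothFieldAt (B.field i) p
  indep : ∀ p, LinearIndependent ℝ (fun i => B.field i p)
  spans : ∀ p, Submodule.span ℝ (range fun i => B.field i p) = ⊤
  G_eq : ∀ p, B.G p = fundG p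
  F₀_eq : ∀ p, B.F₀ p = fundF₀ p
  F₁_eq : ∀ p, B.F₁ p = fundF₁ p
  proj_V : ∀ p, (P.line p.base).mkQ (dproj p (B.V 0 p)) = p.vec
  proj_X : ∀ p, ∀ Y ∈ p.jet, dproj p (B.X p) = Y p.base
  X_mem : ∀ p, B.X p ∈ horizontalLine k p
  V_eq : ∀ i : Fin (k + 1), B.V i = adField B.X (B.V 0) i

/-- `T = (T_r)` are the torsion coefficients of `[𝐕ᵃ, 𝐕ᵇ]` at `p`, i.e.
`[𝐕ᵃ, 𝐕ᵇ] = ∑ r, T_r 𝐕ʳ` modulo `𝐗, 𝐆, 𝐅⁰, 𝐅¹`. -/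
def IsTorsion (a b : Fin (k + 1)) (p : CanonicalBundle P) (T : Fin (k + 1) → ℝ) : Prop :=
  VectorField.mlieBracket 𝓘(ℝ, H × ℝ × ℝ × ℝ) (B.V a) (B.V b) p - ∑ r, T r • B.V r p ∈
    Submodule.span ℝ {B.X p, B.G p, B.F₀ p, B.F₁ p}

/-- The canonical frame: the adapted frame with `T⁰¹₀ = T⁰¹₁ = T⁰¹₂ = 0` and `T⁰³₃ = 0`. -/
structure IsCanonical : Prop extends B.IsAdapted where
  torsion₀₁ : ∀ p T, B.IsTorsion 0 1 p T → T 0 = 0 ∧ T 1 = 0 ∧ T 2 = 0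
  torsion₀₃ : ∀ p T, B.IsTorsion 0 3 p T → T 3 = 0

end FrameTuple

end CanonicalBundle

end RegularPairs

namespace GL2Structure

variable {k : ℕ} {N : Type*} [TopologicalSpace N]
  [ChartedSpace (EuclideanSpace ℝ (Fin (k + 1))) N] [IsManifold (𝓡 (k + 1)) ∞ N]
  (S : GL2Structure k N)
  {N' : Type*} [TopologicalSpace N']
  [ChartedSpace (EuclideanSpace ℝ (Fin (k + 1))) N'] [IsManifold (𝓡 (k + 1)) ∞ N']
  (S' : GL2Structure k N')

/-- The differential at `m` of the projection of the bundle of rational normal curves to `N`. -/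
def CurveBundle.dproj [NeZero k] {S : GL2Structure k N} (m : S.CurveBundle) :
    TangentSpace 𝓘(ℝ, EuclideanSpace ℝ (Fin (k + 1)) × ℝ) m →L[ℝ]
      TangentSpace (𝓡 (k + 1)) m.base :=
  mfderiv 𝓘(ℝ, EuclideanSpace ℝ (Fin (k + 1)) × ℝ) (𝓡 (k + 1))
    (CurveBundle.base : S.CurveBundle → N) m

/-- The regular pair associated with a `Gl(2)`-structure: on the bundle of rational normal curves,
`𝒳` is the vertical distribution, and `𝒟` at a line `ℓ ⊆ T_x N` consists of the tangent vectors
which project into `ℓ`. -/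
def pair [NeZero k] : DistPair (EuclideanSpace ℝ (Fin (k + 1)) × ℝ) S.CurveBundle where
  line m := LinearMap.ker m.dproj.toLinearMap
  plane m := m.line.comap m.dproj.toLinearMap

/-- The canonical bundle of the regular pair associated with a `Gl(2)`-structure. -/
abbrev Bundle [NeZero k] : Type _ := CanonicalBundle S.pair

/-- The model space of the canonical bundle. -/
abbrev BundleModel (k : ℕ) : Type := (EuclideanSpace ℝ (Fin (k + 1)) × ℝ) × ℝ × ℝ × ℝ

/-- The differential of `f` at `y` carries the frames of `S` to frames of `S'`. -/
def PreservesAt (f : N → N') (y : N) : Prop :=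
  ∀ σ ∈ S.frames y, (mfderiv (𝓡 (k + 1)) (𝓡 (k + 1)) f y).comp σ ∈ S'.frames (f y)

/-- `S` and `S'` are equivalent: some diffeomorphism transforms `S` onto `S'`. -/
def Equivalent : Prop :=
  ∃ f : Diffeomorph (𝓡 (k + 1)) (𝓡 (k + 1)) N N' ∞, ∀ y, S.PreservesAt S' f y

/-- The germs of `S` at `x` and of `S'` at `x'` are equivalent. -/
def GermEquivalent (x : N) (x' : N') : Prop :=
  ∃ f : OpenPartialHomeomorph N N', x ∈ f.source ∧ f x = x' ∧
    ContMDiffOn (𝓡 (k + 1)) (𝓡 (k + 1)) ∞ f f.source ∧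
    ContMDiffOn (𝓡 (k + 1)) (𝓡 (k + 1)) ∞ f.symm f.target ∧
    ∀ y ∈ f.source, S.PreservesAt S' f y

section Frames

variable {S S'} [NeZero k] (B : CanonicalBundle.FrameTuple S.pair k)
  (B' : CanonicalBundle.FrameTuple S'.pair k)

/-- The differential of `Φ` at `p` carries the frame `B` to the frame `B'`. -/
def MapsFrameAt (Φ : S.Bundle → S'.Bundle) (p : S.Bundle) : Prop :=
  ∀ i, mfderiv 𝓘(ℝ, BundleModel k) 𝓘(ℝ, BundleModel k) Φ p (B.field i p) = B'.field i (Φ p)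

/-- The frames `B` and `B'` are equivalent, by an isomorphism of the principal bundles on which
they are defined. -/
def FramesEquivalent : Prop :=
  ∃ Φ : Diffeomorph 𝓘(ℝ, BundleModel k) 𝓘(ℝ, BundleModel k) S.Bundle S'.Bundle ∞,
    (∀ c a b p, Φ (CanonicalBundle.act c a b p) = CanonicalBundle.act c a b (Φ p)) ∧
    ∀ p, MapsFrameAt B B' Φ p

/-- The germs of the frames `B` at `p` and `B'` at `p'` are equivalent. -/
def FrameGermsEquivalent (p : S.Bundle) (p' : S'.Bundle) : Prop :=
  ∃ Φ : OpenPartialHomeomorph S.Bundle S'.Bundle, p ∈ Φ.source ∧ Φ p = p' ∧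
    ContMDiffOn 𝓘(ℝ, BundleModel k) 𝓘(ℝ, BundleModel k) ∞ Φ Φ.source ∧
    ContMDiffOn 𝓘(ℝ, BundleModel k) 𝓘(ℝ, BundleModel k) ∞ Φ.symm Φ.target ∧
    ∀ q ∈ Φ.source, MapsFrameAt B B' Φ q

end Frames

/-- The vector field `Z` is an infinitesimal symmetry of `S` near `x`: it is smooth and its local
flow `φ` preserves the structure. -/
def IsInfSymmetryAt (Z : ∀ y : N, TangentSpace (𝓡 (k + 1)) y) (x : N) : Prop :=
  (∀ᶠ y in 𝓝 x, SmoothFieldAt Z y) ∧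
  ∃ φ : ℝ → N → N, (∀ᶠ y in 𝓝 x, φ 0 y = y) ∧ ∀ᶠ z : ℝ × N in 𝓝 (0, x),
    ContMDiffAt (𝓘(ℝ, ℝ).prod (𝓡 (k + 1))) (𝓡 (k + 1)) ∞ (fun w : ℝ × N => φ w.1 w.2) z ∧
    mfderiv 𝓘(ℝ, ℝ) (𝓡 (k + 1)) (fun t => φ t z.2) z.1 (1 : ℝ) = Z (φ z.1 z.2) ∧
    S.PreservesAt S (φ z.1) z.2

/-- The space of germs at `x` of infinitesimal symmetries of `S`. -/
def symmetryGerms (x : N) :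
    Submodule ℝ (Filter.Germ (𝓝 x) (EuclideanSpace ℝ (Fin (k + 1)))) :=
  Submodule.span ℝ {g | ∃ Z : ∀ y : N, TangentSpace (𝓡 (k + 1)) y, S.IsInfSymmetryAt Z x ∧
    g = Filter.Germ.ofFun fun y => (Z y : EuclideanSpace ℝ (Fin (k + 1)))}

/-- The space of infinitesimal symmetries of `S` defined on the whole of `N`. -/
def symmetries : Submodule ℝ (∀ y : N, TangentSpace (𝓡 (k + 1)) y) :=
  Submodule.span ℝ {Z | ∀ x, S.IsInfSymmetryAt Z x}

/-- `S` is flat near `x`: there are local coordinates around `x` whose coordinate frames are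
frames of the structure. -/
def IsFlatAt (x : N) : Prop :=
  ∃ f : OpenPartialHomeomorph N (EuclideanSpace ℝ (Fin (k + 1))), x ∈ f.source ∧
    ContMDiffOn (𝓡 (k + 1)) (𝓡 (k + 1)) ∞ f f.source ∧
    ContMDiffOn (𝓡 (k + 1)) (𝓡 (k + 1)) ∞ f.symm f.target ∧
    ∀ y ∈ f.source, ∃ σ ∈ S.frames y, ∀ a,
      mfderiv (𝓡 (k + 1)) (𝓡 (k + 1)) f y (σ a) = WithLp.toLp 2 a

end GL2Structure

end

/-!
A point `p` of the canonical bundle `E` of a `Gl(2)`-structure `S` amounts to a frame `frame p` in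
`S` at the foot of `p`, and a frame of `S` comes from exactly one point (`eq_of_frame_eq`,
`exists_point`): the vector `v` projects to the value of the frame on `λ ^ k`, and the jet is that of
the parametrization of the rational normal curve by the frame. The actions of `Gl(1)` and
`Aff(1)` become right translations of frames (`frame_act`), so that `G`, `F⁰`, `F¹` and the
generator `fundX` of the unipotent group `flX` form a basis of `gl(2)` acting on binary forms
(`IsVerticalField`). The projective–normal frames are rigid to the second order along
the fibres (`projective_coeff`), which forces the canonical line field to be spanned by `fundX`
(`horizontalLine_eq`).

Regularity: `ad_𝒳 ^ i 𝒟` is the preimage of the `i`-th osculating space of the rational normal curve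
(`mem_adPlane_iff`).

Canonical frame: let `solder` be the form on `E` which reads the projection of a vector to `N` in the
frame at the point. An adapted frame is determined by `V⁰`, a field which `solder` maps to `λ ^ k`, so
`V⁰` is unique up to a combination `α X + β G + γ F⁰ + δ F¹` with functions as coefficients. This
combination changes the four normalized torsion coefficients by expressions which can be solved for
`α` first, then for `β` and `γ`, then for `δ` (`torsion_change`). Hence exactly one adapted frame is
canonical (`existsUnique_isCanonical`).

Equivalence: a map preserving the structures lifts to the frames, and the lift preserves the canonical
frame by uniqueness (`mapsFrameAt_lift`). Conversely, a map preserving the canonical frame preserves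
the vertical vectors, so it descends locally (`exists_descent`); the descended map preserves the
structures because `V⁰, …, Vᵏ` project to the frame (`exists_isLiftAt`). An equivariant map descends
globally, because the group action and the flow of `fundX` act transitively on the fibres
(`eq_of_foot_eq`).

Symmetries: an infinitesimal symmetry lifts to a field on `E` which commutes with the canonical frame
(`exists_isLiftField`), and such a field is determined by its value at a point
(`CommutesNear.eventually_zero`); hence the dimension is at most `dim E = k + 5`. If it is `k + 5`,
some lift `g` has the value `G` at `p`. The bracket with `g` has the eigenvalues `0` and `-1` only, so
the lifts in the eigenspace of `-1` commute (`bracket_eigen_eq_zero`). The corresponding `k + 1`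
symmetries of `N` are the coordinate fields of coordinates (`exists_tderiv_eq_const`), and these are
flat (`isFlatAt_of_lifts`). Conversely, the constant fields and the linear fields of `gl(2)` are
`k + 5` independent symmetries of a flat structure (`affineGerm`). On a connected `N` a symmetry is
determined by its germ at a point (`eq_zero_of_eventually_eq_zero`), which reduces global symmetries
to germs.
-/

open Set Filter Topology VectorField
open scoped Manifold ContDiff
open ContinuousLinearMap (comp_apply comp_smul comp_assoc id_comp id_apply fst snd proj inl inr)

noncomputable section

set_option linter.unusedSectionVars false

-- calculus on manifolds modelled on a normed space, in the class of smooth maps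
local notation "T[" A "]" => TangentSpace 𝓘(ℝ, A)
local notation "CDAt[" A "," B "]" => ContMDiffAt 𝓘(ℝ, A) 𝓘(ℝ, B) ∞
local notation "d[" A "," B "]" => mfderiv 𝓘(ℝ, A) 𝓘(ℝ, B)
local notation "MDAt[" A "," B "]" => MDifferentiableAt 𝓘(ℝ, A) 𝓘(ℝ, B)
local notation "lie[" A "]" => VectorField.mlieBracket 𝓘(ℝ, A)

/-! ### Calculus of vector fields on manifolds -/

/-- Vector fields, without any regularity. -/
abbrev VField (H : Type*) [NormedAddCommGroup H] [NormedSpace ℝ H] (M : Type*) [TopologicalSpace M]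
    [ChartedSpace H M] : Type _ :=
  ∀ y : M, T[H] y

/-- The map `f` is smooth at all points near `x`. -/
def SmoothNear {H : Type*} [NormedAddCommGroup H] [NormedSpace ℝ H] {M : Type*} [TopologicalSpace M]
    [ChartedSpace H M] {H' : Type*} [NormedAddCommGroup H'] [NormedSpace ℝ H'] {M' : Type*}
    [TopologicalSpace M'] [ChartedSpace H' M'] (f : M → M') (x : M) : Prop :=
  ∀ᶠ y in 𝓝 x, CDAt[H, H'] f y

local notation "Smooth[" A "," B "]" => SmoothNear (H := A) (H' := B)

section Calculus

variable {H : Type*} [NormedAddCommGroup H] [NormedSpace ℝ H]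
  {M : Type*} [TopologicalSpace M] [ChartedSpace H M]
  {H' : Type*} [NormedAddCommGroup H'] [NormedSpace ℝ H']
  {M' : Type*} [TopologicalSpace M'] [ChartedSpace H' M']
  {F : Type*} [NormedAddCommGroup F] [NormedSpace ℝ F]
  {G : Type*} [NormedAddCommGroup G] [NormedSpace ℝ G]

/-- The derivative of a vector-valued function along a tangent vector. -/
def tderiv (f : M → F) (x : M) (v : T[H] x) : F := d[H, F] f x v

/-- The derivative of a vector-valued function along a vector field. -/
def fieldDeriv (X : VField H M) (f : M → F) (x : M) : F := tderiv f x (X x)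

theorem SmoothNear.at {f : M → M'} {x : M} (h : Smooth[H, H'] f x) :
    CDAt[H, H'] f x := h.self_of_nhds

theorem SmoothNear.near {f : M → M'} {x : M} (h : Smooth[H, H'] f x) :
    ∀ᶠ y in 𝓝 x, Smooth[H, H'] f y := h.eventually_nhds

theorem SmoothNear.mdiff {f : M → M'} {x : M} (h : Smooth[H, H'] f x) :
    MDAt[H, H'] f x := h.at.mdifferentiableAt (by simp)

theorem tderiv_eq_fderiv {f : M → F} {x : M} (hf : MDAt[H, F] f x)
    (v : T[H] x) :
    tderiv f x v = fderiv ℝ (f ∘ (extChartAt 𝓘(ℝ, H) x).symm) (extChartAt 𝓘(ℝ, H) x x) v := by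
  unfold tderiv
  rw [hf.mfderiv]
  simp only [modelWithCornersSelf_coe, range_id, fderivWithin_univ]
  rfl

theorem MDifferentiableAt.differentiableAt_ext {f : M → F} {x : M}
    (hf : MDAt[H, F] f x) :
    DifferentiableAt ℝ (f ∘ (extChartAt 𝓘(ℝ, H) x).symm) (extChartAt 𝓘(ℝ, H) x x) := by
  have := hf.differentiableWithinAt_writtenInExtChartAt
  simp only [modelWithCornersSelf_coe, range_id, differentiableWithinAt_univ] at this
  exact this

section Rules

variable {x : M}

theorem tderiv_congr {f g : M → F} (h : f =ᶠ[𝓝 x] g) (v : T[H] x) :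
    tderiv f x v = tderiv g x v := by
  unfold tderiv
  rw [h.mfderiv_eq]
  rfl

theorem tderiv_const (c : F) (v : T[H] x) : tderiv (fun _ : M => c) x v = 0 := by
  unfold tderiv
  rw [mfderiv_const]
  rfl

theorem tderiv_comp {N : Type*} [TopologicalSpace N] [ChartedSpace H' N] {f : N → F} {π : M → N}
    (hf : MDAt[H', F] f (π x))
    (hπ : MDAt[H, H'] π x) (v : T[H] x) :
    tderiv (fun y => f (π y)) x v = tderiv f (π x) (d[H, H'] π x v) := by
  unfold tderiv
  have := mfderiv_comp x hf hπ
  change d[H, F] (f ∘ π) x v = _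
  rw [this]
  rfl

theorem tderiv_comp_fderiv {g : F → G} {f : M → F} (hg : DifferentiableAt ℝ g (f x))
    (hf : MDAt[H, F] f x) (v : T[H] x) :
    tderiv (fun y => g (f y)) x v = fderiv ℝ g (f x) (tderiv f x v) := by
  rw [tderiv_comp (H' := F) hg.mdifferentiableAt hf]
  unfold tderiv
  rw [mfderiv_eq_fderiv]
  rfl

theorem tderiv_clm (L : F →L[ℝ] G) {f : M → F} (hf : MDAt[H, F] f x)
    (v : T[H] x) : tderiv (fun y => L (f y)) x v = L (tderiv f x v) := by
  rw [tderiv_comp_fderiv L.differentiableAt hf, L.fderiv]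

theorem mdifferentiableAt_space_comp {g : F → G} {f : M → F} (hg : DifferentiableAt ℝ g (f x))
    (hf : MDAt[H, F] f x) :
    MDAt[H, G] (fun y => g (f y)) x :=
  MDifferentiableAt.comp (I' := 𝓘(ℝ, F)) x hg.mdifferentiableAt hf

theorem tderiv_prodMk {f : M → F} {g : M → G} (hf : MDAt[H, F] f x)
    (hg : MDAt[H, G] g x) (v : T[H] x) :
    tderiv (fun y => (f y, g y)) x v = (tderiv f x v, tderiv g x v) := by
  have h : MDAt[H, F × G] (fun y => (f y, g y)) x := hf.prodMk_space hg
  rw [tderiv_eq_fderiv h, tderiv_eq_fderiv hf, tderiv_eq_fderiv hg]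
  exact congrArg (fun L : H →L[ℝ] F × G => L v)
    (hf.differentiableAt_ext.hasFDerivAt.prodMk hg.differentiableAt_ext.hasFDerivAt).fderiv

theorem tderiv_sub {f g : M → F} (hf : MDAt[H, F] f x)
    (hg : MDAt[H, F] g x) (v : T[H] x) :
    tderiv (fun y => f y - g y) x v = tderiv f x v - tderiv g x v := by
  have h := tderiv_clm (fst ℝ F F - snd ℝ F F) (hf.prodMk_space hg) v
  rw [tderiv_prodMk hf hg] at h
  exact h

theorem tderiv_clm_apply {A : M → F →L[ℝ] G} {f : M → F}
    (hA : MDAt[H, F →L[ℝ] G] A x)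
    (hf : MDAt[H, F] f x) (v : T[H] x) :
    tderiv (fun y => A y (f y)) x v = A x (tderiv f x v) + tderiv A x v (f x) := by
  have hb : IsBoundedBilinearMap ℝ fun p : (F →L[ℝ] G) × F => p.1 p.2 := isBoundedBilinearMap_apply
  have h := tderiv_comp_fderiv (g := fun p : (F →L[ℝ] G) × F => p.1 p.2) (f := fun y => (A y, f y))
    (hb.differentiableAt (A x, f x)) (hA.prodMk_space hf) v
  rw [tderiv_prodMk hA hf, hb.fderiv] at h
  exact h

theorem tderiv_vadd (f : M → F) (v w : T[H] x) :
    tderiv f x (v + w) = tderiv f x v + tderiv f x w := map_add _ _ _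

theorem tderiv_vsmul (f : M → F) (c : ℝ) (v : T[H] x) :
    tderiv f x (c • v) = c • tderiv f x v := map_smul _ _ _

theorem tderiv_vzero (f : M → F) : tderiv f x (0 : T[H] x) = 0 := map_zero _

theorem tderiv_vsum (f : M → F) {ι : Type*} (s : Finset ι) (v : ι → T[H] x) :
    tderiv f x (∑ i ∈ s, v i) = ∑ i ∈ s, tderiv f x (v i) := map_sum (mfderiv _ _ _ _) _ _

/-- The derivative along a vector is the derivative along any curve with that velocity. -/
theorem hasDerivAt_comp_curve {f : M → F} {γ : ℝ → M} {s : ℝ}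
    (hf : MDAt[H, F] f (γ s))
    (hγ : MDAt[ℝ, H] γ s) :
    HasDerivAt (fun r => f (γ r)) (tderiv f (γ s) (d[ℝ, H] γ s (1 : ℝ))) s := by
  have h := (hf.comp s hγ).differentiableAt.hasDerivAt
  have h2 : deriv (f ∘ γ) s =
      tderiv f (γ s) (d[ℝ, H] γ s (1 : ℝ)) := by
    rw [← fderiv_apply_one_eq_deriv, ← mfderiv_eq_fderiv, mfderiv_comp s hf hγ]
    rfl
  rw [h2] at h
  exact h

end Rules

section Smooth

variable {x : M}

theorem SmoothNear.comp_space {g : F → G} {f : M → F}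
    (hg : ∀ᶠ z in 𝓝 (f x), ContDiffAt ℝ ∞ g z) (hf : Smooth[H, F] f x) :
    Smooth[H, G] (fun y => g (f y)) x := by
  filter_upwards [hf, hf.at.continuousAt.eventually hg] with y h1 h2
  exact ContMDiffAt.comp (I' := 𝓘(ℝ, F)) y h2.contMDiffAt h1

theorem smoothNear_const (c : M') : Smooth[H, H'] (fun _ : M => c) x :=
  .of_forall fun _ => contMDiffAt_const

theorem SmoothNear.congr {f g : M → M'} (hf : Smooth[H, H'] f x)
    (h : g =ᶠ[𝓝 x] f) : Smooth[H, H'] g x := by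
  filter_upwards [hf, h.eventuallyEq_nhds] with y h1 h2 using h1.congr_of_eventuallyEq h2

theorem SmoothNear.clm (L : F →L[ℝ] G) {f : M → F} (hf : Smooth[H, F] f x) :
    Smooth[H, G] (fun y => L (f y)) x :=
  SmoothNear.comp_space (.of_forall fun _ => L.contDiff.contDiffAt) hf

theorem SmoothNear.prodMk {f : M → F} {g : M → G} (hf : Smooth[H, F] f x)
    (hg : Smooth[H, G] g x) :
    Smooth[H, F × G] (fun y => (f y, g y)) x := by
  filter_upwards [hf, hg] with y h1 h2 using h1.prodMk_space h2

theorem SmoothNear.add {f g : M → F} (hf : Smooth[H, F] f x)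
    (hg : Smooth[H, F] g x) :
    Smooth[H, F] (fun y => f y + g y) x :=
  SmoothNear.comp_space (g := fun p : F × F => p.1 + p.2)
    (.of_forall fun _ => by fun_prop) (hf.prodMk hg)

theorem SmoothNear.sub {f g : M → F} (hf : Smooth[H, F] f x)
    (hg : Smooth[H, F] g x) :
    Smooth[H, F] (fun y => f y - g y) x :=
  SmoothNear.comp_space (g := fun p : F × F => p.1 - p.2)
    (.of_forall fun _ => by fun_prop) (hf.prodMk hg)

theorem SmoothNear.smul {c : M → ℝ} {g : M → F} (hf : Smooth[H, ℝ] c x)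
    (hg : Smooth[H, F] g x) :
    Smooth[H, F] (fun y => c y • g y) x :=
  SmoothNear.comp_space (g := fun p : ℝ × F => p.1 • p.2)
    (.of_forall fun _ => by fun_prop) (hf.prodMk hg)

theorem SmoothNear.mul {c d : M → ℝ} (hf : Smooth[H, ℝ] c x)
    (hg : Smooth[H, ℝ] d x) :
    Smooth[H, ℝ] (fun y => c y * d y) x :=
  hf.smul hg

theorem SmoothNear.clm_apply {A : M → F →L[ℝ] G} {g : M → F}
    (hf : Smooth[H, F →L[ℝ] G] A x) (hg : Smooth[H, F] g x) :
    Smooth[H, G] (fun y => A y (g y)) x :=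
  SmoothNear.comp_space (g := fun p : (F →L[ℝ] G) × F => p.1 p.2)
    (.of_forall fun _ => by fun_prop) (hf.prodMk hg)

theorem SmoothNear.comp_map {N : Type*} [TopologicalSpace N] [ChartedSpace H' N]
    {K : Type*} [NormedAddCommGroup K] [NormedSpace ℝ K]
    {L : Type*} [TopologicalSpace L] [ChartedSpace K L] {f : N → L} {π : M → N}
    (hf : Smooth[H', K] f (π x)) (hπ : Smooth[H, H'] π x) :
    Smooth[H, K] (fun y => f (π y)) x := by
  filter_upwards [hπ, hπ.at.continuousAt.eventually hf] with y h1 h2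
  exact ContMDiffAt.comp y h2 h1

end Smooth

section Fields

/-- The vector field `X` is smooth at all points near `x`. -/
def SmoothFieldNear [IsManifold 𝓘(ℝ, H) ∞ M] (X : VField H M) (x : M) : Prop :=
  ∀ᶠ y in 𝓝 x, SmoothFieldAt X y

variable [IsManifold 𝓘(ℝ, H) ∞ M] [FiniteDimensional ℝ H] {x : M} {X Y Z : VField H M}

theorem SmoothFieldNear.near (h : SmoothFieldNear X x) : ∀ᶠ y in 𝓝 x, SmoothFieldNear X y :=
  h.eventually_nhds

theorem SmoothFieldNear.congr (h : SmoothFieldNear X x) (h' : ∀ᶠ y in 𝓝 x, Y y = X y) :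
    SmoothFieldNear Y x := by
  filter_upwards [h, h'.eventually_nhds] with y h1 h2
  refine ContMDiffAt.congr_of_eventuallyEq h1 ?_
  filter_upwards [h2] with z hz
  rw [hz]

theorem SmoothFieldAt.mdiff (h : SmoothFieldAt X x) :
    MDifferentiableAt 𝓘(ℝ, H) 𝓘(ℝ, H).tangent (fun y => (⟨y, X y⟩ : TangentBundle 𝓘(ℝ, H) M)) x :=
  ContMDiffAt.mdifferentiableAt h (by simp)

theorem SmoothFieldNear.add (hX : SmoothFieldNear X x) (hY : SmoothFieldNear Y x) :
    SmoothFieldNear (fun y => X y + Y y) x := by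
  filter_upwards [hX, hY] with y h1 h2 using ContMDiffAt.add_section h1 h2

theorem SmoothFieldNear.sub (hX : SmoothFieldNear X x) (hY : SmoothFieldNear Y x) :
    SmoothFieldNear (fun y => X y - Y y) x := by
  filter_upwards [hX, hY] with y h1 h2 using ContMDiffAt.sub_section h1 h2

theorem SmoothFieldNear.smul {c : M → ℝ} (hc : Smooth[H, ℝ] c x)
    (hY : SmoothFieldNear Y x) : SmoothFieldNear (fun y => c y • Y y) x := by
  filter_upwards [hc, hY] with y h1 h2 using ContMDiffAt.smul_section h1 h2

theorem smoothFieldNear_zero :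
    SmoothFieldNear (fun y => (0 : T[H] y)) x :=
  .of_forall fun _ => Bundle.contMDiffAt_zeroSection ..

theorem SmoothFieldNear.sum {ι : Type*} {s : Finset ι} {X : ι → VField H M}
    (h : ∀ i ∈ s, SmoothFieldNear (X i) x) : SmoothFieldNear (fun y => ∑ i ∈ s, X i y) x := by
  classical
  induction s using Finset.induction_on with
  | empty => simpa using smoothFieldNear_zero
  | insert a s ha ih =>
    simp only [Finset.sum_insert ha]
    exact (h a (Finset.mem_insert_self _ _)).add (ih fun i hi => h i (Finset.mem_insert_of_mem hi))

variable (H M) in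
theorem isManifold_minSmoothness_three :
    IsManifold 𝓘(ℝ, H) (minSmoothness ℝ 3) M := by
  rw [minSmoothness_of_isRCLikeNormedField]
  exact IsManifold.of_le (n := ∞) (WithTop.coe_le_coe.2 (le_top : (3 : ℕ∞) ≤ ⊤))

theorem SmoothFieldNear.bracket (hX : SmoothFieldNear X x) (hY : SmoothFieldNear Y x) :
    SmoothFieldNear (lie[H] X Y) x := by
  have : CompleteSpace H := FiniteDimensional.complete ℝ H
  have := isManifold_minSmoothness_three H M
  have : IsManifold 𝓘(ℝ, H) (((⊤ : ℕ∞) : WithTop ℕ∞) + 1) M := ‹IsManifold 𝓘(ℝ, H) ∞ M›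
  filter_upwards [hX, hY] with y h1 h2
  exact ContMDiffAt.mlieBracket_vectorField (m := ⊤) (n := ⊤) h1 h2
    (by rw [minSmoothness_of_isRCLikeNormedField]; rfl)

theorem bracket_congr {X' Y' : VField H M} (hX : ∀ᶠ y in 𝓝 x, X y = X' y)
    (hY : ∀ᶠ y in 𝓝 x, Y y = Y' y) :
    lie[H] X Y x = lie[H] X' Y' x :=
  Filter.EventuallyEq.mlieBracket_vectorField_eq hX hY

end Fields

end Calculus

section Manifold

variable {H : Type*} [NormedAddCommGroup H] [NormedSpace ℝ H] [FiniteDimensional ℝ H]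
  {M : Type*} [TopologicalSpace M] [ChartedSpace H M] [IsManifold 𝓘(ℝ, H) ∞ M]
  {F : Type*} [NormedAddCommGroup F] [NormedSpace ℝ F] {x : M}

/-! ### Lie brackets of vector fields -/

section Brackets

variable {X Y Z : VField H M}

theorem bracket_swap : lie[H] X Y x = -lie[H] Y X x := mlieBracket_swap_apply

theorem bracket_self : lie[H] X X x = 0 := by
  have h : lie[H] X X x = -lie[H] X X x := bracket_swap
  have h2 : (2 : ℝ) • lie[H] X X x = 0 := by
    rw [two_smul]; nth_rewrite 1 [h]; simp
  exact (smul_eq_zero.1 h2).resolve_left two_ne_zero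

theorem bracket_add_right (hY : SmoothFieldAt Y x) (hZ : SmoothFieldAt Z x) :
    lie[H] X (fun y => Y y + Z y) x = lie[H] X Y x + lie[H] X Z x :=
  have : CompleteSpace H := FiniteDimensional.complete ℝ H
  have := isManifold_minSmoothness_three H M
  mlieBracket_add_right hY.mdiff hZ.mdiff

theorem bracket_smul_right {c : M → ℝ} (hc : MDAt[H, ℝ] c x)
    (hY : SmoothFieldAt Y x) :
    lie[H] X (fun y => c y • Y y) x = tderiv c x (X x) • Y x + c x • lie[H] X Y x :=
  have : CompleteSpace H := FiniteDimensional.complete ℝ H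
  have := isManifold_minSmoothness_three H M
  mlieBracket_smul_right hc hY.mdiff

theorem bracket_const_smul_right (c : ℝ) (hY : SmoothFieldAt Y x) :
    lie[H] X (fun y => c • Y y) x = c • lie[H] X Y x := by
  have h := bracket_smul_right (X := X) (c := fun _ => c) (mdifferentiableAt_const) hY
  rw [tderiv_const, zero_smul, zero_add] at h
  exact h

theorem bracket_sub_right (hY : SmoothFieldAt Y x) (hZ : SmoothFieldAt Z x) :
    lie[H] X (fun y => Y y - Z y) x = lie[H] X Y x - lie[H] X Z x := by
  have h := bracket_add_right (X := X) hY
    (show SmoothFieldAt (fun y => (-1 : ℝ) • Z y) x from ContMDiffAt.const_smul_section hZ)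
  rw [bracket_const_smul_right _ hZ, neg_one_smul, ← sub_eq_add_neg] at h
  rw [← h]
  exact bracket_congr (.of_forall fun _ => rfl) (.of_forall fun y => by simp [sub_eq_add_neg])

theorem bracket_zero_right :
    lie[H] X (fun y => (0 : T[H] y)) x = 0 := by
  have := congrFun (mlieBracket_zero_right (I := 𝓘(ℝ, H)) (W := X)) x
  exact this

theorem bracket_sum_right {ι : Type*} {s : Finset ι} {W : ι → VField H M}
    (h : ∀ i ∈ s, SmoothFieldNear (W i) x) :
    lie[H] X (fun y => ∑ i ∈ s, W i y) x = ∑ i ∈ s, lie[H] X (W i) x := by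
  classical
  induction s using Finset.induction_on with
  | empty => simpa using bracket_zero_right
  | insert a s ha ih =>
    simp only [Finset.sum_insert ha]
    rw [← ih fun i hi => h i (Finset.mem_insert_of_mem hi)]
    exact bracket_add_right (h a (Finset.mem_insert_self _ _)).self_of_nhds
      (SmoothFieldNear.sum fun i hi => h i (Finset.mem_insert_of_mem hi)).self_of_nhds

theorem bracket_jacobi (hX : SmoothFieldAt X x) (hY : SmoothFieldAt Y x) (hZ : SmoothFieldAt Z x) :
    lie[H] X (lie[H] Y Z) x = lie[H] (lie[H] X Y) Z x + lie[H] Y (lie[H] X Z) x := by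
  have : CompleteSpace H := FiniteDimensional.complete ℝ H
  have := isManifold_minSmoothness_three H M
  have h2 : minSmoothness ℝ 2 ≤ (∞ : WithTop ℕ∞) := by
    rw [minSmoothness_of_isRCLikeNormedField]
    exact WithTop.coe_le_coe.2 (le_top : (2 : ℕ∞) ≤ ⊤)
  exact leibniz_identity_mlieBracket_apply (hX.of_le h2) (hY.of_le h2) (hZ.of_le h2)

/-- Differentiation along a Lie bracket is the commutator of the differentiations. -/
theorem tderiv_bracket {f : M → F} (hf : Smooth[H, F] f x)
    (hX : SmoothFieldAt X x) (hY : SmoothFieldAt Y x) :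
    tderiv f x (lie[H] X Y x) =
      tderiv (fun y => tderiv f y (Y y)) x (X x) - tderiv (fun y => tderiv f y (X y)) x (Y x) := by
  have : CompleteSpace H := FiniteDimensional.complete ℝ H
  have : IsManifold 𝓘(ℝ, H) 1 M := IsManifold.of_le (n := ∞) (by simp)
  set e := extChartAt 𝓘(ℝ, H) x with he
  -- the fields and the function in the chart
  let X' : H → H := mpullbackWithin 𝓘(ℝ, H) 𝓘(ℝ, H) e.symm X (range 𝓘(ℝ, H))
  let Y' : H → H := mpullbackWithin 𝓘(ℝ, H) 𝓘(ℝ, H) e.symm Y (range 𝓘(ℝ, H))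
  have htgt : e.target ∈ 𝓝 (e x) := extChartAt_target_mem_nhds x
  have hxs : e.symm (e x) = x := extChartAt_to_inv x
  have hsm : ∀ u ∈ e.target, MDAt[H, H] e.symm u := fun u hu =>
    ((contMDiffOn_extChartAt_symm (I := 𝓘(ℝ, H)) (n := 1) x).contMDiffAt
      ((isOpen_extChartAt_target x).mem_nhds hu)).mdifferentiableAt one_ne_zero
  have hcont : ContinuousAt e.symm (e x) := (hsm _ (mem_extChartAt_target x)).continuousAt
  have hfn : ∀ᶠ u in 𝓝 (e x), Smooth[H, F] f (e.symm u) := by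
    refine hcont.eventually ?_
    rw [hxs]
    exact hf.near
  have hinv : ∀ u ∈ e.target, (mfderivWithin 𝓘(ℝ, H) 𝓘(ℝ, H) e.symm (range 𝓘(ℝ, H)) u).IsInvertible :=
    fun u hu => isInvertible_mfderivWithin_extChartAt_symm hu
  let f' : H → F := fun u => f (e.symm u)
  have key : ∀ (W : VField H M), ∀ᶠ u in 𝓝 (e x),
      tderiv f (e.symm u) (W (e.symm u)) =
        fderiv ℝ f' u (mpullbackWithin 𝓘(ℝ, H) 𝓘(ℝ, H) e.symm W (range 𝓘(ℝ, H)) u) := by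
    intro W
    filter_upwards [htgt, hfn] with u hu hfu
    have h1 := hinv u hu
    rw [mpullbackWithin_apply]
    simp only [modelWithCornersSelf_coe, range_id, mfderivWithin_univ] at h1 ⊢
    rw [← mfderiv_eq_fderiv, show f' = f ∘ e.symm from rfl, mfderiv_comp u hfu.mdiff (hsm u hu)]
    change _ = d[H, F] f (e.symm u) (d[H, H] e.symm u ((d[H, H] e.symm u).inverse (W (e.symm u))))
    rw [h1.self_apply_inverse]
    rfl
  have hf' : ContDiffAt ℝ ∞ f' (e x) := by
    refine ContMDiffAt.contDiffAt ?_
    refine ContMDiffAt.comp (e x) (g := f) ?_ ((contMDiffOn_extChartAt_symm x).contMDiffAt htgt)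
    rw [hxs]
    exact hf.at
  have hdiff : ∀ W : VField H M, SmoothFieldAt W x →
      DifferentiableAt ℝ (mpullbackWithin 𝓘(ℝ, H) 𝓘(ℝ, H) e.symm W (range 𝓘(ℝ, H)) : H → H)
        (e x) := by
    intro W hW
    have h1 := MDifferentiableWithinAt.differentiableWithinAt_mpullbackWithin_vectorField
      (s := univ) hW.mdiff.mdifferentiableWithinAt
    rw [show (extChartAt 𝓘(ℝ, H) x).symm ⁻¹' univ ∩ range 𝓘(ℝ, H) = univ by simp] at h1
    exact DifferentiableWithinAt.differentiableAt h1 univ_mem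
  have hback : ∀ (h : M → F) (h' : H → F), DifferentiableAt ℝ h' (e x) →
      (∀ᶠ u in 𝓝 (e x), h (e.symm u) = h' u) → ∀ v : T[H] x, tderiv h x v =
      fderiv ℝ h' (e x) (d[H, H] e x v) := by
    intro h h' hh' heq v
    have h1 : h =ᶠ[𝓝 x] fun y => h' (e y) := by
      filter_upwards [extChartAt_source_mem_nhds (I := 𝓘(ℝ, H)) x,
        (continuousAt_extChartAt (I := 𝓘(ℝ, H)) x).eventually heq] with y hy hy'
      rw [← hy', e.left_inv hy]
    rw [tderiv_congr h1, tderiv_comp (H' := H) (f := h') hh'.mdifferentiableAt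
      ((contMDiffAt_extChartAt (n := 1)).mdifferentiableAt one_ne_zero)]
    unfold tderiv
    rw [mfderiv_eq_fderiv]
    rfl
  have hfd : DifferentiableAt ℝ (fderiv ℝ f') (e x) :=
    (hf'.fderiv_right (m := 1) (WithTop.coe_le_coe.2 (le_top : (1 + 1 : ℕ∞) ≤ ⊤))).differentiableAt
      one_ne_zero
  have hb : d[H, H] e x (lie[H] X Y x) =
      lieBracket ℝ X' Y' (e x) := by
    rw [← mlieBracketWithin_univ, mlieBracketWithin_apply]
    rw [show (extChartAt 𝓘(ℝ, H) x).symm ⁻¹' univ ∩ range 𝓘(ℝ, H) = univ by simp]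
    refine ((isInvertible_mfderiv_extChartAt (I := 𝓘(ℝ, H))
      (mem_extChartAt_source x)).self_apply_inverse _).trans ?_
    exact congrFun (lieBracketWithin_univ (V := X') (W := Y')) (e x)
  have hval : ∀ W : VField H M,
      d[H, H] e x (W x) = mpullbackWithin 𝓘(ℝ, H) 𝓘(ℝ, H) e.symm W (range 𝓘(ℝ, H)) (e x) := by
    intro W
    have h1 : ∀ y, y = x → (W y : H) = W x := by rintro _ rfl; rfl
    rw [mfderiv_extChartAt_self, mpullbackWithin_apply]
    have h2 := mfderivWithin_extChartAt_symm_inverse_apply (I := 𝓘(ℝ, H)) (x := x) (W x)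
    rw [← h1 _ hxs] at h2
    exact (h1 _ hxs).symm.trans h2.symm
  rw [hback f f' (hf'.differentiableAt (by simp)) (.of_forall fun _ => rfl), hb,
    fderiv_apply_lieBracket hf' (by
      rw [minSmoothness_of_isRCLikeNormedField]
      exact WithTop.coe_le_coe.2 (le_top : (2 : ℕ∞) ≤ ⊤)) (hdiff Y hY) (hdiff X hX),
    hback _ _ (hfd.clm_apply (hdiff Y hY)) (key Y), hback _ _ (hfd.clm_apply (hdiff X hX)) (key X),
    hval X, hval Y]

end Brackets

/-! ### Fields in charts, and fields of frames -/

section Charts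

variable {X Y Z : VField H M}

theorem SmoothNear.tderiv {f : M → F} (hf : Smooth[H, F] f x)
    (hX : SmoothFieldNear X x) : Smooth[H, F] (fun y => tderiv f y (X y)) x := by
  filter_upwards [hf.eventually_nhds, hX] with x hf hX
  obtain ⟨U, hU, hUo, hxU⟩ := eventually_nhds_iff.1 hf
  have h1 : ContMDiffOn 𝓘(ℝ, H) 𝓘(ℝ, F) ∞ f U := fun y hy => (hU y hy).contMDiffWithinAt
  have h2 := h1.contMDiffOn_tangentMapWithin (m := ∞) (by simp) hUo.uniqueMDiffOn
  have h3 : ContMDiffAt 𝓘(ℝ, H).tangent 𝓘(ℝ, F).tangent ∞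
      (tangentMapWithin 𝓘(ℝ, H) 𝓘(ℝ, F) f U) (⟨x, X x⟩ : TangentBundle 𝓘(ℝ, H) M) :=
    (h2 _ hxU).contMDiffAt
      ((FiberBundle.continuous_proj H (T[H])).continuousAt.preimage_mem_nhds (hUo.mem_nhds hxU))
  have h4 := (contMDiff_snd_tangentBundle_modelSpace F 𝓘(ℝ, F) (n := ∞)).contMDiffAt.comp x
    (h3.comp x hX)
  refine h4.congr_of_eventuallyEq ?_
  filter_upwards [hUo.mem_nhds hxU] with y hy
  change d[H, F] f y (X y) = mfderivWithin 𝓘(ℝ, H) 𝓘(ℝ, F) f U y (X y)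
  rw [mfderivWithin_of_isOpen hUo hy]

/-- A chart of the smooth structure. -/
abbrev SmoothChart (e : OpenPartialHomeomorph M H) : Prop := e ∈ IsManifold.maximalAtlas 𝓘(ℝ, H) ∞ M

variable {e : OpenPartialHomeomorph M H}

theorem SmoothChart.smoothNear (he : SmoothChart e) (hx : x ∈ e.source) :
    Smooth[H, H] e x := by
  filter_upwards [e.open_source.mem_nhds hx] with y hy
  exact (contMDiffOn_of_mem_maximalAtlas he).contMDiffAt (e.open_source.mem_nhds hy)

theorem SmoothChart.smoothNear_symm (he : SmoothChart e) {u : H} (hu : u ∈ e.target) :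
    Smooth[H, H] e.symm u := by
  filter_upwards [e.open_target.mem_nhds hu] with y hy
  exact (contMDiffOn_symm_of_mem_maximalAtlas he).contMDiffAt (e.open_target.mem_nhds hy)

theorem smoothChart_of_mem_atlas (he : e ∈ atlas H M) : SmoothChart e :=
  IsManifold.subset_maximalAtlas he

theorem SmoothChart.symm_tderiv (he : SmoothChart e) (hx : x ∈ e.source)
    (v : T[H] x) :
    d[H, H] e.symm (e x) (tderiv e x v : H) = v := by
  have hu := e.map_source hx
  have h1 : MDAt[H, H] e.symm (e x) := (he.smoothNear_symm hu).mdiff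
  have h2 := mfderiv_comp x h1 (he.smoothNear hx).mdiff
  have h3 : e.symm ∘ e =ᶠ[𝓝 x] id := by
    filter_upwards [e.open_source.mem_nhds hx] with y hy using e.left_inv hy
  rw [h3.mfderiv_eq, mfderiv_id] at h2
  exact (congrArg (fun L : H →L[ℝ] H => L v) h2).symm

theorem SmoothChart.tderiv_symm (he : SmoothChart e) (hx : x ∈ e.source) (c : H) :
    tderiv e x (d[H, H] e.symm (e x) c : H) = c := by
  have hu := e.map_source hx
  have h1 : MDAt[H, H] e.symm (e x) := (he.smoothNear_symm hu).mdiff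
  have h0 : MDAt[H, H] e (e.symm (e x)) := by
    rw [e.left_inv hx]; exact (he.smoothNear hx).mdiff
  have h2 := mfderiv_comp (e x) h0 h1
  have h3 : e ∘ e.symm =ᶠ[𝓝 (e x)] id := by
    filter_upwards [e.open_target.mem_nhds hu] with y hy using e.right_inv hy
  rw [h3.mfderiv_eq, mfderiv_id] at h2
  have h4 : ∀ y, y = x → ∀ v : H, d[H, H] e y v = d[H, H] e x v := by
    rintro _ rfl _; rfl
  exact (h4 _ (e.left_inv hx) _).symm.trans (congrArg (fun L : H →L[ℝ] H => L c) h2).symm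

theorem SmoothChart.tderiv_injective (he : SmoothChart e) (hx : x ∈ e.source)
    {v w : T[H] x} (h : tderiv e x v = tderiv e x w) : v = w := by
  rw [← he.symm_tderiv hx v, h, he.symm_tderiv hx w]

/-- The vector field with components `c` in the chart `e`. -/
def chartField (e : OpenPartialHomeomorph M H) (c : M → H) (y : M) : T[H] y :=
  (d[H, H] e.symm (e y) (c y) : H)

theorem SmoothChart.tderiv_chartField (he : SmoothChart e) (hx : x ∈ e.source) (c : M → H) :
    _root_.tderiv e x (chartField e c x) = c x := he.tderiv_symm hx (c x)

theorem SmoothChart.isInvertible (he : SmoothChart e) (hx : x ∈ e.source) :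
    (d[H, H] e x).IsInvertible := by
  refine ContinuousLinearMap.IsInvertible.of_inverse (g := (d[H, H] e.symm (e x) : H →L[ℝ] H)) ?_ ?_
  · exact ContinuousLinearMap.ext fun c => he.tderiv_symm hx c
  · exact ContinuousLinearMap.ext fun v => he.symm_tderiv hx v

theorem SmoothChart.smoothFieldNear (he : SmoothChart e) (hx : x ∈ e.source) {c : M → H}
    (hc : Smooth[H, H] c x) (hX : ∀ᶠ y in 𝓝 x, _root_.tderiv e y (X y) = c y) :
    SmoothFieldNear X x := by
  have : CompleteSpace H := FiniteDimensional.complete ℝ H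
  have : IsManifold 𝓘(ℝ, H) 1 M := IsManifold.of_le (n := ∞) (by simp)
  filter_upwards [hc.near, hX.eventually_nhds, e.open_source.mem_nhds hx] with x hc hX hx
  have hu := e.map_source hx
  have h1 : ContMDiffAt 𝓘(ℝ, H) 𝓘(ℝ, H).tangent ∞ (fun u : H =>
      (⟨u, c (e.symm u)⟩ : TangentBundle 𝓘(ℝ, H) H)) (e x) := by
    refine contMDiffAt_vectorSpace_iff_contDiffAt.2 (ContMDiffAt.contDiffAt (ContMDiffAt.comp (e x) (g := c) ?_ (he.smoothNear_symm hu).at))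
    rw [e.left_inv hx]
    exact hc.at
  have h2 := ContMDiffAt.mpullback_vectorField_preimage (n := ∞) h1 (he.smoothNear hx).at
    (he.isInvertible hx) (by simp)
  refine h2.congr_of_eventuallyEq ?_
  filter_upwards [hX, e.open_source.mem_nhds hx] with y hy hys
  have h3 : X y = mpullback 𝓘(ℝ, H) 𝓘(ℝ, H) e (fun u : H => c (e.symm u)) y := by
    apply (he.isInvertible hys).injective
    refine Eq.trans ?_ ((he.isInvertible hys).self_apply_inverse _).symm
    exact hy.trans (congrArg c (e.left_inv hys).symm)
  rw [h3]

theorem SmoothChart.smoothFieldNear_chartField (he : SmoothChart e) (hx : x ∈ e.source) {c : M → H}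
    (hc : Smooth[H, H] c x) : SmoothFieldNear (chartField e c) x :=
  he.smoothFieldNear hx hc <| by
    filter_upwards [e.open_source.mem_nhds hx] with y hy using he.tderiv_chartField hy c

end Charts

section Frames

variable {ι : Type*} [Fintype ι]

/-- The coefficients of a smooth field with respect to a smooth independent family are smooth. -/
theorem smoothNear_coeff {v : ι → VField H M}
    {w : VField H M} {c : M → ι → ℝ} (hv : ∀ i, SmoothFieldNear (v i) x)
    (hw : SmoothFieldNear w x) (hli : ∀ᶠ y in 𝓝 x, LinearIndependent ℝ (fun i => v i y))
    (hc : ∀ᶠ y in 𝓝 x, w y = ∑ i, c y i • v i y) (i : ι) :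
    Smooth[H, ℝ] (fun y => c y i) x := by
  have e := Fintype.equivFin ι
  filter_upwards [eventually_all.2 hv, hw, hli, hc.eventually_nhds] with y h1 h2 h3 h4
  have := SmoothFieldAt.coeff (v := fun j => v (e.symm j)) (c := fun z j => c z (e.symm j))
    (fun j => h1 _) h2 (h3.comp _ e.symm.injective) (by
      filter_upwards [h4] with z hz
      rw [hz, ← e.symm.sum_comp]) (e i)
  simpa using this

theorem exists_smooth_coeff {v : ι → VField H M}
    {w : VField H M} (hv : ∀ i, SmoothFieldNear (v i) x)
    (hw : SmoothFieldNear w x) (hli : ∀ᶠ y in 𝓝 x, LinearIndependent ℝ (fun i => v i y))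
    (hc : ∀ᶠ y in 𝓝 x, w y ∈ Submodule.span ℝ (range fun i => v i y)) :
    ∃ c : M → ι → ℝ, (∀ᶠ y in 𝓝 x, w y = ∑ i, c y i • v i y) ∧
      ∀ i, Smooth[H, ℝ] (fun y => c y i) x := by
  have h : ∀ y, ∃ c : ι → ℝ, w y ∈ Submodule.span ℝ (range fun i => v i y) →
      w y = ∑ i, c i • v i y := fun y => by
    by_cases hy : w y ∈ Submodule.span ℝ (range fun i => v i y)
    · obtain ⟨c, hc⟩ := (Submodule.mem_span_range_iff_exists_fun ℝ).1 hy
      exact ⟨c, fun _ => hc.symm⟩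
    · exact ⟨0, fun h => (hy h).elim⟩
  choose c hc' using h
  have h2 : ∀ᶠ y in 𝓝 x, w y = ∑ i, c y i • v i y := hc.mono fun y hy => hc' y hy
  exact ⟨c, h2, fun i => smoothNear_coeff hv hw hli h2 i⟩

variable {N : Type*} {H' : Type*} [NormedAddCommGroup H'] [NormedSpace ℝ H']
  [FiniteDimensional ℝ H'] [TopologicalSpace N] [ChartedSpace H' N] [IsManifold 𝓘(ℝ, H') ∞ N]
  {n : ℕ}

theorem smoothNear_clm_of_apply {A : M → (Fin n → ℝ) →L[ℝ] F}
    (h : ∀ a, Smooth[H, F] (fun y => A y a) x) :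
    SmoothNear (H := H) (H' := (Fin n → ℝ) →L[ℝ] F) A x := by
  have h1 : A = fun y => (∑ i, ((ContinuousLinearMap.smulRightL ℝ (Fin n → ℝ) F)
      (proj i)).comp (proj (R := ℝ) (φ := fun _ : Fin n => F) i))
      (fun i => A y (Pi.single i 1)) := by
    ext y a
    conv_lhs => rw [pi_eq_sum_univ' a]
    rw [map_sum]
    simp
  rw [h1]
  refine SmoothNear.clm _ ?_
  filter_upwards [eventually_all.2 fun i : Fin n => h (Pi.single i 1)] with y hy
  exact contMDiffAt_pi_space.2 hy

theorem tderiv_clm_apply_const {A : M → (Fin n → ℝ) →L[ℝ] F}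
    (hA : SmoothNear (H := H) (H' := (Fin n → ℝ) →L[ℝ] F) A x) (a : Fin n → ℝ)
    (v : T[H] x) : tderiv (fun y => A y a) x v = tderiv A x v a := by
  have := tderiv_clm_apply hA.mdiff (mdifferentiableAt_const (c := a)) v
  rwa [tderiv_const, map_zero, zero_add] at this

/-- The field of linear maps `σ` is, near `x`, a smooth field of identifications. -/
def SmoothFrameNear (σ : ∀ y : N, (Fin n → ℝ) →L[ℝ] T[H'] y) (x : N) : Prop :=
  ∀ᶠ y in 𝓝 x, Function.Bijective (σ y) ∧ ∀ a, SmoothFieldAt (fun z => σ z a) y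

/-- A field of linear maps into the tangent spaces, in the chart at `x`. -/
def frameRep (σ : ∀ y : N, (Fin n → ℝ) →L[ℝ] T[H'] y) (x y : N) :
    (Fin n → ℝ) →L[ℝ] H' :=
  (d[H', H'] (chartAt H' x) y).comp (σ y)

variable {σ σ' : ∀ y : N, (Fin n → ℝ) →L[ℝ] T[H'] y} {y₀ : N}

theorem smoothChart_chartAt (x : N) : SmoothChart (chartAt H' x) :=
  smoothChart_of_mem_atlas (chart_mem_atlas _ _)

theorem frameRep_apply (x y : N) (a : Fin n → ℝ) :
    frameRep σ x y a = tderiv (chartAt H' x) y (σ y a) := rfl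

theorem SmoothFrameNear.smoothField (h : SmoothFrameNear σ y₀) (a : Fin n → ℝ) :
    SmoothFieldNear (fun z => σ z a) y₀ := h.mono fun _ hy => hy.2 a

theorem SmoothFrameNear.smoothNear_frameRep (h : SmoothFrameNear σ y₀) :
    SmoothNear (H := H') (H' := (Fin n → ℝ) →L[ℝ] H') (frameRep σ y₀) y₀ :=
  smoothNear_clm_of_apply fun a =>
    ((smoothChart_chartAt y₀).smoothNear (mem_chart_source _ _)).tderiv (h.smoothField a)

theorem isInvertible_of_bijective {V W : Type*} [NormedAddCommGroup V] [NormedSpace ℝ V]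
    [FiniteDimensional ℝ V] [NormedAddCommGroup W] [NormedSpace ℝ W] [FiniteDimensional ℝ W]
    {L : V →L[ℝ] W} (h : Function.Bijective L) : L.IsInvertible :=
  ⟨(LinearEquiv.ofBijective L.toLinearMap h).toContinuousLinearEquiv, by ext; rfl⟩

theorem SmoothFrameNear.isInvertible_frameRep (h : SmoothFrameNear σ y₀) :
    ∀ᶠ y in 𝓝 y₀, (frameRep σ y₀ y).IsInvertible := by
  filter_upwards [h, (chartAt H' y₀).open_source.mem_nhds (mem_chart_source H' y₀)] with y h1 h2
  exact isInvertible_of_bijective (((smoothChart_chartAt y₀).isInvertible h2).bijective.comp h1.1)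

theorem smoothNear_inverse {V W : Type*} [NormedAddCommGroup V] [NormedSpace ℝ V]
    [FiniteDimensional ℝ V] [NormedAddCommGroup W] [NormedSpace ℝ W]
    {A : M → V →L[ℝ] W} (hA : Smooth[H, V →L[ℝ] W] A x)
    (hi : (A x).IsInvertible) :
    Smooth[H, W →L[ℝ] V] (fun y => (A y).inverse) x := by
  have : CompleteSpace V := FiniteDimensional.complete ℝ V
  obtain ⟨e, he⟩ := hi
  refine SmoothNear.comp_space (g := ContinuousLinearMap.inverse) ?_ hA
  rw [← he]
  filter_upwards [ContinuousLinearEquiv.nhds e] with L hL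
  obtain ⟨e', rfl⟩ := hL
  exact contDiffAt_map_inverse e'

/-- The components, with respect to a smooth frame of the base, of the projection of a smooth
field are smooth. -/
theorem smoothNear_frame_coeff {π : M → N} {W : ∀ z : M, T[H] z}
    {w : M → Fin n → ℝ} (hσ : SmoothFrameNear σ (π x))
    (hπ : Smooth[H, H'] π x) (hW : SmoothFieldNear W x)
    (hw : ∀ᶠ z in 𝓝 x, d[H, H'] π z (W z) = σ (π z) (w z)) :
    Smooth[H, Fin n → ℝ] w x := by
  let ψ := chartAt H' (π x)
  have hψ := (smoothChart_chartAt (π x)).smoothNear (mem_chart_source H' (π x))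
  have h1 : Smooth[H, H'] (fun z => tderiv (fun z => ψ (π z)) z (W z)) x :=
    (hψ.comp_map hπ).tderiv hW
  have h2 := (smoothNear_inverse (hσ.smoothNear_frameRep.comp_map hπ)
    hσ.isInvertible_frameRep.self_of_nhds).clm_apply h1
  refine h2.congr ?_
  filter_upwards [hw, hπ, hπ.at.continuousAt.eventually hψ,
    hπ.at.continuousAt.eventually hσ.isInvertible_frameRep] with z h3 h4 h5 h6
  rw [tderiv_comp (h5.mdifferentiableAt (by simp)) (h4.mdifferentiableAt (by simp)), h3,
    ← frameRep_apply, h6.inverse_apply_self]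

/-- The bracket of a vertical field with a lift: if `X` is vertical for `π` and `W` projects to
`σ w`, where `σ` is a frame of the base, then `[X, W]` projects to `σ (X w)`. -/
theorem mfderiv_bracket_of_vertical {π : M → N} {X W : ∀ z : M, T[H] z}
    {w : M → Fin n → ℝ} (hσ : SmoothFrameNear σ (π x))
    (hπ : Smooth[H, H'] π x) (hX : SmoothFieldNear X x) (hW : SmoothFieldNear W x)
    (hX0 : ∀ᶠ z in 𝓝 x, d[H, H'] π z (X z) = 0)
    (hw : ∀ᶠ z in 𝓝 x, d[H, H'] π z (W z) = σ (π z) (w z)) :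
    d[H, H'] π x (lie[H] X W x) = σ (π x) (tderiv w x (X x)) := by
  have hws := smoothNear_frame_coeff hσ hπ hW hw
  let ψ := chartAt H' (π x)
  have hψ := (smoothChart_chartAt (π x)).smoothNear (mem_chart_source H' (π x))
  apply (smoothChart_chartAt (π x)).tderiv_injective (mem_chart_source H' (π x))
  rw [← tderiv_comp hψ.mdiff hπ.mdiff, tderiv_bracket (hψ.comp_map hπ) hX.self_of_nhds
    hW.self_of_nhds, ← frameRep_apply]
  have h0 : ∀ᶠ z in 𝓝 x, ∀ v, tderiv (fun z => ψ (π z)) z v =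
      tderiv ψ (π z) (d[H, H'] π z v) := by
    filter_upwards [hπ, hπ.at.continuousAt.eventually hψ] with z h4 h5 v
    rw [tderiv_comp (h5.mdifferentiableAt (by simp)) (h4.mdifferentiableAt (by simp))]
  have h1 : (fun z => tderiv (fun z => ψ (π z)) z (X z)) =ᶠ[𝓝 x] fun _ => 0 := by
    filter_upwards [h0, hX0] with z h2 h3
    rw [h2, h3, tderiv_vzero]
  have h2 : (fun z => tderiv (fun z => ψ (π z)) z (W z)) =ᶠ[𝓝 x]
      fun z => frameRep σ (π x) (π z) (w z) := by
    filter_upwards [h0, hw] with z h2 h3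
    rw [h2, h3, frameRep_apply]
  rw [tderiv_congr h1, tderiv_const, tderiv_congr h2, sub_zero,
    tderiv_clm_apply (hσ.smoothNear_frameRep.comp_map hπ).mdiff hws.mdiff,
    tderiv_comp hσ.smoothNear_frameRep.mdiff hπ.mdiff, hX0.self_of_nhds, tderiv_vzero]
  simp

end Frames

/-! ### Iterated brackets -/

section AdField

variable {N : Type*} {H' : Type*} [NormedAddCommGroup H'] [NormedSpace ℝ H']
  [FiniteDimensional ℝ H'] [TopologicalSpace N] [ChartedSpace H' N] [IsManifold 𝓘(ℝ, H') ∞ N]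
  {n : ℕ}
  {σ : ∀ y : N, (Fin n → ℝ) →L[ℝ] T[H'] y}

theorem adField_succ (X V : VField H M) (i : ℕ) :
    adField X V (i + 1) = lie[H] X (adField X V i) :=
  Function.iterate_succ_apply' _ _ _

theorem SmoothFieldNear.adField {X V : VField H M} (hX : SmoothFieldNear X x)
    (hV : SmoothFieldNear V x) (i : ℕ) : SmoothFieldNear (adField X V i) x := by
  induction i with
  | zero => exact hV
  | succ i ih => rw [adField_succ]; exact hX.bracket ih

theorem adField_congr {X V X' V' : VField H M} (hX : ∀ᶠ y in 𝓝 x, X y = X' y)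
    (hV : ∀ᶠ y in 𝓝 x, V y = V' y) (i : ℕ) : ∀ᶠ y in 𝓝 x, adField X V i y = adField X' V' i y := by
  induction i with
  | zero => exact hV
  | succ i ih =>
    filter_upwards [hX.eventually_nhds, ih.eventually_nhds] with y h1 h2
    rw [adField_succ, adField_succ]
    exact bracket_congr h1 h2

theorem smoothNear_fieldDeriv_iterate {X : VField H M} {w : M → F}
    (hX : SmoothFieldNear X x) (hw : Smooth[H, F] w x) (i : ℕ) :
    Smooth[H, F] ((fieldDeriv X)^[i] w) x := by
  induction i with
  | zero => exact hw
  | succ i ih => rw [Function.iterate_succ_apply']; exact ih.tderiv hX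

/-- Brackets with a field which is tangent to the fibres act on the projection of a field as
derivatives along the fibres. -/
theorem mfderiv_adField_of_vertical {π : M → N} {X W : ∀ z : M, T[H] z}
    {w : M → Fin n → ℝ} (hσ : SmoothFrameNear σ (π x))
    (hπ : Smooth[H, H'] π x) (hX : SmoothFieldNear X x) (hW : SmoothFieldNear W x)
    (hX0 : ∀ᶠ z in 𝓝 x, d[H, H'] π z (X z) = 0)
    (hw : ∀ᶠ z in 𝓝 x, d[H, H'] π z (W z) = σ (π z) (w z)) (i : ℕ) :
    ∀ᶠ z in 𝓝 x, d[H, H'] π z (adField X W i z) = σ (π z) ((fieldDeriv X)^[i] w z) := by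
  induction i with
  | zero => exact hw
  | succ i ih =>
    have hc : ContinuousAt π x := hπ.at.continuousAt
    filter_upwards [hc.eventually hσ.eventually_nhds, hπ.near, hX.near, (hX.adField hW i).near,
      hX0.eventually_nhds, ih.eventually_nhds] with z h1 h2 h3 h4 h5 h6
    rw [adField_succ, Function.iterate_succ_apply']
    exact mfderiv_bracket_of_vertical h1 h2 h3 h4 h5 h6

end AdField

theorem finrank_comap_of_surjective {V W : Type*} [AddCommGroup V] [Module ℝ V]
    [FiniteDimensional ℝ V] [AddCommGroup W] [Module ℝ W] {f : V →ₗ[ℝ] W}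
    (hf : Function.Surjective f) (q : Submodule ℝ W) :
    Module.finrank ℝ (q.comap f) = Module.finrank ℝ (LinearMap.ker f) + Module.finrank ℝ q := by
  let g : q.comap f →ₗ[ℝ] q := f.restrict fun x hx => hx
  have h1 := LinearMap.finrank_range_add_finrank_ker g
  have h2 : LinearMap.range g = ⊤ := by
    rw [LinearMap.range_eq_top]
    rintro ⟨w, hw⟩
    obtain ⟨v, rfl⟩ := hf w
    exact ⟨⟨v, hw⟩, rfl⟩
  have h3 : Module.finrank ℝ (LinearMap.ker g) = Module.finrank ℝ (LinearMap.ker f) := by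
    have h4 : LinearMap.ker g = (LinearMap.ker f).comap (q.comap f).subtype := by
      ext x
      simp only [LinearMap.mem_ker, Submodule.mem_comap, Submodule.subtype_apply]
      exact ⟨fun h => congrArg Subtype.val h, fun h => Subtype.ext h⟩
    rw [h4]
    refine (Submodule.comapSubtypeEquivOfLe ?_).finrank_eq
    intro x hx
    rw [Submodule.mem_comap, LinearMap.mem_ker.1 hx]
    exact q.zero_mem
  rw [h2, h3, finrank_top] at h1
  omega

/-! ### Related vector fields -/

section Related

variable {H' : Type*} [NormedAddCommGroup H'] [NormedSpace ℝ H'] [FiniteDimensional ℝ H']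
  {M' : Type*} [TopologicalSpace M'] [ChartedSpace H' M'] [IsManifold 𝓘(ℝ, H') ∞ M'] {Φ : M → M'}

/-- Brackets of related vector fields are related. -/
theorem mfderiv_bracket_of_related {X Y : VField H M}
    {X' Y' : VField H' M'} (hΦ : Smooth[H, H'] Φ x)
    (hX : SmoothFieldNear X x) (hY : SmoothFieldNear Y x) (hX' : SmoothFieldNear X' (Φ x))
    (hY' : SmoothFieldNear Y' (Φ x))
    (h : ∀ᶠ y in 𝓝 x, d[H, H'] Φ y (X y) = X' (Φ y))
    (h' : ∀ᶠ y in 𝓝 x, d[H, H'] Φ y (Y y) = Y' (Φ y)) :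
    d[H, H'] Φ x (lie[H] X Y x) = lie[H'] X' Y' (Φ x) := by
  set e := chartAt H' (Φ x)
  have he : SmoothChart e := smoothChart_chartAt (Φ x)
  have hmem : Φ x ∈ e.source := mem_chart_source H' (Φ x)
  have hes := he.smoothNear hmem
  have hc : ContinuousAt Φ x := hΦ.at.continuousAt
  have key : ∀ {X Y : VField H M} {X' Y' : VField H' M'}
      (_ : SmoothFieldNear Y' (Φ x))
      (_ : ∀ᶠ y in 𝓝 x, d[H, H'] Φ y (X y) = X' (Φ y))
      (_ : ∀ᶠ y in 𝓝 x, d[H, H'] Φ y (Y y) = Y' (Φ y)),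
      tderiv (fun y => tderiv (fun z => e (Φ z)) y (Y y)) x (X x) =
        tderiv (fun y => tderiv e y (Y' y)) (Φ x) (X' (Φ x)) := by
    intro X Y X' Y' hY' h h'
    have h1 : ∀ᶠ y in 𝓝 x, tderiv (fun z => e (Φ z)) y (Y y) = tderiv e (Φ y) (Y' (Φ y)) := by
      filter_upwards [hc.eventually hes.near, hΦ.near, h'] with y h2 h3 h4
      exact (tderiv_comp (f := e) (π := Φ) h2.mdiff h3.mdiff _).trans (congrArg (tderiv e (Φ y)) h4)
    refine (tderiv_congr h1 _).trans ?_
    refine (tderiv_comp (f := fun y => tderiv e y (Y' y)) (π := Φ) (hes.tderiv hY').mdiff hΦ.mdiff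
      _).trans ?_
    exact congrArg (tderiv (fun y => tderiv e y (Y' y)) (Φ x)) h.self_of_nhds
  refine he.tderiv_injective hmem ?_
  refine (tderiv_comp (f := e) (π := Φ) hes.mdiff hΦ.mdiff _).symm.trans ?_
  rw [tderiv_bracket (SmoothNear.comp_map (f := e) (π := Φ) hes hΦ) hX.self_of_nhds hY.self_of_nhds,
    tderiv_bracket hes hX'.self_of_nhds hY'.self_of_nhds, key hY' h h', key hX' h' h]

theorem mfderiv_adField_of_related {X Y : VField H M}
    {X' Y' : VField H' M'} (hΦ : Smooth[H, H'] Φ x)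
    (hX : SmoothFieldNear X x) (hY : SmoothFieldNear Y x) (hX' : SmoothFieldNear X' (Φ x))
    (hY' : SmoothFieldNear Y' (Φ x))
    (h : ∀ᶠ y in 𝓝 x, d[H, H'] Φ y (X y) = X' (Φ y))
    (h' : ∀ᶠ y in 𝓝 x, d[H, H'] Φ y (Y y) = Y' (Φ y)) (n : ℕ) :
    ∀ᶠ y in 𝓝 x, d[H, H'] Φ y (adField X Y n y) = adField X' Y' n (Φ y) := by
  have hc : ContinuousAt Φ x := hΦ.at.continuousAt
  induction n with
  | zero => exact h'
  | succ n ih =>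
    filter_upwards [ih.eventually_nhds, h.eventually_nhds, hΦ.near, hX.near, (hX.adField hY n).near,
      hc.eventually hX'.near, hc.eventually (hX'.adField hY' n).near] with y h1 h2 h3 h4 h5 h6 h7
    rw [adField_succ, adField_succ]
    exact mfderiv_bracket_of_related h3 h4 h5 h6 h7 h2 h1

theorem exists_related {X' : VField H' M'}
    (hΦ : Smooth[H, H'] Φ x)
    (hi : ∀ᶠ y in 𝓝 x, Function.Bijective (d[H, H'] Φ y))
    (hX' : SmoothFieldNear X' (Φ x)) : ∃ X : VField H M, SmoothFieldNear X x ∧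
      ∀ᶠ y in 𝓝 x, d[H, H'] Φ y (X y) = X' (Φ y) := by
  have hc : ContinuousAt Φ x := hΦ.at.continuousAt
  have hinv : ∀ᶠ y in 𝓝 x, (d[H, H'] Φ y).IsInvertible := hi.mono fun y hy =>
    isInvertible_of_bijective (V := H) (W := H') hy
  refine ⟨VectorField.mpullback 𝓘(ℝ, H) 𝓘(ℝ, H') Φ X', ?_, ?_⟩
  · filter_upwards [hΦ, hinv, hc.eventually hX'] with y h1 h2 h3
    have := (ContMDiffAt.mpullback_vectorField_preimage (m := ∞) (n := ∞) (V := X') h3 h1 h2 le_rfl)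
    exact this
  · filter_upwards [hinv] with y hy
    exact hy.self_apply_inverse _

end Related

/-! ### Local diffeomorphisms and functions with partially vanishing differential -/

section LocalDiffeo

variable {H' : Type*} [NormedAddCommGroup H'] [NormedSpace ℝ H'] [FiniteDimensional ℝ H']
  {M' : Type*} [TopologicalSpace M'] [ChartedSpace H' M'] [IsManifold 𝓘(ℝ, H') ∞ M']

/-- The inverse function theorem for maps of manifolds. -/
theorem exists_openPartialHomeomorph {f : M → M'} {x : M} (hf : Smooth[H, H'] f x)
    (hb : Function.Bijective (d[H, H'] f x)) {U : Set M} (hU : U ∈ 𝓝 x) :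
    ∃ Q : OpenPartialHomeomorph M M', x ∈ Q.source ∧ Q.source ⊆ U ∧ EqOn Q f Q.source ∧
      ContMDiffOn 𝓘(ℝ, H) 𝓘(ℝ, H') ∞ Q Q.source ∧ ContMDiffOn 𝓘(ℝ, H') 𝓘(ℝ, H) ∞ Q.symm Q.target := by
  set e := chartAt H x
  set e' := chartAt H' (f x)
  have he : SmoothChart e := smoothChart_chartAt x
  have he' : SmoothChart e' := smoothChart_chartAt (f x)
  have hx : x ∈ e.source := mem_chart_source H x
  have hx' : f x ∈ e'.source := mem_chart_source H' (f x)
  have hex : e.symm (e x) = x := e.left_inv hx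
  let g : H → H' := fun u => e' (f (e.symm u))
  have hg : Smooth[H, H'] g (e x) := by
    refine SmoothNear.comp_map (f := fun y => e' (f y)) (π := e.symm) ?_
      (he.smoothNear_symm (e.map_source hx))
    rw [hex]
    exact SmoothNear.comp_map (f := e') (π := f) (he'.smoothNear hx') hf
  have hgd : ∀ᶠ u in 𝓝 (e x), ContDiffAt ℝ ∞ g u := hg.mono fun u hu => hu.contDiffAt
  have hinv : (fderiv ℝ g (e x)).IsInvertible := by
    refine isInvertible_of_bijective ?_
    have h1 : ∀ v : T[H] x, fderiv ℝ g (e x) (tderiv e x v) = tderiv e' (f x)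
        (d[H, H'] f x v) := fun v => by
      have h2 := tderiv_comp_fderiv (hg.mdiff.differentiableAt) (f := e) (he.smoothNear hx).mdiff v
      refine h2.symm.trans ?_
      refine (tderiv_congr ?_ v).trans (tderiv_comp (f := e') (π := f) (he'.smoothNear hx').mdiff
        hf.mdiff v)
      filter_upwards [e.open_source.mem_nhds hx] with y hy
      exact congrArg (fun z => e' (f z)) (e.left_inv hy)
    have b1 : Function.Bijective (d[H, H] e x) := (he.isInvertible hx).bijective
    have b2 : Function.Bijective (d[H', H'] e' (f x)) := (he'.isInvertible hx').bijective
    refine (Function.Bijective.of_comp_iff (fderiv ℝ g (e x)) b1).1 ?_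
    have h3 : (fderiv ℝ g (e x)) ∘ (d[H, H] e x) =
      (d[H', H'] e' (f x)) ∘ (d[H, H'] f x) := funext h1
    exact h3 ▸ b2.comp hb
  have hinvn : ∀ᶠ u in 𝓝 (e x), (fderiv ℝ g u).IsInvertible := by
    have hc : ContinuousAt (fderiv ℝ g) (e x) :=
      (hgd.self_of_nhds.fderiv_right (m := 0) (by simp)).continuousAt
    obtain ⟨L, hL⟩ := hinv
    have := hc.eventually (hL ▸ ContinuousLinearEquiv.nhds L)
    exact this
  obtain ⟨L, hL⟩ := hinv
  have hLd : HasFDerivAt g (L : H →L[ℝ] H') (e x) := by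
    rw [hL]; exact (hgd.self_of_nhds.differentiableAt (by simp)).hasFDerivAt
  let R := hgd.self_of_nhds.toOpenPartialHomeomorph g hLd (by simp)
  have hRx : e x ∈ R.source := hgd.self_of_nhds.mem_toOpenPartialHomeomorph_source hLd (by simp)
  have hec : ContinuousAt e x := (he.smoothNear hx).at.continuousAt
  have hO : ∀ᶠ y in 𝓝 x, y ∈ e.source ∧ f y ∈ e'.source ∧ e y ∈ R.source ∧
      ContDiffAt ℝ ∞ g (e y) ∧ (fderiv ℝ g (e y)).IsInvertible ∧ y ∈ U ∧
      CDAt[H, H'] f y := by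
    filter_upwards [e.open_source.mem_nhds hx, hf.at.continuousAt.eventually
      (e'.open_source.mem_nhds hx'), hec.eventually (R.open_source.mem_nhds hRx), hec.eventually hgd,
      hec.eventually hinvn, hU, hf] with y h1 h2 h3 h4 h5 h6 h7
    exact ⟨h1, h2, h3, h4, h5, h6, h7⟩
  obtain ⟨O, hOs, hOo, hxO⟩ := eventually_nhds_iff.1 hO
  let Q := (e.trans (R.trans e'.symm)).restrOpen O hOo
  have hsub : Q.source ⊆ O := fun y hy => hy.2
  have hQf : EqOn Q f Q.source := fun y hy => by
    have h := hOs y (hsub hy)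
    change e'.symm (e' (f (e.symm (e y)))) = f y
    rw [e.left_inv h.1, e'.left_inv h.2.1]
  refine ⟨Q, ⟨⟨hx, hRx, ?_⟩, hxO⟩, fun y hy => (hOs y (hsub hy)).2.2.2.2.2.1, hQf, fun y hy => ?_,
    fun z hz => ?_⟩
  · change e' (f (e.symm (e x))) ∈ e'.target
    rw [hex]; exact e'.map_source hx'
  · exact ((hOs y (hsub hy)).2.2.2.2.2.2.congr_of_eventuallyEq
      (eventually_of_mem (Q.open_source.mem_nhds hy) hQf)).contMDiffWithinAt
  · have hy : Q.symm z ∈ Q.source := Q.map_target hz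
    have h := hOs _ (hsub hy)
    have hQz : f (Q.symm z) = z := (hQf hy).symm.trans (Q.right_inv hz)
    have hz' : z ∈ e'.source := hQz ▸ h.2.1
    have hgz : R (e (Q.symm z)) = e' z := by
      change e' (f (e.symm (e (Q.symm z)))) = e' z
      rw [e.left_inv h.1, hQz]
    have hRt : e' z ∈ R.target := hgz ▸ R.map_source h.2.2.1
    have hRs : R.symm (e' z) = e (Q.symm z) := by rw [← hgz, R.left_inv h.2.2.1]
    obtain ⟨L', hL'⟩ := h.2.2.2.2.1
    have c1 : ContDiffAt ℝ ∞ R.symm (e' z) := by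
      refine R.contDiffAt_symm hRt (f₀' := L') ?_ ?_
      · rw [hRs, hL']
        exact (h.2.2.2.1.differentiableAt (by simp)).hasFDerivAt
      · rw [hRs]; exact h.2.2.2.1
    have c2 : CDAt[H', H'] e' z := (he'.smoothNear hz').at
    have c3 : CDAt[H, H] e.symm (R.symm (e' z)) := by
      rw [hRs]; exact (he.smoothNear_symm (e.map_source h.1)).at
    exact (c3.comp z (c1.contMDiffAt.comp z c2)).contMDiffWithinAt

/-- A function whose differential vanishes on the vectors which a chart maps into a subspace takes
equal values at points whose coordinates differ by an element of the subspace. -/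
theorem eventually_eq_of_tderiv_eq_zero {e : OpenPartialHomeomorph M H} (he : SmoothChart e) {x : M}
    (hx : x ∈ e.source) {h : M → F} (hh : Smooth[H, F] h x) (K : Submodule ℝ H)
    (h0 : ∀ᶠ y in 𝓝 x, ∀ w : T[H] y, tderiv e y w ∈ K → tderiv h y w = 0) :
    ∀ᶠ z : M × M in 𝓝 (x, x), e z.2 - e z.1 ∈ K → h z.1 = h z.2 := by
  have hsc : ContinuousAt e.symm (e x) := (he.smoothNear_symm (e.map_source hx)).at.continuousAt
  have hg : ∀ᶠ u in 𝓝 (e x), DifferentiableAt ℝ (fun u => h (e.symm u)) u ∧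
      ∀ v ∈ K, fderiv ℝ (fun u => h (e.symm u)) u v = 0 := by
    have hh' := hsc.eventually ((e.left_inv hx).symm ▸ hh)
    filter_upwards [hh', hsc.eventually ((e.left_inv hx).symm ▸ h0),
      e.open_target.mem_nhds (e.map_source hx)] with u h1 h2 hu
    have hs := (he.smoothNear_symm hu).mdiff
    have hd : MDAt[H, F] (fun u => h (e.symm u)) u :=
      MDifferentiableAt.comp (I' := 𝓘(ℝ, H)) u (h1.mdifferentiableAt (by simp)) hs
    refine ⟨hd.differentiableAt, fun v hv => ?_⟩
    have h3 := tderiv_comp (f := h) (π := e.symm) (h1.mdifferentiableAt (by simp)) hs v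
    have h4 : tderiv (fun u => h (e.symm u)) u v = fderiv ℝ (fun u => h (e.symm u)) u v :=
      congrArg (fun L : H →L[ℝ] F => L v) mfderiv_eq_fderiv
    rw [← h4]
    refine h3.trans (h2 _ ?_)
    have h5 := he.tderiv_symm (e.map_target hu) v
    rw [e.right_inv hu] at h5
    exact h5.symm ▸ hv
  obtain ⟨r, hr, hball⟩ := Metric.eventually_nhds_iff_ball.1 hg
  have hec : ContinuousAt e x := (he.smoothNear hx).at.continuousAt
  have hnear : ∀ᶠ y in 𝓝 x, e y ∈ Metric.ball (e x) r ∧ y ∈ e.source :=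
    (hec.eventually (Metric.ball_mem_nhds _ hr)).and (e.open_source.mem_nhds hx)
  rw [nhds_prod_eq]
  filter_upwards [hnear.prod_mk hnear] with z hz hzK
  let γ : ℝ → H := fun s => e z.1 + s • (e z.2 - e z.1)
  have hγ : ∀ s ∈ Icc (0 : ℝ) 1, γ s ∈ Metric.ball (e x) r := fun s hs =>
    (convex_ball (e x) r).add_smul_sub_mem hz.1.1 hz.2.1 hs
  have hd : ∀ s ∈ Icc (0 : ℝ) 1, HasDerivAt (fun s => h (e.symm (γ s))) 0 s := fun s hs => by
    have h1 := hball _ (hγ s hs)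
    have h2 : HasDerivAt γ (e z.2 - e z.1) s := by
      have := ((hasDerivAt_id s).smul_const (e z.2 - e z.1)).const_add (e z.1)
      rw [one_smul] at this
      exact this
    have h3 := h1.1.hasFDerivAt.comp_hasDerivAt s h2
    rwa [h1.2 _ hzK] at h3
  have h1 := constant_of_has_deriv_right_zero (fun s hs => (hd s hs).continuousAt.continuousWithinAt)
    (fun s hs => (hd s (Ico_subset_Icc_self hs)).hasDerivWithinAt) 1 (by simp)
  simp only [γ, one_smul, add_sub_cancel, zero_smul, add_zero, e.left_inv hz.1.2,
    e.left_inv hz.2.2] at h1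
  exact h1.symm

end LocalDiffeo

/-! ### Vector fields commuting with a frame -/

section Commute

variable {ι : Type*} [Fintype ι]

/-- Near `x` the smooth field `Z` commutes with the fields `v i`: it is an infinitesimal automorphism
of the family `v`. -/
def CommutesNear (v : ι → VField H M) (Z : VField H M)
    (x : M) : Prop :=
  SmoothFieldNear Z x ∧ ∀ᶠ y in 𝓝 x, ∀ i, lie[H] Z (v i) y = 0

/-- Near `x` the fields `v i` form a smooth frame. -/
structure IsFrameNear (v : ι → VField H M) (x : M) : Prop where
  smooth : ∀ i, SmoothFieldNear (v i) x
  indep : ∀ᶠ y in 𝓝 x, LinearIndependent ℝ (fun i => v i y)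
  spans : ∀ᶠ y in 𝓝 x, Submodule.span ℝ (range fun i => v i y) = ⊤

variable {v : ι → VField H M} {Z Z' : VField H M}

/-- The components in a chart of a field which commutes with a frame satisfy linear differential
inequalities, hence the field vanishes near `x` if it vanishes at one point near `x`. -/
theorem CommutesNear.eventually_zero (hv : IsFrameNear v x) (hZ : CommutesNear v Z x) :
    ∀ᶠ z : M × M in 𝓝 (x, x), Z z.1 = 0 → Z z.2 = 0 := by
  set e := chartAt H x
  have he : SmoothChart e := smoothChart_chartAt x
  have hx : x ∈ e.source := mem_chart_source H x
  have hes := he.smoothNear hx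
  have hec : ContinuousAt e x := hes.at.continuousAt
  have hsc : ContinuousAt e.symm (e x) := (he.smoothNear_symm (e.map_source hx)).at.continuousAt
  have hxe : e.symm (e x) = x := e.left_inv hx
  let g : M → H := fun y => tderiv e y (Z y)
  have hg : Smooth[H, H] g x := hes.tderiv hZ.1
  -- the derivative of `g` along a frame field is linear in `g`
  have h1 : ∀ i, ∃ K : ℝ, ∀ᶠ y in 𝓝 x, ‖tderiv g y (v i y)‖ ≤ K * ‖g y‖ := fun i => by
    let β : M → H := fun y => tderiv e y (v i y)
    have hβ : Smooth[H, H] β x := hes.tderiv (hv.smooth i)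
    have hβ' : Smooth[H, H] (fun u => β (e.symm u)) (e x) :=
      SmoothNear.comp_map (f := β) (π := e.symm) (hxe.symm ▸ hβ) (he.smoothNear_symm (e.map_source hx))
    have hc : ContinuousAt (fun y => fderiv ℝ (fun u => β (e.symm u)) (e y)) x :=
      ContinuousAt.comp (g := fderiv ℝ fun u => β (e.symm u))
        ((hβ'.at.contDiffAt.fderiv_right (m := 0) (by simp)).continuousAt) hec
    refine ⟨‖fderiv ℝ (fun u => β (e.symm u)) (e x)‖ + 1, ?_⟩
    filter_upwards [hc.norm.eventually (gt_mem_nhds (lt_add_one _)), hZ.2, hZ.1, hv.smooth i,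
      hec.eventually hβ'.near, e.open_source.mem_nhds hx, hes.near] with y h1 h2 h3 h4 h5 h6 h7
    have e1 := tderiv_bracket h7 h3 h4
    rw [h2 i, tderiv_vzero] at e1
    have e2 : tderiv g y (v i y) = tderiv β y (Z y) := (sub_eq_zero.1 e1.symm).symm
    have e3 : tderiv β y (Z y) = fderiv ℝ (fun u => β (e.symm u)) (e y) (g y) := by
      refine Eq.trans ?_ (tderiv_comp_fderiv (h5.mdiff.differentiableAt) h7.mdiff (Z y))
      refine tderiv_congr ?_ _
      filter_upwards [e.open_source.mem_nhds h6] with z hz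
      exact congrArg β (e.left_inv hz).symm
    rw [e2, e3]
    exact (ContinuousLinearMap.le_opNorm _ _).trans (by gcongr)
  choose K hK using h1
  -- the same holds for the constant fields of the chart
  have h2 : ∀ w : H, ∃ C : ℝ, ∀ᶠ y in 𝓝 x, ‖tderiv g y (chartField e (fun _ => w) y)‖ ≤ C * ‖g y‖ :=
    fun w => by
    obtain ⟨c, hc, hcs⟩ := exists_smooth_coeff hv.smooth
      (he.smoothFieldNear_chartField hx (smoothNear_const w)) hv.indep
      (hv.spans.mono fun y hy => by rw [hy]; trivial)
    refine ⟨∑ i, (‖c x i‖ + 1) * |K i|, ?_⟩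
    filter_upwards [hc, eventually_all.2 hK, eventually_all.2 fun i =>
      (hcs i).at.continuousAt.norm.eventually (gt_mem_nhds (lt_add_one _))] with y h3 h4 h5
    rw [h3, tderiv_vsum, Finset.sum_mul]
    refine (norm_sum_le _ _).trans (Finset.sum_le_sum fun i _ => ?_)
    rw [tderiv_vsmul, norm_smul, mul_assoc]
    refine mul_le_mul (h5 i).le ((h4 i).trans ?_) (norm_nonneg _) (by positivity)
    exact mul_le_mul_of_nonneg_right (le_abs_self _) (norm_nonneg _)
  choose C hC using h2
  let b := Module.finBasis ℝ H
  let G : H → H := fun u => g (e.symm u)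
  have hG : ∀ᶠ u in 𝓝 (e x), DifferentiableAt ℝ G u ∧ ∀ m, ‖fderiv ℝ G u (b m)‖ ≤ C (b m) * ‖G u‖ := by
    filter_upwards [hsc.eventually (hxe.symm ▸ hg.near), e.open_target.mem_nhds (e.map_source hx),
      hsc.eventually (hxe.symm ▸ eventually_all.2 fun m => hC (b m))] with u h1 h2 h3
    have hs := (he.smoothNear_symm h2).mdiff
    have hd : MDAt[H, H] G u := MDifferentiableAt.comp (I' := 𝓘(ℝ, H)) u h1.mdiff hs
    refine ⟨hd.differentiableAt, fun m => ?_⟩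
    have h4 : fderiv ℝ G u (b m) = tderiv g (e.symm u) (chartField e (fun _ => b m) (e.symm u)) := by
      have h5 := tderiv_comp (f := g) (π := e.symm) h1.mdiff hs (b m)
      have h6 : tderiv G u (b m) = fderiv ℝ G u (b m) :=
        congrArg (fun L : H →L[ℝ] H => L (b m)) mfderiv_eq_fderiv
      rw [← h6]
      refine h5.trans (congrArg (tderiv g (e.symm u)) ?_)
      rw [chartField, e.right_inv h2]
    rw [h4]
    exact h3 m
  obtain ⟨r, hr, hball⟩ := Metric.eventually_nhds_iff_ball.1 hG
  have hnear : ∀ᶠ y in 𝓝 x, e y ∈ Metric.ball (e x) r ∧ y ∈ e.source :=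
    (hec.eventually (Metric.ball_mem_nhds _ hr)).and (e.open_source.mem_nhds hx)
  rw [nhds_prod_eq]
  filter_upwards [hnear.prod_mk hnear] with z hz hz0
  let w := e z.2 - e z.1
  let γ : ℝ → H := fun s => e z.1 + s • w
  have hγ : ∀ s ∈ Icc (0 : ℝ) 1, γ s ∈ Metric.ball (e x) r := fun s hs =>
    (convex_ball (e x) r).add_smul_sub_mem hz.1.1 hz.2.1 hs
  have hd : ∀ s ∈ Icc (0 : ℝ) 1, HasDerivAt (fun s => G (γ s)) (fderiv ℝ G (γ s) w) s := fun s hs => by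
    have h2 : HasDerivAt γ w s := by
      have := ((hasDerivAt_id s).smul_const w).const_add (e z.1)
      rw [one_smul] at this
      exact this
    exact (hball _ (hγ s hs)).1.hasFDerivAt.comp_hasDerivAt s h2
  have hz1 : G (γ 0) = 0 := by
    have h3 : e.symm (γ 0) = z.1 := by simp only [γ, zero_smul, add_zero, e.left_inv hz.1.2]
    change g (e.symm (γ 0)) = 0
    rw [h3]
    exact (congrArg (tderiv e z.1) hz0).trans (tderiv_vzero _)
  have h1 := eq_zero_of_abs_deriv_le_mul_abs_self_of_eq_zero_right
    (K := ∑ m, |b.repr w m| * C (b m)) (fun s hs => (hd s hs).continuousAt.continuousWithinAt)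
    (fun s hs => (hd s (Ico_subset_Icc_self hs)).hasDerivWithinAt) hz1 (fun s hs => by
      have hb := (hball _ (hγ s (Ico_subset_Icc_self hs))).2
      conv_lhs => rw [← b.sum_repr w, map_sum]
      rw [Finset.sum_mul]
      refine (norm_sum_le _ _).trans (Finset.sum_le_sum fun m _ => ?_)
      rw [map_smul, norm_smul, mul_assoc, Real.norm_eq_abs]
      exact mul_le_mul_of_nonneg_left (hb m) (abs_nonneg _)) 1 (by simp)
  have h3 : e.symm (γ 1) = z.2 := by simp only [γ, one_smul, w, add_sub_cancel, e.left_inv hz.2.2]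
  change g (e.symm (γ 1)) = 0 at h1
  rw [h3] at h1
  exact he.tderiv_injective hz.2.2 (h1.trans (tderiv_vzero _).symm)

theorem CommutesNear.add (h : CommutesNear v Z x) (h' : CommutesNear v Z' x) :
    CommutesNear v (fun y => Z y + Z' y) x := by
  refine ⟨h.1.add h'.1, ?_⟩
  filter_upwards [h.2, h'.2, h.1, h'.1] with y h1 h2 h3 h4 i
  rw [bracket_swap, bracket_add_right h3 h4, bracket_swap, h1 i, bracket_swap, h2 i]
  simp

theorem CommutesNear.smul (c : ℝ) (h : CommutesNear v Z x) : CommutesNear v (fun y => c • Z y) x := by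
  refine ⟨h.1.smul (smoothNear_const c), ?_⟩
  filter_upwards [h.2, h.1] with y h1 h2 i
  rw [bracket_swap, bracket_const_smul_right c h2, bracket_swap, h1 i]
  simp

theorem CommutesNear.bracket (hv : IsFrameNear v x) (h : CommutesNear v Z x)
    (h' : CommutesNear v Z' x) : CommutesNear v (lie[H] Z Z') x := by
  refine ⟨h.1.bracket h'.1, ?_⟩
  filter_upwards [h.2.eventually_nhds, h'.2.eventually_nhds, h.1, h'.1,
    eventually_all.2 hv.smooth] with y h1 h2 h3 h4 h5 i
  have e1 := bracket_jacobi h3 h4 (h5 i)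
  rw [bracket_congr (.of_forall fun _ => rfl) (h2.mono fun z hz => hz i), bracket_zero_right,
    bracket_congr (X := Z') (.of_forall fun _ => rfl) (h1.mono fun z hz => hz i),
    bracket_zero_right, add_zero] at e1
  exact e1.symm

theorem CommutesNear.eq_of_eq (hv : IsFrameNear v x) (h : CommutesNear v Z x)
    (h' : CommutesNear v Z' x) (he : Z x = Z' x) : ∀ᶠ y in 𝓝 x, Z y = Z' y := by
  have h1 := (h.add (h'.smul (-1))).eventually_zero hv
  have h2 : Tendsto (fun y => (x, y)) (𝓝 x) (𝓝 (x, x)) :=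
    (continuous_const.prodMk continuous_id).tendsto' _ _ rfl
  filter_upwards [h2.eventually h1] with y hy
  have := hy (by rw [he]; simp)
  rwa [neg_one_smul, ← sub_eq_add_neg, sub_eq_zero] at this

theorem CommutesNear.bracket_sum (hv : IsFrameNear v x) (h : CommutesNear v Z x) (c : ι → ℝ) :
    lie[H] Z (fun y => ∑ i, c i • v i y) x = 0 := by
  rw [bracket_sum_right fun i _ => (hv.smooth i).smul (smoothNear_const (c i))]
  refine Finset.sum_eq_zero fun i _ => ?_
  rw [bracket_const_smul_right (c i) (hv.smooth i).self_of_nhds, h.2.self_of_nhds i, smul_zero]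

/-- The bracket of two fields commuting with a frame is at `x` the opposite of the bracket of the
constant combinations of the frame fields with the same values at `x`. -/
theorem CommutesNear.bracket_eq_neg (hv : IsFrameNear v x) (h : CommutesNear v Z x)
    (h' : CommutesNear v Z' x) {c c' : ι → ℝ} (hc : Z x = ∑ i, c i • v i x)
    (hc' : Z' x = ∑ i, c' i • v i x) :
    lie[H] Z Z' x = -lie[H] (fun y => ∑ i, c i • v i y) (fun y => ∑ i, c' i • v i y) x := by
  have hs : ∀ c : ι → ℝ, SmoothFieldNear (fun y => ∑ i, c i • v i y) x := fun c =>
    SmoothFieldNear.sum fun i _ => (hv.smooth i).smul (smoothNear_const (c i))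
  -- the bracket of two fields which vanish at `x` vanishes at `x`
  have h0 : lie[H] (fun y => Z y - ∑ i, c i • v i y) (fun y => Z' y - ∑ i, c' i • v i y) x =
      0 := by
    have he := smoothChart_chartAt (H' := H) x
    refine he.tderiv_injective (mem_chart_source H x) ?_
    rw [tderiv_bracket (he.smoothNear (mem_chart_source H x)) (h.1.sub (hs c)).self_of_nhds
      (h'.1.sub (hs c')).self_of_nhds, ← hc, ← hc', sub_self, sub_self, tderiv_vzero, tderiv_vzero,
      tderiv_vzero, sub_self]
  have h1 : ∀ (X : VField H M), lie[H] X
      (fun y => Z' y - ∑ i, c' i • v i y) x = lie[H] X Z' x -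
        lie[H] X (fun y => ∑ i, c' i • v i y) x := fun X =>
    bracket_sub_right h'.1.self_of_nhds (hs c').self_of_nhds
  have h2 : ∀ (X : VField H M), lie[H]
      (fun y => Z y - ∑ i, c i • v i y) X x = lie[H] Z X x -
        lie[H] (fun y => ∑ i, c i • v i y) X x := fun X => by
    rw [bracket_swap, bracket_sub_right h.1.self_of_nhds (hs c).self_of_nhds, neg_sub,
      bracket_swap (X := Z), bracket_swap (X := fun y => ∑ i, c i • v i y)]
    abel
  rw [h1, h2, h2, h.bracket_sum hv, bracket_swap (X := fun y => ∑ i, c i • v i y) (Y := Z'),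
    h'.bracket_sum hv] at h0
  rwa [neg_zero, sub_zero, zero_sub, sub_neg_eq_add, ← eq_neg_iff_add_eq_zero] at h0

end Commute

/-! ### The infinitesimal generator of a flow -/

theorem fderiv_slice_right {K L : Type*} [NormedAddCommGroup K] [NormedSpace ℝ K]
    [NormedAddCommGroup L] [NormedSpace ℝ L] {F : K × H → L} {t : K} {u : H}
    (hF : DifferentiableAt ℝ F (t, u)) (w : H) :
    fderiv ℝ (fun v => F (t, v)) u w = fderiv ℝ F (t, u) (0, w) := by
  have h := hF.hasFDerivAt.comp u ((hasFDerivAt_const t u).prodMk (hasFDerivAt_id u))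
  exact congrArg (fun L : H →L[ℝ] _ => L w) h.fderiv

/-- If the local flow `F` preserves the field `b`, its generator commutes with `b`. -/
theorem fderiv_generator {F : ℝ × H → H} {b : H → H} {u : H} (hF : ContDiffAt ℝ ∞ F (0, u))
    (hF0 : F (0, u) = u) (hb : DifferentiableAt ℝ b u)
    (h : ∀ᶠ t : ℝ in 𝓝 0, fderiv ℝ F (t, u) (0, b u) = b (F (t, u))) :
    fderiv ℝ (fun v => fderiv ℝ F (0, v) (1, 0)) u (b u) = fderiv ℝ b u (fderiv ℝ F (0, u) (1, 0)) := by
  have hF' : DifferentiableAt ℝ (fderiv ℝ F) (0, u) :=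
    (hF.fderiv_right (m := ∞) (by simp)).differentiableAt (by simp)
  have h1 : HasDerivAt (fun t : ℝ => (t, u)) ((1 : ℝ), (0 : H)) 0 :=
    (hasDerivAt_id 0).prodMk (hasDerivAt_const 0 u)
  have e0 : HasDerivAt (fun t : ℝ => fderiv ℝ F (t, u)) (fderiv ℝ (fderiv ℝ F) (0, u) (1, 0)) 0 :=
    hF'.hasFDerivAt.comp_hasDerivAt (0 : ℝ) h1
  have e1 : HasDerivAt (fun t : ℝ => fderiv ℝ F (t, u) (0, b u))
      (fderiv ℝ (fderiv ℝ F) (0, u) (1, 0) (0, b u)) 0 :=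
    (ContinuousLinearMap.apply ℝ H ((0 : ℝ), b u)).hasFDerivAt.comp_hasDerivAt (0 : ℝ) e0
  have e2 : HasDerivAt (fun t : ℝ => b (F (t, u))) (fderiv ℝ b u (fderiv ℝ F (0, u) (1, 0))) 0 := by
    have hb' : HasFDerivAt b (fderiv ℝ b u) (F ((0 : ℝ), u)) := by rw [hF0]; exact hb.hasFDerivAt
    exact hb'.comp_hasDerivAt (0 : ℝ) ((hF.differentiableAt (by simp)).hasFDerivAt.comp_hasDerivAt 0 h1)
  have e3 := e1.unique (e2.congr_of_eventuallyEq h)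
  have e4 : HasFDerivAt (fun v : H => fderiv ℝ F (0, v) (1, 0)) ((ContinuousLinearMap.apply ℝ H
      ((1 : ℝ), (0 : H))).comp ((fderiv ℝ (fderiv ℝ F) (0, u)).comp (inr ℝ ℝ H))) u :=
    (ContinuousLinearMap.apply ℝ H ((1 : ℝ), (0 : H))).hasFDerivAt.comp u
      (hF'.hasFDerivAt.comp u (hasFDerivAt_prodMk_right (0 : ℝ) u))
  rw [← e3, e4.fderiv]
  exact hF.isSymmSndFDerivAt (by
    rw [minSmoothness_of_isRCLikeNormedField]
    exact WithTop.coe_le_coe.2 (le_top : (2 : ℕ∞) ≤ ⊤)) (0, b u) (1, 0)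

/-! ### Charts and coordinates -/

section Coordinates

/-- A homeomorphism onto an open set of the model which is smooth in both directions is a chart. -/
theorem smoothChart_of_contMDiffOn {e : OpenPartialHomeomorph M H}
    (h : ContMDiffOn 𝓘(ℝ, H) 𝓘(ℝ, H) ∞ e e.source)
    (h' : ContMDiffOn 𝓘(ℝ, H) 𝓘(ℝ, H) ∞ e.symm e.target) : SmoothChart e := by
  have key : ∀ {a : OpenPartialHomeomorph H H}, ContMDiffOn 𝓘(ℝ, H) 𝓘(ℝ, H) ∞ a a.source →
      ContMDiffOn 𝓘(ℝ, H) 𝓘(ℝ, H) ∞ a.symm a.target → a ∈ contDiffGroupoid ∞ 𝓘(ℝ, H) := by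
    intro a h1 h2
    rw [contDiffGroupoid, mem_groupoid_of_pregroupoid]
    constructor
    · have := contMDiffOn_iff_contDiffOn.1 h1
      simpa [contDiffPregroupoid] using this
    · have := contMDiffOn_iff_contDiffOn.1 h2
      simpa [contDiffPregroupoid] using this
  refine mem_maximalAtlas_iff.2 fun e' he' => ?_
  have g := contMDiffOn_of_mem_maximalAtlas (n := ∞) (I := 𝓘(ℝ, H))
    (IsManifold.subset_maximalAtlas he' : e' ∈ IsManifold.maximalAtlas 𝓘(ℝ, H) ∞ M)
  have g' := contMDiffOn_symm_of_mem_maximalAtlas (n := ∞) (I := 𝓘(ℝ, H))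
    (IsManifold.subset_maximalAtlas he' : e' ∈ IsManifold.maximalAtlas 𝓘(ℝ, H) ∞ M)
  have h1 : ∀ {a b : OpenPartialHomeomorph M H}, ContMDiffOn 𝓘(ℝ, H) 𝓘(ℝ, H) ∞ a.symm a.target →
      ContMDiffOn 𝓘(ℝ, H) 𝓘(ℝ, H) ∞ b b.source →
      ContMDiffOn 𝓘(ℝ, H) 𝓘(ℝ, H) ∞ (a.symm ≫ₕ b) (a.symm ≫ₕ b).source := fun {a b} ha hb => by
    refine (hb.comp (ha.mono ?_) ?_)
    · exact fun x hx => hx.1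
    · exact fun x hx => hx.2
  exact ⟨key (h1 h' g) (h1 g' h), key (h1 g' h) (h1 h' g)⟩

variable {n : ℕ}

/-- A commuting frame is, locally, a frame of coordinate fields: its dual coframe is closed, and the
Poincaré lemma applies. -/
theorem exists_tderiv_eq_const {F : Type*} [NormedAddCommGroup F] [NormedSpace ℝ F] [CompleteSpace F]
    {v : Fin n → VField H M} (hv : ∀ i, SmoothFieldNear (v i) x)
    (hx : Function.Bijective fun a : Fin n → ℝ => ∑ i, a i • v i x)
    (hc : ∀ᶠ y in 𝓝 x, ∀ i j, lie[H] (v i) (v j) y = 0) (C : (Fin n → ℝ) →L[ℝ] F) :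
    ∃ f : M → F, Smooth[H, F] f x ∧
      ∀ᶠ y in 𝓝 x, ∀ a : Fin n → ℝ, tderiv f y (∑ i, a i • v i y) = C a := by
  set e := chartAt H x
  have he : SmoothChart e := smoothChart_chartAt x
  have hxs : x ∈ e.source := mem_chart_source H x
  have hxt := e.map_source hxs
  have hsc : ContinuousAt e.symm (e x) := (he.smoothNear_symm hxt).at.continuousAt
  have hxx : e.symm (e x) = x := e.left_inv hxs
  have hsc' : Tendsto e.symm (𝓝 (e x)) (𝓝 x) := by
    have := hsc.tendsto
    rwa [hxx] at this
  -- the fields in the chart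
  let b : Fin n → H → H := fun i u => tderiv e (e.symm u) (v i (e.symm u))
  have hb : ∀ i, Smooth[H, H] (b i) (e x) := fun i =>
    SmoothNear.comp_map (f := fun y => tderiv e y (v i y)) (π := e.symm)
      (hxx.symm ▸ (he.smoothNear hxs).tderiv (hv i)) (he.smoothNear_symm hxt)
  have hbe : ∀ i, ∀ y ∈ e.source, b i (e y) = tderiv e y (v i y) := fun i y hy =>
    congrArg (fun y => tderiv e y (v i y)) (e.left_inv hy)
  let A : H → (Fin n → ℝ) →L[ℝ] H := fun u => ∑ j, (proj j).smulRight (b j u)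
  have hAa : ∀ u a, A u a = ∑ j, a j • b j u := fun u a => by simp [A]
  have hAt : ∀ u (a : Fin n → ℝ), A u a = tderiv e (e.symm u) (∑ j, a j • v j (e.symm u)) :=
    fun u a => by rw [hAa, tderiv_vsum]; exact Finset.sum_congr rfl fun j _ => (tderiv_vsmul _ _ _).symm
  have hA1 : ∀ u i, A u (Pi.single i 1) = b i u := fun u i => by
    rw [hAa, Finset.sum_eq_single i (fun j _ hj => by rw [Pi.single_eq_of_ne hj, zero_smul]) (by simp)]
    simp
  have hA : SmoothNear (H := H) (H' := (Fin n → ℝ) →L[ℝ] H) A (e x) := by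
    refine smoothNear_clm_of_apply fun a => ?_
    have h1 : (fun u => A u a) = fun u => ∑ j, a j • b j u := funext fun u => hAa u a
    rw [h1]
    filter_upwards [eventually_all.2 hb] with u hu
    exact (ContDiffAt.sum fun j _ => contDiffAt_const.smul (hu j).contDiffAt).contMDiffAt
  have hAi : ∀ᶠ u in 𝓝 (e x), (A u).IsInvertible := by
    have h1 : (A (e x)).IsInvertible := by
      refine isInvertible_of_bijective ?_
      have h2 : ⇑(A (e x)) = d[H, H] e x ∘ fun a : Fin n → ℝ => ∑ i, a i • v i x := by
        funext a
        have := hAt (e x) a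
        rwa [hxx] at this
      rw [h2]
      exact (he.isInvertible hxs).bijective.comp hx
    obtain ⟨L, hL⟩ := h1
    filter_upwards [hA.at.continuousAt.eventually (hL ▸ ContinuousLinearEquiv.nhds L)] with u hu
    exact hu
  -- the dual coframe
  let θ : H → H →L[ℝ] F := fun u => C.comp (A u).inverse
  have hw : Smooth[H, H →L[ℝ] F] θ (e x) :=
    (smoothNear_inverse hA hAi.self_of_nhds).clm (ContinuousLinearMap.compL ℝ H (Fin n → ℝ) F C)
  have hwb : ∀ᶠ u in 𝓝 (e x), ∀ i, θ u (b i u) = C (Pi.single i 1) := by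
    filter_upwards [hAi] with u hu i
    rw [← hA1, comp_apply, hu.inverse_apply_self]
  have hbr : ∀ᶠ u in 𝓝 (e x), ∀ i j, fderiv ℝ (b j) u (b i u) = fderiv ℝ (b i) u (b j u) := by
    filter_upwards [e.open_target.mem_nhds hxt, hsc'.eventually hc,
      hsc'.eventually (eventually_all.2 hv), eventually_all.2 hb] with u h1 h2 h3 h4 i j
    have hy := e.map_target h1
    have h5 := tderiv_bracket (he.smoothNear hy) (h3 i) (h3 j)
    rw [h2 i j, tderiv_vzero] at h5
    have h6 : ∀ i j, tderiv (fun y => tderiv e y (v j y)) (e.symm u) (v i (e.symm u)) =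
        fderiv ℝ (b j) u (b i u) := fun i j => by
      have hd : DifferentiableAt ℝ (b j) (e (e.symm u)) := by
        rw [e.right_inv h1]; exact (h4 j).contDiffAt.differentiableAt (by simp)
      have e2 := tderiv_comp_fderiv hd (he.smoothNear hy).mdiff (v i (e.symm u))
      rw [e.right_inv h1] at e2
      refine Eq.trans (tderiv_congr ?_ _) e2
      filter_upwards [e.open_source.mem_nhds hy] with y hy using (hbe j y hy).symm
    rw [h6, h6] at h5
    exact sub_eq_zero.1 h5.symm
  have hsymm : ∀ᶠ u in 𝓝 (e x), ∀ w w', fderiv ℝ θ u w w' = fderiv ℝ θ u w' w := by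
    filter_upwards [hwb.eventually_nhds, hbr, hAi, hw, eventually_all.2 hb] with u h1 h2 h3 h4 h5
    have hd := h4.contDiffAt.differentiableAt (by simp)
    have h6 : ∀ i j, fderiv ℝ θ u (b i u) (b j u) = -θ u (fderiv ℝ (b j) u (b i u)) := fun i j => by
      have e1 := (hd.hasFDerivAt.clm_apply
        ((h5 j).contDiffAt.differentiableAt (by simp)).hasFDerivAt).fderiv
      have e2 : fderiv ℝ (fun u => θ u (b j u)) u = 0 :=
        (Filter.EventuallyEq.fderiv_eq (h1.mono fun u hu => hu j)).trans (fderiv_const_apply _)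
      have e3 := congrArg (fun L : H →L[ℝ] F => L (b i u)) (e1.symm.trans e2)
      simp at e3
      exact eq_neg_of_add_eq_zero_right e3
    intro w w'
    obtain ⟨a, rfl⟩ := h3.bijective.2 w
    obtain ⟨a', rfl⟩ := h3.bijective.2 w'
    simp only [hAa, map_sum, map_smul, sum_apply, smul_apply, Finset.smul_sum]
    rw [Finset.sum_comm]
    refine Finset.sum_congr rfl fun i _ => Finset.sum_congr rfl fun j _ => ?_
    rw [h6, h6, h2, smul_comm]
  obtain ⟨r, hr, hball⟩ := Metric.eventually_nhds_iff_ball.1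
    ((hw.mono fun u hu => hu.contDiffAt.differentiableAt (n := ∞) (by simp)).and hsymm)
  obtain ⟨g, hg⟩ := (convex_ball (e x) r).exists_forall_hasFDerivAt_of_fderiv_symmetric
    Metric.isOpen_ball (fun u hu => (hball u hu).1.differentiableWithinAt) fun u hu => (hball u hu).2
  have hg' : ∀ᶠ u in 𝓝 (e x), HasFDerivAt g (θ u) u := Metric.eventually_nhds_iff_ball.2 ⟨r, hr, hg⟩
  have hgs : ∀ᶠ u in 𝓝 (e x), ContDiffAt ℝ ∞ g u := by
    obtain ⟨U, hU, hUo, hxU⟩ := eventually_nhds_iff.1 (hg'.and hw)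
    have h1 : ContDiffOn ℝ ∞ g U := (contDiffOn_infty_iff_fderiv_of_isOpen hUo).2
      ⟨fun u hu => (hU u hu).1.differentiableAt.differentiableWithinAt,
        ContDiffOn.congr (fun u hu => (hU u hu).2.contDiffAt.contDiffWithinAt)
          fun u hu => (hU u hu).1.fderiv⟩
    filter_upwards [hUo.mem_nhds hxU] with u hu using h1.contDiffAt (hUo.mem_nhds hu)
  have hec : ContinuousAt e x := (he.smoothNear hxs).at.continuousAt
  refine ⟨fun y => g (e y), SmoothNear.comp_space hgs (he.smoothNear hxs), ?_⟩
  filter_upwards [hec.eventually hg', hec.eventually hAi, e.open_source.mem_nhds hxs] with y h1 h2 h3 a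
  rw [tderiv_comp_fderiv h1.differentiableAt (he.smoothNear h3).mdiff, h1.fderiv]
  have h4 := hAt (e y) a
  rw [e.left_inv h3] at h4
  rw [← h4, comp_apply, h2.inverse_apply_self]

end Coordinates

theorem clm_fieldDeriv_iterate {X : VField H M} {w : M → F}
    (hX : SmoothFieldNear X x) (hw : Smooth[H, F] w x) (L : F →L[ℝ] ℝ) (i : ℕ) :
    ∀ᶠ z in 𝓝 x, L ((fieldDeriv X)^[i] w z) = (fieldDeriv X)^[i] (fun z => L (w z)) z := by
  induction i with
  | zero => exact .of_forall fun _ => rfl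
  | succ i ih =>
    filter_upwards [ih.eventually_nhds, (smoothNear_fieldDeriv_iterate hX hw i).near] with z h1 h2
    rw [Function.iterate_succ_apply', Function.iterate_succ_apply']
    exact (tderiv_clm L h2.mdiff _).symm.trans (tderiv_congr h1 _)

end Manifold

/-! ### Binary forms -/

/-- Binary forms of degree `k`, by coefficients. -/
abbrev BForm (k : ℕ) : Type := Fin (k + 1) → ℝ

local notation "End[" k "]" => (BForm k →L[ℝ] BForm k)

section Forms

variable {k : ℕ} {F : Type*} [NormedAddCommGroup F] [NormedSpace ℝ F]

/-- The powers `(1 + t x) ^ k` span: a functional vanishing on them is a zero polynomial in `t`. -/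
theorem span_linearPower : Submodule.span ℝ (range (linearPower k 1)) = ⊤ := by
  by_contra hne
  obtain ⟨f, hf0, hf⟩ := Submodule.exists_le_ker_of_lt_top _ (lt_top_iff_ne_top.2 hne)
  apply hf0
  let p : Polynomial ℝ := ∑ i : Fin (k + 1),
    Polynomial.monomial (i : ℕ) ((k.choose i : ℝ) * f (Pi.single i 1))
  have hp : p = 0 := Polynomial.funext fun t => by
    have h1 : linearPower k 1 t ∈ LinearMap.ker f := hf (Submodule.subset_span ⟨t, rfl⟩)
    rw [LinearMap.mem_ker, pi_eq_sum_univ' (linearPower k 1 t), map_sum] at h1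
    simp only [map_smul, smul_eq_mul, linearPower, one_pow, mul_one] at h1
    simp only [p, Polynomial.eval_finsetSum, Polynomial.eval_monomial, Polynomial.eval_zero]
    rw [← h1]
    exact Finset.sum_congr rfl fun i _ => by ring
  ext i
  have h2 : p.coeff i = (k.choose i : ℝ) * f (Pi.single i 1) := by
    simp [p, Polynomial.finsetSum_coeff, Polynomial.coeff_monomial, Fin.val_inj]
  rw [hp, Polynomial.coeff_zero, eq_comm, mul_eq_zero] at h2
  have h3 : (k.choose i : ℝ) ≠ 0 := by
    exact_mod_cast (Nat.choose_pos (Nat.lt_succ_iff.1 i.2)).ne'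
  simpa using h2.resolve_left h3

theorem clm_ext_linearPower {A B : BForm k →L[ℝ] F}
    (h : ∀ t, A (linearPower k 1 t) = B (linearPower k 1 t)) : A = B := by
  have h1 : A.toLinearMap = B.toLinearMap := LinearMap.ext_on_range span_linearPower h
  exact ContinuousLinearMap.coe_injective h1

theorem exists_linearSubst (a b c d : ℝ) : ∃ A : End[k], ∀ v s t,
    formEval (A v) s t = formEval v (a * s + b * t) (c * s + d * t) := by
  let B := Module.Basis.ofSpan (K := ℝ) (s := range (linearPower k 1)) span_linearPower.ge
  have hB : ∀ i, ∃ t, linearPower k 1 t = B i := fun i =>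
    Module.Basis.ofSpan_subset (K := ℝ) span_linearPower.ge ⟨i, rfl⟩
  choose τ hτ using hB
  let A : BForm k →ₗ[ℝ] BForm k := B.constr ℝ fun i => linearPower k (a + τ i * c) (b + τ i * d)
  refine ⟨LinearMap.toContinuousLinearMap A, fun v s t => ?_⟩
  let φ : ℝ → ℝ → BForm k →ₗ[ℝ] ℝ := fun s t =>
    { toFun := fun v => formEval v s t
      map_add' := fun v w => by
        simp only [formEval, Pi.add_apply, add_mul, Finset.sum_add_distrib]
      map_smul' := fun c v => by
        simp only [formEval, Pi.smul_apply, smul_eq_mul, Finset.mul_sum, RingHom.id_apply, mul_assoc] }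
  have h : (φ s t).comp A = φ (a * s + b * t) (c * s + d * t) := by
    refine B.ext fun i => ?_
    change formEval (A (B i)) s t = formEval (B i) (a * s + b * t) (c * s + d * t)
    rw [Module.Basis.constr_basis, ← hτ, formEval_linearPower, formEval_linearPower]
    ring
  exact LinearMap.congr_fun h v

/-- The linear substitution which sends the power of the linear form `α s + β t` to the power of
`(α a + β c) s + (α b + β d) t`. -/
def linearSubst (k : ℕ) (a b c d : ℝ) : End[k] := (exists_linearSubst a b c d).choose

theorem formEval_linearSubst (a b c d : ℝ) (v : BForm k) (s t : ℝ) :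
    formEval (linearSubst k a b c d v) s t = formEval v (a * s + b * t) (c * s + d * t) :=
  (exists_linearSubst a b c d).choose_spec v s t

theorem linearSubst_linearPower (a b c d α β : ℝ) :
    linearSubst k a b c d (linearPower k α β) = linearPower k (α * a + β * c) (α * b + β * d) :=
  formEval_injective fun s t => by
    rw [formEval_linearSubst, formEval_linearPower, formEval_linearPower]
    ring

theorem linearSubst_comp (a b c d a' b' c' d' : ℝ) :
    (linearSubst k a b c d).comp (linearSubst k a' b' c' d') =
      linearSubst k (a' * a + b' * c) (a' * b + b' * d) (c' * a + d' * c) (c' * b + d' * d) :=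
  clm_ext_linearPower fun t => by
    simp only [comp_apply, linearSubst_linearPower]
    congr 1 <;> ring

theorem linearSubst_one : linearSubst k 1 0 0 1 = ContinuousLinearMap.id ℝ _ :=
  clm_ext_linearPower fun t => by
    simp [linearSubst_linearPower]

theorem linearPower_smul (c α β : ℝ) : linearPower k (c * α) (c * β) = c ^ k • linearPower k α β := by
  ext i
  have hi : (i : ℕ) ≤ k := Nat.lt_succ_iff.1 i.2
  have : c ^ k = c ^ (k - (i : ℕ)) * c ^ (i : ℕ) := by rw [← pow_add, Nat.sub_add_cancel hi]
  simp only [linearPower, Pi.smul_apply, smul_eq_mul, mul_pow, this]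
  ring

/-- The operator `B` belongs to the structure group: the group generated by the linear
substitutions and the homotheties. -/
def IsGL2 (B : End[k]) : Prop := ∃ c : ℝ, c ≠ 0 ∧ ∃ g A, IsSubstitution g A ∧ B = c • A

theorem isGL2_smul_linearSubst {c a b d e : ℝ} (hc : c ≠ 0) (h : a * e - b * d ≠ 0) :
    IsGL2 (c • linearSubst k a b d e) := by
  refine ⟨c, hc, Matrix.GeneralLinearGroup.mkOfDetNeZero !![a, b; d, e]
    (by rwa [Matrix.det_fin_two_of]), _, fun v s t => formEval_linearSubst a b d e v s t, rfl⟩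

theorem IsGL2.exists_eq {B : End[k]} (h : IsGL2 B) :
    ∃ c a b d e : ℝ, c ≠ 0 ∧ a * e - b * d ≠ 0 ∧ B = c • linearSubst k a b d e := by
  obtain ⟨c, hc, g, A, hA, rfl⟩ := h
  have hdet : g.val.det ≠ 0 := g.isUnit.map Matrix.detMonoidHom |>.ne_zero
  rw [Matrix.det_fin_two] at hdet
  refine ⟨c, g.val 0 0, g.val 0 1, g.val 1 0, g.val 1 1, hc, hdet, ?_⟩
  congr 1
  refine clm_ext_linearPower fun t => ?_
  rw [hA.linearPower, linearSubst_linearPower]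

theorem isGL2_id : IsGL2 (ContinuousLinearMap.id ℝ (BForm k)) := by
  have := isGL2_smul_linearSubst (k := k) one_ne_zero (a := 1) (b := 0) (d := 0) (e := 1) (by simp)
  rwa [one_smul, linearSubst_one] at this

theorem IsGL2.comp {A B : End[k]} (hA : IsGL2 A) (hB : IsGL2 B) :
    IsGL2 (A.comp B) := by
  obtain ⟨c, a, b, d, e, hc, h, rfl⟩ := hA.exists_eq
  obtain ⟨c', a', b', d', e', hc', h', rfl⟩ := hB.exists_eq
  rw [ContinuousLinearMap.smul_comp, comp_smul, linearSubst_comp, smul_smul]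
  refine isGL2_smul_linearSubst (mul_ne_zero hc hc') ?_
  have := mul_ne_zero h h'
  intro h0
  apply this
  linear_combination h0

theorem IsGL2.exists_inverse {A : End[k]} (hA : IsGL2 A) :
    ∃ B, IsGL2 B ∧ A.comp B = ContinuousLinearMap.id ℝ _ ∧
      B.comp A = ContinuousLinearMap.id ℝ _ := by
  obtain ⟨c, a, b, d, e, hc, h, rfl⟩ := hA.exists_eq
  set D := a * e - b * d
  refine ⟨c⁻¹ • linearSubst k (e / D) (-b / D) (-d / D) (a / D),
    isGL2_smul_linearSubst (inv_ne_zero hc) ?_, ?_, ?_⟩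
  · have : e / D * (a / D) - -b / D * (-d / D) = D⁻¹ := by
      field_simp
      simp only [D]; ring
    rw [this]
    exact inv_ne_zero h
  · rw [ContinuousLinearMap.smul_comp, comp_smul, linearSubst_comp, smul_smul,
      mul_inv_cancel₀ hc, one_smul, ← linearSubst_one]
    congr 1 <;> field_simp <;> simp only [D] <;> ring
  · rw [ContinuousLinearMap.smul_comp, comp_smul, linearSubst_comp, smul_smul,
      inv_mul_cancel₀ hc, one_smul, ← linearSubst_one]
    congr 1 <;> field_simp <;> simp only [D] <;> ring

theorem IsGL2.bijective {A : End[k]} (hA : IsGL2 A) : Function.Bijective A := by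
  obtain ⟨B, -, h1, h2⟩ := hA.exists_inverse
  refine Function.bijective_iff_has_inverse.2 ⟨B, fun x => ?_, fun x => ?_⟩
  · exact congrArg (fun L : End[k] => L x) h2
  · exact congrArg (fun L : End[k] => L x) h1

/-- The first basis form. -/
def form₀ (k : ℕ) : BForm k := linearPower k 1 0

/-- The second basis form. -/
def form₁ (k : ℕ) [NeZero k] : BForm k := Pi.single ⟨1, Nat.succ_lt_succ (NeZero.pos k)⟩ 1

theorem hasDerivAt_linearPower_apply (i : Fin (k + 1)) {p q : ℝ → ℝ} {p' q' s : ℝ}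
    (hp : HasDerivAt p p' s) (hq : HasDerivAt q q' s) :
    HasDerivAt (fun r => linearPower k (p r) (q r) i)
      (k.choose i * (((k - (i : ℕ) : ℕ) : ℝ) * p s ^ (k - (i : ℕ) - 1) * p' * q s ^ (i : ℕ) +
        p s ^ (k - (i : ℕ)) * ((i : ℕ) * q s ^ ((i : ℕ) - 1) * q'))) s := by
  have h := ((hp.fun_pow (k - (i : ℕ))).const_mul (k.choose i : ℝ)).mul (hq.fun_pow (i : ℕ))
  refine h.congr_deriv ?_
  ring

variable [NeZero k]

theorem hasDerivAt_linearPower_zero_one :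
    HasDerivAt (fun s => linearPower k 1 s) ((k : ℝ) • form₁ k) 0 := by
  rw [hasDerivAt_pi]
  intro i
  refine (hasDerivAt_linearPower_apply i (hasDerivAt_const _ _) (hasDerivAt_id _)).congr_deriv ?_
  by_cases h : (i : ℕ) = 1
  · have : i = ⟨1, Nat.succ_lt_succ (NeZero.pos k)⟩ := Fin.ext h
    subst this
    simp [form₁]
  · have : i ≠ ⟨1, Nat.succ_lt_succ (NeZero.pos k)⟩ := fun h' => h (congrArg Fin.val h')
    rw [Pi.smul_apply, form₁, Pi.single_eq_of_ne this]
    rcases Nat.lt_or_gt_of_ne h with h | h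
    · have : (i : ℕ) = 0 := by omega
      simp [this]
    · have : (i : ℕ) - 1 ≠ 0 := by omega
      simp [this]

/-- The value of an operator of the structure group on the second basis form. -/
theorem linearSubst_form₁_apply_zero (c a b d e : ℝ) :
    (c • linearSubst k a b d e) (form₁ k) 0 = c * (a ^ (k - 1) * d) := by
  have h1 := ((c • linearSubst k a b d e).hasFDerivAt (x := linearPower k 1 0)).comp_hasDerivAt 0
    hasDerivAt_linearPower_zero_one
  have h2 := (hasDerivAt_pi.1 h1) 0
  have h3 := (hasDerivAt_linearPower_apply (k := k) 0 (((hasDerivAt_id (0 : ℝ)).mul_const d).const_add a)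
    (((hasDerivAt_id (0 : ℝ)).mul_const e).const_add b)).const_mul c
  have h4 := h2.unique (h3.congr_of_eventuallyEq (.of_forall fun s => by
    simp [linearSubst_linearPower]))
  have hk : (k : ℝ) ≠ 0 := NeZero.ne _
  apply mul_left_cancel₀ hk
  rw [map_smul] at h4
  refine h4.trans ?_
  simp
  ring

theorem linearSubst_form₁_apply_one (c a b d e : ℝ) :
    (c • linearSubst k a b d e) (form₁ k) ⟨1, Nat.succ_lt_succ (NeZero.pos k)⟩ =
      c * ((k - 1 : ℕ) * a ^ (k - 1 - 1) * d * b + a ^ (k - 1) * e) := by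
  have h1 := ((c • linearSubst k a b d e).hasFDerivAt (x := linearPower k 1 0)).comp_hasDerivAt 0
    hasDerivAt_linearPower_zero_one
  have h2 := (hasDerivAt_pi.1 h1) ⟨1, Nat.succ_lt_succ (NeZero.pos k)⟩
  have h3 := (hasDerivAt_linearPower_apply (k := k) ⟨1, Nat.succ_lt_succ (NeZero.pos k)⟩
    (((hasDerivAt_id (0 : ℝ)).mul_const d).const_add a)
    (((hasDerivAt_id (0 : ℝ)).mul_const e).const_add b)).const_mul c
  have h4 := h2.unique (h3.congr_of_eventuallyEq (.of_forall fun s => by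
    simp [linearSubst_linearPower]))
  have hk : (k : ℝ) ≠ 0 := NeZero.ne _
  apply mul_left_cancel₀ hk
  rw [map_smul] at h4
  refine h4.trans ?_
  simp
  ring

end Forms

/-! ### The infinitesimal action on binary forms -/

section InfinitesimalAction

variable {k : ℕ}

/-- The `n`-th monomial form (zero for `n > k`). -/
def monoForm (k n : ℕ) : BForm k := fun j => if (j : ℕ) = n then 1 else 0

/-- The `n`-th coefficient of a form (zero for `n > k`). -/
def formCoeff (k n : ℕ) : BForm k →L[ℝ] ℝ := if h : n < k + 1 then proj ⟨n, h⟩ else 0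

theorem formCoeff_apply (a : BForm k) {n : ℕ} (h : n < k + 1) : formCoeff k n a = a ⟨n, h⟩ := by
  simp [formCoeff, h]

theorem formCoeff_linearPower (n : ℕ) (α β : ℝ) (h : n ≤ k) :
    formCoeff k n (linearPower k α β) = (k.choose n : ℝ) * α ^ (k - n) * β ^ n := by
  rw [formCoeff_apply _ (Nat.lt_succ_of_le h)]
  rfl

theorem formCoeff_monoForm (n m : ℕ) (h : n ≤ k) : formCoeff k n (monoForm k m) = if n = m then 1 else 0 := by
  rw [formCoeff_apply _ (Nat.lt_succ_of_le h)]
  rfl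

theorem formCoeff_eq_zero {n : ℕ} (h : k < n) : formCoeff k n = 0 := by
  simp [formCoeff, Nat.not_lt.2 (Nat.succ_le_of_lt h)]

theorem monoForm_eq_zero {n : ℕ} (h : k < n) : monoForm k n = 0 := by
  ext j
  have := j.2
  simp [monoForm, show (j : ℕ) ≠ n by omega]

theorem form₀_eq_monoForm : form₀ k = monoForm k 0 := by
  ext j
  by_cases h : (j : ℕ) = 0 <;> simp [form₀, linearPower, monoForm, h]

theorem clm_ext_monoForm {F : Type*} [NormedAddCommGroup F] [NormedSpace ℝ F]
    {A B : BForm k →L[ℝ] F} (h : ∀ n ≤ k, A (monoForm k n) = B (monoForm k n)) : A = B := by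
  refine ContinuousLinearMap.coe_injective ((Pi.basisFun ℝ (Fin (k + 1))).ext fun i => ?_)
  have : Pi.basisFun ℝ (Fin (k + 1)) i = monoForm k i := by
    ext j
    simp [monoForm, Pi.single_apply, Fin.ext_iff]
  rw [this]
  exact h i (Nat.lt_succ_iff.1 i.2)

/-- The derivative of `linearSubst k 1 s 0 1` at `s = 0`. -/
def opX (k : ℕ) : End[k] :=
  ContinuousLinearMap.pi fun j => match (j : ℕ) with
    | 0 => 0
    | n + 1 => ((k : ℝ) - n) • formCoeff k n

/-- The derivative of `linearSubst k 1 0 0 (exp (-s))` at `s = 0`. -/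
def opF₀ (k : ℕ) : End[k] := ContinuousLinearMap.pi fun j => (-((j : ℕ) : ℝ)) • proj j

/-- The derivative of `linearSubst k 1 0 (-s) 1` at `s = 0`. -/
def opF₁ (k : ℕ) : End[k] :=
  ContinuousLinearMap.pi fun j => (-(((j : ℕ) : ℝ) + 1)) • formCoeff k (j + 1)

theorem opX_monoForm (n : ℕ) :
    opX k (monoForm k n) = ((k : ℝ) - n) • monoForm k (n + 1) := by
  ext j
  obtain ⟨j, hj⟩ := j
  rcases j with _ | j
  · simp [opX, monoForm]
  · change ((k : ℝ) - j) • formCoeff k j (monoForm k n) = _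
    rw [formCoeff_monoForm _ _ (by omega)]
    by_cases h : j = n <;> simp [monoForm, h]

theorem opF₀_monoForm (n : ℕ) : opF₀ k (monoForm k n) = (-(n : ℝ)) • monoForm k n := by
  ext j
  by_cases h : (j : ℕ) = n <;> simp [opF₀, monoForm, h]

theorem opF₁_monoForm_zero : opF₁ k (monoForm k 0) = 0 := by
  ext j
  change (-(((j : ℕ) : ℝ) + 1)) • formCoeff k (j + 1) (monoForm k 0) = 0
  rcases Nat.lt_or_ge k (j + 1) with h | h
  · simp [formCoeff_eq_zero h]
  · simp [formCoeff_monoForm _ _ h]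

theorem opF₁_monoForm_succ {n : ℕ} (h : n + 1 ≤ k) :
    opF₁ k (monoForm k (n + 1)) = (-((n : ℝ) + 1)) • monoForm k n := by
  ext j
  change (-(((j : ℕ) : ℝ) + 1)) • formCoeff k (j + 1) (monoForm k (n + 1)) = _
  rcases Nat.lt_or_ge k (j + 1) with h' | h'
  · rw [formCoeff_eq_zero h']
    have : (j : ℕ) ≠ n := by omega
    simp [monoForm, this]
  · rw [formCoeff_monoForm _ _ h']
    by_cases h : (j : ℕ) = n <;> simp [monoForm, h]

theorem opF₀_comm_opX : (opF₀ k).comp (opX k) - (opX k).comp (opF₀ k) = -opX k :=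
  clm_ext_monoForm fun n hn => by
    simp only [sub_apply, comp_apply,
      neg_apply, opX_monoForm, opF₀_monoForm, map_smul, smul_smul,
      ← sub_smul, ← neg_smul]
    congr 1
    push_cast; ring

theorem opF₁_comm_opX : (opF₁ k).comp (opX k) - (opX k).comp (opF₁ k) =
    -((k : ℝ) • ContinuousLinearMap.id ℝ _) - (2 : ℝ) • opF₀ k :=
  clm_ext_monoForm fun n hn => by
    simp only [sub_apply, comp_apply,
      neg_apply, smul_apply, id_apply,
      opX_monoForm, opF₀_monoForm, map_smul, smul_smul]
    rcases n with _ | n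
    · rw [opF₁_monoForm_zero, map_zero]
      rcases Nat.eq_zero_or_pos k with rfl | h
      · simp
      · rw [opF₁_monoForm_succ h, smul_smul, sub_zero, ← neg_smul, ← sub_smul]
        congr 1
        push_cast; ring
    · rw [opF₁_monoForm_succ hn, map_smul, opX_monoForm, smul_smul]
      rcases Nat.lt_or_ge k (n + 1 + 1) with h | h
      · obtain rfl : k = n + 1 := by omega
        rw [monoForm_eq_zero h, map_zero, smul_zero, ← neg_smul, zero_sub, ← sub_smul, ← neg_smul]
        congr 1
        push_cast; ring
      · rw [opF₁_monoForm_succ h, smul_smul, ← neg_smul, ← sub_smul, ← sub_smul]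
        congr 1
        push_cast; ring

/-- The vectors `Nⁱ e₀`, for `N = opX k`. -/
def ladder (k i : ℕ) : BForm k := (k.descFactorial i : ℝ) • monoForm k i

theorem ladder_zero : ladder k 0 = form₀ k := by simp [ladder, form₀_eq_monoForm]

theorem opX_ladder (i : ℕ) : opX k (ladder k i) = ladder k (i + 1) := by
  rcases Nat.lt_or_ge k i with h | h
  · rw [ladder, ladder, Nat.descFactorial_of_lt h, Nat.descFactorial_of_lt (by omega)]
    simp
  · rw [ladder, map_smul, opX_monoForm, ladder, Nat.descFactorial_succ, smul_smul]
    congr 1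
    push_cast [Nat.cast_sub h]; ring

theorem ladder_eq_zero {i : ℕ} (h : k < i) : ladder k i = 0 := by
  rw [ladder, monoForm_eq_zero h, smul_zero]

theorem opF₀_ladder (i : ℕ) : opF₀ k (ladder k i) = (-(i : ℝ)) • ladder k i := by
  rw [ladder, map_smul, opF₀_monoForm, smul_comm]

theorem opF₁_ladder_zero : opF₁ k (ladder k 0) = 0 := by
  rw [ladder, map_smul, opF₁_monoForm_zero, smul_zero]

theorem opF₁_ladder_succ (i : ℕ) :
    opF₁ k (ladder k (i + 1)) = (-(((k : ℝ) - i) * (i + 1))) • ladder k i := by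
  rcases Nat.lt_or_ge k (i + 1) with h | h
  · rw [ladder_eq_zero h, map_zero]
    rcases Nat.lt_or_ge k i with h' | h'
    · rw [ladder_eq_zero h', smul_zero]
    · obtain rfl : k = i := by omega
      simp
  · rw [ladder, map_smul, opF₁_monoForm_succ h, ladder, Nat.descFactorial_succ, smul_smul, smul_smul]
    congr 1
    push_cast [Nat.cast_sub (show i ≤ k by omega)]; ring

theorem ladder_apply_of_ne {i : ℕ} {j : Fin (k + 1)} (h : (j : ℕ) ≠ i) : ladder k i j = 0 := by
  simp [ladder, monoForm, h]

theorem ladder_apply_self_ne (j : Fin (k + 1)) : ladder k j j ≠ 0 := by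
  have : k.descFactorial j ≠ 0 := by
    rw [Ne, Nat.descFactorial_eq_zero_iff_lt]
    have := j.2
    omega
  simpa [ladder, monoForm] using this

theorem linearIndependent_ladder : LinearIndependent ℝ (fun i : Fin (k + 1) => ladder k i) := by
  rw [Fintype.linearIndependent_iff]
  intro g hg i
  have h := congrFun hg i
  rw [Finset.sum_apply, Finset.sum_eq_single i] at h
  · simpa [ladder_apply_self_ne i] using h
  · intro j _ hj
    rw [Pi.smul_apply, ladder_apply_of_ne (fun h => hj (Fin.ext h.symm)), smul_zero]
  · simp

/-! ### One-parameter groups -/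

theorem contDiff_linearSubst :
    ContDiff ℝ ∞ fun q : ℝ × ℝ × ℝ × ℝ => linearSubst k q.1 q.2.1 q.2.2.1 q.2.2.2 := by
  rw [contDiff_clm_apply_iff]
  intro v
  have hv : v ∈ Submodule.span ℝ (range (linearPower k 1)) := by rw [span_linearPower]; trivial
  induction hv using Submodule.span_induction with
  | mem x hx =>
    obtain ⟨t, rfl⟩ := hx
    simp only [linearSubst_linearPower]
    rw [contDiff_pi]
    intro i
    simp only [linearPower]
    fun_prop
  | zero => simpa using contDiff_const
  | add x y _ _ hx hy => simpa using hx.add hy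
  | smul c x _ hx => simpa using hx.const_smul c

/-- A smooth operator-valued function has the derivative which is seen on the powers of linear
forms. -/
theorem hasDerivAt_clm_of_linearPower {fl : ℝ → End[k]} {D : End[k]}
    {s : ℝ} (h : DifferentiableAt ℝ fl s)
    (h' : ∀ t, HasDerivAt (fun r => fl r (linearPower k 1 t)) (D (linearPower k 1 t)) s) :
    HasDerivAt fl D s := by
  have h1 := h.hasDerivAt
  convert! h1
  refine clm_ext_linearPower fun t => (h' t).unique ?_
  have := h1.clm_apply (hasDerivAt_const s (linearPower k 1 t))
  simpa using this

/-- The one-parameter groups of the operators `opX`, `1`, `opF₀`, `opF₁`. -/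
def flX (k : ℕ) (s : ℝ) : End[k] := linearSubst k 1 s 0 1

/-- The one-parameter group generated by the identity. -/
def flG (k : ℕ) (s : ℝ) : End[k] := Real.exp s • ContinuousLinearMap.id ℝ _

/-- The one-parameter group generated by `opF₀`. -/
def flF₀ (k : ℕ) (s : ℝ) : End[k] := linearSubst k 1 0 0 (Real.exp (-s))

/-- The one-parameter group generated by `opF₁`. -/
def flF₁ (k : ℕ) (s : ℝ) : End[k] := linearSubst k 1 0 (-s) 1

theorem contDiff_flX : ContDiff ℝ ∞ (flX k) :=
  contDiff_linearSubst.comp (g := fun q : ℝ × ℝ × ℝ × ℝ => _) (f := fun s : ℝ => ((1 : ℝ), s, (0 : ℝ), (1 : ℝ)))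
    (by fun_prop)

theorem contDiff_flG : ContDiff ℝ ∞ (flG k) := by
  unfold flG
  exact Real.contDiff_exp.smul contDiff_const

theorem contDiff_flF₀ : ContDiff ℝ ∞ (flF₀ k) :=
  contDiff_linearSubst.comp (g := fun q : ℝ × ℝ × ℝ × ℝ => _)
    (f := fun s : ℝ => ((1 : ℝ), (0 : ℝ), (0 : ℝ), Real.exp (-s))) (by fun_prop)

theorem contDiff_flF₁ : ContDiff ℝ ∞ (flF₁ k) :=
  contDiff_linearSubst.comp (g := fun q : ℝ × ℝ × ℝ × ℝ => _)
    (f := fun s : ℝ => ((1 : ℝ), (0 : ℝ), -s, (1 : ℝ))) (by fun_prop)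

theorem choose_succ_cast (n : ℕ) (h : n ≤ k) :
    (k.choose (n + 1) : ℝ) * (n + 1) = k.choose n * (k - n) := by
  have := Nat.choose_succ_right_eq k n
  have h2 : ((k.choose (n + 1) * (n + 1) : ℕ) : ℝ) = ((k.choose n * (k - n) : ℕ) : ℝ) := by rw [this]
  push_cast [Nat.cast_sub h] at h2
  exact h2

/-- The derivative of the curve of `k`-th powers of monic linear forms. -/
theorem hasDerivAt_linearPower (t : ℝ) :
    HasDerivAt (fun s => linearPower k 1 s) (opX k (linearPower k 1 t)) t := by
  rw [hasDerivAt_pi]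
  intro i
  refine (hasDerivAt_linearPower_apply i (hasDerivAt_const _ _) (hasDerivAt_id _)).congr_deriv ?_
  obtain ⟨i, hi⟩ := i
  rcases i with _ | n
  · simp [opX]
  · change _ = ((k : ℝ) - n) • formCoeff k n (linearPower k 1 t)
    rw [formCoeff_linearPower _ _ _ (by omega)]
    have := choose_succ_cast (k := k) n (by omega)
    simp only [id, one_pow, smul_eq_mul, Nat.add_sub_cancel]
    push_cast
    linear_combination t ^ n * this

theorem hasDerivAt_flX : HasDerivAt (flX k) (opX k) 0 :=
  hasDerivAt_clm_of_linearPower (contDiff_flX.differentiable (by simp) _) fun t => by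
    have h := (hasDerivAt_linearPower (k := k) t)
    have h2 : HasDerivAt (fun s : ℝ => t + s) 1 0 := (hasDerivAt_id 0).const_add t
    have h3 := HasDerivAt.scomp (0 : ℝ) (g₁ := fun s => linearPower k 1 s) (h := fun s : ℝ => t + s)
      (by rw [add_zero]; exact h) h2
    rw [one_smul] at h3
    refine h3.congr_of_eventuallyEq (.of_forall fun s => ?_)
    simp only [flX, linearSubst_linearPower, Function.comp]
    congr 1 <;> ring

theorem hasDerivAt_flG : HasDerivAt (flG k) (ContinuousLinearMap.id ℝ _) 0 := by
  have := (Real.hasDerivAt_exp 0).smul_const (ContinuousLinearMap.id ℝ (BForm k))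
  rw [Real.exp_zero, one_smul] at this
  exact this

theorem hasDerivAt_flF₀ : HasDerivAt (flF₀ k) (opF₀ k) 0 :=
  hasDerivAt_clm_of_linearPower (contDiff_flF₀.differentiable (by simp) _) fun t => by
    rw [hasDerivAt_pi]
    intro i
    have h2 : HasDerivAt (fun s : ℝ => t * Real.exp (-s)) (-t) 0 := by
      have := ((hasDerivAt_neg (0 : ℝ)).exp).const_mul t
      simpa using this
    have h1 := hasDerivAt_linearPower_apply (k := k) i (hasDerivAt_const (0 : ℝ) (1 : ℝ)) h2
    refine (h1.congr_of_eventuallyEq (.of_forall fun s => ?_)).congr_deriv ?_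
    · simp only [flF₀, linearSubst_linearPower]
      congr 1 <;> ring
    · obtain ⟨i, hi⟩ := i
      change _ = (-((i : ℕ) : ℝ)) • linearPower k 1 t ⟨i, hi⟩
      rcases i with _ | n
      · simp
      · simp [linearPower]
        ring

theorem hasDerivAt_flF₁ : HasDerivAt (flF₁ k) (opF₁ k) 0 :=
  hasDerivAt_clm_of_linearPower (contDiff_flF₁.differentiable (by simp) _) fun t => by
    rw [hasDerivAt_pi]
    intro i
    have h2 : HasDerivAt (fun s : ℝ => 1 + t * (-s)) (-t) 0 := by
      have := ((hasDerivAt_neg (0 : ℝ)).const_mul t).const_add 1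
      simpa using this
    have h1 := hasDerivAt_linearPower_apply (k := k) i h2 (hasDerivAt_const (0 : ℝ) t)
    refine (h1.congr_of_eventuallyEq (.of_forall fun s => ?_)).congr_deriv ?_
    · simp only [flF₁, linearSubst_linearPower]
      congr 1 <;> ring
    · obtain ⟨i, hi⟩ := i
      change _ = (-((i : ℝ) + 1)) • formCoeff k (i + 1) (linearPower k 1 t)
      rcases Nat.lt_or_ge k (i + 1) with h | h
      · have : k - i = 0 := by omega
        simp [formCoeff_eq_zero h, this]
      · rw [formCoeff_linearPower _ _ _ h]
        have := choose_succ_cast (k := k) i (by omega)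
        simp
        push_cast [Nat.cast_sub (show i ≤ k by omega)]
        linear_combination t ^ (i + 1) * this

theorem isGL2_flX (s : ℝ) : IsGL2 (flX k s) := by
  have := isGL2_smul_linearSubst (k := k) one_ne_zero (a := 1) (b := s) (d := 0) (e := 1) (by simp)
  rwa [one_smul] at this

theorem isGL2_flG (s : ℝ) : IsGL2 (flG k s) := by
  have := isGL2_smul_linearSubst (k := k) (Real.exp_ne_zero s) (a := 1) (b := 0) (d := 0) (e := 1)
    (by simp)
  rwa [linearSubst_one] at this

theorem isGL2_flF₀ (s : ℝ) : IsGL2 (flF₀ k s) := by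
  have := isGL2_smul_linearSubst (k := k) one_ne_zero (a := 1) (b := 0) (d := 0) (e := Real.exp (-s))
    (by simp [Real.exp_ne_zero])
  rwa [one_smul] at this

theorem isGL2_flF₁ (s : ℝ) : IsGL2 (flF₁ k s) := by
  have := isGL2_smul_linearSubst (k := k) one_ne_zero (a := 1) (b := 0) (d := -s) (e := 1) (by simp)
  rwa [one_smul] at this

theorem flX_zero : flX k 0 = ContinuousLinearMap.id ℝ _ := linearSubst_one

theorem flG_zero : flG k 0 = ContinuousLinearMap.id ℝ _ := by simp [flG]

theorem flF₀_zero : flF₀ k 0 = ContinuousLinearMap.id ℝ _ := by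
  simp only [flF₀, neg_zero, Real.exp_zero]
  exact linearSubst_one

theorem flF₁_zero : flF₁ k 0 = ContinuousLinearMap.id ℝ _ := by
  simp only [flF₁, neg_zero]
  exact linearSubst_one

/-- The action of the element `(c, a, b)` of `Gl(1) ⊕ Aff(1)` on binary forms. -/
def actOp (k : ℕ) (c a b : ℝ) : End[k] := c • linearSubst k 1 0 (-b / a) (1 / a)

theorem isGL2_actOp {c a b : ℝ} (hc : c ≠ 0) (ha : a ≠ 0) : IsGL2 (actOp k c a b) :=
  isGL2_smul_linearSubst hc (by simpa using ha)

/-! ### Coordinates on the structure group -/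

/-- The element of the structure group with coordinates `(t, y, x₀, x₁)`. The coordinates are chosen
so that it sends `e₀` to `y` times the power of `1 + t`, and that `x₀`, `x₁` describe the
projective parameter. -/
def coordOp (k : ℕ) (q : ℝ × ℝ × ℝ × ℝ) : End[k] :=
  q.2.1 • linearSubst k 1 q.1 (-q.2.2.2 / 2) (q.2.2.1 - q.2.2.2 * q.1 / 2)

theorem contDiff_coordOp : ContDiff ℝ ∞ (coordOp k) := by
  unfold coordOp
  refine ContDiff.smul (f := fun q : ℝ × ℝ × ℝ × ℝ => q.2.1) (by fun_prop) ?_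
  exact contDiff_linearSubst.comp (g := fun q : ℝ × ℝ × ℝ × ℝ => _)
    (f := fun q : ℝ × ℝ × ℝ × ℝ => ((1 : ℝ), q.1, -q.2.2.2 / 2, q.2.2.1 - q.2.2.2 * q.1 / 2)) (by fun_prop)

theorem isGL2_coordOp {q : ℝ × ℝ × ℝ × ℝ} (h1 : q.2.1 ≠ 0) (h2 : q.2.2.1 ≠ 0) :
    IsGL2 (coordOp k q) := by
  refine isGL2_smul_linearSubst h1 ?_
  convert! h2 using 1
  ring

theorem coordOp_linearPower (q : ℝ × ℝ × ℝ × ℝ) (α β : ℝ) :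
    coordOp k q (linearPower k α β) = q.2.1 • linearPower k (α - β * q.2.2.2 / 2)
      (α * q.1 + β * (q.2.2.1 - q.2.2.2 * q.1 / 2)) := by
  rw [coordOp, smul_apply, linearSubst_linearPower]
  congr 2; ring

theorem coordOp_form₀ (q : ℝ × ℝ × ℝ × ℝ) :
    coordOp k q (form₀ k) = q.2.1 • linearPower k 1 q.1 := by
  rw [form₀, coordOp_linearPower]
  simp

theorem coordOp_one : coordOp k (0, 1, 1, 0) = ContinuousLinearMap.id ℝ _ := by
  rw [coordOp, ← linearSubst_one]
  simp

variable [NeZero k]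

/-- The coordinates of an element of the structure group. -/
def readCoord (k : ℕ) [NeZero k] (B : End[k]) : ℝ × ℝ × ℝ × ℝ :=
  let y := B (form₀ k) 0
  let t := B (form₀ k) ⟨1, Nat.succ_lt_succ (NeZero.pos k)⟩ / (k * y)
  let x₁ := -2 * B (form₁ k) 0 / y
  (t, y, B (form₁ k) ⟨1, Nat.succ_lt_succ (NeZero.pos k)⟩ / y + k * x₁ * t / 2, x₁)

theorem contDiffAt_readCoord {B : End[k]} (h : B (form₀ k) 0 ≠ 0) :
    ContDiffAt ℝ ∞ (readCoord k) B := by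
  have h1 : ∀ v i, ContDiffAt ℝ ∞ (fun B : End[k] => B v i) B := fun v i =>
    (contDiff_apply ℝ ℝ i).contDiffAt.comp B
      (ContDiff.contDiffAt (by fun_prop : ContDiff ℝ ∞ fun B : End[k] => B v))
  have hk : (k : ℝ) ≠ 0 := NeZero.ne _
  have ht := (h1 (form₀ k) ⟨1, Nat.succ_lt_succ (NeZero.pos k)⟩).div
    ((contDiffAt_const (c := (k : ℝ))).mul (h1 (form₀ k) 0)) (mul_ne_zero hk h)
  have hx := ((contDiffAt_const (c := (-2 : ℝ))).mul (h1 (form₁ k) 0)).div (h1 (form₀ k) 0) h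
  refine ht.prodMk ((h1 _ _).prodMk (ContDiffAt.prodMk ?_ hx))
  exact ((h1 _ _).div (h1 (form₀ k) 0) h).add
    ((((contDiffAt_const (c := (k : ℝ))).mul hx).mul ht).div_const 2)

theorem readCoord_coordOp {q : ℝ × ℝ × ℝ × ℝ} (h : q.2.1 ≠ 0) : readCoord k (coordOp k q) = q := by
  obtain ⟨t, y, x₀, x₁⟩ := q
  change y ≠ 0 at h
  have hk : (k : ℝ) ≠ 0 := NeZero.ne _
  have hk1 : ((k - 1 : ℕ) : ℝ) = k - 1 := by rw [Nat.cast_sub (NeZero.pos k)]; simp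
  have e0 : coordOp k (t, y, x₀, x₁) (form₀ k) 0 = y := by
    rw [coordOp_form₀, Pi.smul_apply, linearPower_zero]; simp
  have e1 : coordOp k (t, y, x₀, x₁) (form₀ k) ⟨1, Nat.succ_lt_succ (NeZero.pos k)⟩ = y * (k * t) := by
    rw [coordOp_form₀, Pi.smul_apply, linearPower_one]; simp
  have e2 : coordOp k (t, y, x₀, x₁) (form₁ k) 0 = y * (-x₁ / 2) := by
    rw [coordOp, linearSubst_form₁_apply_zero]; simp
  have e3 : coordOp k (t, y, x₀, x₁) (form₁ k) ⟨1, Nat.succ_lt_succ (NeZero.pos k)⟩ =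
      y * (x₀ - k * x₁ * t / 2) := by
    rw [coordOp, linearSubst_form₁_apply_one, hk1]; simp; left; ring
  have f1 : y * (k * t) / (k * y) = t := by field_simp
  have f2 : -2 * (y * (-x₁ / 2)) / y = x₁ := by field_simp
  simp only [readCoord, e0, e1, e2, e3, f1, f2]
  refine Prod.ext rfl (Prod.ext rfl (Prod.ext ?_ rfl))
  change y * (x₀ - k * x₁ * t / 2) / y + k * x₁ * t / 2 = x₀
  field_simp
  ring

theorem IsGL2.exists_coordOp {B : End[k]} (hB : IsGL2 B) (h : B (form₀ k) 0 ≠ 0) :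
    ∃ q : ℝ × ℝ × ℝ × ℝ, q.2.1 ≠ 0 ∧ q.2.2.1 ≠ 0 ∧ B = coordOp k q := by
  obtain ⟨c, a, b, d, e, hc, hD, rfl⟩ := hB.exists_eq
  have ha : a ≠ 0 := by
    rintro rfl
    apply h
    rw [smul_apply, form₀, linearSubst_linearPower, Pi.smul_apply, linearPower_zero]
    simp [NeZero.ne k]
  refine ⟨(b / a, c * a ^ k, (a * e - b * d) / a ^ 2, -2 * d / a), ?_, ?_, ?_⟩
  · exact mul_ne_zero hc (pow_ne_zero _ ha)
  · exact div_ne_zero hD (pow_ne_zero _ ha)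
  · refine clm_ext_linearPower fun t => ?_
    rw [coordOp_linearPower, smul_apply, linearSubst_linearPower, mul_smul, ← linearPower_smul]
    congr 2
    · field_simp; ring
    · field_simp; ring

end InfinitesimalAction

/-! ### Iterated derivations of the line -/

section Scalar

/-- The `n`-th power of the derivation `f d/ds`, applied to `u`. -/
def derivIter (f : ℝ → ℝ) (n : ℕ) (u : ℝ → ℝ) : ℝ → ℝ := (fun v s => f s * deriv v s)^[n] u

theorem derivIter_succ (f : ℝ → ℝ) (n : ℕ) (u : ℝ → ℝ) :
    derivIter f (n + 1) u = derivIter f n fun s => f s * deriv u s := Function.iterate_succ_apply _ _ _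

variable {f v u : ℝ → ℝ} {s₀ : ℝ}

theorem derivIter_congr (h : u =ᶠ[𝓝 s₀] v) (n : ℕ) : derivIter f n u =ᶠ[𝓝 s₀] derivIter f n v := by
  induction n generalizing u v with
  | zero => exact h
  | succ n ih =>
    rw [derivIter_succ, derivIter_succ]
    refine ih ?_
    filter_upwards [h.deriv] with s hs
    rw [hs]

theorem ContDiffAt.deriv_infty (h : ContDiffAt ℝ ∞ f s₀) : ContDiffAt ℝ ∞ (deriv f) s₀ := by
  have h1 : ContDiffAt ℝ ∞ (fderiv ℝ f) s₀ := h.fderiv_right (by simp)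
  exact h1.clm_apply contDiffAt_const

theorem ContDiffAt.differentiableAt_near (h : ContDiffAt ℝ ∞ f s₀) :
    ∀ᶠ s in 𝓝 s₀, DifferentiableAt ℝ f s := by
  have h1 : ContDiffAt ℝ 1 f s₀ := h.of_le (by exact_mod_cast le_top)
  filter_upwards [h1.eventually (by simp)] with s hs
  exact hs.differentiableAt (by simp)

theorem hasDerivAt_pow_mul {m : ℕ} {s : ℝ} (h : DifferentiableAt ℝ v s) :
    deriv (fun r => (r - s₀) ^ (m + 1) * v r) s =
      (s - s₀) ^ m * ((m + 1) * v s + (s - s₀) * deriv v s) := by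
  have h1 : HasDerivAt (fun r : ℝ => r - s₀) 1 s := (hasDerivAt_id s).sub_const s₀
  have h2 := ((h1.fun_pow (m + 1)).mul h.hasDerivAt).deriv
  refine h2.trans ?_
  simp
  ring

theorem derivIter_pow_mul_succ (hv : ContDiffAt ℝ ∞ v s₀) (m n : ℕ) :
    derivIter f (n + 1) (fun r => (r - s₀) ^ (m + 1) * v r) s₀ =
      derivIter f n (fun r => (r - s₀) ^ m * ((m + 1) * (f r * v r) + (r - s₀) * (f r * deriv v r))) s₀ := by
  rw [derivIter_succ]
  refine (derivIter_congr ?_ n).self_of_nhds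
  filter_upwards [hv.differentiableAt_near] with s hs
  rw [hasDerivAt_pow_mul hs]
  ring

theorem contDiffAt_reduced (hf : ContDiffAt ℝ ∞ f s₀) (hv : ContDiffAt ℝ ∞ v s₀) (m : ℕ) :
    ContDiffAt ℝ ∞ (fun r => (m + 1) * (f r * v r) + (r - s₀) * (f r * deriv v r)) s₀ :=
  (contDiffAt_const.mul (hf.mul hv)).add
    ((contDiffAt_id.sub contDiffAt_const).mul (hf.mul hv.deriv_infty))

theorem deriv_reduced {s : ℝ} (hf : DifferentiableAt ℝ f s) (hv : DifferentiableAt ℝ v s)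
    (hv' : DifferentiableAt ℝ (deriv v) s) (m : ℕ) :
    deriv (fun r => (m + 1) * (f r * v r) + (r - s₀) * (f r * deriv v r)) s =
      (m + 1) * (deriv f s * v s + f s * deriv v s) + f s * deriv v s +
        (s - s₀) * (deriv f s * deriv v s + f s * deriv (deriv v) s) := by
  have h1 : HasDerivAt (fun r : ℝ => r - s₀) 1 s := (hasDerivAt_id s).sub_const s₀
  have h2 := (((hf.hasDerivAt.mul hv.hasDerivAt).const_mul ((m : ℝ) + 1)).add
    (h1.mul (hf.hasDerivAt.mul hv'.hasDerivAt))).deriv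
  refine h2.trans ?_
  simp only [Pi.mul_apply]
  ring

theorem derivIter_succ_pow_mul (hf : ContDiffAt ℝ ∞ f s₀) (hv : ContDiffAt ℝ ∞ v s₀) (m : ℕ) :
    derivIter f (m + 1) (fun r => (r - s₀) ^ m * v r) s₀ =
      m.factorial * f s₀ ^ m * ((m + 1) * f s₀ * deriv v s₀ + (m + 1) * m / 2 * deriv f s₀ * v s₀) := by
  induction m generalizing v with
  | zero => simp [derivIter]
  | succ m ih =>
    rw [derivIter_pow_mul_succ hv, ih (contDiffAt_reduced hf hv m),
      deriv_reduced hf.differentiableAt_near.self_of_nhds hv.differentiableAt_near.self_of_nhds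
        hv.deriv_infty.differentiableAt_near.self_of_nhds, Nat.factorial_succ]
    push_cast
    ring

/-- Two derivations more than the order of the zero bring in the second derivatives of `f` and `v`. -/
theorem derivIter_add_two_pow_mul (hf : ContDiffAt ℝ ∞ f s₀) (hv : ContDiffAt ℝ ∞ v s₀)
    (h0 : f s₀ = 1) (h1 : deriv f s₀ = 0) (m : ℕ) :
    derivIter f (m + 2) (fun r => (r - s₀) ^ m * v r) s₀ =
      m.factorial * ((m + 2) * (m + 1) / 2 * deriv (deriv v) s₀ +
        (m + 2) * (m + 1) * m / 6 * deriv (deriv f) s₀ * v s₀) := by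
  induction m generalizing v with
  | zero =>
    have h2 : deriv (fun s => f s * deriv v s) s₀ = deriv f s₀ * deriv v s₀ + f s₀ * deriv (deriv v) s₀ :=
      (hf.differentiableAt_near.self_of_nhds.hasDerivAt.mul
        hv.deriv_infty.differentiableAt_near.self_of_nhds.hasDerivAt).deriv
    simp [derivIter, h2, h0, h1]
  | succ m ih =>
    have h2 : deriv (fun r => (m + 1) * (f r * v r) + (r - s₀) * (f r * deriv v r)) =ᶠ[𝓝 s₀]
        fun s => (m + 1) * (deriv f s * v s + f s * deriv v s) + f s * deriv v s +
          (s - s₀) * (deriv f s * deriv v s + f s * deriv (deriv v) s) := by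
      filter_upwards [hf.differentiableAt_near, hv.differentiableAt_near,
        hv.deriv_infty.differentiableAt_near] with s a1 a2 a3
      exact deriv_reduced a1 a2 a3 m
    have hf0 := hf.differentiableAt_near.self_of_nhds.hasDerivAt
    have hf1 := hf.deriv_infty.differentiableAt_near.self_of_nhds.hasDerivAt
    have hv0 := hv.differentiableAt_near.self_of_nhds.hasDerivAt
    have hv1 := hv.deriv_infty.differentiableAt_near.self_of_nhds.hasDerivAt
    have hv2 := hv.deriv_infty.deriv_infty.differentiableAt_near.self_of_nhds.hasDerivAt
    have h3 : deriv (deriv (fun r => (m + 1) * (f r * v r) + (r - s₀) * (f r * deriv v r))) s₀ =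
        (m + 1) * (deriv (deriv f) s₀ * v s₀ + deriv (deriv v) s₀) + 2 * deriv (deriv v) s₀ := by
      rw [h2.deriv_eq]
      have h4 : HasDerivAt (fun r : ℝ => r - s₀) 1 s₀ := (hasDerivAt_id s₀).sub_const s₀
      have h5 := (((((hf1.mul hv0).add (hf0.mul hv1)).const_mul ((m : ℝ) + 1)).add (hf0.mul hv1)).add
        (h4.mul ((hf1.mul hv1).add (hf0.mul hv2)))).deriv
      refine h5.trans ?_
      simp [h0, h1]
      ring
    rw [derivIter_pow_mul_succ hv (n := m + 2), ih (contDiffAt_reduced hf hv m), h3, Nat.factorial_succ, h0]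
    push_cast
    ring

/-- The conditions on `g` and `f` which say that the rescaling of a projective vector field by `f`
and of a normal vector field by `g` is again projective and normal determine the second
derivative of `f` and the derivative of `g`. -/
theorem deriv_eq_zero_of_projective {g : ℝ → ℝ} {k : ℕ} (hk : 1 ≤ k)
    (hf : ∀ᶠ s in 𝓝 s₀, ContDiffAt ℝ ∞ f s) (hg : ∀ᶠ s in 𝓝 s₀, ContDiffAt ℝ ∞ g s)
    (hf0 : f s₀ = 1) (hf1 : deriv f s₀ = 0) (hg0 : g s₀ = 1)
    (h1 : ∀ᶠ s₁ in 𝓝 s₀, derivIter f (k + 1) (fun s => (s - s₁) ^ k * g s) s₁ = 0)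
    (h2 : derivIter f (k + 1) (fun s => (s - s₀) ^ (k - 1) * g s) s₀ = 0) :
    deriv g s₀ = 0 ∧ deriv (deriv f) s₀ = 0 := by
  have hfs := hf.self_of_nhds
  have hgs := hg.self_of_nhds
  have hkk : (0 : ℝ) < k + 1 := by positivity
  have h3 : (fun s => f s * deriv g s + k / 2 * (deriv f s * g s)) =ᶠ[𝓝 s₀] fun _ => 0 := by
    filter_upwards [hf, hg, h1, hfs.continuousAt.eventually_ne (by rw [hf0]; exact one_ne_zero : f s₀ ≠ 0)]
      with s a1 a2 a3 a4
    rw [derivIter_succ_pow_mul a1 a2] at a3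
    have := (mul_eq_zero.1 a3).resolve_left
      (mul_ne_zero (Nat.cast_ne_zero.2 (Nat.factorial_ne_zero k)) (pow_ne_zero _ a4))
    have h5 : ((k : ℝ) + 1) * (f s * deriv g s + k / 2 * (deriv f s * g s)) = 0 := by
      linear_combination this
    exact (mul_eq_zero.1 h5).resolve_left hkk.ne'
  have h4 := h3.self_of_nhds
  have hg' : deriv g s₀ = 0 := by simpa [hf0, hf1] using h4
  have h5 := h3.deriv_eq
  have e := ((hfs.differentiableAt_near.self_of_nhds.hasDerivAt.mul
    hgs.deriv_infty.differentiableAt_near.self_of_nhds.hasDerivAt).add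
    ((hfs.deriv_infty.differentiableAt_near.self_of_nhds.hasDerivAt.mul
    hgs.differentiableAt_near.self_of_nhds.hasDerivAt).const_mul ((k : ℝ) / 2))).deriv
  rw [deriv_const] at h5
  have h6 := e.symm.trans h5
  simp only [hf0, hf1, hg0, hg'] at h6
  obtain ⟨m, rfl⟩ : ∃ m, k = m + 1 := ⟨k - 1, by omega⟩
  rw [Nat.add_sub_cancel, derivIter_add_two_pow_mul hfs hgs hf0 hf1] at h2
  have h7 := (mul_eq_zero.1 h2).resolve_left (Nat.cast_ne_zero.2 (Nat.factorial_ne_zero m))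
  rw [hg0] at h7
  refine ⟨hg', ?_⟩
  push_cast at h6
  have h8 : deriv (deriv g) s₀ = -((m + 1) / 2 * deriv (deriv f) s₀) := by linear_combination h6
  rw [h8] at h7
  have h9 : ((m : ℝ) + 2) * (m + 1) * (m + 3) * deriv (deriv f) s₀ = 0 := by
    linear_combination -12 * h7
  have : (0 : ℝ) < ((m : ℝ) + 2) * (m + 1) * (m + 3) := by positivity
  exact (mul_eq_zero.1 h9).resolve_left this.ne'

end Scalar

/-! ### Charts of a coordinate atlas -/

namespace CoordAtlas

variable {H : Type*} [NormedAddCommGroup H] [NormedSpace ℝ H] {Z : Type*} (A : CoordAtlas H Z)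

/-- The chart of the manifold defined by a coordinate map. -/
def openChart (i : A.Idx) (z : Z) : @OpenPartialHomeomorph Z H A.core.toTopologicalSpace _ :=
  A.core.openPartialHomeomorph (A.chart i z) ⟨i, z, rfl⟩

theorem openChart_mem_atlas (i : A.Idx) (z : Z) :
    A.openChart i z ∈ @atlas H _ Z A.core.toTopologicalSpace A.core.toChartedSpace := by
  change _ ∈ ⋃ (e : PartialEquiv Z H) (he : e ∈ A.core.atlas), {A.core.openPartialHomeomorph e he}
  simp only [mem_iUnion, mem_singleton_iff]
  exact ⟨A.chart i z, ⟨i, z, rfl⟩, rfl⟩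

end CoordAtlas

section Osculating

/-! ### Osculating spaces of the rational normal curve -/

variable {k : ℕ}

theorem opX_flX (t : ℝ) (a : BForm k) : opX k (flX k t a) = flX k t (opX k a) := by
  have : (opX k).comp (flX k t) = (flX k t).comp (opX k) := clm_ext_linearPower fun r => by
    have h1 := (flX k t).hasFDerivAt.comp_hasDerivAt r (hasDerivAt_linearPower (k := k) r)
    have h2 : HasDerivAt (fun s : ℝ => s + t) 1 r := (hasDerivAt_id r).add_const t
    have h3 := HasDerivAt.scomp r (g₁ := fun s => linearPower k 1 s) (h := fun s : ℝ => s + t)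
      (hasDerivAt_linearPower (k := k) (r + t)) h2
    rw [one_smul] at h3
    have h4 := h1.unique (h3.congr_of_eventuallyEq (.of_forall fun s => by
      simp only [Function.comp, flX, linearSubst_linearPower]
      congr 1 <;> ring))
    rw [comp_apply, comp_apply, h4]
    congr 1
    simp only [flX, linearSubst_linearPower]
    congr 1 <;> ring
  exact congrArg (fun L : End[k] => L a) this

theorem flX_form₀ (t : ℝ) : flX k t (form₀ k) = linearPower k 1 t := by
  simp only [flX, form₀, linearSubst_linearPower]
  congr 1 <;> ring

theorem flX_flX (s t : ℝ) (a : BForm k) : flX k s (flX k t a) = flX k (t + s) a := by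
  have h := linearSubst_comp (k := k) 1 s 0 1 1 t 0 1
  have h2 := congrArg (fun L : End[k] => L a) h
  refine h2.trans ?_
  simp only [flX]
  ring_nf

/-- The `j`-th derivative of the curve of powers of linear forms. -/
def powerDeriv (k j : ℕ) (t : ℝ) : BForm k := flX k t (ladder k j)

theorem powerDeriv_zero (t : ℝ) : powerDeriv k 0 t = linearPower k 1 t := by
  rw [powerDeriv, ladder_zero, flX_form₀]

theorem opX_powerDeriv (j : ℕ) (t : ℝ) : opX k (powerDeriv k j t) = powerDeriv k (j + 1) t := by
  rw [powerDeriv, opX_flX, opX_ladder, powerDeriv]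

theorem hasDerivAt_powerDeriv (j : ℕ) (t : ℝ) :
    HasDerivAt (powerDeriv k j) (powerDeriv k (j + 1) t) t := by
  have h1 := (hasDerivAt_flX (k := k)).clm_apply (hasDerivAt_const (0 : ℝ) (powerDeriv k j t))
  rw [map_zero, add_zero, opX_powerDeriv] at h1
  have h2 : HasDerivAt (fun s : ℝ => s - t) 1 t := (hasDerivAt_id t).sub_const t
  have h3 := HasDerivAt.scomp t (g₁ := fun s => flX k s (powerDeriv k j t)) (h := fun s : ℝ => s - t)
    (by simpa only [sub_self] using h1) h2
  rw [one_smul] at h3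
  refine h3.congr_of_eventuallyEq (.of_forall fun s => ?_)
  simp only [Function.comp, powerDeriv, flX_flX]
  congr 2; ring

theorem powerDeriv_eq_zero {j : ℕ} (h : k < j) (t : ℝ) : powerDeriv k j t = 0 := by
  rw [powerDeriv, ladder_eq_zero h, map_zero]

theorem contDiff_linearPower : ContDiff ℝ ∞ (fun t => linearPower k 1 t) := by
  rw [contDiff_pi]
  intro i
  simp only [linearPower]
  fun_prop

/-- The osculating spaces of the rational normal curve. -/
def oscSpace (k : ℕ) (t : ℝ) (i : ℕ) : Submodule ℝ (BForm k) :=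
  Submodule.span ℝ ((fun j => powerDeriv k j t) '' Set.Iic i)

theorem powerDeriv_mem {i j : ℕ} (h : j ≤ i) (t : ℝ) : powerDeriv k j t ∈ oscSpace k t i :=
  Submodule.subset_span ⟨j, h, rfl⟩

theorem oscSpace_mono {i j : ℕ} (h : i ≤ j) (t : ℝ) : oscSpace k t i ≤ oscSpace k t j :=
  Submodule.span_mono (image_mono (Iic_subset_Iic.2 h))

theorem oscSpace_zero (t : ℝ) : oscSpace k t 0 = ℝ ∙ linearPower k 1 t := by
  have : (Set.Iic 0 : Set ℕ) = {0} := by ext; simp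
  rw [oscSpace, this, image_singleton, powerDeriv_zero]

theorem opX_mem_oscSpace {i : ℕ} {t : ℝ} {a : BForm k} (h : a ∈ oscSpace k t i) :
    opX k a ∈ oscSpace k t (i + 1) := by
  induction h using Submodule.span_induction with
  | mem x hx =>
    obtain ⟨j, hj, rfl⟩ := hx
    change opX k (powerDeriv k j t) ∈ _
    rw [opX_powerDeriv]
    exact powerDeriv_mem (Nat.succ_le_succ hj) t
  | zero => rw [map_zero]; exact Submodule.zero_mem _
  | add x y _ _ hx hy => rw [map_add]; exact Submodule.add_mem _ hx hy
  | smul c x _ hx => rw [map_smul]; exact Submodule.smul_mem _ _ hx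

theorem flX_mem_oscSpace {i : ℕ} {s t : ℝ} {a : BForm k} (h : a ∈ oscSpace k t i) :
    flX k s a ∈ oscSpace k (t + s) i := by
  induction h using Submodule.span_induction with
  | mem x hx =>
    obtain ⟨j, hj, rfl⟩ := hx
    change flX k s (powerDeriv k j t) ∈ _
    rw [powerDeriv, flX_flX]
    exact powerDeriv_mem hj _
  | zero => rw [map_zero]; exact Submodule.zero_mem _
  | add x y _ _ hx hy => rw [map_add]; exact Submodule.add_mem _ hx hy
  | smul c x _ hx => rw [map_smul]; exact Submodule.smul_mem _ _ hx

theorem linearIndependent_powerDeriv (t : ℝ) :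
    LinearIndependent ℝ (fun i : Fin (k + 1) => powerDeriv k i t) :=
  linearIndependent_ladder.map' (flX k t).toLinearMap
    (LinearMap.ker_eq_bot.2 (isGL2_flX t).bijective.1)

theorem finrank_oscSpace {i : ℕ} (h : i ≤ k) (t : ℝ) : Module.finrank ℝ (oscSpace k t i) = i + 1 := by
  have h1 : LinearIndependent ℝ (fun j : Fin (i + 1) => powerDeriv k j t) :=
    (linearIndependent_powerDeriv t).comp (Fin.castLE (Nat.succ_le_succ h)) (Fin.castLE_injective _)
  have h2 : ((fun j => powerDeriv k j t) '' Set.Iic i) = range fun j : Fin (i + 1) => powerDeriv k j t := by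
    ext a
    constructor
    · rintro ⟨j, hj, rfl⟩
      exact ⟨⟨j, Nat.lt_succ_of_le hj⟩, rfl⟩
    · rintro ⟨j, rfl⟩
      exact ⟨j, Nat.lt_succ_iff.1 j.2, rfl⟩
  rw [oscSpace, h2, finrank_span_eq_card h1, Fintype.card_fin]

theorem oscSpace_top (t : ℝ) : oscSpace k t k = ⊤ :=
  Submodule.eq_top_of_finrank_eq (by rw [finrank_oscSpace le_rfl]; simp)

/-- A curve of forms which stays in the moving osculating space of order `i` has its velocity in the
one of order `i + 1`. -/
theorem deriv_mem_oscSpace {i : ℕ} {t : ℝ} {a : ℝ → BForm k} {a' : BForm k}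
    (ha : ∀ᶠ s in 𝓝 (0 : ℝ), a s ∈ oscSpace k (t + s) i) (h : HasDerivAt a a' 0) :
    a' ∈ oscSpace k t (i + 1) := by
  have h1 : HasDerivAt (fun s => flX k (-s)) (-opX k) 0 := by
    have h2 := HasDerivAt.scomp (0 : ℝ) (g₁ := flX k) (h := fun s : ℝ => -s)
      (by simpa only [neg_zero] using hasDerivAt_flX) (hasDerivAt_neg (0 : ℝ))
    rw [neg_one_smul] at h2
    exact h2
  have h2 := h1.clm_apply h
  simp only [neg_zero, flX_zero, id_apply, neg_apply] at h2
  have h0 : a 0 ∈ oscSpace k t i := by simpa using ha.self_of_nhds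
  have h3 : -(opX k) (a 0) + a' ∈ oscSpace k t i := by
    by_contra hne
    obtain ⟨f, hf, hf'⟩ := Submodule.exists_le_ker_of_notMem hne
    have h4 := (LinearMap.toContinuousLinearMap f).hasFDerivAt.comp_hasDerivAt (0 : ℝ) h2
    have h5 : HasDerivAt (fun _ : ℝ => (0 : ℝ)) (f (-(opX k) (a 0) + a')) 0 := by
      refine h4.congr_of_eventuallyEq ?_
      filter_upwards [ha] with s hs
      have := flX_mem_oscSpace (s := -s) hs
      rw [add_neg_cancel_right] at this
      exact (LinearMap.mem_ker.1 (hf' this)).symm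
    exact hf (h5.unique (hasDerivAt_const _ _))
  have h4 := Submodule.add_mem _ (oscSpace_mono (Nat.le_succ i) t h3) (opX_mem_oscSpace h0)
  simpa using h4

theorem derivIter_pow_mul_of_lt {f : ℝ → ℝ} {s₀ : ℝ} (hf : ContDiffAt ℝ ∞ f s₀) {j : ℕ} :
    ∀ {v : ℝ → ℝ}, ContDiffAt ℝ ∞ v s₀ → ∀ {i : ℕ}, i < j →
      derivIter f i (fun s => (s - s₀) ^ j * v s) s₀ = 0 := by
  induction j with
  | zero => intro v _ i h; exact absurd h (Nat.not_lt_zero _)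
  | succ j ih =>
    intro v hv i h
    cases i with
    | zero => simp [derivIter]
    | succ i =>
      rw [derivIter_pow_mul_succ hv]
      exact ih (contDiffAt_reduced hf hv j) (Nat.lt_of_succ_lt_succ h)

/-- The linear functional which takes the value `(t - t₁) ^ j` at `(x + t y) ^ k`. -/
theorem exists_powerFunctional {j : ℕ} (hj : j ≤ k) (t₁ : ℝ) :
    ∃ L : BForm k →L[ℝ] ℝ, ∀ t, L (linearPower k 1 t) = (t - t₁) ^ j := by
  refine ⟨(k.choose j : ℝ)⁻¹ • (formCoeff k j).comp (flX k (-t₁)), fun t => ?_⟩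
  have hc : (k.choose j : ℝ) ≠ 0 := by exact_mod_cast (Nat.choose_pos hj).ne'
  rw [smul_apply, comp_apply, flX, linearSubst_linearPower, formCoeff_linearPower _ _ _ hj]
  simp only [smul_eq_mul]
  rw [show (1 : ℝ) * 1 + t * 0 = 1 by ring, show (1 : ℝ) * -t₁ + t * 1 = t - t₁ by ring, one_pow,
    mul_one, inv_mul_cancel_left₀ hc]

end Osculating

/-- The effect of a substitution on the coordinates of the structure group. -/
theorem smul_linearSubst_comp_coordOp {k : ℕ} {c a b d e t y x₀ x₁ : ℝ} (hD : a + t * d ≠ 0) :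
    (c • linearSubst k a b d e).comp (coordOp k (t, y, x₀, x₁)) =
      coordOp k ((b + t * e) / (a + t * d), y * (c * (a + t * d) ^ k),
        x₀ * ((a * e - b * d) / (a + t * d) ^ 2), x₁ + x₀ * (-2 * d / (a + t * d))) :=
  clm_ext_linearPower fun r => by
    rw [comp_apply, coordOp_linearPower, coordOp_linearPower, map_smul,
      smul_apply, linearSubst_linearPower, smul_smul]
    simp only
    rw [← mul_assoc, mul_smul (y * c), ← linearPower_smul]
    congr 2 <;> field_simp <;> ring

namespace GL2Structure

variable {k : ℕ} [NeZero k] {N : Type*} [TopologicalSpace N]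
  [ChartedSpace (EuclideanSpace ℝ (Fin (k + 1))) N] [IsManifold (𝓡 (k + 1)) ∞ N]
  {S : GL2Structure k N}
  {N' : Type*} [TopologicalSpace N']
  [ChartedSpace (EuclideanSpace ℝ (Fin (k + 1))) N'] [IsManifold (𝓡 (k + 1)) ∞ N']
  {S' : GL2Structure k N'}

local notation "HN" => (EuclideanSpace ℝ (Fin (k + 1)))
local notation "HE" => (BundleModel k)
local notation "idV" => (ContinuousLinearMap.id ℝ (BForm k))

/-- Fields of linear maps from binary forms to the tangent spaces. -/
abbrev FrameField (k : ℕ) (N : Type*) [TopologicalSpace N]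
    [ChartedSpace (EuclideanSpace ℝ (Fin (k + 1))) N] : Type _ :=
  ∀ y : N, BForm k →L[ℝ] TangentSpace (𝓡 (k + 1)) y

theorem IsLocalSection.smoothFrameNear {σ : FrameField k N} {x : N} (h : S.IsLocalSection σ x) :
    SmoothFrameNear σ x := h.mono fun _ hy => ⟨S.bijective _ _ hy.1, hy.2⟩

theorem IsLocalSection.mem {σ : FrameField k N} {x : N} (h : S.IsLocalSection σ x) :
    σ x ∈ S.frames x := h.self_of_nhds.1

theorem IsLocalSection.near {σ : FrameField k N} {x : N} (h : S.IsLocalSection σ x) :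
    ∀ᶠ y in 𝓝 x, S.IsLocalSection σ y := h.eventually_nhds

theorem mem_frames_iff_isGL2 {x : N} {σ σ' : BForm k →L[ℝ] T[HN] x}
    (h : σ ∈ S.frames x) : σ' ∈ S.frames x ↔ ∃ B, IsGL2 B ∧ σ' = σ.comp B := by
  rw [S.mem_frames_iff x σ h]
  constructor
  · rintro ⟨c, hc, g, A, hA, rfl⟩
    exact ⟨c • A, ⟨c, hc, g, A, hA, rfl⟩, (comp_smul _ _ _).symm⟩
  · rintro ⟨_, ⟨c, hc, g, A, hA, rfl⟩, rfl⟩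
    exact ⟨c, hc, g, A, hA, comp_smul _ _ _⟩

theorem comp_mem_frames {x : N} {σ : BForm k →L[ℝ] T[HN] x}
    (h : σ ∈ S.frames x) {B : End[k]} (hB : IsGL2 B) : σ.comp B ∈ S.frames x :=
  (mem_frames_iff_isGL2 h).2 ⟨B, hB, rfl⟩

theorem IsLocalSection.comp {σ : FrameField k N} {x : N} (h : S.IsLocalSection σ x)
    {B : End[k]} (hB : IsGL2 B) : S.IsLocalSection (fun y => (σ y).comp B) x :=
  h.mono fun _ hy => ⟨comp_mem_frames hy.1 hB, fun a => hy.2 (B a)⟩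

namespace CurveBundle

/-- The indices of the charts of the bundle of rational normal curves. -/
abbrev BaseChart (N : Type*) (k : ℕ) [TopologicalSpace N]
    [ChartedSpace (EuclideanSpace ℝ (Fin (k + 1))) N] : Type _ :=
  {ψ : OpenPartialHomeomorph N (EuclideanSpace ℝ (Fin (k + 1))) // ψ ∈ atlas _ N}

variable (ψ : BaseChart N k) (σ : FrameField k N) (m₀ : S.CurveBundle)

/-- The chart of the bundle of rational normal curves which is defined by a chart of the base and a
local section of the frame bundle. -/
def lineChart : OpenPartialHomeomorph S.CurveBundle (HN × ℝ) := (coordAtlas S).openChart (ψ, σ) m₀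

theorem smoothChart_lineChart : SmoothChart (lineChart ψ σ m₀) :=
  smoothChart_of_mem_atlas ((coordAtlas S).openChart_mem_atlas (ψ, σ) m₀)

/-- The line of the rational normal curve at `x` with given affine coordinate. -/
def affinePoint {x : N} (τ : BForm k →L[ℝ] T[HN] x) (h : τ ∈ S.frames x) (t : ℝ) :
    S.CurveBundle :=
  ⟨x, ℝ ∙ τ (linearPower k 1 t), τ, h, 1, t, Or.inl one_ne_zero, rfl⟩

variable {ψ σ m₀}

theorem isAffineCoord_affinePoint {x : N} (h : σ x ∈ S.frames x) (t : ℝ) :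
    IsAffineCoord σ (affinePoint (σ x) h t) t := rfl

theorem lineChart_apply {m : S.CurveBundle} (hσ : S.IsLocalSection σ m.base) {t : ℝ}
    (h : IsAffineCoord σ m t) : lineChart ψ σ m₀ m = (ψ.1 m.base, t) :=
  coords_eq hσ.mem h

theorem isAffineCoord_lineChart {m : S.CurveBundle} (hm : m ∈ (lineChart ψ σ m₀).source) :
    IsAffineCoord σ m (lineChart ψ σ m₀ m).2 := by
  obtain ⟨h1, h2, t, h3⟩ := hm
  rw [lineChart_apply h2 h3]
  exact h3

theorem lineChart_fst (m : S.CurveBundle) : (lineChart ψ σ m₀ m).1 = ψ.1 m.base := rfl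

theorem mem_lineChart_target {u : HN} {t : ℝ} (hu : u ∈ ψ.1.target)
    (h : S.IsLocalSection σ (ψ.1.symm u)) : (u, t) ∈ (lineChart ψ σ m₀).target ∧
      (lineChart ψ σ m₀).symm (u, t) = affinePoint (σ (ψ.1.symm u)) h.mem t := by
  have h1 : affinePoint (σ (ψ.1.symm u)) h.mem t ∈ (lineChart ψ σ m₀).source :=
    ⟨ψ.1.map_target hu, h, t, rfl⟩
  have h2 : lineChart ψ σ m₀ (affinePoint (σ (ψ.1.symm u)) h.mem t) = (u, t) := by
    refine (lineChart_apply (m := affinePoint (σ (ψ.1.symm u)) h.mem t) h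
      (isAffineCoord_affinePoint h.mem t)).trans ?_
    exact Prod.ext (ψ.1.right_inv hu) rfl
  constructor
  · rw [← h2]; exact (lineChart ψ σ m₀).map_source h1
  · rw [← h2]; exact (lineChart ψ σ m₀).left_inv h1

theorem smoothNear_base (m : S.CurveBundle) :
    Smooth[HN × ℝ, HN] (base : S.CurveBundle → N) m := by
  obtain ⟨σ, h⟩ := exists_mem_coordSource m
  let ψ : BaseChart N k := ⟨chartAt _ m.base, chart_mem_atlas _ _⟩
  have hm : m ∈ (lineChart ψ σ m).source := h
  have h1 := (smoothChart_lineChart ψ σ m).smoothNear hm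
  have h2 : Smooth[HN × ℝ, HN] (fun m => (lineChart ψ σ m m).1) m := h1.clm (fst ℝ _ _)
  have h3 : Smooth[HN, HN]
      ψ.1.symm (ψ.1 m.base) :=
    (smoothChart_of_mem_atlas ψ.2).smoothNear_symm (ψ.1.map_source h.1)
  refine (SmoothNear.comp_map (f := ψ.1.symm) (π := fun m => (lineChart ψ σ m m).1) h3 h2).congr ?_
  filter_upwards [(lineChart ψ σ m).open_source.mem_nhds hm] with m' hm'
  exact (ψ.1.left_inv hm'.1).symm

theorem tderiv_lineChart_fst {m : S.CurveBundle} (hm : m ∈ (lineChart ψ σ m₀).source)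
    (w : T[HN × ℝ] m) :
    (tderiv (lineChart ψ σ m₀) m w).1 = tderiv ψ.1 m.base (m.dproj w) := by
  have h1 := ((smoothChart_lineChart ψ σ m₀).smoothNear hm).mdiff
  have h2 := ((smoothChart_of_mem_atlas ψ.2).smoothNear hm.1).mdiff
  exact (tderiv_clm (fst ℝ _ _) h1 w).symm.trans (tderiv_comp h2 (smoothNear_base m).mdiff w)

theorem dproj_eq_iff {m : S.CurveBundle} (hm : m ∈ (lineChart ψ σ m₀).source)
    (w : T[HN × ℝ] m)
    (v : T[HN] m.base) :
    m.dproj w = v ↔ (tderiv (lineChart ψ σ m₀) m w).1 = tderiv ψ.1 m.base v := by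
  rw [tderiv_lineChart_fst hm]
  exact ⟨fun h => congrArg _ h, fun h => (smoothChart_of_mem_atlas ψ.2).tderiv_injective hm.1 h⟩

variable (S ψ σ m₀)

/-- The vertical coordinate vector field `∂/∂t`. -/
def vertField : VField (HN × ℝ) S.CurveBundle := chartField (lineChart ψ σ m₀) fun _ => (0, 1)

/-- The lift of the tautological vector field `σ((1 + t)^k)` which is horizontal in coordinates. -/
def tautField : VField (HN × ℝ) S.CurveBundle :=
  chartField (lineChart ψ σ m₀) fun m =>
    (tderiv ψ.1 m.base (σ m.base (linearPower k 1 (lineChart ψ σ m₀ m).2)), 0)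

variable {S ψ σ m₀}

variable {m : S.CurveBundle} (hm : m ∈ (lineChart ψ σ m₀).source)

include hm

theorem tderiv_vertField : tderiv (lineChart ψ σ m₀) m (vertField S ψ σ m₀ m) = (0, 1) :=
  (smoothChart_lineChart ψ σ m₀).tderiv_chartField hm _

theorem tderiv_tautField : tderiv (lineChart ψ σ m₀) m (tautField S ψ σ m₀ m) =
    (tderiv ψ.1 m.base (σ m.base (linearPower k 1 (lineChart ψ σ m₀ m).2)), 0) :=
  (smoothChart_lineChart ψ σ m₀).tderiv_chartField hm _

theorem dproj_vertField : m.dproj (vertField S ψ σ m₀ m) = 0 := by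
  rw [dproj_eq_iff hm, tderiv_vertField hm, tderiv_vzero]

theorem dproj_tautField : m.dproj (tautField S ψ σ m₀ m) =
    σ m.base (linearPower k 1 (lineChart ψ σ m₀ m).2) := by
  rw [dproj_eq_iff hm, tderiv_tautField hm]

theorem near_lineChart : ∀ᶠ m' in 𝓝 m, m' ∈ (lineChart ψ σ m₀).source :=
  (lineChart ψ σ m₀).open_source.mem_nhds hm

theorem smoothFieldNear_vertField : SmoothFieldNear (vertField S ψ σ m₀) m :=
  (smoothChart_lineChart ψ σ m₀).smoothFieldNear_chartField hm (smoothNear_const _)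

theorem smoothNear_affineCoord : Smooth[HN × ℝ, ℝ]
    (fun m => (lineChart ψ σ m₀ m).2) m :=
  ((smoothChart_lineChart ψ σ m₀).smoothNear hm).clm (snd ℝ _ _)

theorem tderiv_affineCoord (w : T[HN × ℝ] m) :
    tderiv (fun m => (lineChart ψ σ m₀ m).2) m w = (tderiv (lineChart ψ σ m₀) m w).2 :=
  tderiv_clm (snd ℝ _ _) ((smoothChart_lineChart ψ σ m₀).smoothNear hm).mdiff w

theorem smoothFieldNear_tautField : SmoothFieldNear (tautField S ψ σ m₀) m := by
  refine (smoothChart_lineChart ψ σ m₀).smoothFieldNear_chartField hm (SmoothNear.prodMk ?_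
    (smoothNear_const _))
  have hl : Smooth[HN × ℝ, BForm k]
      (fun m => linearPower k 1 (lineChart ψ σ m₀ m).2) m :=
    SmoothNear.comp_space (.of_forall fun t => (contDiff_linearPower (k := k)).contDiffAt)
      (smoothNear_affineCoord hm)
  have hA : Smooth[HN, BForm k →L[ℝ] HN]
      (fun y : N => (d[HN, HN] ψ.1 y).comp (σ y)) m.base :=
    smoothNear_clm_of_apply fun a =>
      ((smoothChart_of_mem_atlas ψ.2).smoothNear hm.1).tderiv (hm.2.1.smoothFrameNear.smoothField a)
  exact (SmoothNear.comp_map hA (smoothNear_base m)).clm_apply hl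

theorem eq_smul_vertField {w : T[HN × ℝ] m}
    (hw : m.dproj w = 0) : w = tderiv (fun m => (lineChart ψ σ m₀ m).2) m w • vertField S ψ σ m₀ m := by
  refine (smoothChart_lineChart ψ σ m₀).tderiv_injective hm ?_
  rw [tderiv_vsmul, tderiv_vertField hm, tderiv_affineCoord hm]
  refine Prod.ext ?_ ?_
  · rw [(dproj_eq_iff hm w 0).1 hw, tderiv_vzero]
    simp
  · simp

theorem line_pair_eq : S.pair.line m = ℝ ∙ vertField S ψ σ m₀ m := by
  ext w
  rw [Submodule.mem_span_singleton]
  constructor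
  · intro hw
    exact ⟨_, (eq_smul_vertField hm (LinearMap.mem_ker.1 hw)).symm⟩
  · rintro ⟨c, rfl⟩
    refine LinearMap.mem_ker.2 ?_
    change m.dproj (c • _) = 0
    rw [map_smul, dproj_vertField hm, smul_zero]

theorem plane_pair_eq : S.pair.plane m =
    Submodule.span ℝ {vertField S ψ σ m₀ m, tautField S ψ σ m₀ m} := by
  ext w
  rw [Submodule.mem_span_pair]
  constructor
  · intro hw
    have hw' : m.dproj w ∈ m.line := hw
    rw [isAffineCoord_lineChart hm, Submodule.mem_span_singleton] at hw'
    obtain ⟨c, hc⟩ := hw'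
    have h1 : m.dproj (w - c • tautField S ψ σ m₀ m) = 0 := by
      rw [map_sub, map_smul, dproj_tautField hm, hc, sub_self]
    exact ⟨_, c, by rw [← eq_smul_vertField hm h1]; abel⟩
  · rintro ⟨a, b, rfl⟩
    change m.dproj (a • _ + b • _) ∈ m.line
    rw [map_add, map_smul, map_smul, dproj_vertField hm, dproj_tautField hm, smul_zero, zero_add]
    rw [isAffineCoord_lineChart hm]
    exact Submodule.smul_mem _ _ (Submodule.mem_span_singleton_self _)

theorem isFrameAt : S.pair.IsFrameAt (vertField S ψ σ m₀) (tautField S ψ σ m₀) m where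
  smooth_fst := (smoothFieldNear_vertField hm).self_of_nhds
  smooth_snd := (smoothFieldNear_tautField hm).self_of_nhds
  indep := by
    rw [LinearIndependent.pair_iff]
    intro a b hab
    have h1 := congrArg (tderiv (lineChart ψ σ m₀) m) hab
    rw [tderiv_vadd, tderiv_vsmul, tderiv_vsmul, tderiv_vzero, tderiv_vertField hm] at h1
    have h2 := congrArg m.dproj hab
    rw [map_add, map_smul, map_smul, dproj_vertField hm, dproj_tautField hm, smul_zero, zero_add,
      map_zero, ← map_smul] at h2
    have h3 : b • linearPower k 1 (lineChart ψ σ m₀ m).2 = 0 :=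
      (S.bijective _ _ hm.2.1.mem).1 (h2.trans (map_zero _).symm)
    have hb : b = 0 := by
      have := congrFun h3 0
      rw [Pi.smul_apply, linearPower_zero] at this
      simpa using this
    rw [hb, zero_smul, add_zero] at h1
    exact ⟨by simpa using congrArg Prod.snd h1, hb⟩
  line_eq := line_pair_eq hm
  plane_eq := plane_pair_eq hm

theorem isFrameNear : S.pair.IsFrameNear (vertField S ψ σ m₀) (tautField S ψ σ m₀) m :=
  (near_lineChart hm).mono fun _ h => isFrameAt h

end CurveBundle

namespace CurveBundle

/-! ### Regularity of the associated pair -/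

variable {ψ : BaseChart N k} {σ : FrameField k N} {m₀ m : S.CurveBundle}

/-- The curve through `m` in the fibre, parametrized by the affine coordinate. -/
def vertCurve (ψ : BaseChart N k) (σ : FrameField k N) (m₀ m : S.CurveBundle) (s : ℝ) :
    S.CurveBundle :=
  (lineChart ψ σ m₀).symm ((lineChart ψ σ m₀ m).1, (lineChart ψ σ m₀ m).2 + s)

variable (hm : m ∈ (lineChart ψ σ m₀).source)

include hm

theorem vertCurve_spec (s : ℝ) : vertCurve ψ σ m₀ m s ∈ (lineChart ψ σ m₀).source ∧
    lineChart ψ σ m₀ (vertCurve ψ σ m₀ m s) = ((lineChart ψ σ m₀ m).1, (lineChart ψ σ m₀ m).2 + s) ∧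
    (vertCurve ψ σ m₀ m s).base = m.base := by
  have h0 : ψ.1.symm (ψ.1 m.base) = m.base := ψ.1.left_inv hm.1
  have h1 : S.IsLocalSection σ (ψ.1.symm (ψ.1 m.base)) := by rw [h0]; exact hm.2.1
  obtain ⟨h2, h3⟩ := mem_lineChart_target (m₀ := m₀) (t := (lineChart ψ σ m₀ m).2 + s)
    (ψ.1.map_source hm.1) h1
  refine ⟨(lineChart ψ σ m₀).map_target h2, (lineChart ψ σ m₀).right_inv h2, ?_⟩
  have h4 := congrArg base h3
  exact h4.trans h0

theorem vertCurve_zero : vertCurve ψ σ m₀ m 0 = m := by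
  rw [vertCurve, add_zero]
  exact (lineChart ψ σ m₀).left_inv hm

theorem smoothNear_vertCurve (s : ℝ) :
    Smooth[ℝ, HN × ℝ] (vertCurve ψ σ m₀ m) s := by
  have h1 := vertCurve_spec hm s
  have h2 : Smooth[ℝ, HN × ℝ]
      (fun s : ℝ => ((lineChart ψ σ m₀ m).1, (lineChart ψ σ m₀ m).2 + s)) s :=
    .of_forall fun r => ContDiffAt.contMDiffAt (by fun_prop)
  refine SmoothNear.comp_map (f := (lineChart ψ σ m₀).symm) ?_ h2
  refine (smoothChart_lineChart ψ σ m₀).smoothNear_symm ?_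
  rw [← h1.2.1]
  exact (lineChart ψ σ m₀).map_source h1.1

theorem hasDerivAt_comp_vertCurve {F : Type*} [NormedAddCommGroup F] [NormedSpace ℝ F]
    {f : S.CurveBundle → F} {s : ℝ}
    (hf : MDAt[HN × ℝ, F] f (vertCurve ψ σ m₀ m s)) :
    HasDerivAt (fun r => f (vertCurve ψ σ m₀ m r))
      (tderiv f (vertCurve ψ σ m₀ m s) (vertField S ψ σ m₀ (vertCurve ψ σ m₀ m s))) s := by
  have hγ := (smoothNear_vertCurve hm s).mdiff
  have hs := (vertCurve_spec hm s).1
  have h1 := hasDerivAt_comp_curve ((smoothChart_lineChart ψ σ m₀).smoothNear hs).mdiff hγ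
  have h2 : HasDerivAt (fun r => lineChart ψ σ m₀ (vertCurve ψ σ m₀ m r)) (0, 1) s := by
    have h3 : HasDerivAt (fun r : ℝ => ((lineChart ψ σ m₀ m).1, (lineChart ψ σ m₀ m).2 + r)) (0, 1) s :=
      (hasDerivAt_const s _).prodMk ((hasDerivAt_id s).const_add _)
    exact h3.congr_of_eventuallyEq (.of_forall fun r => (vertCurve_spec hm r).2.1)
  have h4 : d[ℝ, HN × ℝ] (vertCurve ψ σ m₀ m) s (1 : ℝ) =
      vertField S ψ σ m₀ (vertCurve ψ σ m₀ m s) :=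
    (smoothChart_lineChart ψ σ m₀).tderiv_injective hs
      ((h1.unique h2).trans (tderiv_vertField hs).symm)
  exact (hasDerivAt_comp_curve hf hγ).congr_deriv (congrArg _ h4)

theorem fieldDeriv_iterate_powerDeriv (i : ℕ) : ∀ᶠ z in 𝓝 m, (fieldDeriv (vertField S ψ σ m₀))^[i]
    (fun m => linearPower k 1 (lineChart ψ σ m₀ m).2) z = powerDeriv k i (lineChart ψ σ m₀ z).2 := by
  induction i with
  | zero => exact .of_forall fun z => (powerDeriv_zero _).symm
  | succ i ih =>
    filter_upwards [ih.eventually_nhds, near_lineChart hm] with z h1 h2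
    rw [Function.iterate_succ_apply']
    refine (tderiv_congr h1 _).trans ?_
    have h3 := hasDerivAt_powerDeriv (k := k) i (lineChart ψ σ m₀ z).2
    refine (tderiv_comp_fderiv (g := powerDeriv k i) (f := fun m => (lineChart ψ σ m₀ m).2)
      h3.differentiableAt (smoothNear_affineCoord h2).mdiff _).trans ?_
    rw [tderiv_affineCoord h2, tderiv_vertField h2, h3.hasFDerivAt.fderiv]
    simp

theorem dproj_adField (i : ℕ) : m.dproj (adField (vertField S ψ σ m₀) (tautField S ψ σ m₀) i m) =
    σ m.base (powerDeriv k i (lineChart ψ σ m₀ m).2) := by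
  have h := mfderiv_adField_of_vertical (π := (base : S.CurveBundle → N))
    (w := fun m => linearPower k 1 (lineChart ψ σ m₀ m).2) hm.2.1.smoothFrameNear
    (smoothNear_base m) (smoothFieldNear_vertField hm) (smoothFieldNear_tautField hm)
    ((near_lineChart hm).mono fun z hz => dproj_vertField hz)
    ((near_lineChart hm).mono fun z hz => dproj_tautField hz) i
  have h2 := h.self_of_nhds
  rw [(fieldDeriv_iterate_powerDeriv hm i).self_of_nhds] at h2
  exact h2

theorem dproj_surjective : Function.Surjective m.dproj := by
  intro v
  refine ⟨chartField (lineChart ψ σ m₀) (fun _ => (tderiv ψ.1 m.base v, 0)) m, ?_⟩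
  rw [dproj_eq_iff hm, (smoothChart_lineChart ψ σ m₀).tderiv_chartField hm]

/-- The projective and normal coordinate fields. -/
theorem isProjectiveNear : S.pair.IsProjectiveNear k (vertField S ψ σ m₀) (tautField S ψ σ m₀) m := by
  refine ⟨isFrameNear hm, (near_lineChart hm).mono fun z hz => ?_⟩
  have h1 := dproj_adField hz (k + 1)
  rw [powerDeriv_eq_zero (Nat.lt_succ_self k), map_zero] at h1
  rw [eq_smul_vertField hz h1]
  exact Submodule.smul_mem _ _ (Submodule.subset_span (Or.inl rfl))

omit hm in
/-- A section of a distribution belongs to the bracket of the vertical distribution with it. -/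
theorem mem_distBracket_of_section (hm : m ∈ (lineChart ψ σ m₀).source)
    {D : ∀ m : S.CurveBundle, Submodule ℝ (T[HN × ℝ] m)}
    {Y : VField (HN × ℝ) S.CurveBundle}
    (hY : IsSectionNear D Y m) : Y m ∈ distBracket S.pair.line D m := by
  have hc : Smooth[HN × ℝ, ℝ]
      (fun z => (lineChart ψ σ m₀ z).2 - (lineChart ψ σ m₀ m).2) m :=
    (smoothNear_affineCoord hm).sub (smoothNear_const _)
  have hYs : SmoothFieldNear Y m := hY.mono fun _ h => h.1
  refine Submodule.subset_span ⟨vertField S ψ σ m₀,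
    fun z => ((lineChart ψ σ m₀ z).2 - (lineChart ψ σ m₀ m).2) • Y z, ?_, ?_, ?_⟩
  · filter_upwards [near_lineChart hm] with z hz
    refine ⟨(smoothFieldNear_vertField hz).self_of_nhds, ?_⟩
    rw [line_pair_eq hz]
    exact Submodule.mem_span_singleton_self _
  · filter_upwards [(hYs.smul hc), hY] with z h1 h2
    exact ⟨h1, Submodule.smul_mem _ _ h2.2⟩
  · rw [bracket_smul_right hc.mdiff hYs.self_of_nhds, sub_self, zero_smul, add_zero]
    have h1 : tderiv (fun z => (lineChart ψ σ m₀ z).2 - (lineChart ψ σ m₀ m).2) m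
        (vertField S ψ σ m₀ m) = 1 := by
      rw [tderiv_sub (smoothNear_affineCoord hm).mdiff (smoothNear_const (H' := ℝ) _).mdiff,
        tderiv_const, tderiv_affineCoord hm, tderiv_vertField hm]
      simp
    rw [h1, one_smul]

omit hm in
/-- The plane `ad_𝒳 ^ i 𝒟` is the preimage of the `i`-th osculating space of the rational normal curve: a
bracket with a vertical field differentiates along the curve. -/
theorem mem_adPlane_iff (i : ℕ) : ∀ {m : S.CurveBundle} (_ : m ∈ (lineChart ψ σ m₀).source)
    (w : T[HN × ℝ] m),
    w ∈ S.pair.adPlane i m ↔ ∃ a ∈ oscSpace k (lineChart ψ σ m₀ m).2 i, m.dproj w = σ m.base a := by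
  induction i with
  | zero =>
    intro m hm w
    change m.dproj w ∈ m.line ↔ _
    rw [isAffineCoord_lineChart hm, Submodule.mem_span_singleton, oscSpace_zero]
    constructor
    · rintro ⟨c, hc⟩
      exact ⟨c • _, Submodule.smul_mem _ _ (Submodule.mem_span_singleton_self _),
        by rw [map_smul, hc]⟩
    · rintro ⟨a, ha, h⟩
      obtain ⟨c, rfl⟩ := Submodule.mem_span_singleton.1 ha
      exact ⟨c, by rw [h, map_smul]⟩
  | succ i ih =>
    intro m hm w
    have hsucc : S.pair.adPlane (i + 1) m = distBracket S.pair.line (S.pair.adPlane i) m := by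
      rw [DistPair.adPlane, Function.iterate_succ_apply']
      rfl
    rw [hsucc]
    constructor
    · intro hw
      have hle : distBracket S.pair.line (S.pair.adPlane i) m ≤
          ((oscSpace k (lineChart ψ σ m₀ m).2 (i + 1)).map (σ m.base).toLinearMap).comap
            m.dproj.toLinearMap := by
        refine Submodule.span_le.2 ?_
        rintro _ ⟨X, Y, hX, hY, rfl⟩
        have hex : ∀ z : S.CurveBundle, ∃ a : BForm k, z ∈ (lineChart ψ σ m₀).source →
            Y z ∈ S.pair.adPlane i z →
            a ∈ oscSpace k (lineChart ψ σ m₀ z).2 i ∧ z.dproj (Y z) = σ z.base a := fun z => by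
          by_cases hz : z ∈ (lineChart ψ σ m₀).source ∧ Y z ∈ S.pair.adPlane i z
          · obtain ⟨a, ha⟩ := (ih hz.1 _).1 hz.2
            exact ⟨a, fun _ _ => ha⟩
          · exact ⟨0, fun h1 h2 => (hz ⟨h1, h2⟩).elim⟩
        choose a ha using hex
        have hXs : SmoothFieldNear X m := hX.mono fun _ h => h.1
        have hYs : SmoothFieldNear Y m := hY.mono fun _ h => h.1
        have hw : ∀ᶠ z in 𝓝 m, z.dproj (Y z) = σ z.base (a z) := by
          filter_upwards [near_lineChart hm, hY] with z h1 h2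
          exact (ha z h1 h2.2).2
        have hX0 : ∀ᶠ z in 𝓝 m, z.dproj (X z) = 0 := hX.mono fun z hz => hz.2
        have has : Smooth[HN × ℝ, BForm k] a m :=
          smoothNear_frame_coeff hm.2.1.smoothFrameNear (smoothNear_base m) hYs hw
        have hb := mfderiv_bracket_of_vertical hm.2.1.smoothFrameNear (smoothNear_base m) hXs hYs
          hX0 hw
        refine ⟨tderiv a m (X m), ?_, hb.symm⟩
        rw [eq_smul_vertField hm hX0.self_of_nhds, tderiv_vsmul]
        refine Submodule.smul_mem _ _ ?_
        have h0 : vertCurve ψ σ m₀ m 0 = m := vertCurve_zero hm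
        have hd := hasDerivAt_comp_vertCurve hm (f := a) (s := 0) (by rw [h0]; exact has.mdiff)
        rw [h0] at hd
        refine deriv_mem_oscSpace ?_ hd
        have hcont : ContinuousAt (vertCurve ψ σ m₀ m) 0 := (smoothNear_vertCurve hm 0).at.continuousAt
        have ht : Tendsto (vertCurve ψ σ m₀ m) (𝓝 0) (𝓝 m) := by
          have := hcont.tendsto
          rwa [h0] at this
        filter_upwards [ht.eventually hY] with s hs
        have h3 := (ha _ (vertCurve_spec hm s).1 hs.2).1
        rwa [(vertCurve_spec hm s).2.1] at h3
      obtain ⟨a, ha, ha'⟩ := hle hw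
      exact ⟨a, ha, ha'.symm⟩
    · rintro ⟨a, ha, haw⟩
      have hXmem : ∀ z ∈ (lineChart ψ σ m₀).source, vertField S ψ σ m₀ z ∈ S.pair.adPlane i z :=
        fun z hz => (ih hz _).2 ⟨0, Submodule.zero_mem _, by rw [dproj_vertField hz, map_zero]⟩
      have hVmem : ∀ z ∈ (lineChart ψ σ m₀).source, ∀ j ≤ i,
          adField (vertField S ψ σ m₀) (tautField S ψ σ m₀) j z ∈ S.pair.adPlane i z :=
        fun z hz j hj => (ih hz _).2 ⟨_, powerDeriv_mem hj _, dproj_adField hz j⟩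
      have hXs : IsSectionNear (S.pair.adPlane i) (vertField S ψ σ m₀) m :=
        (near_lineChart hm).mono fun z hz =>
          ⟨(smoothFieldNear_vertField hz).self_of_nhds, hXmem z hz⟩
      have hVs : ∀ j ≤ i, IsSectionNear (S.pair.adPlane i)
          (adField (vertField S ψ σ m₀) (tautField S ψ σ m₀) j) m := fun j hj =>
        (near_lineChart hm).mono fun z hz =>
          ⟨((smoothFieldNear_vertField hz).adField (smoothFieldNear_tautField hz) j).self_of_nhds,
            hVmem z hz j hj⟩
      have hX' : vertField S ψ σ m₀ m ∈ distBracket S.pair.line (S.pair.adPlane i) m :=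
        mem_distBracket_of_section hm hXs
      have hV' : ∀ j ≤ i + 1, adField (vertField S ψ σ m₀) (tautField S ψ σ m₀) j m ∈
          distBracket S.pair.line (S.pair.adPlane i) m := by
        intro j hj
        rcases Nat.lt_or_ge i j with h | h
        · obtain rfl : j = i + 1 := le_antisymm hj h
          rw [adField_succ]
          refine Submodule.subset_span ⟨_, _, ?_, hVs i le_rfl, rfl⟩
          filter_upwards [near_lineChart hm] with z hz
          refine ⟨(smoothFieldNear_vertField hz).self_of_nhds, ?_⟩
          rw [line_pair_eq hz]
          exact Submodule.mem_span_singleton_self _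
        · exact mem_distBracket_of_section hm (hVs j h)
      have hker : ∀ u : T[HN × ℝ] m, m.dproj u = 0 →
          u ∈ distBracket S.pair.line (S.pair.adPlane i) m := fun u hu => by
        rw [eq_smul_vertField hm hu]
        exact Submodule.smul_mem _ _ hX'
      obtain ⟨u, hu, hu'⟩ : ∃ u ∈ distBracket S.pair.line (S.pair.adPlane i) m,
          m.dproj u = σ m.base a := by
        clear haw
        induction ha using Submodule.span_induction with
        | mem x hx =>
          obtain ⟨j, hj, rfl⟩ := hx
          exact ⟨_, hV' j hj, dproj_adField hm j⟩
        | zero => exact ⟨0, Submodule.zero_mem _, by rw [map_zero, map_zero]⟩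
        | add x y _ _ hx hy =>
          obtain ⟨u, hu, hu'⟩ := hx
          obtain ⟨v, hv, hv'⟩ := hy
          exact ⟨u + v, Submodule.add_mem _ hu hv, by rw [map_add, map_add, hu', hv']⟩
        | smul c x _ hx =>
          obtain ⟨u, hu, hu'⟩ := hx
          exact ⟨c • u, Submodule.smul_mem _ _ hu, by rw [map_smul, map_smul, hu']⟩
      have h1 := Submodule.add_mem _ (hker (w - u) (by rw [map_sub, haw, hu', sub_self])) hu
      rwa [sub_add_cancel] at h1

omit hm in
theorem exists_lineChart (m : S.CurveBundle) : ∃ (ψ : BaseChart N k) (σ : FrameField k N),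
    m ∈ (lineChart ψ σ m).source := by
  obtain ⟨σ, h⟩ := exists_mem_coordSource m
  exact ⟨⟨chartAt _ m.base, chart_mem_atlas _ _⟩, σ, h⟩

omit hm in
theorem isRegular_pair : S.pair.IsRegular k where
  line_dist m := by
    obtain ⟨ψ, σ, hm⟩ := exists_lineChart m
    refine ⟨fun _ => vertField S ψ σ m, (near_lineChart hm).mono fun z hz => ⟨fun _ =>
      (smoothFieldNear_vertField hz).self_of_nhds,
      LinearIndependent.of_subsingleton 0 (isFrameAt hz).fst_ne_zero, ?_⟩⟩
    rw [line_pair_eq hz, Set.range_const]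
  plane_dist m := by
    obtain ⟨ψ, σ, hm⟩ := exists_lineChart m
    refine ⟨fun i z => ![vertField S ψ σ m z, tautField S ψ σ m z] i,
      (near_lineChart hm).mono fun z hz => ⟨fun i => ?_, (isFrameAt hz).indep, ?_⟩⟩
    · fin_cases i
      · exact (smoothFieldNear_vertField hz).self_of_nhds
      · exact (smoothFieldNear_tautField hz).self_of_nhds
    · rw [plane_pair_eq hz]
      congr 1
      exact (Matrix.range_cons_cons_empty _ _ _).symm
  line_le m := by
    obtain ⟨ψ, σ, hm⟩ := exists_lineChart m
    rw [plane_pair_eq hm, line_pair_eq hm]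
    exact Submodule.span_mono (by simp)
  rank_ad i _ hi m := by
    obtain ⟨ψ, σ, hm⟩ := exists_lineChart m
    have h1 : S.pair.adPlane i m = ((oscSpace k (lineChart ψ σ m m).2 i).map
        (σ m.base).toLinearMap).comap m.dproj.toLinearMap := by
      ext w
      rw [mem_adPlane_iff i hm]
      exact ⟨fun ⟨a, ha, h⟩ => ⟨a, ha, h.symm⟩, fun ⟨a, ha, h⟩ => ⟨a, ha, h.symm⟩⟩
    have hfd : FiniteDimensional ℝ (T[HN × ℝ] m) := inferInstanceAs (FiniteDimensional ℝ (HN × ℝ))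
    have h2 : Module.finrank ℝ (S.pair.line m) = 1 := by
      rw [line_pair_eq hm]
      exact finrank_span_singleton (isFrameAt hm).fst_ne_zero
    rw [h1, finrank_comap_of_surjective (dproj_surjective hm)]
    have h3 := (Submodule.equivMapOfInjective (σ m.base).toLinearMap (S.bijective _ _ hm.2.1.mem).1
      (oscSpace k (lineChart ψ σ m m).2 i)).finrank_eq
    rw [finrank_oscSpace hi] at h3
    have h4 : Module.finrank ℝ (LinearMap.ker m.dproj.toLinearMap) = 1 := h2
    rw [h4, ← h3]
    omega
  ad_eq_top m := by
    obtain ⟨ψ, σ, hm⟩ := exists_lineChart m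
    refine eq_top_iff.2 fun w _ => (mem_adPlane_iff k hm w).2 ?_
    obtain ⟨a, ha⟩ := (S.bijective _ _ hm.2.1.mem).2 (m.dproj w)
    exact ⟨a, by rw [oscSpace_top]; trivial, ha.symm⟩

end CurveBundle

/-! ### The canonical bundle as a bundle of frames -/

open CurveBundle CanonicalBundle

/-- The point `p` of the canonical bundle lies over the domain of a chart of the bundle of curves. -/
abbrev InChart (ψ : BaseChart N k) (σ : FrameField k N) (p₀ p : S.Bundle) : Prop :=
  p.base ∈ (lineChart ψ σ p₀.base).source

section Charts

variable (ψ : BaseChart N k) (σ : FrameField k N) (p₀ : S.Bundle)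

/-- The chart of the canonical bundle which is defined by a chart of the base and a local section
of the frame bundle. -/
def frameChart : OpenPartialHomeomorph S.Bundle HE :=
  (CanonicalBundle.coordAtlas S.pair).openChart (⟨lineChart ψ σ p₀.base,
    (CurveBundle.coordAtlas S).openChart_mem_atlas (ψ, σ) p₀.base⟩, vertField S ψ σ p₀.base,
    tautField S ψ σ p₀.base) p₀

theorem smoothChart_frameChart : SmoothChart (frameChart ψ σ p₀) :=
  smoothChart_of_mem_atlas ((CanonicalBundle.coordAtlas S.pair).openChart_mem_atlas _ p₀)

variable {ψ σ p₀} {p : S.Bundle}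

theorem mem_frameChart_source_iff : p ∈ (frameChart ψ σ p₀).source ↔
    InChart ψ σ p₀ p :=
  ⟨fun h => h.1, fun h => ⟨h, isFrameNear h⟩⟩

/-- The coordinates of a point of the canonical bundle in the structure group. -/
def groupCoord (ψ : BaseChart N k) (σ : FrameField k N) (p₀ p : S.Bundle) : ℝ × ℝ × ℝ × ℝ :=
  ((frameChart ψ σ p₀ p).1.2, (frameChart ψ σ p₀ p).2)

theorem frameChart_apply (hp : InChart ψ σ p₀ p) {c : ℝ × ℝ × ℝ}
    (hc : IsCoord (vertField S ψ σ p₀.base) (tautField S ψ σ p₀.base) p c) :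
    frameChart ψ σ p₀ p = (lineChart ψ σ p₀.base p.base, c) :=
  coords_eq (isFrameNear hp) hc

theorem frameChart_fst : (frameChart ψ σ p₀ p).1 = lineChart ψ σ p₀.base p.base := rfl

theorem isCoord_frameChart (hp : InChart ψ σ p₀ p) :
    IsCoord (vertField S ψ σ p₀.base) (tautField S ψ σ p₀.base) p (frameChart ψ σ p₀ p).2 ∧
      (frameChart ψ σ p₀ p).2.1 ≠ 0 ∧ (frameChart ψ σ p₀ p).2.2.1 ≠ 0 := by
  obtain ⟨c, hc, h1, h2⟩ := exists_isCoord p (isFrameNear hp)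
  rw [frameChart_apply hp hc]
  exact ⟨hc, h1, h2⟩

theorem groupCoord_eq (hp : InChart ψ σ p₀ p) {c : ℝ × ℝ × ℝ}
    (hc : IsCoord (vertField S ψ σ p₀.base) (tautField S ψ σ p₀.base) p c) :
    groupCoord ψ σ p₀ p = ((lineChart ψ σ p₀.base p.base).2, c) := by
  rw [groupCoord, frameChart_apply hp hc]

end Charts

section Transition

variable {ψ ψ' : BaseChart N k} {σ σ' : FrameField k N} {m₀ m₀' m : S.CurveBundle}

/-- The transition between the affine coordinates of the fibre, and its effect on the vertical
coordinate fields. -/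
theorem vertField_transition (hm : m ∈ (lineChart ψ σ m₀).source)
    (hm' : m ∈ (lineChart ψ' σ' m₀').source) {c a b d e : ℝ} (hc : c ≠ 0) (hΔ : a * e - b * d ≠ 0)
    (hσ : σ m.base = (σ' m.base).comp (c • linearSubst k a b d e)) :
    a + (lineChart ψ σ m₀ m).2 * d ≠ 0 ∧
    (lineChart ψ' σ' m₀' m).2 =
      (b + (lineChart ψ σ m₀ m).2 * e) / (a + (lineChart ψ σ m₀ m).2 * d) ∧
    JetRel m (vertField S ψ' σ' m₀') (vertField S ψ σ m₀)
      ((a * e - b * d) / (a + (lineChart ψ σ m₀ m).2 * d) ^ 2)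
      (-2 * d / (a + (lineChart ψ σ m₀ m).2 * d)) := by
  set t := (lineChart ψ σ m₀ m).2 with ht
  have hγ := fun s => vertCurve_spec hm s
  have h0 : vertCurve ψ σ m₀ m 0 = m := vertCurve_zero hm
  -- the relation between the affine coordinates along the fibre
  have hline : ∀ s, (vertCurve ψ σ m₀ m s).line = ℝ ∙ σ (vertCurve ψ σ m₀ m s).base (linearPower k 1 (t + s)) := by
    intro s
    have h1 := isAffineCoord_lineChart (hγ s).1
    rw [(hγ s).2.1] at h1
    exact h1
  have hσs : ∀ s, σ (vertCurve ψ σ m₀ m s).base =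
      (σ' (vertCurve ψ σ m₀ m s).base).comp (c • linearSubst k a b d e) := by
    intro s
    rw [(hγ s).2.2]
    exact hσ
  have hσL : ∀ s, σ (vertCurve ψ σ m₀ m s).base (linearPower k 1 (t + s)) =
      c • σ' (vertCurve ψ σ m₀ m s).base (linearPower k (a + (t + s) * d) (b + (t + s) * e)) := by
    intro s
    rw [hσs, comp_apply, smul_apply, linearSubst_linearPower, map_smul, one_mul, one_mul]
  have hD0 : a + t * d ≠ 0 := by
    intro hD
    have h1 : IsAffineCoord σ' m (lineChart ψ' σ' m₀' m).2 := isAffineCoord_lineChart hm'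
    have h2 := hσL 0
    rw [h0, add_zero, hD] at h2
    have h3 : m.line = ℝ ∙ σ m.base (linearPower k 1 t) := isAffineCoord_lineChart hm
    have h4 : σ' m.base (linearPower k 1 (lineChart ψ' σ' m₀' m).2) ∈
        (ℝ ∙ σ m.base (linearPower k 1 t)) := by
      rw [← h3, h1]; exact Submodule.mem_span_singleton_self _
    obtain ⟨r, hr⟩ := Submodule.mem_span_singleton.1 h4
    rw [h2, smul_smul, ← map_smul] at hr
    have h5 := congrFun ((S.bijective _ _ hm'.2.1.mem).1 hr) 0
    rw [Pi.smul_apply, linearPower_zero, linearPower_zero, zero_pow (NeZero.ne k)] at h5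
    simp at h5
  have hDs : ∀ᶠ s in 𝓝 (0 : ℝ), a + (t + s) * d ≠ 0 := by
    have : ContinuousAt (fun s : ℝ => a + (t + s) * d) 0 := by fun_prop
    exact this.eventually_ne (by simpa using hD0)
  have htend : Tendsto (vertCurve ψ σ m₀ m) (𝓝 0) (𝓝 m) := by
    have := (smoothNear_vertCurve hm 0).at.continuousAt.tendsto
    rwa [h0] at this
  have hcoord : ∀ᶠ s in 𝓝 (0 : ℝ), (lineChart ψ' σ' m₀' (vertCurve ψ σ m₀ m s)).2 =
      (b + (t + s) * e) / (a + (t + s) * d) := by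
    filter_upwards [hDs, htend.eventually (near_lineChart hm')] with s h1 h2
    refine IsAffineCoord.unique h2.2.1.mem (isAffineCoord_lineChart h2) ?_
    rw [IsAffineCoord, hline, hσL, linearPower_of_ne h1, map_smul, smul_smul,
      Submodule.span_singleton_smul_eq (mul_ne_zero hc (pow_ne_zero _ h1)).isUnit]
  -- the coefficient function
  obtain ⟨f, hf⟩ := (isFrameNear hm').exists_coeff_line (W := vertField S ψ σ m₀)
    ((near_lineChart hm).mono fun z hz => ⟨(smoothFieldNear_vertField hz).self_of_nhds, by
      rw [line_pair_eq hz]; exact Submodule.mem_span_singleton_self _⟩)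
  have hfγ : ∀ᶠ s in 𝓝 (0 : ℝ), f (vertCurve ψ σ m₀ m s) =
      (a * e - b * d) / (a + (t + s) * d) ^ 2 := by
    filter_upwards [hDs, htend.eventually (near_lineChart hm'), hcoord.eventually_nhds,
      htend.eventually hf] with s h1 h2 h3 h4
    have h5 := hasDerivAt_comp_vertCurve hm (s := s) (smoothNear_affineCoord h2).mdiff
    rw [tderiv_affineCoord h2] at h5
    have h6 : (tderiv (lineChart ψ' σ' m₀') (vertCurve ψ σ m₀ m s)
        (vertField S ψ σ m₀ (vertCurve ψ σ m₀ m s))).2 = f (vertCurve ψ σ m₀ m s) := by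
      rw [h4.2, tderiv_vsmul, tderiv_vertField h2]
      simp
    rw [h6] at h5
    have h7 := h5.congr_of_eventuallyEq (h3.mono fun r hr => hr.symm)
    have h8 : HasDerivAt (fun r : ℝ => b + (t + r) * e) (1 * e) s :=
      (((hasDerivAt_id s).const_add t).mul_const e).const_add b
    have h9 : HasDerivAt (fun r : ℝ => a + (t + r) * d) (1 * d) s :=
      (((hasDerivAt_id s).const_add t).mul_const d).const_add a
    rw [h7.unique (h8.div h9 h1)]
    congr 1
    ring
  have hf0 : f m = (a * e - b * d) / (a + t * d) ^ 2 := by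
    have := hfγ.self_of_nhds
    rwa [h0, add_zero] at this
  have hfsm : Smooth[HN × ℝ, ℝ] f m := hf.mono fun _ h => h.1
  have hf1 : tderiv f m (vertField S ψ σ m₀ m) =
      (a * e - b * d) / (a + t * d) ^ 2 * (-2 * d / (a + t * d)) := by
    have h5 := hasDerivAt_comp_vertCurve hm (s := 0) (f := f) (by rw [h0]; exact hfsm.mdiff)
    have h9 : HasDerivAt (fun r : ℝ => (a + (t + r) * d) ^ 2)
        ((2 : ℕ) * (a + (t + 0) * d) ^ (2 - 1) * (1 * d)) 0 :=
      ((((hasDerivAt_id 0).const_add t).mul_const d).const_add a).fun_pow 2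
    have h10 := (hasDerivAt_const (0 : ℝ) (a * e - b * d)).div h9 (by
      rw [add_zero]; exact pow_ne_zero _ hD0)
    have h11 := (h5.congr_of_eventuallyEq (hfγ.mono fun r hr => hr.symm)).unique h10
    rw [h0] at h11
    rw [h11]
    simp
    field_simp
  refine ⟨hD0, ?_, f, hf, hf0, ?_⟩
  · have := hcoord.self_of_nhds
    rwa [h0, add_zero] at this
  · have h1 : tderiv f m (vertField S ψ σ m₀ m) = f m * dirDeriv (vertField S ψ' σ' m₀') f m := by
      rw [hf.self_of_nhds.2, tderiv_vsmul]
      rfl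
    rw [hf1, hf0] at h1
    exact (mul_left_cancel₀ (div_ne_zero hΔ (pow_ne_zero _ hD0)) h1).symm

end Transition

section Frame

variable {ψ ψ' : BaseChart N k} {σ σ' : FrameField k N} {p p₀ p₀' : S.Bundle}

/-- The frame obtained from the coordinates of `p` does not depend on the chart; this makes `frame`
independent of choices. -/
theorem coordOp_groupCoord_transition (hp : InChart ψ σ p₀ p)
    (hp' : p.base ∈ (lineChart ψ' σ' p₀'.base).source) :
    (σ p.base.base).comp (coordOp k (groupCoord ψ σ p₀ p)) =
      (σ' p.base.base).comp (coordOp k (groupCoord ψ' σ' p₀' p)) := by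
  have hs : S.IsLocalSection σ p.base.base := hp.2.1
  have hs' : S.IsLocalSection σ' p.base.base := hp'.2.1
  obtain ⟨B, hB, hσ⟩ := (mem_frames_iff_isGL2 hs'.mem).1 hs.mem
  obtain ⟨c, a, b, d, e, hc, hΔ, rfl⟩ := hB.exists_eq
  obtain ⟨hD, ht, hjet⟩ := vertField_transition hp hp' hc hΔ hσ
  obtain ⟨⟨h1, h2⟩, hy, hx⟩ := isCoord_frameChart hp
  set t := (lineChart ψ σ p₀.base p.base).2 with ht0
  obtain ⟨⟨y, x₀, x₁⟩, q⟩ : ∃ c, (frameChart ψ σ p₀ p).2 = c := ⟨_, rfl⟩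
  rw [q] at h1 h2
  have hV : p.base.dproj (tautField S ψ σ p₀.base p.base -
      (c * (a + t * d) ^ k) • tautField S ψ' σ' p₀'.base p.base) = 0 := by
    rw [map_sub, map_smul, dproj_tautField hp, dproj_tautField hp', ht, hσ,
      comp_apply, smul_apply, linearSubst_linearPower, map_smul, one_mul,
      one_mul, linearPower_of_ne hD, map_smul, smul_smul, sub_self]
  have hmk : (S.pair.line p.base).mkQ (tautField S ψ σ p₀.base p.base) =
      (c * (a + t * d) ^ k) • (S.pair.line p.base).mkQ (tautField S ψ' σ' p₀'.base p.base) := by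
    rw [← map_smul, ← sub_eq_zero, ← map_sub, Submodule.mkQ_apply, Submodule.Quotient.mk_eq_zero]
    exact hV
  have hc' : IsCoord (vertField S ψ' σ' p₀'.base) (tautField S ψ' σ' p₀'.base) p
      (y * (c * (a + t * d) ^ k), x₀ * ((a * e - b * d) / (a + t * d) ^ 2),
        x₁ + x₀ * (-2 * d / (a + t * d))) := by
    constructor
    · rw [h1, hmk, smul_smul]
    · rw [h2]
      exact setOf_jetRel_eq (div_ne_zero hΔ (pow_ne_zero _ hD)) hjet
  have hg : groupCoord ψ σ p₀ p = (t, y, x₀, x₁) := by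
    rw [groupCoord, q]; rfl
  rw [groupCoord_eq hp' hc', ht, hg, ← smul_linearSubst_comp_coordOp hD, hσ]
  rfl

theorem exists_frameChart (p : S.Bundle) : ∃ (ψ : BaseChart N k) (σ : FrameField k N),
    p.base ∈ (lineChart ψ σ p.base).source := exists_lineChart p.base

/-- The frame of the structure which corresponds to a point of the canonical bundle. -/
def frame (p : S.Bundle) : BForm k →L[ℝ] T[HN] p.base.base :=
  ((exists_frameChart p).choose_spec.choose p.base.base).comp
    (coordOp k (groupCoord (exists_frameChart p).choose (exists_frameChart p).choose_spec.choose p p))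

theorem frame_eq (hp : InChart ψ σ p₀ p) :
    frame p = (σ p.base.base).comp (coordOp k (groupCoord ψ σ p₀ p)) :=
  coordOp_groupCoord_transition (exists_frameChart p).choose_spec.choose_spec hp

theorem isGL2_groupCoord (hp : InChart ψ σ p₀ p) :
    IsGL2 (coordOp k (groupCoord ψ σ p₀ p)) :=
  isGL2_coordOp (isCoord_frameChart hp).2.1 (isCoord_frameChart hp).2.2

theorem frame_mem (p : S.Bundle) : frame p ∈ S.frames p.base.base := by
  obtain ⟨ψ, σ, hp⟩ := exists_frameChart p
  rw [frame_eq hp]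
  exact comp_mem_frames hp.2.1.mem (isGL2_groupCoord hp)

theorem frame_bijective (p : S.Bundle) : Function.Bijective (frame p) :=
  S.bijective _ _ (frame_mem p)

theorem frame_form₀ (hp : InChart ψ σ p₀ p) :
    frame p (form₀ k) = (frameChart ψ σ p₀ p).2.1 •
      σ p.base.base (linearPower k 1 (lineChart ψ σ p₀.base p.base).2) := by
  rw [frame_eq hp, comp_apply, coordOp_form₀, map_smul]
  rfl

theorem line_eq_span_frame (p : S.Bundle) : p.base.line = ℝ ∙ frame p (form₀ k) := by
  obtain ⟨ψ, σ, hp⟩ := exists_frameChart p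
  rw [frame_form₀ hp, Submodule.span_singleton_smul_eq (isCoord_frameChart hp).2.1.isUnit]
  exact isAffineCoord_lineChart hp

/-- A point of the canonical bundle whose first basis vector has an affine coordinate belongs to the
chart. -/
theorem mem_source_of_frame (hψ : p.base.base ∈ ψ.1.source) (hσ : S.IsLocalSection σ p.base.base)
    {b : End[k]} (hb : IsGL2 b) (hb0 : b (form₀ k) 0 ≠ 0)
    (h : frame p = (σ p.base.base).comp b) :
    InChart ψ σ p₀ p ∧ groupCoord ψ σ p₀ p = readCoord k b := by
  obtain ⟨q, hq1, hq2, rfl⟩ := hb.exists_coordOp hb0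
  have hp : InChart ψ σ p₀ p := by
    refine ⟨hψ, hσ, q.1, ?_⟩
    rw [IsAffineCoord, line_eq_span_frame, h, comp_apply, coordOp_form₀,
      map_smul, Submodule.span_singleton_smul_eq hq1.isUnit]
  refine ⟨hp, ?_⟩
  rw [frame_eq hp] at h
  have h1 : coordOp k (groupCoord ψ σ p₀ p) = coordOp k q := by
    ext1 a
    exact (S.bijective _ _ hσ.mem).1 (congrArg (fun L : BForm k →L[ℝ] T[HN] p.base.base => L a) h)
  rw [← h1, readCoord_coordOp]
  exact (isCoord_frameChart hp).2.1

theorem eq_of_groupCoord (hp : InChart ψ σ p₀ p) {p' : S.Bundle}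
    (hp' : p'.base ∈ (lineChart ψ σ p₀.base).source) (h0 : p.base.base = p'.base.base)
    (h : groupCoord ψ σ p₀ p = groupCoord ψ σ p₀ p') : p = p' := by
  refine (frameChart ψ σ p₀).injOn (mem_frameChart_source_iff.2 hp)
    (mem_frameChart_source_iff.2 hp') ?_
  have h1 := congrArg Prod.fst h
  have h2 := congrArg Prod.snd h
  refine Prod.ext (Prod.ext ?_ h1) h2
  rw [frameChart_fst, frameChart_fst, lineChart_fst, lineChart_fst, h0]

theorem exists_section_of_frame (x : N) (τ : BForm k →L[ℝ] T[HN] x)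
    (hτ : τ ∈ S.frames x) : ∃ σ : FrameField k N, S.IsLocalSection σ x ∧ σ x = τ := by
  obtain ⟨σ, hσ⟩ := S.exists_smooth x
  obtain ⟨B, hB, rfl⟩ := (mem_frames_iff_isGL2 hσ.self_of_nhds.1).1 hτ
  exact ⟨fun y => (σ y).comp B, IsLocalSection.comp hσ hB, rfl⟩

/-- A local section through the frame of `p`, and the chart in which `p` is the origin. -/
theorem exists_adapted_chart (p : S.Bundle) : ∃ (ψ : BaseChart N k) (σ : FrameField k N),
    S.IsLocalSection σ p.base.base ∧ σ p.base.base = frame p ∧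
    p.base ∈ (lineChart ψ σ p.base).source ∧ groupCoord ψ σ p p = (0, 1, 1, 0) := by
  obtain ⟨σ, hσ, h⟩ := exists_section_of_frame p.base.base (frame p) (frame_mem p)
  have h1 := mem_source_of_frame (ψ := ⟨chartAt _ p.base.base, chart_mem_atlas _ _⟩) (p₀ := p)
    (mem_chart_source _ _) hσ isGL2_id (b := ContinuousLinearMap.id ℝ _)
    (by simp [form₀, linearPower_zero]) (by rw [h]; rfl)
  refine ⟨_, σ, hσ, h, h1.1, ?_⟩
  rw [h1.2, ← coordOp_one, readCoord_coordOp one_ne_zero]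

/-- A point of the canonical bundle is determined by its frame. -/
theorem eq_of_frame_eq {p p' : S.Bundle} (h0 : p.base.base = p'.base.base)
    (h : ∀ a, (frame p a : HN) = frame p' a) : p = p' := by
  obtain ⟨ψ, σ, hσ, hσp, hp, -⟩ := exists_adapted_chart p
  have h1 := mem_source_of_frame (p := p) (ψ := ψ) (p₀ := p) hp.1 hσ isGL2_id
    (b := ContinuousLinearMap.id ℝ _) (by simp [form₀, linearPower_zero]) (by rw [hσp]; rfl)
  have h2 : ∀ y (_ : p.base.base = y) (τ : BForm k →L[ℝ] T[HN] y),
      (∀ a, (frame p a : HN) = τ a) → τ = (σ y).comp (ContinuousLinearMap.id ℝ _) := by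
    rintro y rfl τ hτ
    rw [hσp]
    ext1 a
    exact (hτ a).symm
  have h3 := mem_source_of_frame (p := p') (ψ := ψ) (p₀ := p) (h0 ▸ hp.1) (h0 ▸ hσ) isGL2_id
    (by simp [form₀, linearPower_zero]) (h2 _ h0 (frame p') h)
  exact eq_of_groupCoord h1.1 h3.1 h0 (h1.2.trans h3.2.symm)

theorem exists_point_aux (ψ : BaseChart N k) {σ : FrameField k N} {x : N} (hψ : x ∈ ψ.1.source)
    (hσ : S.IsLocalSection σ x) {q : ℝ × ℝ × ℝ × ℝ} (hq1 : q.2.1 ≠ 0) (hq2 : q.2.2.1 ≠ 0) :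
    ∃ p : S.Bundle, p.base.base = x ∧ ∀ a, (frame p a : HN) = σ x (coordOp k q a) := by
  have hm : affinePoint (σ x) hσ.mem q.1 ∈ (lineChart ψ σ (affinePoint (σ x) hσ.mem q.1)).source :=
    ⟨hψ, hσ, q.1, rfl⟩
  let p : S.Bundle := ofCoord (isFrameNear hm) q.2 hq1 hq2
  have hp : p.base ∈ (lineChart ψ σ p.base).source := hm
  have hc : groupCoord ψ σ p p = q := by
    refine (groupCoord_eq (p₀ := p) hp (isCoord_ofCoord (isFrameNear hm) q.2 hq1 hq2)).trans ?_
    have h1 := lineChart_apply (ψ := ψ) (m₀ := p.base) (m := affinePoint (σ x) hσ.mem q.1) hσ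
      (isAffineCoord_affinePoint hσ.mem q.1)
    exact Prod.ext (congrArg Prod.snd h1) rfl
  refine ⟨p, rfl, fun a => ?_⟩
  rw [frame_eq hp, hc]
  rfl

/-- Every frame of the structure comes from a point of the canonical bundle. -/
theorem exists_point (x : N) (τ : BForm k →L[ℝ] T[HN] x) (hτ : τ ∈ S.frames x) :
    ∃ p : S.Bundle, p.base.base = x ∧ ∀ a, (frame p a : HN) = τ a := by
  obtain ⟨σ, hσ, rfl⟩ := exists_section_of_frame x τ hτ
  obtain ⟨p, h1, h2⟩ := exists_point_aux (S := S) ⟨chartAt _ x, chart_mem_atlas _ _⟩ (mem_chart_source _ _) hσ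
    (q := (0, 1, 1, 0)) one_ne_zero one_ne_zero
  refine ⟨p, h1, fun a => (h2 a).trans ?_⟩
  rw [coordOp_one]
  rfl

/-- The point of the canonical bundle with a given frame. -/
def point (x : N) (τ : BForm k →L[ℝ] T[HN] x) (hτ : τ ∈ S.frames x) : S.Bundle :=
  (exists_point x τ hτ).choose

theorem point_base (x : N) (τ : BForm k →L[ℝ] T[HN] x) (hτ : τ ∈ S.frames x) :
    (point x τ hτ).base.base = x := (exists_point x τ hτ).choose_spec.1

theorem frame_point (x : N) (τ : BForm k →L[ℝ] T[HN] x) (hτ : τ ∈ S.frames x)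
    (a : BForm k) : (frame (point x τ hτ) a : HN) = τ a :=
  (exists_point x τ hτ).choose_spec.2 a

end Frame

/-! ### Smoothness in terms of frames -/

/-- The projection of the canonical bundle to the manifold which carries the structure. -/
def foot (p : S.Bundle) : N := p.base.base

/-- The differential of the projection of the canonical bundle to `N`. -/
def dfoot (p : S.Bundle) : T[HE] p →L[ℝ] T[HN] p.base.base := d[HE, HN] (foot : S.Bundle → N) p

/-- The frame of a point of the canonical bundle, in terms of a field of frames. -/
def frameCoord (σ : FrameField k N) (p : S.Bundle) : End[k] :=
  (σ p.base.base).inverse.comp (frame p)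

theorem IsLocalSection.isInvertible {σ : FrameField k N} {x : N} (h : S.IsLocalSection σ x) :
    (σ x).IsInvertible :=
  isInvertible_of_bijective (W := HN) (S.bijective _ _ h.mem)

section FrameCoord

variable {ψ : BaseChart N k} {σ : FrameField k N} {p p₀ : S.Bundle}

theorem apply_frameCoord (h : S.IsLocalSection σ p.base.base) (a : BForm k) :
    σ p.base.base (frameCoord σ p a) = frame p a := h.isInvertible.self_apply_inverse _

theorem frameCoord_eq_of_apply {x : N} (hx : p.base.base = x) (h : S.IsLocalSection σ x)
    {b : End[k]}
    (hb : ∀ a, (frame p a : HN) = σ x (b a)) : frameCoord σ p = b := by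
  subst hx
  ext1 a
  refine (S.bijective _ _ h.mem).1 ?_
  rw [apply_frameCoord h]
  exact hb a

theorem isGL2_frameCoord (h : S.IsLocalSection σ p.base.base) : IsGL2 (frameCoord σ p) := by
  obtain ⟨B, hB, hB'⟩ := (mem_frames_iff_isGL2 h.mem).1 (frame_mem p)
  rwa [frameCoord_eq_of_apply rfl h (b := B) fun a => by rw [hB']; rfl]

theorem frameCoord_eq_coordOp (hp : InChart ψ σ p₀ p) :
    frameCoord σ p = coordOp k (groupCoord ψ σ p₀ p) :=
  frameCoord_eq_of_apply rfl hp.2.1 fun a => by rw [frame_eq hp]; rfl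

theorem readCoord_frameCoord (hp : InChart ψ σ p₀ p) :
    readCoord k (frameCoord σ p) = groupCoord ψ σ p₀ p := by
  rw [frameCoord_eq_coordOp hp, readCoord_coordOp]
  exact (isCoord_frameChart hp).2.1

theorem frameCoord_form₀_ne (hp : InChart ψ σ p₀ p) :
    frameCoord σ p (form₀ k) 0 ≠ 0 := by
  rw [frameCoord_eq_coordOp hp, coordOp_form₀, Pi.smul_apply, linearPower_zero, one_pow, smul_eq_mul,
    mul_one]
  exact (isCoord_frameChart hp).2.1

theorem near_frameChart (hp : InChart ψ σ p₀ p) :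
    ∀ᶠ p' in 𝓝 p, p'.base ∈ (lineChart ψ σ p₀.base).source :=
  Filter.mem_of_superset
    ((frameChart ψ σ p₀).open_source.mem_nhds (mem_frameChart_source_iff.2 hp))
    fun _ h => mem_frameChart_source_iff.1 h

theorem smoothNear_frameChart (hp : InChart ψ σ p₀ p) :
    Smooth[HE, HE] (frameChart ψ σ p₀) p :=
  (smoothChart_frameChart ψ σ p₀).smoothNear (mem_frameChart_source_iff.2 hp)

theorem smoothNear_groupCoord (hp : InChart ψ σ p₀ p) :
    Smooth[HE, ℝ × ℝ × ℝ × ℝ] (groupCoord ψ σ p₀) p :=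
  (smoothNear_frameChart hp).clm (((snd ℝ _ _).comp (fst ℝ _ _)).prod (snd ℝ _ _))

theorem smoothNear_frameCoord (hp : InChart ψ σ p₀ p) :
    Smooth[HE, End[k]] (frameCoord σ) p :=
  (SmoothNear.comp_space (.of_forall fun _ => contDiff_coordOp.contDiffAt)
    (smoothNear_groupCoord hp)).congr
    ((near_frameChart hp).mono fun _ h => frameCoord_eq_coordOp h)

theorem smoothNear_canonicalBase (p : S.Bundle) : Smooth[HE, HN × ℝ] (CanonicalBundle.base : S.Bundle → S.CurveBundle) p := by
  obtain ⟨ψ, σ, hp⟩ := exists_frameChart p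
  have h1 : Smooth[HE, HN × ℝ]
      (fun p' : S.Bundle => (frameChart ψ σ p p').1) p :=
    (smoothNear_frameChart hp).clm (fst ℝ _ _)
  have h2 := (smoothChart_lineChart ψ σ p.base).smoothNear_symm
    ((lineChart ψ σ p.base).map_source hp)
  refine (SmoothNear.comp_map (f := (lineChart ψ σ p.base).symm)
    (π := fun p' : S.Bundle => (frameChart ψ σ p p').1) h2 h1).congr ?_
  filter_upwards [near_frameChart hp] with p' hp'
  exact ((lineChart ψ σ p.base).left_inv hp').symm

theorem smoothNear_foot (p : S.Bundle) : Smooth[HE, HN] (foot : S.Bundle → N) p :=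
  SmoothNear.comp_map (f := (CurveBundle.base : S.CurveBundle → N))
    (π := (CanonicalBundle.base : S.Bundle → S.CurveBundle)) (smoothNear_base p.base)
    (smoothNear_canonicalBase p)

theorem continuousAt_foot (p : S.Bundle) : ContinuousAt (foot : S.Bundle → N) p :=
  (smoothNear_foot p).at.continuousAt

theorem dfoot_eq (w : T[HE] p) :
    dfoot p w = p.base.dproj (CanonicalBundle.dproj p w) := by
  have h := mfderiv_comp p (I := 𝓘(ℝ, HE))
    (I' := 𝓘(ℝ, HN × ℝ)) (I'' := 𝓡 (k + 1))
    (g := (CurveBundle.base : S.CurveBundle → N)) (f := (CanonicalBundle.base : S.Bundle → S.CurveBundle))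
    (smoothNear_base p.base).mdiff (smoothNear_canonicalBase p).mdiff
  exact congrArg (fun L : HE →L[ℝ] HN => L w) h

/-- The derivative of the chart of `E` in terms of the foot and of the matrix of the frame. -/
theorem tderiv_frameChart (hp : InChart ψ σ p₀ p)
    (w : T[HE] p) :
    (tderiv (frameChart ψ σ p₀) p w).1.1 = tderiv ψ.1 p.base.base (dfoot p w) ∧
    ((tderiv (frameChart ψ σ p₀) p w).1.2, (tderiv (frameChart ψ σ p₀) p w).2) =
      fderiv ℝ (readCoord k) (frameCoord σ p) (tderiv (frameCoord σ) p w) := by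
  have he := (smoothNear_frameChart hp).mdiff
  constructor
  · have h1 := tderiv_clm ((fst ℝ _ _).comp (fst ℝ _ _)) he w
    exact h1.symm.trans (tderiv_comp (f := ψ.1) (π := (foot : S.Bundle → N))
      ((smoothChart_of_mem_atlas ψ.2).smoothNear hp.1).mdiff (smoothNear_foot p).mdiff w)
  · have h1 := tderiv_clm (((snd ℝ _ _).comp (fst ℝ _ _)).prod
      (snd ℝ _ _)) he w
    refine h1.symm.trans ?_
    rw [← tderiv_comp_fderiv ((contDiffAt_readCoord (frameCoord_form₀_ne hp)).differentiableAt (by simp))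
      (smoothNear_frameCoord hp).mdiff w]
    refine tderiv_congr ?_ w
    filter_upwards [near_frameChart hp] with p' hp'
    exact (readCoord_frameCoord hp').symm

/-- A tangent vector of the canonical bundle is determined by its projection and by the derivative of
the frame. -/
theorem tangent_ext (hp : InChart ψ σ p₀ p)
    {v w : T[HE] p} (h1 : dfoot p v = dfoot p w)
    (h2 : tderiv (frameCoord σ) p v = tderiv (frameCoord σ) p w) : v = w := by
  refine (smoothChart_frameChart ψ σ p₀).tderiv_injective (mem_frameChart_source_iff.2 hp) ?_
  have e1 := tderiv_frameChart hp v
  have e2 := tderiv_frameChart hp w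
  rw [h1, h2] at e1
  have e3 := e1.2.trans e2.2.symm
  have e4 := congrArg Prod.fst e3
  have e5 := congrArg Prod.snd e3
  exact Prod.ext (Prod.ext (e1.1.trans e2.1.symm) e4) e5

/-- A map into the canonical bundle is smooth if its projection and its frame are. -/
theorem smoothNear_of_frameCoord {K : Type*} [NormedAddCommGroup K] [NormedSpace ℝ K]
    {Z : Type*} [TopologicalSpace Z] [ChartedSpace K Z] {G : Z → S.Bundle} {z : Z}
    (hp : (G z).base ∈ (lineChart ψ σ p₀.base).source)
    (h1 : Smooth[K, HN] (fun z => foot (G z)) z)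
    (h2 : Smooth[K, End[k]] (fun z => frameCoord σ (G z)) z) :
    Smooth[K, HE] G z := by
  have hb0 := frameCoord_form₀_ne hp
  have hr : Smooth[K, ℝ × ℝ × ℝ × ℝ] (fun z => readCoord k (frameCoord σ (G z))) z := by
    refine SmoothNear.comp_space (g := readCoord k) ?_ h2
    have hc : Continuous fun B : End[k] => B (form₀ k) 0 :=
      (continuous_apply 0).comp (ContinuousLinearMap.apply ℝ (BForm k) (form₀ k)).continuous
    filter_upwards [hc.continuousAt.eventually_ne hb0] with B hB
    exact contDiffAt_readCoord hB
  have hψ : Smooth[K, HN] (fun z => ψ.1 (foot (G z))) z :=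
    SmoothNear.comp_map ((smoothChart_of_mem_atlas ψ.2).smoothNear hp.1) h1
  have hu : Smooth[K, HE] (fun z => ((ψ.1 (foot (G z)),
      (readCoord k (frameCoord σ (G z))).1), (readCoord k (frameCoord σ (G z))).2)) z :=
    (hψ.prodMk (hr.clm (fst ℝ _ _))).prodMk (hr.clm (snd ℝ _ _))
  have hmem : ∀ᶠ z' in 𝓝 z, (G z').base ∈ (lineChart ψ σ p₀.base).source := by
    have hc : ContinuousAt (fun z' => frameCoord σ (G z') (form₀ k) 0) z :=
      ((continuous_apply (0 : Fin (k + 1))).comp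
        (ContinuousLinearMap.apply ℝ (BForm k) (form₀ k)).continuous).continuousAt.comp
          h2.at.continuousAt
    have hf : ContinuousAt (fun z' => foot (G z')) z := h1.at.continuousAt
    filter_upwards [hc.eventually_ne hb0, hf.eventually (ψ.1.open_source.mem_nhds hp.1),
      hf.eventually (IsLocalSection.near hp.2.1)] with z' a1 a2 a3
    exact (mem_source_of_frame (p₀ := p₀) a2 a3 (isGL2_frameCoord a3) a1
      (by ext1 a; exact (apply_frameCoord a3 a).symm)).1
  have heq : ∀ᶠ z' in 𝓝 z, frameChart ψ σ p₀ (G z') = ((ψ.1 (foot (G z')),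
      (readCoord k (frameCoord σ (G z'))).1), (readCoord k (frameCoord σ (G z'))).2) := by
    filter_upwards [hmem] with z' hz'
    rw [readCoord_frameCoord hz']
    rfl
  have hs := (smoothChart_frameChart ψ σ p₀).smoothNear_symm
    ((frameChart ψ σ p₀).map_source (mem_frameChart_source_iff.2 hp))
  rw [heq.self_of_nhds] at hs
  refine (SmoothNear.comp_map (f := (frameChart ψ σ p₀).symm) (π := fun z => ((ψ.1 (foot (G z)),
      (readCoord k (frameCoord σ (G z))).1), (readCoord k (frameCoord σ (G z))).2)) hs hu).congr ?_
  filter_upwards [heq, hmem] with z' e1 e2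
  rw [← e1]
  exact ((frameChart ψ σ p₀).left_inv (mem_frameChart_source_iff.2 e2)).symm

/-- A vector field on the canonical bundle is smooth if its projection and the derivative of the frame
along it are. -/
theorem smoothFieldNear_of_frameCoord (hp : InChart ψ σ p₀ p)
    {W : ∀ p : S.Bundle, T[HE] p}
    {u : S.Bundle → HN}
    (hu : Smooth[HE, HN] u p)
    (hu' : ∀ᶠ p' in 𝓝 p, tderiv ψ.1 p'.base.base (dfoot p' (W p')) = u p')
    {A : S.Bundle → End[k]}
    (hA : Smooth[HE, End[k]] A p)
    (hA' : ∀ᶠ p' in 𝓝 p, tderiv (frameCoord σ) p' (W p') = A p') : SmoothFieldNear W p := by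
  have hb0 := frameCoord_form₀_ne hp
  have hd : Smooth[HE, End[k] →L[ℝ] ℝ × ℝ × ℝ × ℝ]
      (fun p' => fderiv ℝ (readCoord k) (frameCoord σ p')) p := by
    refine SmoothNear.comp_space (g := fderiv ℝ (readCoord k)) ?_ (smoothNear_frameCoord hp)
    have hc : Continuous fun B : End[k] => B (form₀ k) 0 :=
      (continuous_apply 0).comp (ContinuousLinearMap.apply ℝ (BForm k) (form₀ k)).continuous
    filter_upwards [hc.continuousAt.eventually_ne hb0] with B hB
    exact (contDiffAt_readCoord hB).fderiv_right (by simp)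
  have hr := hd.clm_apply hA
  refine (smoothChart_frameChart ψ σ p₀).smoothFieldNear (mem_frameChart_source_iff.2 hp)
    ((hu.prodMk (hr.clm (fst ℝ _ _))).prodMk (hr.clm (snd ℝ _ _))) ?_
  filter_upwards [hu', hA', near_frameChart hp] with p' h1 h2 h3
  have h4 := tderiv_frameChart h3 (W p')
  rw [h1, h2] at h4
  have e4 := congrArg Prod.fst h4.2
  have e5 := congrArg Prod.snd h4.2
  exact Prod.ext (Prod.ext h4.1 e4) e5

end FrameCoord

/-! ### Vertical vector fields -/

section Vertical

variable {ψ : BaseChart N k} {σ : FrameField k N} {p p₀ : S.Bundle}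

theorem tderiv_of_eq {F : Type*} [NormedAddCommGroup F] [NormedSpace ℝ F] {f : S.Bundle → F}
    {p q : S.Bundle} (h : p = q) (v : HE) :
    tderiv f p (v : T[HE] p) = tderiv f q (v : T[HE] q) := by
  subst h; rfl

/-- The velocity of a curve in a fibre of the canonical bundle, along which the frame is
moved by a curve of operators. -/
theorem velocity_of_frame {γ : ℝ → S.Bundle} (h0 : γ 0 = p)
    (hb : ∀ s, (γ s).base.base = p.base.base) {fl : ℝ → End[k]}
    {D : End[k]} (hfl : ContDiff ℝ ∞ fl) (hD : HasDerivAt fl D 0)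
    (hγ : ∀ s a, (frame (γ s) a : HN) = frame p (fl s a)) :
    Smooth[ℝ, HE] γ 0 ∧ dfoot p (velocity γ p) = 0 ∧
      ∀ (ψ : BaseChart N k) (σ : FrameField k N) (p₀ : S.Bundle)
        (_ : InChart ψ σ p₀ p),
        tderiv (frameCoord σ) p (velocity γ p) = (frameCoord σ p).comp D := by
  have key : ∀ (ψ : BaseChart N k) (σ : FrameField k N) (p₀ : S.Bundle)
      (_ : InChart ψ σ p₀ p),
      ∀ s, frameCoord σ (γ s) = (frameCoord σ p).comp (fl s) := fun ψ σ p₀ hp s => by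
    refine frameCoord_eq_of_apply (hb s) hp.2.1 fun a => (hγ s a).trans ?_
    exact (apply_frameCoord hp.2.1 (fl s a)).symm
  have hs : Smooth[ℝ, HE] γ 0 := by
    obtain ⟨ψ, σ, hp⟩ := exists_frameChart p
    refine smoothNear_of_frameCoord (ψ := ψ) (σ := σ) (p₀ := p) (by rw [h0]; exact hp) ?_ ?_
    · exact (smoothNear_const p.base.base).congr (.of_forall hb)
    · have : (fun s => frameCoord σ (γ s)) = fun s => (frameCoord σ p).comp (fl s) :=
        funext (key ψ σ p hp)
      rw [this]
      exact .of_forall fun s => (contDiff_const.clm_comp hfl).contDiffAt.contMDiffAt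
  refine ⟨hs, ?_, fun ψ σ p₀ hp => ?_⟩
  · have h1 : d[ℝ, HN] (fun s => foot (γ s)) 0 = 0 := by
      have : (fun s => foot (γ s)) = fun _ => p.base.base := funext hb
      rw [this]
      exact mfderiv_const
    have h2 := mfderiv_comp 0 (I := 𝓘(ℝ, ℝ)) (I' := 𝓘(ℝ, HE)) (I'' := 𝓡 (k + 1))
      (g := (foot : S.Bundle → N)) (f := γ) (smoothNear_foot _).mdiff hs.mdiff
    have h3 := congrArg (fun L : ℝ →L[ℝ] HN => L 1) (h2.symm.trans h1)
    have h4 : ∀ q (_ : γ 0 = q) , dfoot q (velocity γ q) =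
        (d[HE, HN] (foot : S.Bundle → N) (γ 0) (d[ℝ, HE] γ 0 (1 : ℝ)) : HN) := by
      rintro q rfl; rfl
    exact (h4 p h0).trans h3
  · have hp' : (γ 0).base ∈ (lineChart ψ σ p₀.base).source := by rw [h0]; exact hp
    have h1 := hasDerivAt_comp_curve (f := frameCoord σ) (γ := γ) (s := 0)
      (smoothNear_frameCoord hp').mdiff hs.mdiff
    have h2 : HasDerivAt (fun s => (frameCoord σ p).comp (fl s)) ((frameCoord σ p).comp D) 0 := by
      have := (hasDerivAt_const (0 : ℝ) (frameCoord σ p)).clm_comp hD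
      simpa using this
    have h3 := h1.unique (h2.congr_of_eventuallyEq (.of_forall (key ψ σ p₀ hp)))
    exact (tderiv_of_eq h0.symm _).trans h3

theorem frame_comp_mem (p : S.Bundle) {B : End[k]} (hB : IsGL2 B) :
    (frame p).comp B ∈ S.frames p.base.base := comp_mem_frames (frame_mem p) hB

/-- The point whose frame is the frame of `p`, composed with an element of the structure group. -/
def translate (p : S.Bundle) (B : End[k]) (hB : IsGL2 B) : S.Bundle :=
  point p.base.base ((frame p).comp B) (frame_comp_mem p hB)

/-- The vector field of the translations `flX`. -/
def fundX (p : S.Bundle) : T[HE] p := velocity (fun s => translate p (flX k s) (isGL2_flX s)) p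

theorem translate_id (p : S.Bundle) (B : End[k]) (hB : IsGL2 B)
    (h : B = ContinuousLinearMap.id ℝ _) : translate p B hB = p := by
  subst h
  exact eq_of_frame_eq (point_base _ _ _) (frame_point _ _ _)

theorem fundX_spec (p : S.Bundle) :
    Smooth[ℝ, HE] (fun s => translate p (flX k s) (isGL2_flX s)) 0 ∧
    dfoot p (fundX p) = 0 ∧ ∀ (ψ : BaseChart N k) (σ : FrameField k N) (p₀ : S.Bundle)
        (_ : InChart ψ σ p₀ p),
        tderiv (frameCoord σ) p (fundX p) = (frameCoord σ p).comp (opX k) :=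
  velocity_of_frame (translate_id p _ (isGL2_flX 0) flX_zero) (fun _ => point_base _ _ _) contDiff_flX
    hasDerivAt_flX fun _ _ => frame_point _ _ _ _

theorem coordOp_comp_actOp {c a b t y x₀ x₁ : ℝ} (ha : a ≠ 0) :
    (coordOp k (t, y, x₀, x₁)).comp (actOp k c a b) =
      coordOp k (t, y * c, a⁻¹ * x₀, 2 * b * a⁻¹ + a⁻¹ * x₁) :=
  clm_ext_linearPower fun r => by
    rw [comp_apply, actOp, smul_apply, linearSubst_linearPower, map_smul,
      coordOp_linearPower, coordOp_linearPower, smul_smul]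
    simp only
    have e1 : 1 * 1 + r * (-b / a) - (1 * 0 + r * (1 / a)) * x₁ / 2 =
        1 - r * (2 * b * a⁻¹ + a⁻¹ * x₁) / 2 := by
      field_simp
      ring
    have e2 : (1 * 1 + r * (-b / a)) * t + (1 * 0 + r * (1 / a)) * (x₀ - x₁ * t / 2) =
        1 * t + r * (a⁻¹ * x₀ - (2 * b * a⁻¹ + a⁻¹ * x₁) * t / 2) := by
      field_simp
      ring
    rw [e1, e2, mul_comm]

/-- The action of `Gl(1) ⊕ Aff(1)` is the right translation of frames by the subgroup of `Gl(2)` which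
preserves the line of `λ ^ k`. -/
theorem frame_act (c a : ℝˣ) (b : ℝ) (p : S.Bundle) :
    frame (act c a b p) = (frame p).comp (actOp k c a b) := by
  obtain ⟨ψ, σ, hp⟩ := exists_frameChart p
  obtain ⟨h1, hy, hx⟩ := isCoord_frameChart hp
  obtain ⟨⟨y, x₀, x₁⟩, q⟩ : ∃ c, (frameChart ψ σ p p).2 = c := ⟨_, rfl⟩
  rw [q] at h1 hy hx
  have hc : IsCoord (vertField S ψ σ p.base) (tautField S ψ σ p.base) (act c a b p)
      (y * c, (a : ℝ)⁻¹ * x₀, 2 * b * (a : ℝ)⁻¹ + (a : ℝ)⁻¹ * x₁) := by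
    constructor
    · change (c : ℝ) • p.vec = (y * c) • _
      rw [h1.1, smul_smul, mul_comm]
      rfl
    · change {Y | ∃ X ∈ p.jet, JetRel p.base X Y (a : ℝ)⁻¹ (2 * b * (a : ℝ)⁻¹)} = _
      have hne : vertField S ψ σ p.base p.base ≠ 0 := (isFrameAt hp).fst_ne_zero
      obtain ⟨X', hX'⟩ := exists_jetRel hne x₀ x₁
      ext Y
      constructor
      · rintro ⟨X, hX, hY⟩
        rw [h1.2] at hX
        exact hX.comp hY
      · intro hY
        refine ⟨X', by rw [h1.2]; exact hX', ?_⟩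
        have h3 := setOf_jetRel_eq (b₀ := (a : ℝ)⁻¹) (b₁ := 2 * b * (a : ℝ)⁻¹) hx hX'
        have h4 : Y ∈ {Y | JetRel p.base (vertField S ψ σ p.base) Y ((a : ℝ)⁻¹ * x₀)
          (2 * b * (a : ℝ)⁻¹ + (a : ℝ)⁻¹ * x₁)} := hY
        rw [← h3] at h4
        exact h4
  have hp' : (act c a b p).base ∈ (lineChart ψ σ p.base).source := hp
  have e1 := frame_eq (p := act c a b p) (p₀ := p) hp'
  have e2 := frame_eq (p := p) (p₀ := p) hp
  have e3 : groupCoord ψ σ p p = ((lineChart ψ σ p.base p.base).2, y, x₀, x₁) := by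
    rw [groupCoord, q]; rfl
  rw [groupCoord_eq hp' hc] at e1
  rw [e3] at e2
  refine e1.trans ?_
  rw [e2, comp_assoc, coordOp_comp_actOp a.ne_zero]
  rfl

theorem act_one (p : S.Bundle) : act 1 1 0 p = p := by
  refine eq_of_frame_eq rfl fun a => ?_
  rw [frame_act]
  simp [actOp, linearSubst_one]
  rfl

theorem fundG_spec (p : S.Bundle) : dfoot p (fundG p) = 0 ∧
    ∀ (ψ : BaseChart N k) (σ : FrameField k N) (p₀ : S.Bundle)
        (_ : InChart ψ σ p₀ p),
        tderiv (frameCoord σ) p (fundG p) = (frameCoord σ p).comp (ContinuousLinearMap.id ℝ _) := by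
  refine (velocity_of_frame (p := p)
    (γ := fun t => act (Units.mk0 (Real.exp t) (Real.exp_ne_zero t)) 1 0 p) ?_ (fun s => rfl) contDiff_flG hasDerivAt_flG fun s a => ?_).2
  · have : Units.mk0 (Real.exp 0) (Real.exp_ne_zero 0) = 1 := Units.ext Real.exp_zero
    rw [this, act_one]
  · rw [frame_act]
    simp only [actOp, flG, Units.val_mk0, Units.val_one, neg_zero, div_one, linearSubst_one]
    rfl

theorem fundF₀_spec (p : S.Bundle) : dfoot p (fundF₀ p) = 0 ∧
    ∀ (ψ : BaseChart N k) (σ : FrameField k N) (p₀ : S.Bundle)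
        (_ : InChart ψ σ p₀ p),
        tderiv (frameCoord σ) p (fundF₀ p) = (frameCoord σ p).comp (opF₀ k) := by
  refine (velocity_of_frame (p := p)
    (γ := fun t => act 1 (Units.mk0 (Real.exp t) (Real.exp_ne_zero t)) 0 p) ?_ (fun s => rfl) contDiff_flF₀ hasDerivAt_flF₀ fun s a => ?_).2
  · have : Units.mk0 (Real.exp 0) (Real.exp_ne_zero 0) = 1 := Units.ext Real.exp_zero
    rw [this, act_one]
  · rw [frame_act]
    simp only [actOp, flF₀, Units.val_mk0, Units.val_one, neg_zero, zero_div, one_smul, one_div,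
      Real.exp_neg]
    rfl

theorem fundF₁_spec (p : S.Bundle) : dfoot p (fundF₁ p) = 0 ∧
    ∀ (ψ : BaseChart N k) (σ : FrameField k N) (p₀ : S.Bundle)
        (_ : InChart ψ σ p₀ p),
        tderiv (frameCoord σ) p (fundF₁ p) = (frameCoord σ p).comp (opF₁ k) := by
  refine (velocity_of_frame (p := p) (γ := fun t => act 1 1 t p) ?_ (fun s => rfl) contDiff_flF₁ hasDerivAt_flF₁ fun s a => ?_).2
  · rw [act_one]
  · rw [frame_act]
    simp only [actOp, flF₁, Units.val_one, one_smul, div_one]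
    rfl

/-- The vertical vector field which moves the frames by the operator `D`. -/
def IsVerticalField (D : End[k])
    (Y : ∀ p : S.Bundle, T[HE] p) : Prop :=
  ∀ p : S.Bundle, dfoot p (Y p) = 0 ∧
    ∀ (ψ : BaseChart N k) (σ : FrameField k N) (p₀ : S.Bundle)
        (_ : InChart ψ σ p₀ p),
        tderiv (frameCoord σ) p (Y p) = (frameCoord σ p).comp D

theorem isVerticalField_X : IsVerticalField (S := S) (opX k) fundX := fun p => (fundX_spec p).2
theorem isVerticalField_G : IsVerticalField (S := S) (ContinuousLinearMap.id ℝ _) fundG := fundG_spec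
theorem isVerticalField_F₀ : IsVerticalField (S := S) (opF₀ k) fundF₀ := fundF₀_spec
theorem isVerticalField_F₁ : IsVerticalField (S := S) (opF₁ k) fundF₁ := fundF₁_spec

theorem SmoothNear.clm_comp_const {D : End[k]} {A : S.Bundle → End[k]}
    (hA : Smooth[HE, End[k]] A p) :
    Smooth[HE, End[k]] (fun p => (A p).comp D) p :=
  hA.clm ((ContinuousLinearMap.compL ℝ (BForm k) (BForm k) (BForm k)).flip D)

theorem IsVerticalField.smoothFieldNear {D : End[k]}
    {Y : ∀ p : S.Bundle, T[HE] p} (h : IsVerticalField D Y) (p : S.Bundle) :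
    SmoothFieldNear Y p := by
  obtain ⟨ψ, σ, hp⟩ := exists_frameChart p
  refine smoothFieldNear_of_frameCoord hp (smoothNear_const 0) ?_
    (SmoothNear.clm_comp_const (D := D) (smoothNear_frameCoord hp)) ?_
  · exact .of_forall fun p' => by rw [(h p').1, tderiv_vzero]
  · exact (near_frameChart hp).mono fun p' hp' => (h p').2 ψ σ p hp'

end Vertical

/-! ### The partial connection -/

namespace CurveBundle

variable {ψ : BaseChart N k} {σ : FrameField k N} {m₀ m : S.CurveBundle}

local notation "HM" => (HN × ℝ)

theorem smoothNear_comp_vertCurve (hm : m ∈ (lineChart ψ σ m₀).source) {F : Type*}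
    [NormedAddCommGroup F] [NormedSpace ℝ F] {h : S.CurveBundle → F} {s : ℝ}
    (hh : Smooth[HM, F] h (vertCurve ψ σ m₀ m s)) :
    ∀ᶠ r in 𝓝 s, ContDiffAt ℝ ∞ (fun r => h (vertCurve ψ σ m₀ m r)) r :=
  (SmoothNear.comp_map hh (smoothNear_vertCurve hm s)).mono fun _ h => h.contDiffAt

/-- Along a line of the fibration of the curve bundle, the derivative along a vertical field is
multiplied by the coefficient of the field. -/
theorem fieldDeriv_iterate_vertCurve (hm : m ∈ (lineChart ψ σ m₀).source)
    {X : ∀ m : S.CurveBundle, T[HM] m} {f : S.CurveBundle → ℝ} {s : ℝ}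
    (hX : SmoothFieldNear X (vertCurve ψ σ m₀ m s))
    (hf : ∀ᶠ z in 𝓝 (vertCurve ψ σ m₀ m s), X z = f z • vertField S ψ σ m₀ z) (i : ℕ) :
    ∀ {h : S.CurveBundle → ℝ}, Smooth[HM, ℝ] h (vertCurve ψ σ m₀ m s) →
      ∀ᶠ r in 𝓝 s, (fieldDeriv X)^[i] h (vertCurve ψ σ m₀ m r) =
        derivIter (fun r => f (vertCurve ψ σ m₀ m r)) i (fun r => h (vertCurve ψ σ m₀ m r)) r := by
  induction i with
  | zero => intro h _; exact .of_forall fun _ => rfl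
  | succ i ih =>
    intro h hh
    have hc : ContinuousAt (vertCurve ψ σ m₀ m) s := (smoothNear_vertCurve hm s).at.continuousAt
    have h1 : (fun r => fieldDeriv X h (vertCurve ψ σ m₀ m r)) =ᶠ[𝓝 s]
        fun r => f (vertCurve ψ σ m₀ m r) * deriv (fun r => h (vertCurve ψ σ m₀ m r)) r := by
      filter_upwards [hc.eventually hh.near, hc.eventually hf] with r h2 h3
      rw [(hasDerivAt_comp_vertCurve hm h2.mdiff).deriv]
      refine (congrArg (tderiv h (vertCurve ψ σ m₀ m r)) h3).trans ?_
      rw [tderiv_vsmul, smul_eq_mul]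
    filter_upwards [ih (hh.tderiv hX : Smooth[HM, ℝ] (fieldDeriv X h) _),
      derivIter_congr h1 i] with r h2 h3
    rw [Function.iterate_succ_apply, derivIter_succ]
    exact Eq.trans h2 h3

/-- The generators `f X` of the vertical distribution and the multiples `g V` of the tautological
field which form projective–normal frames: the derivative of `g` and the second derivative of `f`
vanish at a point where `f = g = 1` and `X(f) = 0`. -/
theorem projective_coeff (hk : 2 ≤ k) (hm : m ∈ (lineChart ψ σ m₀).source)
    (ht : (lineChart ψ σ m₀ m).2 = 0)
    {X V : ∀ m : S.CurveBundle, T[HM] m} {f g : S.CurveBundle → ℝ}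
    (hXV : S.pair.IsProjectiveNear k X V m)
    (hf : Smooth[HM, ℝ] f m) (hg : Smooth[HM, ℝ] g m)
    (hX : ∀ᶠ z in 𝓝 m, X z = f z • vertField S ψ σ m₀ z)
    (hV : ∀ᶠ z in 𝓝 m, z.dproj (V z) = z.dproj (g z • tautField S ψ σ m₀ z))
    (hf0 : f m = 1) (hf1 : fieldDeriv (vertField S ψ σ m₀) f m = 0) (hg0 : g m = 1) :
    fieldDeriv (vertField S ψ σ m₀) g m = 0 ∧
      fieldDeriv (vertField S ψ σ m₀) (fieldDeriv (vertField S ψ σ m₀) f) m = 0 := by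
  set c := vertCurve ψ σ m₀ m with hcdef
  have hc0 : c 0 = m := vertCurve_zero hm
  have hc : Tendsto c (𝓝 0) (𝓝 m) := by
    have := (smoothNear_vertCurve hm 0).at.continuousAt.tendsto
    rwa [← hcdef, hc0] at this
  have hXs : SmoothFieldNear X m := hXV.1.mono fun z hz => hz.smooth_fst
  have hVs : SmoothFieldNear V m := hXV.1.mono fun z hz => hz.smooth_snd
  let w : S.CurveBundle → BForm k := fun z => g z • linearPower k 1 (lineChart ψ σ m₀ z).2
  have hlin : ∀ z ∈ (lineChart ψ σ m₀).source, Smooth[HM, BForm k]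
      (fun z => linearPower k 1 (lineChart ψ σ m₀ z).2) z := fun z hz =>
    SmoothNear.comp_space (g := fun t => linearPower k 1 t)
      (.of_forall fun _ => contDiff_linearPower.contDiffAt) (smoothNear_affineCoord hz)
  have hw : Smooth[HM, BForm k] w m := hg.smul (hlin m hm)
  have hw' : ∀ᶠ z in 𝓝 m, z.dproj (V z) = σ z.base (w z) := by
    filter_upwards [hV, near_lineChart hm] with z h1 h2
    rw [h1, map_smul, dproj_tautField h2, map_smul]
  have hX0 : ∀ᶠ z in 𝓝 m, z.dproj (X z) = 0 := by
    filter_upwards [hX, near_lineChart hm] with z h1 h2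
    rw [h1, map_smul, dproj_vertField h2, smul_zero]
  have had : ∀ i, ∀ᶠ z in 𝓝 m, z.dproj (adField X V i z) = σ z.base ((fieldDeriv X)^[i] w z) :=
    fun i => mfderiv_adField_of_vertical (π := (base : S.CurveBundle → N))
      hm.2.1.smoothFrameNear (smoothNear_base m) hXs hVs hX0 hw' i
  have hadall : ∀ᶠ z in 𝓝 m, ∀ i ∈ Finset.range k,
      z.dproj (adField X V i z) = σ z.base ((fieldDeriv X)^[i] w z) :=
    (Finset.eventually_all _).2 fun i _ => had i
  have hspan : ∀ᶠ z in 𝓝 m, (fieldDeriv X)^[k + 1] w z ∈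
      Submodule.span ℝ {a | ∃ i, i + 2 ≤ k ∧ a = (fieldDeriv X)^[i] w z} := by
    filter_upwards [hXV.2, had (k + 1), hadall, hX0, near_lineChart hm] with z h1 h2 h3 h4 h5
    have h6 := Submodule.mem_map_of_mem (f := z.dproj.toLinearMap) h1
    rw [Submodule.map_span] at h6
    have h7 : z.dproj.toLinearMap (adField X V (k + 1) z) = σ z.base ((fieldDeriv X)^[k + 1] w z) := h2
    rw [h7] at h6
    have hσ : Function.Injective (σ z.base) := (S.bijective _ _ h5.2.1.mem).1
    have h8 : Submodule.span ℝ (z.dproj.toLinearMap '' ({X z} ∪ {w | ∃ i, i + 2 ≤ k ∧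
        w = adField X V i z})) ≤ (Submodule.span ℝ {a | ∃ i, i + 2 ≤ k ∧
          a = (fieldDeriv X)^[i] w z}).map (σ z.base).toLinearMap := by
      rw [Submodule.span_le]
      rintro _ ⟨a, rfl | ⟨i, hi, rfl⟩, rfl⟩
      · exact (congrArg (· ∈ _) h4).mpr (Submodule.zero_mem _)
      · refine (congrArg (· ∈ _) (h3 i (Finset.mem_range.2 (by omega)))).mpr ?_
        exact Submodule.mem_map_of_mem (f := (σ z.base).toLinearMap)
          (Submodule.subset_span ⟨i, hi, rfl⟩)
    obtain ⟨a, ha, ha'⟩ := h8 h6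
    rwa [← hσ ha']
  -- the functional is composed with the iterated derivatives along the curve through `m`
  have main : ∀ j, k ≤ j + 1 → j ≤ k → ∀ᶠ s₁ in 𝓝 (0 : ℝ),
      derivIter (fun s => f (c s)) (k + 1) (fun s => (s - s₁) ^ j * g (c s)) s₁ = 0 := by
    intro j hj hj'
    filter_upwards [hc.eventually hspan, hc.eventually hf.near, hc.eventually hg.near,
      hc.eventually hXs.near, hc.eventually hX.eventually_nhds, hc.eventually hw.near]
      with s₁ h1 h2 h3 h4 h5 h6
    obtain ⟨L, hL⟩ := exists_powerFunctional (k := k) hj' s₁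
    have e1 : ∀ i, L ((fieldDeriv X)^[i] w (c s₁)) =
        derivIter (fun s => f (c s)) i (fun s => (s - s₁) ^ j * g (c s)) s₁ := fun i => by
      rw [(clm_fieldDeriv_iterate h4 h6 L i).self_of_nhds,
        (fieldDeriv_iterate_vertCurve hm h4 h5 i (h6.clm L)).self_of_nhds]
      congr 1
      funext s
      simp only [w]
      rw [map_smul, hL, (vertCurve_spec hm s).2.1, ht, zero_add, smul_eq_mul, mul_comm]
    rw [← e1]
    have hle : Submodule.span ℝ {a | ∃ i, i + 2 ≤ k ∧ a = (fieldDeriv X)^[i] w (c s₁)} ≤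
        LinearMap.ker L.toLinearMap := by
      rw [Submodule.span_le]
      rintro _ ⟨i, hi, rfl⟩
      refine LinearMap.mem_ker.2 ((e1 i).trans ?_)
      exact derivIter_pow_mul_of_lt (smoothNear_comp_vertCurve hm h2).self_of_nhds
        (smoothNear_comp_vertCurve hm h3).self_of_nhds (by omega)
    exact LinearMap.mem_ker.1 (hle h1)
  have hd : ∀ {h : S.CurveBundle → ℝ}, Smooth[HM, ℝ] h m →
      ∀ᶠ s in 𝓝 (0 : ℝ), deriv (fun s => h (c s)) s = fieldDeriv (vertField S ψ σ m₀) h (c s) := by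
    intro h hh
    filter_upwards [hc.eventually hh.near] with s hs
    exact (hasDerivAt_comp_vertCurve hm hs.mdiff).deriv
  have hd0 : ∀ {h : S.CurveBundle → ℝ}, Smooth[HM, ℝ] h m →
      deriv (fun s => h (c s)) 0 = fieldDeriv (vertField S ψ σ m₀) h m := by
    intro h hh
    rw [(hd hh).self_of_nhds, hc0]
  have hfc : ∀ᶠ s in 𝓝 (0 : ℝ), ContDiffAt ℝ ∞ (fun s => f (c s)) s :=
    smoothNear_comp_vertCurve hm (by rw [← hcdef, hc0]; exact hf)
  have hgc : ∀ᶠ s in 𝓝 (0 : ℝ), ContDiffAt ℝ ∞ (fun s => g (c s)) s :=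
    smoothNear_comp_vertCurve hm (by rw [← hcdef, hc0]; exact hg)
  have key := deriv_eq_zero_of_projective (s₀ := 0) (f := fun s => f (c s)) (g := fun s => g (c s))
    (k := k) (by omega) hfc hgc (by rw [hc0, hf0]) (by rw [hd0 hf, hf1]) (by rw [hc0, hg0])
    (main k (by omega) le_rfl) (main (k - 1) (by omega) (by omega)).self_of_nhds
  rw [hd0 hg] at key
  refine ⟨key.1, ?_⟩
  have h9 := key.2
  rw [Filter.EventuallyEq.deriv_eq (hd hf)] at h9
  exact (hd0 (hf.tderiv (smoothFieldNear_vertField hm) :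
    Smooth[HM, ℝ] (fieldDeriv (vertField S ψ σ m₀) f) m)).symm.trans h9

end CurveBundle

section Adapted

variable {ψ : BaseChart N k} {σ : FrameField k N} {p p₀ : S.Bundle}

theorem vec_eq (hp : InChart ψ σ p₀ p) : p.vec =
    (groupCoord ψ σ p₀ p).2.1 • (S.pair.line p.base).mkQ (tautField S ψ σ p₀.base p.base) :=
  (isCoord_frameChart hp).1.1

theorem mkQ_dproj_iff (w : T[HE] p) :
    (S.pair.line p.base).mkQ (CanonicalBundle.dproj p w) = p.vec ↔
      dfoot p w = frame p (form₀ k) := by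
  obtain ⟨ψ, σ, hp⟩ := exists_frameChart p
  rw [vec_eq hp, ← map_smul, Submodule.mkQ_apply, Submodule.mkQ_apply, Submodule.Quotient.eq,
    dfoot_eq, frame_form₀ hp]
  have h1 : p.base.dproj ((frameChart ψ σ p p).2.1 • tautField S ψ σ p.base p.base) =
      (frameChart ψ σ p p).2.1 • σ p.base.base (linearPower k 1 (lineChart ψ σ p.base p.base).2) := by
    rw [map_smul, dproj_tautField hp]
  rw [← h1]
  refine (LinearMap.mem_ker).trans ?_
  refine Iff.trans ?_ sub_eq_zero
  refine Eq.congr_left ?_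
  exact map_sub p.base.dproj _ _

/-- The derivative of the fibre coordinates at a point where the frame is the reference frame. -/
theorem fderiv_readCoord_one {fl : ℝ → End[k]} {D : End[k]}
    (hD : HasDerivAt fl D 0) {q : ℝ → ℝ × ℝ × ℝ × ℝ} {q' : ℝ × ℝ × ℝ × ℝ}
    (hq' : HasDerivAt q q' 0) (hq : ∀ s, fl s = coordOp k (q s)) (hq0 : q 0 = (0, 1, 1, 0)) :
    fderiv ℝ (readCoord k) (ContinuousLinearMap.id ℝ _) D = q' := by
  have h0 : fl 0 = ContinuousLinearMap.id ℝ _ := by rw [hq, hq0, coordOp_one]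
  have h1 : idV (form₀ k) 0 ≠ 0 := by
    simp [form₀, linearPower_zero]
  have h2 := ((contDiffAt_readCoord h1).differentiableAt (by simp)).hasFDerivAt
  rw [← h0] at h2
  have h3 := h2.comp_hasDerivAt (0 : ℝ) hD
  rw [h0] at h3
  refine h3.unique (hq'.congr_of_eventuallyEq ?_)
  have h4 : ∀ᶠ s in 𝓝 (0 : ℝ), (q s).2.1 ≠ 0 := by
    have : ContinuousAt (fun s => (q s).2.1) 0 := by
      have := hq'.continuousAt
      fun_prop
    exact this.eventually_ne (by rw [hq0]; simp)
  filter_upwards [h4] with s hs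
  rw [Function.comp, hq, readCoord_coordOp hs]

theorem fderiv_readCoord_opX : fderiv ℝ (readCoord k) (ContinuousLinearMap.id ℝ _) (opX k) =
    (1, 0, 0, 0) := by
  refine fderiv_readCoord_one (hasDerivAt_flX (k := k)) (q := fun s => (s, 1, 1, 0)) ?_ (fun s => ?_)
    rfl
  · exact (hasDerivAt_id (0 : ℝ)).prodMk (hasDerivAt_const _ _)
  · refine clm_ext_linearPower fun r => ?_
    rw [flX, linearSubst_linearPower, coordOp_linearPower, one_smul]
    congr 1 <;> ring

theorem fderiv_readCoord_id : fderiv ℝ (readCoord k) (ContinuousLinearMap.id ℝ _)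
    (ContinuousLinearMap.id ℝ _) = (0, 1, 0, 0) := by
  refine fderiv_readCoord_one (hasDerivAt_flG (k := k)) (q := fun s => (0, Real.exp s, 1, 0)) ?_
    (fun s => ?_) (by simp)
  · have := Real.hasDerivAt_exp 0
    rw [Real.exp_zero] at this
    exact (hasDerivAt_const _ _).prodMk (this.prodMk (hasDerivAt_const _ _))
  · refine clm_ext_linearPower fun r => ?_
    rw [flG, coordOp_linearPower, smul_apply, id_apply]
    congr 2 <;> ring

theorem fderiv_readCoord_opF₀ : fderiv ℝ (readCoord k) (ContinuousLinearMap.id ℝ _) (opF₀ k) =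
    (0, 0, -1, 0) := by
  refine fderiv_readCoord_one (hasDerivAt_flF₀ (k := k)) (q := fun s => (0, 1, Real.exp (-s), 0)) ?_
    (fun s => ?_) (by simp)
  · have := (hasDerivAt_neg (0 : ℝ)).exp
    rw [neg_zero, Real.exp_zero, one_mul] at this
    exact (hasDerivAt_const _ _).prodMk ((hasDerivAt_const _ _).prodMk
      (this.prodMk (hasDerivAt_const _ _)))
  · refine clm_ext_linearPower fun r => ?_
    rw [flF₀, linearSubst_linearPower, coordOp_linearPower, one_smul]
    congr 1 <;> ring

theorem fderiv_readCoord_opF₁ : fderiv ℝ (readCoord k) (ContinuousLinearMap.id ℝ _) (opF₁ k) =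
    (0, 0, 0, 2) := by
  refine fderiv_readCoord_one (hasDerivAt_flF₁ (k := k)) (q := fun s => (0, 1, 1, 2 * s)) ?_
    (fun s => ?_) (by simp)
  · have := (hasDerivAt_id (0 : ℝ)).const_mul 2
    rw [mul_one] at this
    exact (hasDerivAt_const _ _).prodMk ((hasDerivAt_const _ _).prodMk
      ((hasDerivAt_const _ _).prodMk this))
  · refine clm_ext_linearPower fun r => ?_
    rw [flF₁, linearSubst_linearPower, coordOp_linearPower, one_smul]
    congr 1 <;> ring

/-- The derivatives of the coordinates along the field which moves the frames by `D`, at a point where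
the frame is the reference frame. -/
theorem IsVerticalField.tderiv_frameChart {D : End[k]}
    {Y : ∀ p : S.Bundle, T[HE] p} (hY : IsVerticalField D Y)
    (hp : InChart ψ σ p₀ p) (h1 : groupCoord ψ σ p₀ p = (0, 1, 1, 0))
    {q : ℝ × ℝ × ℝ × ℝ} (hD : fderiv ℝ (readCoord k) (ContinuousLinearMap.id ℝ _) D = q) :
    tderiv (frameChart ψ σ p₀) p (Y p) = ((0, q.1), q.2) := by
  have h2 := GL2Structure.tderiv_frameChart hp (Y p)
  rw [(hY p).1, tderiv_vzero, (hY p).2 ψ σ p₀ hp, frameCoord_eq_coordOp hp, h1, coordOp_one,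
    id_comp, hD] at h2
  have e1 := congrArg Prod.fst h2.2
  have e2 := congrArg Prod.snd h2.2
  exact Prod.ext (Prod.ext h2.1 e1) e2

/-- The frames of the sections defined by a projective–normal frame, in coordinates. -/
theorem section_coord (hp : InChart ψ σ p₀ p)
    {X V : VField (HN × ℝ) S.CurveBundle}
    {s : S.CurveBundle → S.Bundle} (hXV : S.pair.IsFrameNear X V p.base)
    (hs : IsSectionOf X V s p.base) :
    ∃ f g : S.CurveBundle → ℝ,
      Smooth[HN × ℝ, ℝ] f p.base ∧
      Smooth[HN × ℝ, ℝ] g p.base ∧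
      ∀ᶠ z in 𝓝 p.base, X z = f z • vertField S ψ σ p₀.base z ∧ f z ≠ 0 ∧
        z.dproj (V z) = z.dproj (g z • tautField S ψ σ p₀.base z) ∧
        (s z).base = z ∧
        frameChart ψ σ p₀ (s z) =
          (lineChart ψ σ p₀.base z, g z, f z, fieldDeriv (vertField S ψ σ p₀.base) f z) := by
  have hF := isFrameNear hp
  obtain ⟨f, hf⟩ := hF.exists_coeff_line (W := X) (hXV.mono fun y hy =>
    ⟨hy.smooth_fst, by rw [hy.line_eq]; exact Submodule.mem_span_singleton_self _⟩)
  obtain ⟨g, e, hg⟩ := hF.exists_coeff_plane (W := V) (hXV.mono fun y hy =>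
    ⟨hy.smooth_snd, by rw [hy.plane_eq]; exact Submodule.subset_span (by simp)⟩)
  refine ⟨f, g, hf.mono fun _ h => h.1, hg.mono fun _ h => h.1, ?_⟩
  filter_upwards [hf.eventually_nhds, hg, hs, hXV, hF, near_lineChart hp] with z h1 h2 h3 h4 h5 h6
  have hne : f z ≠ 0 := fun h0 => h4.fst_ne_zero (by rw [h1.self_of_nhds.2, h0, zero_smul])
  refine ⟨h1.self_of_nhds.2, hne, ?_, h3.1, ?_⟩
  · rw [h2.2, map_add, map_smul, dproj_vertField h6, smul_zero, zero_add]
  · obtain ⟨hb, hv, hj⟩ := h3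
    have h7 : ∀ q : S.Bundle, q.base = z → q.vec = (S.pair.line q.base).mkQ (V q.base) →
        q.jet = jetAt q.base X → frameChart ψ σ p₀ q =
          (lineChart ψ σ p₀.base z, g z, f z, fieldDeriv (vertField S ψ σ p₀.base) f z) := by
      rintro q rfl hv hj
      refine frameChart_apply h6 ⟨?_, ?_⟩
      · rw [hv, h2.2, map_add, map_smul, map_smul, h5.mkQ_fst, smul_zero, zero_add]
      · rw [hj, jetAt, setOf_jetRel_eq hne
          (⟨f, h1, rfl, rfl⟩ : JetRel q.base (vertField S ψ σ p₀.base) X _ _), one_mul, one_mul,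
          zero_add]
        rfl
    exact h7 _ hb hv hj

/-- The lines of the partial connection are spanned by the field of the translations `flX`. -/
theorem horizontalLine_eq (hk : 2 ≤ k) (p : S.Bundle) :
    horizontalLine k p = ℝ ∙ fundX p := by
  obtain ⟨ψ, σ, -, -, hp, h1⟩ := exists_adapted_chart p
  have ht : (lineChart ψ σ p.base p.base).2 = 0 := congrArg Prod.fst h1
  have hc : (frameChart ψ σ p p).2 = (1, 1, 0) := congrArg Prod.snd h1
  have hXc := (isVerticalField_X (S := S)).tderiv_frameChart hp h1 fderiv_readCoord_opX
  -- the derivative of a section in the vertical direction, in coordinates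
  have key : ∀ X V s, S.pair.IsFrameNear X V p.base → IsSectionOf X V s p.base → s p.base = p →
      ∀ f g : S.CurveBundle → ℝ,
      Smooth[HN × ℝ, ℝ] f p.base →
      Smooth[HN × ℝ, ℝ] g p.base →
      (∀ᶠ z in 𝓝 p.base, (s z).base = z ∧ frameChart ψ σ p (s z) =
          (lineChart ψ σ p.base z, g z, f z, fieldDeriv (vertField S ψ σ p.base) f z)) →
      X p.base = vertField S ψ σ p.base p.base →
      fieldDeriv (vertField S ψ σ p.base) g p.base = 0 →
      fieldDeriv (vertField S ψ σ p.base) f p.base = 0 →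
      fieldDeriv (vertField S ψ σ p.base) (fieldDeriv (vertField S ψ σ p.base) f) p.base = 0 →
      (d[HN × ℝ, HE] s p.base (X p.base) : HE) = fundX p := by
    intro X V s hXV hs hsp f g hf hg hfg hXm hg1 hf1 hf2
    have hX := smoothFieldNear_vertField hp
    have hu := ((smoothChart_lineChart ψ σ p.base).smoothNear hp).prodMk
      (hg.prodMk (hf.prodMk (hf.tderiv hX)))
    have hs' : ∀ᶠ z in 𝓝 p.base, s z = (frameChart ψ σ p).symm
        (lineChart ψ σ p.base z, g z, f z, fieldDeriv (vertField S ψ σ p.base) f z) := by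
      filter_upwards [hfg, near_lineChart hp] with z h2 h3
      rw [← h2.2]
      refine ((frameChart ψ σ p).left_inv (mem_frameChart_source_iff.2 ?_)).symm
      change (s z).base ∈ _
      rw [h2.1]; exact h3
    have hsm : Smooth[HN × ℝ, HE] s p.base := by
      have h4 := (smoothChart_frameChart ψ σ p).smoothNear_symm
        ((frameChart ψ σ p).map_source (mem_frameChart_source_iff.2 hp))
      have h5 := hfg.self_of_nhds.2
      rw [hsp] at h5
      rw [h5] at h4
      exact (SmoothNear.comp_map (f := (frameChart ψ σ p).symm) (π := fun z =>
        (lineChart ψ σ p.base z, g z, f z, fieldDeriv (vertField S ψ σ p.base) f z)) h4 hu).congr hs'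
    have h6 := tderiv_comp (f := frameChart ψ σ p) (π := s) (x := p.base)
      (by rw [hsp]; exact (smoothNear_frameChart hp).mdiff) hsm.mdiff (X p.base)
    have h7 := tderiv_congr (hfg.mono fun z hz => hz.2) (X p.base)
    have h8 : tderiv (fun z => (lineChart ψ σ p.base z, g z, f z,
        fieldDeriv (vertField S ψ σ p.base) f z)) p.base (X p.base) = ((0, 1), 0, 0, 0) := by
      rw [hXm]
      refine (tderiv_prodMk ((smoothChart_lineChart ψ σ p.base).smoothNear hp).mdiff
        (hg.prodMk (hf.prodMk (hf.tderiv hX))).mdiff _).trans ?_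
      refine Prod.ext (tderiv_vertField hp) ?_
      refine (tderiv_prodMk hg.mdiff (hf.prodMk (hf.tderiv hX)).mdiff _).trans ?_
      refine Prod.ext hg1 ?_
      refine (tderiv_prodMk hf.mdiff (hf.tderiv hX).mdiff _).trans ?_
      exact Prod.ext hf1 hf2
    have h9 : ∀ q, q = p → ∀ v : HE,
        tderiv (frameChart ψ σ p) q (v : T[HE] q) = ((0, 1), 0, 0, 0) →
        v = fundX p := by
      rintro q rfl v hv
      exact (smoothChart_frameChart ψ σ q).tderiv_injective (mem_frameChart_source_iff.2 hp)
        (hv.trans hXc.symm)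
    exact h9 _ hsp _ (h6.symm.trans (h7.trans h8))
  apply le_antisymm
  · refine Submodule.span_le.2 ?_
    rintro w ⟨X, V, s, hXV, hs, hsp, rfl⟩
    obtain ⟨f, g, hf, hg, hfg⟩ := section_coord hp hXV.1 hs
    have h2 := hfg.self_of_nhds.2.2.2.2
    have e1 : (1, 1, 0) = (g p.base, f p.base, fieldDeriv (vertField S ψ σ p.base) f p.base) := by
      have h3 := congrArg Prod.snd h2
      rw [hsp, hc] at h3
      exact h3
    have hg0 : g p.base = 1 := (congrArg Prod.fst e1).symm
    have hf0 : f p.base = 1 := (congrArg (fun q : ℝ × ℝ × ℝ => q.2.1) e1).symm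
    have hf1 : fieldDeriv (vertField S ψ σ p.base) f p.base = 0 :=
      (congrArg (fun q : ℝ × ℝ × ℝ => q.2.2) e1).symm
    have h4 := projective_coeff hk hp ht hXV hf hg (hfg.mono fun _ h => h.1)
      (hfg.mono fun _ h => h.2.2.1) hf0 hf1 hg0
    have hXm : X p.base = vertField S ψ σ p.base p.base := by
      rw [hfg.self_of_nhds.1, hf0, one_smul]
    have h5 := key X V s hXV.1 hs hsp f g hf hg (hfg.mono fun _ h => h.2.2.2) hXm h4.1 hf1 h4.2
    exact (congrArg (· ∈ (ℝ ∙ fundX p)) h5).mpr (Submodule.mem_span_singleton_self _)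
  · rw [Submodule.span_singleton_le_iff_mem]
    -- the coordinate fields form a projective–normal frame
    let s : S.CurveBundle → S.Bundle := fun z =>
      (frameChart ψ σ p).symm (lineChart ψ σ p.base z, 1, 1, 0)
    have hs : ∀ᶠ z in 𝓝 p.base, ∃ h : S.pair.IsFrameNear (vertField S ψ σ p.base)
        (tautField S ψ σ p.base) z, s z = ofCoord h (1, 1, 0) one_ne_zero one_ne_zero := by
      filter_upwards [near_lineChart hp] with z hz
      refine ⟨isFrameNear hz, ?_⟩
      have h2 : (ofCoord (isFrameNear hz) (1, 1, 0) one_ne_zero one_ne_zero : S.Bundle) ∈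
        (frameChart ψ σ p).source := mem_frameChart_source_iff.2 hz
      have h3 := frameChart_apply (p := ofCoord (isFrameNear hz) (1, 1, 0) one_ne_zero one_ne_zero)
        (p₀ := p) hz (isCoord_ofCoord _ _ one_ne_zero one_ne_zero)
      rw [← (frameChart ψ σ p).left_inv h2, h3]
      rfl
    have hsec : IsSectionOf (vertField S ψ σ p.base) (tautField S ψ σ p.base) s p.base := by
      filter_upwards [hs] with z hz
      obtain ⟨h, hz⟩ := hz
      rw [hz]
      refine ⟨rfl, ?_, rfl⟩
      exact one_smul _ _
    have hsp : s p.base = p := by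
      change (frameChart ψ σ p).symm (lineChart ψ σ p.base p.base, 1, 1, 0) = p
      rw [← hc, ← frameChart_fst (ψ := ψ) (σ := σ) (p₀ := p) (p := p)]
      exact (frameChart ψ σ p).left_inv (mem_frameChart_source_iff.2 hp)
    refine Submodule.subset_span ⟨vertField S ψ σ p.base, tautField S ψ σ p.base, s,
      isProjectiveNear hp, hsec, hsp, ?_⟩
    refine (key _ _ s (isFrameNear hp) hsec hsp (fun _ => 1) (fun _ => 1) (smoothNear_const _)
      (smoothNear_const _) ?_ rfl (tderiv_const _ _) (tderiv_const _ _) ?_).symm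
    · filter_upwards [hs, near_lineChart hp] with z hz hz'
      obtain ⟨h, hz⟩ := hz
      rw [hz]
      refine ⟨rfl, ?_⟩
      refine (frameChart_apply (p := ofCoord h (1, 1, 0) one_ne_zero one_ne_zero)
        (p₀ := p) hz' (isCoord_ofCoord _ _ one_ne_zero one_ne_zero)).trans ?_
      have : fieldDeriv (vertField S ψ σ p.base) (fun _ => (1 : ℝ)) z = 0 := tderiv_const _ _
      rw [this]
      rfl
    · have : fieldDeriv (vertField S ψ σ p.base) (fun _ => (1 : ℝ)) = fun _ => 0 :=
        funext fun z => tderiv_const _ _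
      rw [this]
      exact tderiv_const _ _

theorem dproj_fundX (p : S.Bundle) : ∀ Y ∈ p.jet, CanonicalBundle.dproj p (fundX p) = Y p.base := by
  intro Y hY
  obtain ⟨ψ, σ, -, -, hp, h1⟩ := exists_adapted_chart p
  have hc : (frameChart ψ σ p p).2 = (1, 1, 0) := congrArg Prod.snd h1
  have hXc := (isVerticalField_X (S := S)).tderiv_frameChart hp h1 fderiv_readCoord_opX
  have h2 := (isCoord_frameChart hp).1.2
  rw [hc] at h2
  rw [h2] at hY
  obtain ⟨f, hf, hf0, -⟩ := hY
  rw [hf.self_of_nhds.2, hf0]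
  refine Eq.trans ?_ (one_smul ℝ _).symm
  refine (smoothChart_lineChart ψ σ p.base).tderiv_injective hp ?_
  rw [tderiv_vertField hp]
  have h3 := tderiv_clm (fst ℝ (HN × ℝ) (ℝ × ℝ × ℝ)) (smoothNear_frameChart hp).mdiff (fundX p)
  rw [hXc] at h3
  refine Eq.trans ?_ h3
  exact (tderiv_comp (f := lineChart ψ σ p.base) (π := (CanonicalBundle.base : S.Bundle → S.CurveBundle))
    ((smoothChart_lineChart ψ σ p.base).smoothNear hp).mdiff (smoothNear_canonicalBase p).mdiff _).symm

end Adapted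

section

variable (S) in
/-- Vector fields on the canonical bundle. -/
abbrev BundleField : Type _ := ∀ p : S.Bundle, T[HE] p

/-! ### The soldering form -/

/-- The soldering form of the canonical bundle: the binary form which corresponds to the projection of
a tangent vector under the frame of its base point. -/
def solder (p : S.Bundle) : T[HE] p →L[ℝ] BForm k := (frame p).inverse.comp (dfoot p)

variable {ψ : BaseChart N k} {σ : FrameField k N} {p p₀ : S.Bundle}

theorem isInvertible_frame (p : S.Bundle) : (frame p).IsInvertible :=
  isInvertible_of_bijective (W := HN) (frame_bijective p)

theorem frame_solder (w : T[HE] p) :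
    frame p (solder p w) = dfoot p w := (isInvertible_frame p).self_apply_inverse _

theorem solder_eq_iff {w : T[HE] p} {a : BForm k} :
    solder p w = a ↔ dfoot p w = frame p a :=
  ⟨fun h => by rw [← h, frame_solder], fun h => (frame_bijective p).1 (by rw [frame_solder, h])⟩

theorem solder_eq_zero_iff {w : T[HE] p} :
    solder p w = 0 ↔ dfoot p w = 0 := by rw [solder_eq_iff, map_zero]

theorem solder_vert {D : End[k]} {Y : BundleField S} (hY : IsVerticalField D Y)
    (p : S.Bundle) : solder p (Y p) = 0 := solder_eq_zero_iff.2 (hY p).1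

theorem dfoot_eq_frameCoord (hp : InChart ψ σ p₀ p)
    (w : T[HE] p) :
    dfoot p w = σ p.base.base (frameCoord σ p (solder p w)) := by
  rw [apply_frameCoord hp.2.1, frame_solder]

theorem smoothNear_solder {W : BundleField S} (hW : SmoothFieldNear W p) :
    Smooth[HE, BForm k] (fun q => solder q (W q)) p := by
  obtain ⟨ψ, σ, hp⟩ := exists_frameChart p
  have h1 : Smooth[HE, BForm k] (fun q => frameCoord σ q (solder q (W q))) p :=
    smoothNear_frame_coeff (π := (foot : S.Bundle → N)) (W := W)
      (IsLocalSection.smoothFrameNear hp.2.1) (smoothNear_foot p) hW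
      ((near_frameChart hp).mono fun q hq => dfoot_eq_frameCoord hq (W q))
  have hb : ∀ q : S.Bundle, q.base ∈ (lineChart ψ σ p.base).source → (frameCoord σ q).IsInvertible :=
    fun q hq => isInvertible_of_bijective (isGL2_frameCoord hq.2.1).bijective
  have h2 := smoothNear_inverse (smoothNear_frameCoord hp) (hb p hp)
  refine (h2.clm_apply h1).congr ?_
  filter_upwards [near_frameChart hp] with q hq
  exact ((hb q hq).inverse_apply_self _).symm

/-- The bracket with a vertical field. -/
theorem solder_bracket_vertical {Y W : BundleField S} (hY : SmoothFieldNear Y p)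
    (hY0 : ∀ᶠ q in 𝓝 p, solder q (Y q) = 0) {D : End[k]}
    (hD : ∀ (ψ : BaseChart N k) (σ : FrameField k N) (p₀ : S.Bundle)
        (_ : InChart ψ σ p₀ p),
        tderiv (frameCoord σ) p (Y p) = (frameCoord σ p).comp D)
    (hW : SmoothFieldNear W p) :
    solder p (lie[HE] Y W p) = tderiv (fun q => solder q (W q)) p (Y p) + D (solder p (W p)) := by
  obtain ⟨ψ, σ, hp⟩ := exists_frameChart p
  have h1 := mfderiv_bracket_of_vertical (π := (foot : S.Bundle → N)) (X := Y) (W := W)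
      (w := fun q => frameCoord σ q (solder q (W q)))
      (IsLocalSection.smoothFrameNear hp.2.1) (smoothNear_foot p) hY hW
      (hY0.mono fun q hq => solder_eq_zero_iff.1 hq)
      ((near_frameChart hp).mono fun q hq => dfoot_eq_frameCoord hq (W q))
  have h2 := tderiv_clm_apply (smoothNear_frameCoord hp).mdiff (smoothNear_solder hW).mdiff (Y p)
  rw [hD ψ σ p hp, comp_apply, ← map_add] at h2
  rw [solder_eq_iff]
  refine h1.trans ?_
  refine (congrArg (σ p.base.base) h2).trans ?_
  exact apply_frameCoord hp.2.1 _

theorem IsVerticalField.solder_bracket {D : End[k]} {Y W : BundleField S}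
    (hY : IsVerticalField D Y) (hW : SmoothFieldNear W p) :
    solder p (lie[HE] Y W p) = tderiv (fun q => solder q (W q)) p (Y p) + D (solder p (W p)) :=
  solder_bracket_vertical (hY.smoothFieldNear p) (.of_forall fun q => solder_vert hY q) (hY p).2 hW

/-- A field with prescribed values of the soldering form; the group coordinates are constant along it. -/
theorem exists_solder_eq {u : S.Bundle → BForm k} (hu : Smooth[HE, BForm k] u p) :
    ∃ V : BundleField S, SmoothFieldNear V p ∧ ∀ᶠ q in 𝓝 p, solder q (V q) = u q := by
  obtain ⟨ψ, σ, hp⟩ := exists_frameChart p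
  have hsec : S.IsLocalSection σ p.base.base := hp.2.1
  have hψ := smoothChart_of_mem_atlas ψ.2
  let R : N → BForm k →L[ℝ] HN := fun y =>
    (d[HN, HN] ψ.1 y).comp (σ y)
  have hR : Smooth[HN, BForm k →L[ℝ] HN] R p.base.base :=
    smoothNear_clm_of_apply fun a => (hψ.smoothNear hp.1).tderiv (hsec.smoothFrameNear.smoothField a)
  have hc : Smooth[HE, HN]
      (fun q : S.Bundle => R (foot q) (frameCoord σ q (u q))) p :=
    (SmoothNear.comp_map (f := R) (π := (foot : S.Bundle → N)) hR (smoothNear_foot p)).clm_apply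
      ((smoothNear_frameCoord hp).clm_apply hu)
  have he := smoothChart_frameChart ψ σ p
  refine ⟨chartField (frameChart ψ σ p) fun q => ((R (foot q) (frameCoord σ q (u q)), 0), 0),
    he.smoothFieldNear_chartField (mem_frameChart_source_iff.2 hp)
      ((hc.prodMk (smoothNear_const 0)).prodMk (smoothNear_const 0)), ?_⟩
  filter_upwards [near_frameChart hp] with q hq
  rw [solder_eq_iff, ← apply_frameCoord hq.2.1]
  refine hψ.tderiv_injective hq.1 ?_
  rw [← (tderiv_frameChart hq _).1, he.tderiv_chartField (mem_frameChart_source_iff.2 hq)]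
  rfl

/-! ### Vertical vectors and brackets of the fundamental fields -/

theorem IsVerticalField.unique {D : End[k]} {Y Y' : BundleField S}
    (h : IsVerticalField D Y) (h' : IsVerticalField D Y') : Y = Y' := by
  funext p
  obtain ⟨ψ, σ, hp⟩ := exists_frameChart p
  exact tangent_ext hp ((h p).1.trans (h' p).1.symm)
    (((h p).2 ψ σ p hp).trans ((h' p).2 ψ σ p hp).symm)

/-- Brackets of vertical fields are computed in the Lie algebra of operators on binary forms. -/
theorem IsVerticalField.bracket {D D' : End[k]} {Y Y' : BundleField S}
    (h : IsVerticalField D Y) (h' : IsVerticalField D' Y') :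
    IsVerticalField (D.comp D' - D'.comp D) (lie[HE] Y Y') := by
  intro p
  constructor
  · rw [← solder_eq_zero_iff, h.solder_bracket (h'.smoothFieldNear p), solder_vert h', map_zero,
      add_zero]
    exact (tderiv_congr (.of_forall fun q => solder_vert h' q) _).trans (tderiv_const _ _)
  · intro ψ σ p₀ hp
    have hs := smoothNear_frameCoord hp
    rw [tderiv_bracket hs (h.smoothFieldNear p).self_of_nhds (h'.smoothFieldNear p).self_of_nhds]
    have key : ∀ {D D' : End[k]} {Y Y' : BundleField S},
        IsVerticalField D Y → IsVerticalField D' Y' →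
        tderiv (fun q => tderiv (frameCoord σ) q (Y' q)) p (Y p) =
          ((frameCoord σ p).comp D).comp D' := by
      intro D D' Y Y' h h'
      have h1 := tderiv_congr ((near_frameChart hp).mono fun q hq => (h' q).2 ψ σ p₀ hq) (Y p)
      refine h1.trans ?_
      refine (tderiv_clm ((ContinuousLinearMap.compL ℝ (BForm k) (BForm k) (BForm k)).flip D')
        hs.mdiff (Y p)).trans ?_
      rw [(h p).2 ψ σ p₀ hp]
      rfl
    rw [key h h', key h' h, ContinuousLinearMap.comp_sub, comp_assoc, comp_assoc]

theorem IsVerticalField.add {D D' : End[k]} {Y Y' : BundleField S}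
    (h : IsVerticalField D Y) (h' : IsVerticalField D' Y') :
    IsVerticalField (D + D') (fun q => Y q + Y' q) := fun p =>
  ⟨by rw [map_add, (h p).1, (h' p).1, add_zero], fun ψ σ p₀ hp => by
    rw [tderiv_vadd, (h p).2 ψ σ p₀ hp, (h' p).2 ψ σ p₀ hp, ContinuousLinearMap.comp_add]⟩

theorem IsVerticalField.smul {D : End[k]} {Y : BundleField S}
    (h : IsVerticalField D Y) (c : ℝ) : IsVerticalField (c • D) (fun q => c • Y q) := fun p =>
  ⟨by rw [map_smul, (h p).1, smul_zero], fun ψ σ p₀ hp => by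
    rw [tderiv_vsmul, (h p).2 ψ σ p₀ hp, comp_smul]⟩

theorem isVerticalField_zero : IsVerticalField (S := S) (0 : End[k]) (fun _ => 0) :=
  fun p => ⟨map_zero _, fun ψ σ p₀ hp => by rw [tderiv_vzero, ContinuousLinearMap.comp_zero]⟩

theorem bracket_X_G : lie[HE] (fundX (S := S)) fundG p = 0 := by
  have h := (isVerticalField_X (S := S)).bracket isVerticalField_G
  rw [ContinuousLinearMap.comp_id, id_comp, sub_self] at h
  exact congrFun (h.unique isVerticalField_zero) p

theorem bracket_X_F₀ : lie[HE] (fundX (S := S)) fundF₀ p = fundX p := by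
  have h := (isVerticalField_X (S := S)).bracket isVerticalField_F₀
  rw [← neg_sub, opF₀_comm_opX, neg_neg] at h
  exact congrFun (h.unique isVerticalField_X) p

theorem bracket_X_F₁ : lie[HE] (fundX (S := S)) fundF₁ p =
    (k : ℝ) • fundG p + (2 : ℝ) • fundF₀ p := by
  have h := (isVerticalField_X (S := S)).bracket isVerticalField_F₁
  have e : -(-((k : ℝ) • idV) - (2 : ℝ) • opF₀ k) = (k : ℝ) • idV + (2 : ℝ) • opF₀ k := by abel
  rw [← neg_sub, opF₁_comm_opX, e] at h
  exact congrFun (h.unique ((isVerticalField_G.smul _).add (isVerticalField_F₀.smul _))) p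

/-- The vertical vector with given components. -/
def fundComb (α β γ δ : ℝ) (p : S.Bundle) : T[HE] p :=
  α • fundX p + β • fundG p + γ • fundF₀ p + δ • fundF₁ p

/-- The operator on binary forms by which the vertical vector with given components acts. -/
def opComb (k : ℕ) (α β γ δ : ℝ) : End[k] :=
  α • opX k + β • ContinuousLinearMap.id ℝ _ + γ • opF₀ k + δ • opF₁ k

theorem isVerticalField_fundComb (α β γ δ : ℝ) :
    IsVerticalField (S := S) (opComb k α β γ δ) (fundComb α β γ δ) :=
  (((isVerticalField_X.smul α).add (isVerticalField_G.smul β)).add (isVerticalField_F₀.smul γ)).add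
    (isVerticalField_F₁.smul δ)

theorem tderiv_frameChart_fundComb (hp : InChart ψ σ p₀ p)
    (h1 : groupCoord ψ σ p₀ p = (0, 1, 1, 0)) (α β γ δ : ℝ) :
    tderiv (frameChart ψ σ p₀) p (fundComb α β γ δ p) = ((0, α), β, -γ, 2 * δ) := by
  refine (isVerticalField_fundComb α β γ δ).tderiv_frameChart hp h1 (q := (α, β, -γ, 2 * δ)) ?_
  simp only [opComb, map_add, map_smul, fderiv_readCoord_opX, fderiv_readCoord_id,
    fderiv_readCoord_opF₀, fderiv_readCoord_opF₁]
  ext <;> simp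
  ring

theorem exists_fundComb (w : T[HE] p) (hw : solder p w = 0) :
    ∃ α β γ δ : ℝ, w = fundComb α β γ δ p := by
  obtain ⟨ψ, σ, -, -, hp, h1⟩ := exists_adapted_chart p
  have h2 := (tderiv_frameChart hp w).1
  rw [solder_eq_zero_iff.1 hw, tderiv_vzero] at h2
  refine ⟨(tderiv (frameChart ψ σ p) p w).1.2, (tderiv (frameChart ψ σ p) p w).2.1,
    -(tderiv (frameChart ψ σ p) p w).2.2.1, (tderiv (frameChart ψ σ p) p w).2.2.2 / 2, ?_⟩
  refine (smoothChart_frameChart ψ σ p).tderiv_injective (mem_frameChart_source_iff.2 hp) ?_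
  rw [tderiv_frameChart_fundComb hp h1]
  refine Prod.ext (Prod.ext h2 rfl) (Prod.ext rfl (Prod.ext (neg_neg _).symm ?_))
  change _ = 2 * (_ / 2)
  ring

theorem fundComb_eq_zero {α β γ δ : ℝ} (h : (fundComb α β γ δ p : T[HE] p) = 0) :
    α = 0 ∧ β = 0 ∧ γ = 0 ∧ δ = 0 := by
  obtain ⟨ψ, σ, -, -, hp, h1⟩ := exists_adapted_chart p
  have h2 := tderiv_frameChart_fundComb hp h1 α β γ δ
  rw [h, tderiv_vzero] at h2
  have e1 := congrArg (fun q : HE => q.1.2) h2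
  have e2 := congrArg (fun q : HE => q.2.1) h2
  have e3 := congrArg (fun q : HE => q.2.2.1) h2
  have e4 := congrArg (fun q : HE => q.2.2.2) h2
  simp only [Prod.snd_zero, Prod.fst_zero] at e1 e2 e3 e4
  exact ⟨e1.symm, e2.symm, by linarith, by linarith⟩

theorem smoothFieldNear_fundComb {α β γ δ : S.Bundle → ℝ}
    (hα : Smooth[HE, ℝ] α p) (hβ : Smooth[HE, ℝ] β p)
    (hγ : Smooth[HE, ℝ] γ p) (hδ : Smooth[HE, ℝ] δ p) :
    SmoothFieldNear (fun q => fundComb (α q) (β q) (γ q) (δ q) q) p :=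
  ((((isVerticalField_X.smoothFieldNear p).smul hα).add
    ((isVerticalField_G.smoothFieldNear p).smul hβ)).add
    ((isVerticalField_F₀.smoothFieldNear p).smul hγ)).add
    ((isVerticalField_F₁.smoothFieldNear p).smul hδ)

/-- The vertical fields are the combinations of `X`, `G`, `F⁰`, `F¹` with smooth coefficients. -/
theorem exists_smooth_fundComb {W : BundleField S} (hW : SmoothFieldNear W p)
    (h0 : ∀ᶠ q in 𝓝 p, solder q (W q) = 0) :
    ∃ α β γ δ : S.Bundle → ℝ, Smooth[HE, ℝ] α p ∧
      Smooth[HE, ℝ] β p ∧ Smooth[HE, ℝ] γ p ∧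
      Smooth[HE, ℝ] δ p ∧
      ∀ᶠ q in 𝓝 p, W q = fundComb (α q) (β q) (γ q) (δ q) q := by
  have hsum : ∀ (q : S.Bundle) (c : Fin 4 → ℝ),
      ∑ i, c i • (![fundX, fundG, fundF₀, fundF₁] : Fin 4 → BundleField S) i q =
        fundComb (c 0) (c 1) (c 2) (c 3) q := fun q c => by
    rw [Fin.sum_univ_four]; rfl
  have hli : ∀ q : S.Bundle, LinearIndependent ℝ
      (fun i => (![fundX, fundG, fundF₀, fundF₁] : Fin 4 → BundleField S) i q) := fun q => by
    rw [Fintype.linearIndependent_iff]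
    intro c hc
    rw [hsum] at hc
    obtain ⟨h1, h2, h3, h4⟩ := fundComb_eq_zero hc
    intro i
    fin_cases i
    exacts [h1, h2, h3, h4]
  obtain ⟨c, hc, hs⟩ := exists_smooth_coeff (v := ![fundX, fundG, fundF₀, fundF₁]) (w := W) (x := p)
    (by
      intro i
      fin_cases i
      exacts [isVerticalField_X.smoothFieldNear p, isVerticalField_G.smoothFieldNear p,
        isVerticalField_F₀.smoothFieldNear p, isVerticalField_F₁.smoothFieldNear p]) hW
    (.of_forall hli) (h0.mono fun q hq => by
      obtain ⟨α, β, γ, δ, h⟩ := exists_fundComb _ hq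
      rw [h]
      exact (congrArg (· ∈ Submodule.span ℝ _) (hsum q ![α, β, γ, δ])).mp
        (Submodule.sum_mem _ fun i _ => Submodule.smul_mem _ _ (Submodule.subset_span ⟨i, rfl⟩)))
  refine ⟨fun q => c q 0, fun q => c q 1, fun q => c q 2, fun q => c q 3, hs 0, hs 1, hs 2, hs 3, ?_⟩
  filter_upwards [hc] with q hq
  rw [hq, hsum]

theorem solder_fundComb (α β γ δ : ℝ) (p : S.Bundle) : solder p (fundComb α β γ δ p) = 0 :=
  solder_vert (isVerticalField_fundComb α β γ δ) p

theorem solder_bracket_fundComb {α β γ δ : S.Bundle → ℝ}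
    (hα : Smooth[HE, ℝ] α p) (hβ : Smooth[HE, ℝ] β p)
    (hγ : Smooth[HE, ℝ] γ p) (hδ : Smooth[HE, ℝ] δ p)
    {W : BundleField S} (hW : SmoothFieldNear W p) {u : BForm k} (hu : ∀ᶠ q in 𝓝 p, solder q (W q) = u) :
    solder p (lie[HE] (fun q => fundComb (α q) (β q) (γ q) (δ q) q) W p) =
      opComb k (α p) (β p) (γ p) (δ p) u := by
  rw [solder_bracket_vertical (smoothFieldNear_fundComb hα hβ hγ hδ)
    (.of_forall fun q => solder_fundComb _ _ _ _ q)
    ((isVerticalField_fundComb (α p) (β p) (γ p) (δ p)) p).2 hW, tderiv_congr hu, tderiv_const,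
    zero_add, hu.self_of_nhds]

theorem bracket_X_fundComb {α β γ δ : S.Bundle → ℝ}
    (hα : Smooth[HE, ℝ] α p) (hβ : Smooth[HE, ℝ] β p)
    (hγ : Smooth[HE, ℝ] γ p) (hδ : Smooth[HE, ℝ] δ p) :
    lie[HE] fundX (fun q => fundComb (α q) (β q) (γ q) (δ q) q) p =
      fundComb (tderiv α p (fundX p) + γ p) (tderiv β p (fundX p) + k * δ p)
        (tderiv γ p (fundX p) + 2 * δ p) (tderiv δ p (fundX p)) p := by
  have hX := (isVerticalField_X (S := S)).smoothFieldNear p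
  have hG := (isVerticalField_G (S := S)).smoothFieldNear p
  have hF₀ := (isVerticalField_F₀ (S := S)).smoothFieldNear p
  have hF₁ := (isVerticalField_F₁ (S := S)).smoothFieldNear p
  have h1 := bracket_add_right (X := fundX) (((hX.smul hα).add (hG.smul hβ)).add
    (hF₀.smul hγ)).self_of_nhds (hF₁.smul hδ).self_of_nhds
  have h2 := bracket_add_right (X := fundX) ((hX.smul hα).add (hG.smul hβ)).self_of_nhds
    (hF₀.smul hγ).self_of_nhds
  have h3 := bracket_add_right (X := fundX) (hX.smul hα).self_of_nhds (hG.smul hβ).self_of_nhds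
  refine h1.trans ?_
  rw [h2, h3, bracket_smul_right hα.mdiff hX.self_of_nhds, bracket_smul_right hβ.mdiff hG.self_of_nhds,
    bracket_smul_right hγ.mdiff hF₀.self_of_nhds, bracket_smul_right hδ.mdiff hF₁.self_of_nhds,
    bracket_self, bracket_X_G, bracket_X_F₀, bracket_X_F₁, fundComb]
  module

end

section

variable {p : S.Bundle}

/-! ### The canonical frame -/

theorem formCoeff_ladder {n : ℕ} (h : n ≤ k) (m : ℕ) :
    formCoeff k n (ladder k m) = if n = m then (k.descFactorial n : ℝ) else 0 := by
  rw [ladder, map_smul, formCoeff_monoForm _ _ h]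
  split_ifs with hnm
  · rw [hnm, smul_eq_mul, mul_one]
  · rw [smul_zero]

theorem descFactorial_ne {n : ℕ} (h : n ≤ k) : (k.descFactorial n : ℝ) ≠ 0 := by
  exact_mod_cast (Nat.pos_of_ne_zero (by rw [Ne, Nat.descFactorial_eq_zero_iff_lt]; omega)).ne'

/-- The coefficient of the form `a` at the `n`-th form of the ladder. -/
def ladderCoeff (k n : ℕ) : BForm k →L[ℝ] ℝ := (k.descFactorial n : ℝ)⁻¹ • formCoeff k n

theorem ladderCoeff_ladder {n : ℕ} (h : n ≤ k) (m : ℕ) :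
    ladderCoeff k n (ladder k m) = if n = m then 1 else 0 := by
  rw [ladderCoeff, smul_apply, formCoeff_ladder h]
  split_ifs
  · rw [smul_eq_mul, inv_mul_cancel₀ (descFactorial_ne h)]
  · rw [smul_zero]

/-- The components of the bracket `[V, ad^n V]` of a field on the canonical bundle. -/
def torsionForm (V : S.BundleField) (n : ℕ) (p : S.Bundle) : BForm k :=
  solder p (lie[HE] V (adField fundX V n) p)

/-- Near `p` the field `V` generates a canonical frame: it lifts the first form of the ladder, and the
torsion coefficients `T⁰¹₀, T⁰¹₁, T⁰¹₂, T⁰³₃` vanish. -/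
def IsCanonicalFieldNear (V : S.BundleField) (p : S.Bundle) : Prop :=
  SmoothFieldNear V p ∧ ∀ᶠ q in 𝓝 p, solder q (V q) = ladder k 0 ∧
    (∀ i ≤ 2, ladderCoeff k i (torsionForm V 1 q) = 0) ∧ ladderCoeff k 3 (torsionForm V 3 q) = 0

theorem solder_adField {V : S.BundleField} (hV : SmoothFieldNear V p)
    (h0 : ∀ᶠ q in 𝓝 p, solder q (V q) = ladder k 0) (n : ℕ) :
    ∀ᶠ q in 𝓝 p, solder q (adField fundX V n q) = ladder k n := by
  induction n with
  | zero => exact h0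
  | succ n ih =>
    filter_upwards [ih.eventually_nhds,
      ((isVerticalField_X.smoothFieldNear p).adField hV n).near] with q h1 h2
    rw [adField_succ]
    rw [isVerticalField_X.solder_bracket h2, tderiv_congr h1, tderiv_const, zero_add, h1.self_of_nhds,
      opX_ladder]

theorem adField_add {V W : S.BundleField} (hV : SmoothFieldNear V p) (hW : SmoothFieldNear W p)
    (n : ℕ) : ∀ᶠ q in 𝓝 p, adField fundX (fun q => V q + W q) n q =
      adField fundX V n q + adField fundX W n q := by
  have hX := fun q : S.Bundle => (isVerticalField_X (S := S)).smoothFieldNear q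
  induction n with
  | zero => exact .of_forall fun _ => rfl
  | succ n ih =>
    filter_upwards [ih.eventually_nhds, ((hX p).adField hV n).near, ((hX p).adField hW n).near]
      with q h1 h2 h3
    rw [adField_succ, adField_succ, adField_succ, ← bracket_add_right h2.self_of_nhds h3.self_of_nhds]
    exact bracket_congr (.of_forall fun _ => rfl) h1

/-- Iterated brackets of `X` with a vertical field are vertical. -/
theorem exists_adField_fundComb {α β γ δ : S.Bundle → ℝ}
    (hα : Smooth[HE, ℝ] α p) (hβ : Smooth[HE, ℝ] β p)
    (hγ : Smooth[HE, ℝ] γ p) (hδ : Smooth[HE, ℝ] δ p) (n : ℕ) :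
    ∃ α' β' γ' δ' : S.Bundle → ℝ, Smooth[HE, ℝ] α' p ∧
      Smooth[HE, ℝ] β' p ∧ Smooth[HE, ℝ] γ' p ∧
      Smooth[HE, ℝ] δ' p ∧
      ∀ᶠ q in 𝓝 p, adField fundX (fun q => fundComb (α q) (β q) (γ q) (δ q) q) n q =
        fundComb (α' q) (β' q) (γ' q) (δ' q) q := by
  have hX := (isVerticalField_X (S := S)).smoothFieldNear p
  induction n with
  | zero => exact ⟨α, β, γ, δ, hα, hβ, hγ, hδ, .of_forall fun _ => rfl⟩
  | succ n ih =>
    obtain ⟨a, b, c, d, ha, hb, hc, hd, h⟩ := ih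
    refine ⟨_, _, _, _, (ha.tderiv hX).add hc, (hb.tderiv hX).add ((smoothNear_const (k : ℝ)).mul hd),
      (hc.tderiv hX).add ((smoothNear_const (2 : ℝ)).mul hd), hd.tderiv hX, ?_⟩
    filter_upwards [h.eventually_nhds, ha.near, hb.near, hc.near, hd.near] with q h1 h2 h3 h4 h5
    rw [adField_succ, bracket_congr (.of_forall fun _ => rfl) h1]
    exact bracket_X_fundComb h2 h3 h4 h5

/-- The change of the torsion under the addition of a vertical field. -/
theorem torsionForm_add {V : S.BundleField} (hV : SmoothFieldNear V p)
    (h0 : ∀ᶠ q in 𝓝 p, solder q (V q) = ladder k 0) {α β γ δ α' β' γ' δ' : S.Bundle → ℝ}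
    (hα : Smooth[HE, ℝ] α p) (hβ : Smooth[HE, ℝ] β p)
    (hγ : Smooth[HE, ℝ] γ p) (hδ : Smooth[HE, ℝ] δ p)
    (hα' : Smooth[HE, ℝ] α' p) (hβ' : Smooth[HE, ℝ] β' p)
    (hγ' : Smooth[HE, ℝ] γ' p) (hδ' : Smooth[HE, ℝ] δ' p)
    {n : ℕ} (hn : ∀ᶠ q in 𝓝 p, adField fundX (fun q => fundComb (α q) (β q) (γ q) (δ q) q) n q =
        fundComb (α' q) (β' q) (γ' q) (δ' q) q) :
    torsionForm (fun q => V q + fundComb (α q) (β q) (γ q) (δ q) q) n p = torsionForm V n p +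
      opComb k (α p) (β p) (γ p) (δ p) (ladder k n) -
      opComb k (α' p) (β' p) (γ' p) (δ' p) (ladder k 0) := by
  have hX := (isVerticalField_X (S := S)).smoothFieldNear p
  have hW := smoothFieldNear_fundComb hα hβ hγ hδ
  have hW' := smoothFieldNear_fundComb hα' hβ' hγ' hδ'
  have hVn := hX.adField hV n
  have h1 : lie[HE] (fun q => V q + fundComb (α q) (β q) (γ q) (δ q) q)
      (adField fundX (fun q => V q + fundComb (α q) (β q) (γ q) (δ q) q) n) p =
      lie[HE] (fun q => V q + fundComb (α q) (β q) (γ q) (δ q) q)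
        (fun q => adField fundX V n q + fundComb (α' q) (β' q) (γ' q) (δ' q) q) p := by
    refine bracket_congr (.of_forall fun _ => rfl) ?_
    filter_upwards [adField_add hV hW n, hn] with q e1 e2
    rw [e1, e2]
  have hsw : ∀ {A B C : S.BundleField}, SmoothFieldNear A p → SmoothFieldNear B p →
      lie[HE] (fun q => A q + B q) C p = lie[HE] A C p + lie[HE] B C p := by
    intro A B C hA hB
    rw [bracket_swap, bracket_add_right hA.self_of_nhds hB.self_of_nhds, neg_add, ← bracket_swap,
      ← bracket_swap]
  rw [torsionForm, h1, bracket_add_right hVn.self_of_nhds hW'.self_of_nhds, hsw hV hW, hsw hV hW,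
    map_add, map_add, map_add, solder_bracket_fundComb hα hβ hγ hδ hVn (solder_adField hV h0 n),
    bracket_swap (X := V) (Y := fun q => fundComb (α' q) (β' q) (γ' q) (δ' q) q), map_neg,
    solder_bracket_fundComb hα' hβ' hγ' hδ' hV h0,
    solder_bracket_fundComb hα hβ hγ hδ hW' (.of_forall fun q => solder_fundComb _ _ _ _ q),
    map_zero, torsionForm]
  abel

theorem ladderCoeff_opComb_zero {n : ℕ} (h : n ≤ k) (α β γ δ : ℝ) :
    ladderCoeff k n (opComb k α β γ δ (ladder k 0)) =
      (if n = 1 then α else 0) + if n = 0 then β else 0 := by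
  have e : opComb k α β γ δ (ladder k 0) = α • ladder k 1 + β • ladder k 0 := by
    simp only [opComb, add_apply, smul_apply, id_apply, opX_ladder, opF₀_ladder, opF₁_ladder_zero]
    simp
  rw [e, map_add, map_smul, map_smul, ladderCoeff_ladder h, ladderCoeff_ladder h]
  simp

theorem ladderCoeff_opComb_succ {n : ℕ} (h : n ≤ k) (m : ℕ) (α β γ δ : ℝ) :
    ladderCoeff k n (opComb k α β γ δ (ladder k (m + 1))) =
      (if n = m + 2 then α else 0) + (if n = m + 1 then β - (m + 1) * γ else 0) -
        if n = m then (k - m) * (m + 1) * δ else 0 := by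
  have e : opComb k α β γ δ (ladder k (m + 1)) = α • ladder k (m + 2) + (β - (m + 1) * γ) •
      ladder k (m + 1) - ((k - m) * (m + 1) * δ) • ladder k m := by
    simp only [opComb, add_apply, smul_apply, id_apply, opX_ladder, opF₀_ladder, opF₁_ladder_succ]
    push_cast
    module
  rw [e, map_sub, map_add, map_smul, map_smul, map_smul, ladderCoeff_ladder h, ladderCoeff_ladder h,
    ladderCoeff_ladder h]
  simp

/-- The equations for the vertical correction which makes a field canonical. -/
theorem torsion_change {V : S.BundleField} (hk : 3 ≤ k) (hV : SmoothFieldNear V p)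
    (h0 : ∀ᶠ q in 𝓝 p, solder q (V q) = ladder k 0) {α β γ δ : S.Bundle → ℝ}
    (hα : Smooth[HE, ℝ] α p) (hβ : Smooth[HE, ℝ] β p)
    (hγ : Smooth[HE, ℝ] γ p) (hδ : Smooth[HE, ℝ] δ p) :
    ladderCoeff k 2 (torsionForm (fun q => V q + fundComb (α q) (β q) (γ q) (δ q) q) 1 p) =
      ladderCoeff k 2 (torsionForm V 1 p) + α p ∧
    ladderCoeff k 1 (torsionForm (fun q => V q + fundComb (α q) (β q) (γ q) (δ q) q) 1 p) =
      ladderCoeff k 1 (torsionForm V 1 p) + β p - 2 * γ p - tderiv α p (fundX p) ∧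
    ladderCoeff k 0 (torsionForm (fun q => V q + fundComb (α q) (β q) (γ q) (δ q) q) 1 p) =
      ladderCoeff k 0 (torsionForm V 1 p) - 2 * k * δ p - tderiv β p (fundX p) ∧
    ladderCoeff k 3 (torsionForm (fun q => V q + fundComb (α q) (β q) (γ q) (δ q) q) 3 p) =
      ladderCoeff k 3 (torsionForm V 3 p) + β p - 3 * γ p := by
  have hX := (isVerticalField_X (S := S)).smoothFieldNear p
  have h1 : ∀ᶠ q in 𝓝 p, adField fundX (fun q : S.Bundle => fundComb (α q) (β q) (γ q) (δ q) q) 1 q =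
      fundComb (tderiv α q (fundX q) + γ q) (tderiv β q (fundX q) + k * δ q)
        (tderiv γ q (fundX q) + 2 * δ q) (tderiv δ q (fundX q)) q := by
    filter_upwards [hα.near, hβ.near, hγ.near, hδ.near] with q h2 h3 h4 h5
    exact bracket_X_fundComb h2 h3 h4 h5
  have e1 := torsionForm_add hV h0 hα hβ hγ hδ ((hα.tderiv hX).add hγ)
    ((hβ.tderiv hX).add ((smoothNear_const (k : ℝ)).mul hδ))
    ((hγ.tderiv hX).add ((smoothNear_const (2 : ℝ)).mul hδ)) (hδ.tderiv hX) h1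
  obtain ⟨a, b, c, d, ha, hb, hc, hd, h3⟩ := exists_adField_fundComb (S := S) hα hβ hγ hδ 3
  have e3 := torsionForm_add hV h0 hα hβ hγ hδ ha hb hc hd h3
  rw [e1, e3]
  simp only [map_sub, map_add, ladderCoeff_opComb_zero (show 2 ≤ k by omega),
    ladderCoeff_opComb_zero (show 1 ≤ k by omega), ladderCoeff_opComb_zero (show 0 ≤ k by omega),
    ladderCoeff_opComb_zero hk, ladderCoeff_opComb_succ (show 2 ≤ k by omega) 0,
    ladderCoeff_opComb_succ (show 1 ≤ k by omega) 0, ladderCoeff_opComb_succ (show 0 ≤ k by omega) 0,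
    ladderCoeff_opComb_succ hk 2]
  norm_num
  exact ⟨by ring, by ring, by ring⟩

theorem smoothNear_torsionForm {V : S.BundleField} (hV : SmoothFieldNear V p) (n : ℕ) :
    Smooth[HE, BForm k] (torsionForm V n) p :=
  smoothNear_solder (hV.bracket ((isVerticalField_X.smoothFieldNear p).adField hV n))

/-- Every point has a neighbourhood with a canonical field. -/
theorem exists_canonicalFieldNear (hk : 3 ≤ k) (p : S.Bundle) :
    ∃ V : S.BundleField, IsCanonicalFieldNear V p := by
  obtain ⟨V, hV, h0⟩ := exists_solder_eq (p := p) (smoothNear_const (ladder k 0))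
  have hX := (isVerticalField_X (S := S)).smoothFieldNear p
  have ht : ∀ i n, Smooth[HE, ℝ] (fun q => ladderCoeff k i (torsionForm V n q)) p :=
    fun i n => (smoothNear_torsionForm hV n).clm _
  have hm : ∀ (c : ℝ) {f : S.Bundle → ℝ}, Smooth[HE, ℝ] f p →
      Smooth[HE, ℝ] (fun q => c * f q) p := fun c f hf => (smoothNear_const c).mul hf
  -- the coefficients solve the triangular system of `torsion_change`
  let α : S.Bundle → ℝ := fun q => -1 * ladderCoeff k 2 (torsionForm V 1 q)
  have hα : Smooth[HE, ℝ] α p := hm _ (ht 2 1)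
  let γ : S.Bundle → ℝ := fun q => tderiv α q (fundX q) - ladderCoeff k 1 (torsionForm V 1 q) +
    ladderCoeff k 3 (torsionForm V 3 q)
  have hγ : Smooth[HE, ℝ] γ p := ((hα.tderiv hX).sub (ht 1 1)).add (ht 3 3)
  let β : S.Bundle → ℝ := fun q => 3 * γ q - ladderCoeff k 3 (torsionForm V 3 q)
  have hβ : Smooth[HE, ℝ] β p := (hm 3 hγ).sub (ht 3 3)
  let δ : S.Bundle → ℝ := fun q => (2 * k : ℝ)⁻¹ * (ladderCoeff k 0 (torsionForm V 1 q) -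
    tderiv β q (fundX q))
  have hδ : Smooth[HE, ℝ] δ p := hm _ ((ht 0 1).sub (hβ.tderiv hX))
  refine ⟨fun q => V q + fundComb (α q) (β q) (γ q) (δ q) q,
    hV.add (smoothFieldNear_fundComb hα hβ hγ hδ), ?_⟩
  filter_upwards [hV.near, h0.eventually_nhds, hα.near, hβ.near, hγ.near, hδ.near]
    with q a1 a2 a3 a4 a5 a6
  refine ⟨by rw [map_add, a2.self_of_nhds, solder_fundComb, add_zero], ?_⟩
  obtain ⟨e2, e1, e0, e3⟩ := torsion_change hk a1 a2 a3 a4 a5 a6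
  have hk0 : (k : ℝ) ≠ 0 := NeZero.ne _
  refine ⟨fun i hi => ?_, ?_⟩
  · interval_cases i
    · rw [e0]
      simp only [δ]
      field_simp
      ring
    · rw [e1]
      simp only [β, γ]
      ring
    · rw [e2]
      simp only [α]
      ring
  · rw [e3]
    simp only [β]
    ring

/-- The triangular system of `torsion_change` without constant terms has only the zero solution: first
`α = 0`, then `β = γ = 0`, then `δ = 0`. -/
theorem IsCanonicalFieldNear.unique (hk : 3 ≤ k) {V V' : S.BundleField}
    (h : IsCanonicalFieldNear V p) (h' : IsCanonicalFieldNear V' p) : ∀ᶠ q in 𝓝 p, V' q = V q := by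
  obtain ⟨α, β, γ, δ, hα, hβ, hγ, hδ, hW⟩ := exists_smooth_fundComb (h'.1.sub h.1) (by
    filter_upwards [h.2, h'.2] with q h1 h2
    rw [map_sub, h1.1, h2.1, sub_self])
  have hk0 : (k : ℝ) ≠ 0 := NeZero.ne _
  have hVV : ∀ᶠ q in 𝓝 p, V' q = V q + fundComb (α q) (β q) (γ q) (δ q) q := by
    filter_upwards [hW] with q hq
    rw [← hq]
    abel
  have htor : ∀ n, ∀ᶠ q in 𝓝 p, torsionForm V' n q =
      torsionForm (fun q => V q + fundComb (α q) (β q) (γ q) (δ q) q) n q := fun n => by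
    filter_upwards [hVV.eventually_nhds] with q hq
    exact congrArg (solder q) (bracket_congr hq (adField_congr (.of_forall fun _ => rfl) hq n))
  have main : ∀ᶠ q in 𝓝 p, α q = 0 ∧ β q - 2 * γ q - tderiv α q (fundX q) = 0 ∧
      - 2 * k * δ q - tderiv β q (fundX q) = 0 ∧ β q - 3 * γ q = 0 := by
    filter_upwards [h.1.near, h.2.eventually_nhds, hα.near, hβ.near, hγ.near, hδ.near, htor 1, htor 3,
      h'.2] with q a1 a2 a3 a4 a5 a6 a7 a8 a9
    obtain ⟨e2, e1, e0, e3⟩ := torsion_change hk a1 (a2.mono fun _ h => h.1) a3 a4 a5 a6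
    rw [← a7, a9.2.1 _ (by norm_num), a2.self_of_nhds.2.1 _ (by norm_num)] at e0 e1 e2
    rw [← a8, a9.2.2, a2.self_of_nhds.2.2] at e3
    exact ⟨by linarith, by linarith, by linarith, by linarith⟩
  have hα0 : ∀ᶠ q in 𝓝 p, tderiv α q (fundX q) = 0 := by
    filter_upwards [main.eventually_nhds] with q hq
    rw [tderiv_congr (hq.mono fun _ h => h.1), tderiv_const]
  have hβγ : ∀ᶠ q in 𝓝 p, β q = 0 ∧ γ q = 0 := by
    filter_upwards [main, hα0] with q h1 h2
    rw [h2] at h1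
    exact ⟨by linarith, by linarith⟩
  have hβ0 : ∀ᶠ q in 𝓝 p, tderiv β q (fundX q) = 0 := by
    filter_upwards [hβγ.eventually_nhds] with q hq
    rw [tderiv_congr (hq.mono fun _ h => h.1), tderiv_const]
  filter_upwards [main, hβγ, hβ0, hVV] with q h1 h2 h3 h4
  have h5 : δ q = 0 := by
    have := h1.2.2.1
    rw [h3] at this
    have h6 : (k : ℝ) * δ q = 0 := by linarith
    exact (mul_eq_zero.1 h6).resolve_left hk0
  rw [h4, h1.1, h2.1, h2.2, h5, fundComb]
  simp

theorem IsCanonicalFieldNear.near {V : S.BundleField} (h : IsCanonicalFieldNear V p) :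
    ∀ᶠ q in 𝓝 p, IsCanonicalFieldNear V q := by
  filter_upwards [h.1.near, h.2.eventually_nhds] with q h1 h2
  exact ⟨h1, h2⟩

theorem IsCanonicalFieldNear.congr {V V' : S.BundleField} (h : IsCanonicalFieldNear V p)
    (h' : ∀ᶠ q in 𝓝 p, V' q = V q) : IsCanonicalFieldNear V' p := by
  refine ⟨h.1.congr h', ?_⟩
  filter_upwards [h.2, h'.eventually_nhds] with q h1 h2
  have : ∀ n, torsionForm V' n q = torsionForm V n q := fun n =>
    congrArg (solder q) (bracket_congr h2 (adField_congr (.of_forall fun _ => rfl) h2 n))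
  rw [h2.self_of_nhds, this, this]
  exact h1

/-- The canonical fields near the points agree, and give a field on the whole canonical bundle. -/
theorem exists_canonicalField (hk : 3 ≤ k) :
    ∃ V : S.BundleField, ∀ p, IsCanonicalFieldNear V p := by
  choose V hV using exists_canonicalFieldNear (S := S) hk
  refine ⟨fun q => V q q, fun p => (hV p).congr ?_⟩
  filter_upwards [(hV p).near] with q hq
  exact (hq.unique hk (hV q)).self_of_nhds

end

section

variable {p : S.Bundle}

/-! ### Existence and uniqueness of the canonical frame -/

theorem sum_ladderCoeff (a : BForm k) : ∑ r : Fin (k + 1), ladderCoeff k r a • ladder k r = a := by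
  ext j
  have h1 : (k.descFactorial j : ℝ) ≠ 0 := descFactorial_ne (Nat.lt_succ_iff.1 j.2)
  rw [Finset.sum_apply, Finset.sum_eq_single j]
  · rw [Pi.smul_apply, ladderCoeff, smul_apply, formCoeff_apply _ j.2, ladder, Pi.smul_apply, monoForm,
      if_pos rfl]
    simp only [smul_eq_mul]
    field_simp
  · intro i _ hij
    rw [Pi.smul_apply, ladder_apply_of_ne (fun h => hij (Fin.ext h.symm)), smul_zero]
  · intro h; exact absurd (Finset.mem_univ _) h

theorem ladderCoeff_sum (T : Fin (k + 1) → ℝ) (n : Fin (k + 1)) :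
    ladderCoeff k n (∑ r : Fin (k + 1), T r • ladder k r) = T n := by
  rw [map_sum, Finset.sum_eq_single n]
  · rw [map_smul, ladderCoeff_ladder (Nat.lt_succ_iff.1 n.2), if_pos rfl, smul_eq_mul, mul_one]
  · intro i _ hin
    rw [map_smul, ladderCoeff_ladder (Nat.lt_succ_iff.1 n.2), if_neg fun h => hin (Fin.ext h.symm),
      smul_zero]
  · intro h; exact absurd (Finset.mem_univ _) h

/-- The tuple of fields generated by a field `V` on the canonical bundle, together with the
fundamental fields. -/
def frameTuple (V : S.BundleField) : FrameTuple S.pair k where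
  G := fundG
  F₀ := fundF₀
  F₁ := fundF₁
  X := fundX
  V i := adField fundX V i

theorem sum_frameTuple (V : S.BundleField) (c : Fin 4 ⊕ Fin (k + 1) → ℝ) (p : S.Bundle) :
    ∑ i, c i • (frameTuple V).field i p = fundComb (c (.inl 3)) (c (.inl 0)) (c (.inl 1)) (c (.inl 2)) p +
      ∑ r : Fin (k + 1), c (.inr r) • adField fundX V r p := by
  rw [Fintype.sum_sum_type, Fin.sum_univ_four]
  change c (.inl 0) • fundG p + c (.inl 1) • fundF₀ p + c (.inl 2) • fundF₁ p + c (.inl 3) • fundX p + _ =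
    _
  rw [fundComb]
  congr 1
  abel

theorem solder_sum_adField {V : S.BundleField} (hV : ∀ p, SmoothFieldNear V p)
    (h0 : ∀ p, solder p (V p) = ladder k 0) (T : Fin (k + 1) → ℝ) (p : S.Bundle) :
    solder p (∑ r : Fin (k + 1), T r • adField fundX V r p) = ∑ r : Fin (k + 1), T r • ladder k r := by
  rw [map_sum]
  refine Finset.sum_congr rfl fun r _ => ?_
  rw [map_smul, (solder_adField (hV p) (.of_forall h0) r).self_of_nhds]

/-- Every tangent vector is a combination of the fields generated by a lift of the first form of the
ladder and of the fundamental fields. -/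
theorem exists_eq_sum_frameTuple {V : S.BundleField} (hV : ∀ p, SmoothFieldNear V p)
    (h0 : ∀ p, solder p (V p) = ladder k 0) (w : T[HE] p) :
    ∃ c : Fin 4 ⊕ Fin (k + 1) → ℝ, w = ∑ i, c i • (frameTuple V).field i p := by
  obtain ⟨α, β, γ, δ, h⟩ := exists_fundComb (p := p)
    (w - ∑ r : Fin (k + 1), ladderCoeff k r (solder p w) • adField fundX V r p) (by
      rw [map_sub, solder_sum_adField hV h0, sum_ladderCoeff, sub_self])
  refine ⟨Sum.elim ![β, γ, δ, α] fun r => ladderCoeff k r (solder p w), ?_⟩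
  rw [sum_frameTuple]
  exact sub_eq_iff_eq_add.1 h

theorem frameTuple_coeff_eq_zero {V : S.BundleField} (hV : ∀ p, SmoothFieldNear V p)
    (h0 : ∀ p, solder p (V p) = ladder k 0) {c : Fin 4 ⊕ Fin (k + 1) → ℝ}
    (hc : ∑ i, c i • (frameTuple V).field i p = 0) (i) : c i = 0 := by
  rw [sum_frameTuple] at hc
  have h1 := congrArg (solder p) hc
  rw [map_add, solder_fundComb, zero_add, solder_sum_adField hV h0, map_zero] at h1
  have h2 : ∀ r, c (.inr r) = 0 := fun r => by
    rw [← ladderCoeff_sum (fun r => c (.inr r)) r, h1, map_zero]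
  simp only [h2, zero_smul, Finset.sum_const_zero, add_zero] at hc
  obtain ⟨h3, h4, h5, h6⟩ := fundComb_eq_zero hc
  rcases i with i | r
  · fin_cases i
    exacts [h4, h5, h6, h3]
  · exact h2 r

theorem linearIndependent_frameTuple {V : S.BundleField} (hV : ∀ p, SmoothFieldNear V p)
    (h0 : ∀ p, solder p (V p) = ladder k 0) (p : S.Bundle) :
    LinearIndependent ℝ (fun i => (frameTuple V).field i p) :=
  Fintype.linearIndependent_iff.2 fun _ hc => frameTuple_coeff_eq_zero hV h0 hc

theorem mem_span_vertical_iff (w : T[HE] p) :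
    w ∈ Submodule.span ℝ {fundX p, fundG p, fundF₀ p, fundF₁ p} ↔ solder p w = 0 := by
  constructor
  · intro h
    have hle : Submodule.span ℝ {fundX p, fundG p, fundF₀ p, fundF₁ p} ≤
        LinearMap.ker (solder p).toLinearMap := by
      rw [Submodule.span_le]
      rintro w (rfl | rfl | rfl | rfl)
      exacts [solder_vert isVerticalField_X p, solder_vert isVerticalField_G p,
        solder_vert isVerticalField_F₀ p, solder_vert isVerticalField_F₁ p]
    exact LinearMap.mem_ker.1 (hle h)
  · intro h
    obtain ⟨α, β, γ, δ, rfl⟩ := exists_fundComb w h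
    refine Submodule.add_mem _ (Submodule.add_mem _ (Submodule.add_mem _ ?_ ?_) ?_) ?_ <;>
      exact Submodule.smul_mem _ _ (Submodule.subset_span (by simp))

theorem isTorsion_frameTuple_iff {V : S.BundleField} (hV : ∀ p, SmoothFieldNear V p)
    (h0 : ∀ p, solder p (V p) = ladder k 0) (n : ℕ) (hn : n ≤ k) (p : S.Bundle)
    (T : Fin (k + 1) → ℝ) :
    (frameTuple V).IsTorsion 0 ⟨n, Nat.lt_succ_iff.2 hn⟩ p T ↔
      ∀ r : Fin (k + 1), ladderCoeff k r (torsionForm V n p) = T r := by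
  refine (mem_span_vertical_iff _).trans ?_
  have h1 : solder p (lie[HE] ((frameTuple V).V 0)
      ((frameTuple V).V ⟨n, Nat.lt_succ_iff.2 hn⟩) p - ∑ r, T r • (frameTuple V).V r p) =
      torsionForm V n p - ∑ r : Fin (k + 1), T r • ladder k r :=
    (map_sub _ _ _).trans (congrArg (torsionForm V n p - ·) (solder_sum_adField hV h0 T p))
  rw [h1, sub_eq_zero]
  constructor
  · intro h r
    rw [h, ladderCoeff_sum]
  · intro h
    simp only [← h, sum_ladderCoeff]

theorem isCanonical_frameTuple (hk : 3 ≤ k) {V : S.BundleField} (h : ∀ p, IsCanonicalFieldNear V p) :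
    (frameTuple V).IsCanonical := by
  have hV := fun p => (h p).1
  have h0 := fun p => (h p).2.self_of_nhds.1
  have hX := fun p : S.Bundle => (isVerticalField_X (S := S)).smoothFieldNear p
  have v1 : (1 : Fin (k + 1)) = ⟨1, by omega⟩ := Fin.ext (Nat.mod_eq_of_lt (show 1 < k + 1 by omega))
  have v2 : (2 : Fin (k + 1)) = ⟨2, by omega⟩ := Fin.ext (Nat.mod_eq_of_lt (show 2 < k + 1 by omega))
  have v3 : (3 : Fin (k + 1)) = ⟨3, by omega⟩ := Fin.ext (Nat.mod_eq_of_lt (show 3 < k + 1 by omega))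
  refine { smooth := ?_, indep := linearIndependent_frameTuple hV h0, spans := ?_, G_eq := fun _ => rfl,
           F₀_eq := fun _ => rfl, F₁_eq := fun _ => rfl, proj_V := fun p => ?_, proj_X := dproj_fundX,
           X_mem := fun p => ?_, V_eq := fun _ => rfl, torsion₀₁ := fun p T hT => ?_,
           torsion₀₃ := fun p T hT => ?_ }
  · rintro (i | r) p
    · fin_cases i
      exacts [(isVerticalField_G.smoothFieldNear p).self_of_nhds,
        (isVerticalField_F₀.smoothFieldNear p).self_of_nhds,
        (isVerticalField_F₁.smoothFieldNear p).self_of_nhds, (hX p).self_of_nhds]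
    · exact ((hX p).adField (hV p) r).self_of_nhds
  · intro p
    rw [eq_top_iff]
    rintro w -
    obtain ⟨c, rfl⟩ := exists_eq_sum_frameTuple hV h0 w
    exact Submodule.sum_mem _ fun i _ => Submodule.smul_mem _ _ (Submodule.subset_span ⟨i, rfl⟩)
  · rw [mkQ_dproj_iff, ← ladder_zero]
    exact solder_eq_iff.1 (h0 p)
  · rw [horizontalLine_eq (by omega)]
    exact Submodule.mem_span_singleton_self _
  · rw [v1, isTorsion_frameTuple_iff hV h0 1 (by omega)] at hT
    have h1 := (h p).2.self_of_nhds.2.1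
    refine ⟨?_, ?_, ?_⟩
    · rw [← hT]; exact h1 0 (by norm_num)
    · rw [v1, ← hT]; exact h1 1 (by norm_num)
    · rw [v2, ← hT]; exact h1 2 (by norm_num)
  · rw [v3, isTorsion_frameTuple_iff hV h0 3 (by omega)] at hT
    rw [v3, ← hT]
    exact (h p).2.self_of_nhds.2.2

theorem fundX_dproj_ne_zero (p : S.Bundle) : CanonicalBundle.dproj p (fundX p) ≠ 0 := by
  obtain ⟨X, V, h, -, hj⟩ := p.exists_frame
  rw [dproj_fundX p X (by rw [hj]; exact JetRel.refl _ _)]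
  exact h.self_of_nhds.fst_ne_zero

/-- An adapted frame is determined by `V⁰`: its field `X` lies in the canonical line field and projects
to the value of the jet, as `fundX` does. -/
theorem eq_frameTuple (hk : 3 ≤ k) {B : FrameTuple S.pair k} (h : B.IsAdapted) :
    B = frameTuple (B.V 0) := by
  have hX : B.X = fundX := by
    funext p
    have h1 := h.X_mem p
    rw [horizontalLine_eq (by omega)] at h1
    obtain ⟨c, hc⟩ := Submodule.mem_span_singleton.1 h1
    obtain ⟨X, V, -, -, hj⟩ := p.exists_frame
    have hY : X ∈ p.jet := by rw [hj]; exact JetRel.refl _ _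
    have h2 := (h.proj_X p X hY).trans (dproj_fundX p X hY).symm
    rw [← hc, map_smul] at h2
    have h3 : (c - 1) • CanonicalBundle.dproj p (fundX p) = 0 := by
      rw [sub_smul, one_smul, h2, sub_self]
    rcases smul_eq_zero.1 h3 with h4 | h4
    · rw [← hc, sub_eq_zero.1 h4, one_smul]
    · exact absurd h4 (fundX_dproj_ne_zero p)
  refine FrameTuple.ext (funext h.G_eq) (funext h.F₀_eq) (funext h.F₁_eq) hX ?_
  funext i
  rw [h.V_eq, hX]
  rfl

theorem FrameTuple.IsCanonical.isCanonicalFieldNear (hk : 3 ≤ k) {B : FrameTuple S.pair k}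
    (h : B.IsCanonical) (p : S.Bundle) : IsCanonicalFieldNear (B.V 0) p := by
  have hB := eq_frameTuple hk h.toIsAdapted
  have hV : ∀ p, SmoothFieldNear (B.V 0) p := fun p =>
    .of_forall fun q => h.smooth (.inr 0) q
  have h0 : ∀ p, solder p (B.V 0 p) = ladder k 0 := fun p => by
    rw [solder_eq_iff, ladder_zero, ← mkQ_dproj_iff]
    exact h.proj_V p
  refine ⟨hV p, .of_forall fun q => ⟨h0 q, ?_⟩⟩
  have v1 : (1 : Fin (k + 1)) = ⟨1, by omega⟩ := Fin.ext (Nat.mod_eq_of_lt (show 1 < k + 1 by omega))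
  have v2 : (2 : Fin (k + 1)) = ⟨2, by omega⟩ := Fin.ext (Nat.mod_eq_of_lt (show 2 < k + 1 by omega))
  have v3 : (3 : Fin (k + 1)) = ⟨3, by omega⟩ := Fin.ext (Nat.mod_eq_of_lt (show 3 < k + 1 by omega))
  have t : ∀ n (hn : n ≤ k), B.IsTorsion 0 ⟨n, Nat.lt_succ_iff.2 hn⟩ q
      (fun r => ladderCoeff k r (torsionForm (B.V 0) n q)) := fun n hn => by
    have := (isTorsion_frameTuple_iff hV h0 n hn q
      (fun r => ladderCoeff k r (torsionForm (B.V 0) n q))).2 fun _ => rfl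
    rwa [← hB] at this
  have t1 := h.torsion₀₁ q _ (by rw [v1]; exact t 1 (by omega))
  have t3 := h.torsion₀₃ q _ (by rw [v3]; exact t 3 (by omega))
  rw [v1, v2] at t1
  rw [v3] at t3
  refine ⟨fun i hi => ?_, t3⟩
  interval_cases i
  exacts [t1.1, t1.2.1, t1.2.2]

theorem existsUnique_isCanonical (hk : 3 ≤ k) :
    ∃! B : FrameTuple S.pair k, B.IsCanonical := by
  obtain ⟨V, hV⟩ := exists_canonicalField (S := S) hk
  refine ⟨frameTuple V, isCanonical_frameTuple hk hV, fun B hB => ?_⟩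
  rw [eq_frameTuple hk hB.toIsAdapted]
  congr 1
  funext p
  exact ((hV p).unique hk (FrameTuple.IsCanonical.isCanonicalFieldNear hk hB p)).self_of_nhds

end

section

/-! ### Lifts of maps to the canonical bundles -/

/-- The map `Φ` of the canonical bundles lifts `f` at the point `q`: it is given by the action of the
differential of `f` on the frames. -/
structure IsLiftAt (f : N → N') (Φ : S.Bundle → S'.Bundle) (q : S.Bundle) : Prop where
  foot_eq : foot (Φ q) = f (foot q)
  frame_eq : ∀ a, (frame (Φ q) a : HN) = d[HN, HN] f (foot q) (frame q a)

variable {f : N → N'} {Φ : S.Bundle → S'.Bundle} {p : S.Bundle}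

/-- The matrix of the differential of `f` with respect to two fields of frames. -/
def frameMatrix (f : N → N') (σ : FrameField k N) (σ' : FrameField k N') (y : N) :
    End[k] :=
  (σ' (f y)).inverse.comp ((d[HN, HN] f y).comp (σ y))

theorem SmoothNear.clm_comp {A B : S.Bundle → End[k]}
    (hA : Smooth[HE, End[k]] A p)
    (hB : Smooth[HE, End[k]] B p) :
    Smooth[HE, End[k]] (fun q => (A q).comp (B q)) p :=
  smoothNear_clm_of_apply fun a => hA.clm_apply (hB.clm (ContinuousLinearMap.apply ℝ _ a))

theorem tderiv_clm_comp_of_eq_zero {A B : S.Bundle → End[k]}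
    (hA : Smooth[HE, End[k]] A p)
    (hB : Smooth[HE, End[k]] B p) {w : T[HE] p}
    (h0 : tderiv A p w = 0) :
    tderiv (fun q => (A q).comp (B q)) p w = (A p).comp (tderiv B p w) := by
  ext1 a
  have hBa := hB.clm (ContinuousLinearMap.apply ℝ (BForm k) a)
  have h1 := tderiv_clm_apply_const (_root_.GL2Structure.SmoothNear.clm_comp hA hB) a w
  refine h1.symm.trans ?_
  refine (tderiv_clm_apply hA.mdiff hBa.mdiff w).trans ?_
  rw [h0, zero_apply, add_zero]
  exact congrArg (A p) (tderiv_clm_apply_const hB a w)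

theorem smoothNear_frameMatrix {x : N} {σ : FrameField k N} {σ' : FrameField k N'}
    (hσ : S.IsLocalSection σ x) (hσ' : S'.IsLocalSection σ' (f x))
    (hf : Smooth[HN, HN] f x) :
    Smooth[HN, End[k]] (frameMatrix f σ σ') x := by
  have hc : ContinuousAt f x := hf.at.continuousAt
  refine smoothNear_clm_of_apply fun a => ?_
  refine smoothNear_frame_coeff (π := f) (σ := σ') (W := fun y => σ y a) hσ'.smoothFrameNear hf
    (hσ.smoothFrameNear.smoothField a) ?_
  filter_upwards [hc.eventually hσ'.near] with y hy
  exact (hy.isInvertible.self_apply_inverse _).symm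

/-- In frames, a lift is the multiplication by the matrix of the differential of the map. -/
theorem frameCoord_lift (hf : Smooth[HN, HN] f p.base.base)
    (hΦ : ∀ᶠ q in 𝓝 p, IsLiftAt f Φ q)
    {ψ : BaseChart N k} {σ : FrameField k N}
    {ψ' : BaseChart N' k} {σ' : FrameField k N'} {p₀ : S.Bundle} {p₀' : S'.Bundle}
    (hp : InChart ψ σ p₀ p)
    (hp' : (Φ p).base ∈ (lineChart ψ' σ' p₀'.base).source) :
    ∀ᶠ q in 𝓝 p, frameCoord σ' (Φ q) = (frameMatrix f σ σ' (foot q)).comp (frameCoord σ q) := by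
  have hc : ContinuousAt (fun q : S.Bundle => f (foot q)) p :=
    ContinuousAt.comp (g := f) hf.at.continuousAt (continuousAt_foot p)
  have hs : S'.IsLocalSection σ' (f (foot p)) := by
    rw [← hΦ.self_of_nhds.foot_eq]; exact hp'.2.1
  filter_upwards [hΦ, hc.eventually hs.near, near_frameChart hp] with q h1 h2 h3
  refine frameCoord_eq_of_apply h1.foot_eq h2 fun a => ?_
  refine (h1.frame_eq a).trans ?_
  refine Eq.trans ?_ (h2.isInvertible.self_apply_inverse _).symm
  exact congrArg (d[HN, HN] f (foot q)) (apply_frameCoord h3.2.1 a).symm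

theorem smoothNear_lift (hf : Smooth[HN, HN] f p.base.base)
    (hΦ : ∀ᶠ q in 𝓝 p, IsLiftAt f Φ q) : Smooth[HE, HE] Φ p := by
  obtain ⟨ψ, σ, hp⟩ := exists_frameChart p
  obtain ⟨ψ', σ', hp'⟩ := exists_frameChart (Φ p)
  have hs : S'.IsLocalSection σ' (f (foot p)) := by
    rw [← hΦ.self_of_nhds.foot_eq]; exact hp'.2.1
  refine smoothNear_of_frameCoord hp' ?_ ?_
  · exact (SmoothNear.comp_map (f := f) (π := (foot : S.Bundle → N)) hf (smoothNear_foot p)).congr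
      (hΦ.mono fun q hq => hq.foot_eq)
  · have h1 := SmoothNear.comp_map (f := frameMatrix f σ σ') (π := (foot : S.Bundle → N))
      (smoothNear_frameMatrix hp.2.1 hs hf) (smoothNear_foot p)
    exact (SmoothNear.clm_comp h1 (smoothNear_frameCoord hp)).congr (frameCoord_lift hf hΦ hp hp')

theorem dfoot_lift (hf : Smooth[HN, HN] f p.base.base)
    (hΦ : ∀ᶠ q in 𝓝 p, IsLiftAt f Φ q)
    (w : T[HE] p) :
    (dfoot (Φ p) (d[HE, HE] Φ p w) : HN) = d[HN, HN] f p.base.base (dfoot p w) := by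
  have h1 := mfderiv_comp p (I := 𝓘(ℝ, HE)) (I' := 𝓘(ℝ, HE)) (I'' := 𝓡 (k + 1))
    (g := (foot : S'.Bundle → N')) (f := Φ) (smoothNear_foot (Φ p)).mdiff (smoothNear_lift hf hΦ).mdiff
  have h2 := mfderiv_comp p (I := 𝓘(ℝ, HE)) (I' := 𝓡 (k + 1)) (I'' := 𝓡 (k + 1))
    (g := f) (f := (foot : S.Bundle → N)) hf.mdiff (smoothNear_foot p).mdiff
  have h3 : (foot : S'.Bundle → N') ∘ Φ =ᶠ[𝓝 p] f ∘ (foot : S.Bundle → N) :=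
    hΦ.mono fun q hq => hq.foot_eq
  have h4 := h3.mfderiv_eq (I := 𝓘(ℝ, HE)) (I' := 𝓡 (k + 1))
  have e1 := congrArg (fun L : HE →L[ℝ] HN => L w) h1
  have e2 := congrArg (fun L : HE →L[ℝ] HN => L w) h2
  have e4 := congrArg (fun L : HE →L[ℝ] HN => L w) h4
  exact e1.symm.trans (e4.trans e2)

theorem solder_lift (hf : Smooth[HN, HN] f p.base.base)
    (hΦ : ∀ᶠ q in 𝓝 p, IsLiftAt f Φ q)
    (w : T[HE] p) :
    solder (Φ p) (d[HE, HE] Φ p w) = solder p w := by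
  rw [solder_eq_iff]
  refine (dfoot_lift hf hΦ w).trans ?_
  refine Eq.trans ?_ (hΦ.self_of_nhds.frame_eq (solder p w)).symm
  exact congrArg (d[HN, HN] f p.base.base) (frame_solder w).symm

/-- Lifts preserve the vertical fields. -/
theorem vertical_lift (hf : Smooth[HN, HN] f p.base.base)
    (hΦ : ∀ᶠ q in 𝓝 p, IsLiftAt f Φ q)
    {D : End[k]} {Y : S.BundleField} {Y' : S'.BundleField}
    (hY : IsVerticalField D Y) (hY' : IsVerticalField D Y') :
    d[HE, HE] Φ p (Y p) = Y' (Φ p) := by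
  obtain ⟨ψ, σ, hp⟩ := exists_frameChart p
  obtain ⟨ψ', σ', hp'⟩ := exists_frameChart (Φ p)
  have hs : S'.IsLocalSection σ' (f (foot p)) := by
    rw [← hΦ.self_of_nhds.foot_eq]; exact hp'.2.1
  refine tangent_ext hp' ?_ ?_
  · refine Eq.trans ?_ (hY' (Φ p)).1.symm
    rw [← solder_eq_zero_iff, solder_lift hf hΦ, solder_vert hY]
  · rw [(hY' (Φ p)).2 ψ' σ' (Φ p) hp']
    have hs0 := smoothNear_frameMatrix hp.2.1 hs hf
    have h1 := SmoothNear.comp_map (f := frameMatrix f σ σ') (π := (foot : S.Bundle → N))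
      hs0 (smoothNear_foot p)
    have e1 := tderiv_comp (f := frameCoord σ') (π := Φ) (smoothNear_frameCoord hp').mdiff
      (smoothNear_lift hf hΦ).mdiff (Y p)
    refine e1.symm.trans ?_
    refine (tderiv_congr (frameCoord_lift hf hΦ hp hp') (Y p)).trans ?_
    have e4 : tderiv (fun q : S.Bundle => frameMatrix f σ σ' (foot q)) p (Y p) = 0 := by
      refine (tderiv_comp (f := frameMatrix f σ σ') (π := (foot : S.Bundle → N)) hs0.mdiff
        (smoothNear_foot p).mdiff (Y p)).trans ?_
      exact (congrArg (tderiv (frameMatrix f σ σ') (foot p)) (hY p).1).trans (tderiv_vzero _)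
    refine (tderiv_clm_comp_of_eq_zero h1 (smoothNear_frameCoord hp) e4).trans ?_
    rw [(hY p).2 ψ σ p hp, (frameCoord_lift hf hΦ hp hp').self_of_nhds]
    rfl

/-- The soldering form and the vertical fields are preserved, so the differential of a lift is injective. -/
theorem bijective_lift (hf : Smooth[HN, HN] f p.base.base)
    (hΦ : ∀ᶠ q in 𝓝 p, IsLiftAt f Φ q) :
    Function.Bijective (d[HE, HE] Φ p) := by
  let L : HE →L[ℝ] HE := d[HE, HE] Φ p
  have hinj : Function.Injective L.toLinearMap := by
    rw [← LinearMap.ker_eq_bot, LinearMap.ker_eq_bot']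
    intro w hw
    have hw' : d[HE, HE] Φ p w = 0 := hw
    have h1 := solder_lift hf hΦ w
    rw [hw', map_zero] at h1
    obtain ⟨α, β, γ, δ, h2⟩ := exists_fundComb (p := p) w h1.symm
    have h3 := vertical_lift hf hΦ (isVerticalField_fundComb α β γ δ)
      (isVerticalField_fundComb (S := S') α β γ δ)
    rw [← h2] at h3
    obtain ⟨rfl, rfl, rfl, rfl⟩ := fundComb_eq_zero (h3.symm.trans hw')
    refine h2.trans ?_
    simp only [fundComb, zero_smul, add_zero]
    rfl
  have hsurj : Function.Surjective L.toLinearMap := LinearMap.injective_iff_surjective.1 hinj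
  exact ⟨hinj, hsurj⟩

theorem IsLiftAt.near_foot (hf : Smooth[HN, HN] f p.base.base) :
    ∀ᶠ q in 𝓝 p, Smooth[HN, HN] f q.base.base :=
  (continuousAt_foot p).eventually hf.near

/-- Lifts of maps which preserve the structures carry the canonical fields to each other. -/
theorem canonicalField_lift (hk : 3 ≤ k) (hf : Smooth[HN, HN] f p.base.base)
    (hΦ : ∀ᶠ q in 𝓝 p, IsLiftAt f Φ q) {V : S.BundleField} {V' : S'.BundleField}
    (hV : IsCanonicalFieldNear V p) (hV' : IsCanonicalFieldNear V' (Φ p)) :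
    ∀ᶠ q in 𝓝 p, d[HE, HE] Φ q (V q) = V' (Φ q) := by
  have hs := smoothNear_lift hf hΦ
  have hc : ContinuousAt Φ p := hs.at.continuousAt
  have hfn := IsLiftAt.near_foot hf
  obtain ⟨W, hW, hWV⟩ := exists_related (X' := V') hs (by
    filter_upwards [hfn, hΦ.eventually_nhds] with q h1 h2
    exact bijective_lift h1 h2) hV'.1
  have hX : ∀ᶠ q in 𝓝 p, d[HE, HE] Φ q (fundX q) = fundX (Φ q) := by
    filter_upwards [hfn, hΦ.eventually_nhds] with q h1 h2
    exact vertical_lift h1 h2 isVerticalField_X isVerticalField_X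
  have hXs := fun q : S.Bundle => (isVerticalField_X (S := S)).smoothFieldNear q
  have hXs' := fun q : S'.Bundle => (isVerticalField_X (S := S')).smoothFieldNear q
  have htor : ∀ n, ∀ᶠ q in 𝓝 p, torsionForm W n q = torsionForm V' n (Φ q) := fun n => by
    filter_upwards [hfn, hΦ.eventually_nhds, hs.near, hW.near, hWV.eventually_nhds,
      ((hXs p).adField hW n).near, hc.eventually hV'.1.near,
      hc.eventually ((hXs' (Φ p)).adField hV'.1 n).near,
      (mfderiv_adField_of_related hs (hXs p) hW (hXs' _) hV'.1 hX hWV n).eventually_nhds]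
      with q h1 h2 h3 h4 h5 h6 h7 h8 h9
    rw [torsionForm, ← solder_lift h1 h2, mfderiv_bracket_of_related h3 h4 h6 h7 h8 h5 h9]
    rfl
  have hWc : IsCanonicalFieldNear W p := by
    refine ⟨hW, ?_⟩
    filter_upwards [hfn, hΦ.eventually_nhds, hWV, hc.eventually hV'.2, htor 1, htor 3]
      with q h1 h2 h3 h4 h5 h6
    refine ⟨?_, ?_, ?_⟩
    · rw [← solder_lift h1 h2, h3, h4.1]
    · rw [h5]; exact h4.2.1
    · rw [h6]; exact h4.2.2
  filter_upwards [hWV, hWc.unique hk hV] with q h1 h2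
  rw [h2, h1]

end

section

/-! ### Descent of maps from the canonical bundle -/

/-- A smooth local section of the projection to `N`, through a given point. -/
theorem exists_local_section (p : S.Bundle) : ∃ s : N → S.Bundle, s (foot p) = p ∧
    Smooth[HN, HE] s (foot p) ∧ ∀ᶠ y in 𝓝 (foot p), foot (s y) = y := by
  classical
  obtain ⟨ψ, σ, hσ, hσp, hp, -⟩ := exists_adapted_chart p
  let s : N → S.Bundle := fun y => if h : σ y ∈ S.frames y then point y (σ y) h else p
  have hs : ∀ y, S.IsLocalSection σ y → foot (s y) = y ∧
      ∀ a, (frame (s y) a : HN) = σ y a := fun y hy => by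
    have h : σ y ∈ S.frames y := hy.mem
    have h1 : s y = point y (σ y) h := dif_pos h
    rw [h1]
    exact ⟨point_base _ _ _, frame_point _ _ _⟩
  have hsp : s (foot p) = p := eq_of_frame_eq (hs _ hσ).1 fun a => by
    refine ((hs _ hσ).2 a).trans ?_
    exact congrArg (fun L : BForm k →L[ℝ] HN => L a) hσp
  refine ⟨s, hsp, ?_, hσ.near.mono fun y hy => (hs y hy).1⟩
  refine smoothNear_of_frameCoord (ψ := ψ) (σ := σ) (p₀ := p) (by rw [hsp]; exact hp) ?_ ?_
  · have h1 : Smooth[HN, HN] (fun y : N => y) (foot p) :=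
      .of_forall fun _ => contMDiffAt_id
    exact h1.congr (hσ.near.mono fun y hy => (hs y hy).1)
  · refine (smoothNear_const idV).congr ?_
    filter_upwards [hσ.near] with y hy
    exact frameCoord_eq_of_apply (hs y hy).1 hy (hs y hy).2

theorem eventually_of_foot {p : S.Bundle} {P : N → Prop} (h : ∀ᶠ q in 𝓝 p, P (foot q)) :
    ∀ᶠ y in 𝓝 (foot p), P y := by
  obtain ⟨s, hs, hs', hf⟩ := exists_local_section p
  have hc : ContinuousAt s (foot p) := hs'.at.continuousAt
  filter_upwards [hc.eventually (hs.symm ▸ h), hf] with y h1 h2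
  rwa [h2] at h1

/-- A map whose differential vanishes on the vertical vectors comes from a map of `N`. -/
theorem exists_descent {p : S.Bundle} {h : S.Bundle → N'} (hh : Smooth[HE, HN] h p)
    (h0 : ∀ᶠ q in 𝓝 p, ∀ w : T[HE] q, dfoot q w = 0 → d[HE, HN] h q w = 0) :
    ∃ f : N → N', Smooth[HN, HN] f (foot p) ∧ ∀ᶠ q in 𝓝 p, h q = f (foot q) := by
  obtain ⟨s, hs, hs', hfs⟩ := exists_local_section p
  obtain ⟨ψ, σ, hp⟩ := exists_frameChart p
  have hc : ContinuousAt s (foot p) := hs'.at.continuousAt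
  have hhc : ContinuousAt h p := hh.at.continuousAt
  refine ⟨fun y => h (s y), SmoothNear.comp_map (f := h) (π := s) (hs.symm ▸ hh) hs', ?_⟩
  set e' := chartAt HN (h p)
  have he' : SmoothChart e' := smoothChart_chartAt (h p)
  have hmem : h p ∈ e'.source := mem_chart_source _ (h p)
  have hg : Smooth[HE, HN] (fun q => e' (h q)) p :=
    SmoothNear.comp_map (f := e') (π := h) (he'.smoothNear hmem) hh
  let K : Submodule ℝ HE := LinearMap.ker
    ((fst ℝ HN ℝ).comp (fst ℝ (HN × ℝ) (ℝ × ℝ × ℝ))).toLinearMap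
  have hps : p ∈ (frameChart ψ σ p).source := mem_frameChart_source_iff.2 hp
  have key := eventually_eq_of_tderiv_eq_zero (smoothChart_frameChart ψ σ p) hps hg K (by
    filter_upwards [h0, near_frameChart hp, hhc.eventually (e'.open_source.mem_nhds hmem), hh] with
      q h1 h2 h3 h4 w hw
    refine (tderiv_comp (f := e') (π := h) (he'.smoothNear h3).mdiff (h4.mdifferentiableAt (by simp))
      w).trans ?_
    refine (congrArg (tderiv e' (h q)) (h1 w ?_)).trans (tderiv_vzero _)
    have h5 : (tderiv (frameChart ψ σ p) q w).1.1 = 0 := hw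
    rw [(tderiv_frameChart h2 w).1] at h5
    refine (smoothChart_of_mem_atlas ψ.2).tderiv_injective h2.1 ?_
    exact h5.trans (tderiv_vzero _).symm)
  have hfc := continuousAt_foot p
  have hsf : ContinuousAt (fun q => s (foot q)) p := ContinuousAt.comp (g := s) hc hfc
  have hsfp : s (foot p) = p := hs
  have htend : Tendsto (fun q => (s (foot q), q)) (𝓝 p) (𝓝 (p, p)) := by
    have := hsf.prodMk (continuousAt_id (x := p))
    have h1 := this.tendsto
    simp only [hsfp, id] at h1
    exact h1
  filter_upwards [htend.eventually key, hfc.eventually hfs, near_frameChart hp,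
    hsf.eventually (hsfp.symm ▸ near_frameChart hp), hhc.eventually (e'.open_source.mem_nhds hmem),
    hsf.eventually (hsfp.symm ▸ hhc.eventually (e'.open_source.mem_nhds hmem))]
    with q h1 h2 h3 h4 h5 h6
  refine (e'.injOn h6 h5 (h1 ?_)).symm
  change ((frameChart ψ σ p q) - (frameChart ψ σ p (s (foot q)))).1.1 = 0
  have h7 : (frameChart ψ σ p (s (foot q))).1.1 = (frameChart ψ σ p q).1.1 := by
    rw [frameChart_fst, frameChart_fst, lineChart_fst, lineChart_fst]
    exact congrArg ψ.1 h2
  rw [Prod.fst_sub, Prod.fst_sub, h7, sub_self]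

/-! ### Equivalence of structures and of canonical frames -/

/-- The lift of `f` to the canonical bundles; the point `q₀` is the value where the differential of
`f` does not preserve the structures. -/
def liftMap (S : GL2Structure k N) {S' : GL2Structure k N'} (f : N → N') (q₀ : S'.Bundle)
    (q : S.Bundle) : S'.Bundle :=
  open Classical in if h : S.PreservesAt S' f (foot q) then point (f (foot q)) _ (h _ (frame_mem q))
  else q₀

variable {f : N → N'} {Φ : S.Bundle → S'.Bundle} {p : S.Bundle}

theorem isLiftAt_liftMap {q₀ : S'.Bundle} (h : S.PreservesAt S' f (foot p)) :
    IsLiftAt f (liftMap S f q₀) p := by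
  have h1 : liftMap S f q₀ p = point (f (foot p)) _ (h _ (frame_mem p)) := dif_pos h
  constructor
  · rw [h1]; exact point_base _ _ _
  · rw [h1]; exact frame_point _ _ _

theorem mem_frames_of_frame {y : N} (h : foot p = y) {τ : BForm k →L[ℝ] T[HN] y}
    (hτ : ∀ a, (frame p a : HN) = τ a) : τ ∈ S.frames y := by
  subst h
  have : τ = frame p := ContinuousLinearMap.ext fun a => (hτ a).symm
  exact this ▸ frame_mem p

theorem IsLiftAt.preservesAt (h : IsLiftAt f Φ p) : S.PreservesAt S' f (foot p) := fun σ hσ => by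
  obtain ⟨B, hB, rfl⟩ := (mem_frames_iff_isGL2 (frame_mem p)).1 hσ
  exact comp_mem_frames (mem_frames_of_frame (τ := (d[HN, HN] f (foot p)).comp (frame p))
    h.foot_eq h.frame_eq) hB

theorem exists_foot_eq (S : GL2Structure k N) (x : N) : ∃ p : S.Bundle, foot p = x := by
  obtain ⟨σ, hσ⟩ := S.exists_smooth x
  exact ⟨point x _ hσ.self_of_nhds.1, point_base _ _ _⟩

theorem PreservesAt.bijective {y : N} (h : S.PreservesAt S' f y) :
    Function.Bijective (d[HN, HN] f y) := by
  obtain ⟨σ, hσ⟩ := S.exists_smooth y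
  have hσ' := hσ.self_of_nhds.1
  exact (Function.Bijective.of_comp_iff _ (S.bijective _ _ hσ')).1 (S'.bijective _ _ (h _ hσ'))

theorem PreservesAt.congr {g : N → N'} {y : N} (h : S.PreservesAt S' f y) (hfg : g =ᶠ[𝓝 y] f) :
    S.PreservesAt S' g y := fun σ hσ => by
  have h1 := h σ hσ
  rw [PreservesAt] at *
  rwa [hfg.mfderiv_eq, hfg.self_of_nhds]

/-- The image of the canonical field under a lift is canonical, so uniqueness identifies the frames. -/
theorem mapsFrameAt_lift (hk : 3 ≤ k) (hf : Smooth[HN, HN] f p.base.base)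
    (hΦ : ∀ᶠ q in 𝓝 p, IsLiftAt f Φ q) {B : FrameTuple S.pair k} {B' : FrameTuple S'.pair k}
    (hB : B.IsCanonical) (hB' : B'.IsCanonical) : MapsFrameAt B B' Φ p := by
  have hV := GL2Structure.FrameTuple.IsCanonical.isCanonicalFieldNear hk hB p
  have hV' := GL2Structure.FrameTuple.IsCanonical.isCanonicalFieldNear hk hB' (Φ p)
  have hX : ∀ᶠ q in 𝓝 p, d[HE, HE] Φ q (fundX q) = fundX (Φ q) := by
    filter_upwards [IsLiftAt.near_foot hf, hΦ.eventually_nhds] with q h1 h2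
    exact vertical_lift h1 h2 isVerticalField_X isVerticalField_X
  rw [eq_frameTuple hk hB.toIsAdapted, eq_frameTuple hk hB'.toIsAdapted]
  rintro (i | j)
  · fin_cases i
    · exact vertical_lift hf hΦ isVerticalField_G isVerticalField_G
    · exact vertical_lift hf hΦ isVerticalField_F₀ isVerticalField_F₀
    · exact vertical_lift hf hΦ isVerticalField_F₁ isVerticalField_F₁
    · exact hX.self_of_nhds
  · exact (mfderiv_adField_of_related (smoothNear_lift hf hΦ) (isVerticalField_X.smoothFieldNear p)
      hV.1 (isVerticalField_X.smoothFieldNear _) hV'.1 hX (canonicalField_lift hk hf hΦ hV hV')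
      j).self_of_nhds

theorem clm_ext_ladder {A B : BForm k →L[ℝ] HN}
    (h : ∀ r : Fin (k + 1), A (ladder k r) = B (ladder k r)) : A = B := by
  ext1 a
  rw [← sum_ladderCoeff a, map_sum, map_sum]
  exact Finset.sum_congr rfl fun r _ => by rw [map_smul, map_smul, h]

theorem dfoot_fundComb (α β γ δ : ℝ) : dfoot p (fundComb α β γ δ p) = 0 :=
  (isVerticalField_fundComb α β γ δ p).1

/-- A map of the canonical bundles which carries the canonical frame to the canonical frame is the
lift of a map of the manifolds. -/
theorem exists_isLiftAt (hk : 3 ≤ k) {B : FrameTuple S.pair k} {B' : FrameTuple S'.pair k}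
    (hB : B.IsCanonical) (hB' : B'.IsCanonical) (hΦ : Smooth[HE, HE] Φ p)
    (hm : ∀ᶠ q in 𝓝 p, MapsFrameAt B B' Φ q) :
    ∃ f : N → N', Smooth[HN, HN] f (foot p) ∧ ∀ᶠ q in 𝓝 p, IsLiftAt f Φ q := by
  rw [eq_frameTuple hk hB.toIsAdapted, eq_frameTuple hk hB'.toIsAdapted] at hm
  have hV := fun q => GL2Structure.FrameTuple.IsCanonical.isCanonicalFieldNear hk hB q
  have hV' := fun q => GL2Structure.FrameTuple.IsCanonical.isCanonicalFieldNear hk hB' q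
  have hh : Smooth[HE, HN] (fun q => foot (Φ q)) p :=
    SmoothNear.comp_map (f := (foot : S'.Bundle → N')) (π := Φ) (smoothNear_foot _) hΦ
  have hd : ∀ᶠ q in 𝓝 p, ∀ w : T[HE] q,
      (d[HE, HN] (fun q => foot (Φ q)) q w : HN) = dfoot (Φ q) (d[HE, HE] Φ q w) := by
    filter_upwards [hΦ.near] with q hq w
    exact congrArg (fun L : HE →L[ℝ] HN => L w) (mfderiv_comp q (I := 𝓘(ℝ, HE)) (I' := 𝓘(ℝ, HE))
      (I'' := 𝓡 (k + 1)) (g := (foot : S'.Bundle → N')) (f := Φ) (smoothNear_foot (Φ q)).mdiff hq.mdiff)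
  obtain ⟨f, hf, hff⟩ := exists_descent hh (by
    filter_upwards [hd, hm] with q h1 h2 w hw
    obtain ⟨α, β, γ, δ, rfl⟩ := exists_fundComb w (solder_eq_zero_iff.2 hw)
    refine (h1 _).trans ?_
    have h3 : d[HE, HE] Φ q (fundComb α β γ δ q) = fundComb α β γ δ (Φ q) := by
      simp only [fundComb, map_add, map_smul]
      rw [show d[HE, HE] Φ q (fundX q) = fundX (Φ q) from h2 (.inl 3),
        show d[HE, HE] Φ q (fundG q) = fundG (Φ q) from h2 (.inl 0),
        show d[HE, HE] Φ q (fundF₀ q) = fundF₀ (Φ q) from h2 (.inl 1),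
        show d[HE, HE] Φ q (fundF₁ q) = fundF₁ (Φ q) from h2 (.inl 2)]
    rw [h3]
    exact dfoot_fundComb α β γ δ)
  refine ⟨f, hf, ?_⟩
  filter_upwards [hff.eventually_nhds, hd, hm, (continuousAt_foot p).eventually hf] with q h1 h2 h3 h4
  refine ⟨h1.self_of_nhds, fun a => ?_⟩
  have h5 : ∀ w : T[HE] q, d[HN, HN] f (foot q) (dfoot q w) =
      (dfoot (Φ q) (d[HE, HE] Φ q w) : HN) := fun w => by
    have e1 := congrArg (fun L : HE →L[ℝ] HN => L w) (mfderiv_comp q (I := 𝓘(ℝ, HE)) (I' := 𝓡 (k + 1))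
      (I'' := 𝓡 (k + 1)) (g := f) (f := (foot : S.Bundle → N)) (h4.mdifferentiableAt (by simp))
      (smoothNear_foot q).mdiff)
    have e2 := congrArg (fun L : HE →L[ℝ] HN => L w)
      (Filter.EventuallyEq.mfderiv_eq (I := 𝓘(ℝ, HE)) (I' := 𝓡 (k + 1)) h1)
    exact e1.symm.trans (e2.symm.trans (h2 w))
  have hs : ∀ r : Fin (k + 1), (frame (Φ q) (ladder k r) : HN) =
      d[HN, HN] f (foot q) (frame q (ladder k r)) := fun r => by
    have s1 := (solder_adField (hV q).1 ((hV q).2.mono fun _ h => h.1) r).self_of_nhds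
    have s2 := (solder_adField (hV' (Φ q)).1 ((hV' (Φ q)).2.mono fun _ h => h.1) r).self_of_nhds
    rw [solder_eq_iff] at s1 s2
    rw [← s1, ← s2, h5]
    exact congrArg (dfoot (Φ q)) (h3 (.inr r)).symm
  exact congrArg (fun L : BForm k →L[ℝ] HN => L a) (clm_ext_ladder (A := frame (Φ q))
    (B := (d[HN, HN] f (foot q)).comp (frame q)) hs)

theorem germEquivalent_iff (hk : 3 ≤ k) {B : FrameTuple S.pair k} {B' : FrameTuple S'.pair k}
    (hB : B.IsCanonical) (hB' : B'.IsCanonical) (x : N) (x' : N') : S.GermEquivalent S' x x' ↔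
      ∃ (p : S.Bundle) (p' : S'.Bundle), p.base.base = x ∧ p'.base.base = x' ∧
        FrameGermsEquivalent B B' p p' := by
  constructor
  · rintro ⟨f, hx, rfl, hf, -, hfp⟩
    obtain ⟨p, rfl⟩ := exists_foot_eq S x
    obtain ⟨q₀, -⟩ := exists_foot_eq S' (f (foot p))
    have hsrc : ∀ᶠ q in 𝓝 p, foot q ∈ f.source :=
      (continuousAt_foot p).eventually (f.open_source.mem_nhds hx)
    have hfs : ∀ y ∈ f.source, Smooth[HN, HN] f y := fun y hy => by
      filter_upwards [f.open_source.mem_nhds hy] with z hz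
      exact hf.contMDiffAt (f.open_source.mem_nhds hz)
    have hlift : ∀ᶠ q in 𝓝 p, IsLiftAt f (liftMap S f q₀) q := by
      filter_upwards [hsrc] with q hq
      exact isLiftAt_liftMap (hfp _ hq)
    have hgood : ∀ᶠ q in 𝓝 p, MapsFrameAt B B' (liftMap S f q₀) q := by
      filter_upwards [hsrc, hlift.eventually_nhds] with q h1 h2
      exact mapsFrameAt_lift hk (hfs _ h1) h2 hB hB'
    obtain ⟨Q, h1, h2, h3, h4, h5⟩ := exists_openPartialHomeomorph (smoothNear_lift (hfs _ hx) hlift)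
      (bijective_lift (hfs _ hx) hlift) hgood
    refine ⟨p, Q p, rfl, ?_, Q, h1, rfl, h4, h5, fun q hq i => ?_⟩
    · rw [h3 h1]; exact hlift.self_of_nhds.foot_eq
    · have hQ : Q =ᶠ[𝓝 q] liftMap S f q₀ := eventually_of_mem (Q.open_source.mem_nhds hq) h3
      rw [hQ.mfderiv_eq, hQ.self_of_nhds]
      exact h2 hq i
  · rintro ⟨p, p', rfl, rfl, Φ, hp, rfl, hΦ, -, hm⟩
    have hsm : Smooth[HE, HE] Φ p := by
      filter_upwards [Φ.open_source.mem_nhds hp] with q hq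
      exact hΦ.contMDiffAt (Φ.open_source.mem_nhds hq)
    obtain ⟨f, hf, hl⟩ := exists_isLiftAt hk hB hB' hsm
      (eventually_of_mem (Φ.open_source.mem_nhds hp) hm)
    have hpres : ∀ᶠ y in 𝓝 (foot p), S.PreservesAt S' f y :=
      eventually_of_foot (hl.mono fun q hq => hq.preservesAt)
    obtain ⟨Q, h1, h2, h3, h4, h5⟩ := exists_openPartialHomeomorph hf hpres.self_of_nhds.bijective hpres
    refine ⟨Q, h1, (h3 h1).trans hl.self_of_nhds.foot_eq.symm, h4, h5, fun y hy => ?_⟩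
    exact (h2 hy).congr (eventually_of_mem (Q.open_source.mem_nhds hy) h3)

end

/-! ### Global equivalence -/

theorem coordOp_eq_flX_comp_actOp {t y x₀ x₁ : ℝ} (h : x₀ ≠ 0) :
    coordOp k (t, y, x₀, x₁) = (flX k t).comp (actOp k y x₀⁻¹ (x₁ / (2 * x₀))) := by
  have h1 : flX k t = coordOp k (t, 1, 1, 0) := by simp [coordOp, flX]
  rw [h1, coordOp_comp_actOp (inv_ne_zero h), inv_inv, one_mul, mul_one, mul_zero, add_zero]
  congr 4
  field_simp

theorem foot_translate (p : S.Bundle) {B : End[k]} (hB : IsGL2 B) :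
    foot (translate p B hB) = foot p := point_base _ _ _

theorem frame_translate (p : S.Bundle) {B : End[k]} (hB : IsGL2 B) (a : BForm k) :
    (frame (translate p B hB) a : HN) = frame p (B a) := frame_point _ _ _ a

/-- The group `Gl(1) ⊕ Aff(1)` and the translations along `fundX` act transitively on the fibres of
the canonical bundle over `N`. -/
theorem eq_of_foot_eq {T : Type*} {h : S.Bundle → T}
    (hact : ∀ c a b p, h (act c a b p) = h p)
    (hX : ∀ p t, h (translate p (flX k t) (isGL2_flX t)) = h p) {p q : S.Bundle}
    (hpq : foot p = foot q) : h q = h p := by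
  have key : ∀ (p q : S.Bundle) (B : End[k]) (_ : IsGL2 B) (_ : B (form₀ k) 0 ≠ 0)
      (_ : foot p = foot q) (_ : ∀ a, (frame q a : HN) = frame p (B a)),
      h q = h p := by
    intro p q B hB h0 hpq hf
    obtain ⟨⟨t, y, x₀, x₁⟩, hy, hx, rfl⟩ := hB.exists_coordOp h0
    have e : q = act (Units.mk0 y hy) (Units.mk0 x₀⁻¹ (inv_ne_zero hx)) (x₁ / (2 * x₀))
        (translate p (flX k t) (isGL2_flX t)) := by
      refine eq_of_frame_eq (hpq.symm.trans (foot_translate p _).symm) fun a => ?_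
      have h1 := hf a
      rw [coordOp_eq_flX_comp_actOp hx] at h1
      rw [frame_act]
      exact h1.trans (frame_translate p (isGL2_flX t) (actOp k y x₀⁻¹ (x₁ / (2 * x₀)) a)).symm
    rw [e, hact, hX]
  obtain ⟨B, hB, hf⟩ : ∃ B, IsGL2 B ∧
      ∀ a, (frame q a : HN) = frame p (B a) := by
    have h2 : ∀ y (_ : foot p = y) (τ : BForm k →L[ℝ] T[HN] y) (_ : τ ∈ S.frames y),
        ∃ B, IsGL2 B ∧ ∀ a, (τ a : HN) = frame p (B a) := by
      rintro y rfl τ hτ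
      obtain ⟨B, hB, rfl⟩ := (mem_frames_iff_isGL2 (frame_mem p)).1 hτ
      exact ⟨B, hB, fun _ => rfl⟩
    exact h2 _ hpq _ (frame_mem q)
  by_cases h0 : B (form₀ k) 0 = 0
  · -- a parabolic element of `Aff(1)` moves the exceptional line to the affine part of the curve
    rw [← hact 1 1 1 p]
    have hinv : (actOp k 1 1 1).comp (actOp k 1 1 (-1)) = ContinuousLinearMap.id ℝ _ := by
      simp [actOp, linearSubst_comp, linearSubst_one]
    refine key _ q ((actOp k 1 1 (-1)).comp B) ((isGL2_actOp one_ne_zero one_ne_zero).comp hB) ?_ hpq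
      fun a => ?_
    · obtain ⟨c, a, b, d, e, hc, hD, rfl⟩ := hB.exists_eq
      simp only [form₀, smul_apply, linearSubst_linearPower, Pi.smul_apply, linearPower_zero, actOp,
        comp_apply, map_smul, smul_eq_mul, mul_eq_zero, hc, false_or,
        pow_eq_zero_iff (NeZero.ne k)] at h0 ⊢
      have ha : a = 0 := by simpa using h0
      subst ha
      have hb : b ≠ 0 := fun hb => hD (by rw [hb]; ring)
      simp [hc, hb, NeZero.ne k]
    · rw [frame_act]
      refine (hf a).trans ?_
      change _ = frame p (((actOp k 1 1 1).comp (actOp k 1 1 (-1))) (B a))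
      rw [hinv]
      rfl
  · exact key p q B hB h0 hpq hf

theorem continuous_translate_flX (p : S.Bundle) :
    Continuous fun t => translate p (flX k t) (isGL2_flX t) := by
  refine continuous_iff_continuousAt.2 fun t => ?_
  obtain ⟨ψ, σ, hp⟩ := exists_frameChart (translate p (flX k t) (isGL2_flX t))
  have hσ' : S.IsLocalSection σ (foot (translate p (flX k t) (isGL2_flX t))) := hp.2.1
  have hσ : S.IsLocalSection σ p.base.base := (foot_translate p (isGL2_flX t) ▸ hσ' :)
  refine (smoothNear_of_frameCoord (K := ℝ) (z := t)
    (G := fun t => translate p (flX k t) (isGL2_flX t)) hp ?_ ?_).at.continuousAt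
  · exact (smoothNear_const (foot p)).congr (.of_forall fun s => foot_translate p _)
  · refine SmoothNear.congr (f := fun s => (frameCoord σ p).comp (flX k s))
      (.of_forall fun s => (contDiff_const.clm_comp contDiff_flX).contDiffAt.contMDiffAt)
      (.of_forall fun s => ?_)
    exact frameCoord_eq_of_apply (foot_translate p _) hσ fun a =>
      (frame_translate p _ a).trans (apply_frameCoord hσ _).symm

/-- An equivariant map of the canonical bundles which carries the canonical frame to the canonical
frame is the lift of a smooth map which preserves the structures. -/
theorem exists_global_descent (hk : 3 ≤ k) {B : FrameTuple S.pair k} {B' : FrameTuple S'.pair k}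
    (hB : B.IsCanonical) (hB' : B'.IsCanonical) {Φ : S.Bundle → S'.Bundle}
    (hΦ : ContMDiff 𝓘(ℝ, HE) 𝓘(ℝ, HE) ∞ Φ) (hact : ∀ c a b p, Φ (act c a b p) = act c a b (Φ p))
    (hm : ∀ p, MapsFrameAt B B' Φ p) : ∃ f : N → N', (∀ p, foot (Φ p) = f (foot p)) ∧
      ContMDiff (𝓡 (k + 1)) (𝓡 (k + 1)) ∞ f ∧ ∀ y, S.PreservesAt S' f y := by
  have hloc := fun p => exists_isLiftAt hk hB hB' (.of_forall fun q => hΦ q :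
    Smooth[HE, HE] Φ p) (.of_forall hm)
  -- the descended map is constant along the orbits of the flow of `fundX`, which are connected
  have hX : ∀ p t, foot (Φ (translate p (flX k t) (isGL2_flX t))) = foot (Φ p) := fun p t => by
    have hlc : IsLocallyConstant fun t => foot (Φ (translate p (flX k t) (isGL2_flX t))) := by
      rw [IsLocallyConstant.iff_eventually_eq]
      intro s
      obtain ⟨f, -, hf⟩ := hloc (translate p (flX k s) (isGL2_flX s))
      have h1 := (continuous_translate_flX p).continuousAt.eventually hf
      filter_upwards [h1] with r hr
      rw [hr.foot_eq, h1.self_of_nhds.foot_eq, foot_translate, foot_translate]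
    refine (hlc.apply_eq_of_preconnectedSpace t 0).trans ?_
    simp only [translate_id p _ (isGL2_flX 0) flX_zero]
  have hfib : ∀ p q : S.Bundle, foot p = foot q → foot (Φ q) = foot (Φ p) := fun p q hpq =>
    eq_of_foot_eq (h := fun q => foot (Φ q)) (fun c a b p => (congrArg foot (hact c a b p)).trans rfl) hX hpq
  choose s hs using fun y => exists_foot_eq S y
  have hfoot : ∀ p, foot (Φ p) = foot (Φ (s (foot p))) := fun p => hfib _ _ (hs _)
  have hgood : ∀ y, CDAt[HN, HN] (fun y => foot (Φ (s y))) y ∧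
      S.PreservesAt S' (fun y => foot (Φ (s y))) y := fun y => by
    obtain ⟨f, hf, hl⟩ := hloc (s y)
    have he : ∀ᶠ z in 𝓝 (foot (s y)), foot (Φ (s z)) = f z :=
      eventually_of_foot (hl.mono fun q hq => (hfoot q).symm.trans hq.foot_eq)
    have h1 := hf.at.congr_of_eventuallyEq he
    have h2 := hl.self_of_nhds.preservesAt.congr he
    rw [hs] at h1 h2
    exact ⟨h1, h2⟩
  exact ⟨_, hfoot, fun y => (hgood y).1, fun y => (hgood y).2⟩

theorem mfderiv_left_inverse {H H' : Type*} [NormedAddCommGroup H] [NormedSpace ℝ H]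
    [NormedAddCommGroup H'] [NormedSpace ℝ H'] {M M' : Type*} [TopologicalSpace M] [ChartedSpace H M]
    [TopologicalSpace M'] [ChartedSpace H' M'] {f : M → M'} {g : M' → M}
    (hf : ContMDiff 𝓘(ℝ, H) 𝓘(ℝ, H') ∞ f) (hg : ContMDiff 𝓘(ℝ, H') 𝓘(ℝ, H) ∞ g)
    (hgf : Function.LeftInverse g f) (x : M) (v : H) :
    (d[H', H] g (f x) (d[H, H'] f x v) : H) = v := by
  have h1 := mfderiv_comp x (I := 𝓘(ℝ, H)) (I' := 𝓘(ℝ, H')) (I'' := 𝓘(ℝ, H))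
    ((hg (f x)).mdifferentiableAt (by simp)) ((hf x).mdifferentiableAt (by simp))
  rw [hgf.comp_eq_id] at h1
  have h2 := congrArg (fun L : H →L[ℝ] H => L v) (h1.symm.trans (mfderiv_id (x := x)))
  exact h2

theorem equivalent_iff (hk : 3 ≤ k) {B : FrameTuple S.pair k} {B' : FrameTuple S'.pair k}
    (hB : B.IsCanonical) (hB' : B'.IsCanonical) : S.Equivalent S' ↔ FramesEquivalent B B' := by
  constructor
  · rintro ⟨f, hf⟩
    have hfs : ∀ y, Smooth[HN, HN] f y := fun y =>
      .of_forall fun z => f.contMDiff z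
    have hgs : ∀ y, Smooth[HN, HN] f.symm y := fun y =>
      .of_forall fun z => f.symm.contMDiff z
    have hinv : ∀ x (v : HN), (d[HN, HN] f.symm (f x)
        (d[HN, HN] f x v) : HN) = v :=
      mfderiv_left_inverse f.contMDiff f.symm.contMDiff f.symm_apply_apply
    have hinv' : ∀ y (v : HN), (d[HN, HN] f (f.symm y)
        (d[HN, HN] f.symm y v) : HN) = v :=
      mfderiv_left_inverse f.symm.contMDiff f.contMDiff f.apply_symm_apply
    have hg : ∀ y, S'.PreservesAt S f.symm y := fun y => by
      obtain ⟨x, rfl⟩ := f.surjective y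
      obtain ⟨p, rfl⟩ := exists_foot_eq S x
      intro τ hτ
      obtain ⟨C, hC, rfl⟩ := (mem_frames_iff_isGL2 (hf _ _ (frame_mem p))).1 hτ
      refine mem_frames_of_frame (p := translate p C hC)
        ((foot_translate p hC).trans (f.symm_apply_apply _).symm) fun a => ?_
      exact (frame_translate p hC a).trans (hinv (foot p) (frame p (C a))).symm
    let Φ : S.Bundle → S'.Bundle := fun q => point (f (foot q)) _ (hf _ _ (frame_mem q))
    let Ψ : S'.Bundle → S.Bundle := fun q => point (f.symm (foot q)) _ (hg _ _ (frame_mem q))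
    have hΦ : ∀ q, IsLiftAt f Φ q := fun q => ⟨point_base _ _ _, frame_point _ _ _⟩
    have hΨ : ∀ q, IsLiftAt f.symm Ψ q := fun q => ⟨point_base _ _ _, frame_point _ _ _⟩
    have hcast : ∀ (g : N → N') (y y' : N) (_ : y = y') (v : HN),
        (d[HN, HN] g y v : HN) = d[HN, HN] g y' v := by
      rintro g y _ rfl v; rfl
    have hcast' : ∀ (g : N' → N) (y y' : N') (_ : y = y') (v : HN),
        (d[HN, HN] g y v : HN) = d[HN, HN] g y' v := by
      rintro g y _ rfl v; rfl
    let D : Diffeomorph 𝓘(ℝ, HE) 𝓘(ℝ, HE) S.Bundle S'.Bundle ∞ :=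
      { toFun := Φ
        invFun := Ψ
        left_inv := fun q => by
          refine eq_of_frame_eq ?_ fun a => ?_
          · refine (hΨ _).foot_eq.trans ?_
            rw [(hΦ q).foot_eq]
            exact f.symm_apply_apply _
          · refine ((hΨ _).frame_eq a).trans ?_
            rw [(hΦ q).frame_eq]
            exact (hcast' _ _ _ (hΦ q).foot_eq _).trans (hinv _ _)
        right_inv := fun q => by
          refine eq_of_frame_eq ?_ fun a => ?_
          · refine (hΦ _).foot_eq.trans ?_
            rw [(hΨ q).foot_eq]
            exact f.apply_symm_apply _
          · refine ((hΦ _).frame_eq a).trans ?_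
            rw [(hΨ q).frame_eq]
            exact (hcast _ _ _ (hΨ q).foot_eq _).trans (hinv' _ _)
        contMDiff_toFun := fun q => (smoothNear_lift (hfs _) (.of_forall hΦ)).at
        contMDiff_invFun := fun q => (smoothNear_lift (hgs _) (.of_forall hΨ)).at }
    refine ⟨D, fun c a b q => ?_, fun q => mapsFrameAt_lift hk (hfs _) (.of_forall hΦ) hB hB'⟩
    refine eq_of_frame_eq ((hΦ _).foot_eq.trans (hΦ q).foot_eq.symm) fun v => ?_
    refine ((hΦ _).frame_eq v).trans ?_
    rw [frame_act, frame_act]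
    exact ((hΦ q).frame_eq (actOp k c a b v)).symm
  · rintro ⟨Φ, hact, hm⟩
    obtain ⟨f, h1, h2, h3⟩ := exists_global_descent hk hB hB' Φ.contMDiff hact hm
    obtain ⟨g, h4, h5, -⟩ := exists_global_descent (Φ := Φ.symm) hk hB' hB Φ.symm.contMDiff
      (fun c a b p => Φ.injective (by
        change Φ _ = Φ _
        rw [hact, Φ.apply_symm_apply, Φ.apply_symm_apply]))
      (fun p i => by
        obtain ⟨q, rfl⟩ := Φ.surjective p
        refine (congrArg (d[HE, HE] Φ.symm (Φ q)) (hm q i).symm).trans ?_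
        refine (mfderiv_left_inverse Φ.contMDiff Φ.symm.contMDiff Φ.symm_apply_apply q _).trans ?_
        exact congrArg (B.field i) (Φ.symm_apply_apply q).symm)
    refine ⟨⟨⟨f, g, fun y => ?_, fun y => ?_⟩, h2, h5⟩, h3⟩
    · obtain ⟨p, rfl⟩ := exists_foot_eq S y
      rw [← h1, ← h4, Φ.symm_apply_apply]
    · obtain ⟨p, rfl⟩ := exists_foot_eq S' y
      rw [← h4, ← h1, Φ.apply_symm_apply]

/-! ### Lifts of infinitesimal symmetries -/

/-- Near `p` the field `Zt` lifts the field `Z` of `N` and is an infinitesimal automorphism of the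
frame generated by `V`. -/
structure IsLiftField (V : S.BundleField) (Z : VField HN N)
    (Zt : S.BundleField) (p : S.Bundle) : Prop where
  smooth : SmoothFieldNear (H := HN) Z (foot p)
  commutes : CommutesNear (frameTuple V).field Zt p
  dfoot_eq : ∀ᶠ q in 𝓝 p, dfoot q (Zt q) = Z (foot q)

theorem isLiftAt_eq_self {f : N → N} {Φ : S.Bundle → S.Bundle} {p : S.Bundle} (h : IsLiftAt f Φ p)
    (hf : f =ᶠ[𝓝 (foot p)] id) : Φ p = p := by
  refine eq_of_frame_eq (h.foot_eq.trans hf.self_of_nhds) fun a => (h.frame_eq a).trans ?_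
  rw [hf.mfderiv_eq, mfderiv_id]
  rfl

theorem mfderiv_slice {G : ℝ × HE → N} {t : ℝ} {u : HE}
    (hG : MDAt[ℝ × HE, HN] G (t, u)) (w : HE) :
    (d[HE, HN] (fun v => G (t, v)) u w : HN) = d[ℝ × HE, HN] G (t, u) ((0, w) : ℝ × HE) := by
  have hd : DifferentiableAt ℝ (fun v : HE => (t, v)) u := by fun_prop
  have h := mfderiv_comp u (I := 𝓘(ℝ, HE)) (I' := 𝓘(ℝ, ℝ × HE)) (I'' := 𝓡 (k + 1)) (g := G)
    (f := fun v : HE => (t, v)) hG hd.mdifferentiableAt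
  rw [mfderiv_eq_fderiv, (hasFDerivAt_prodMk_right t u).fderiv] at h
  exact congrArg (fun L : HE →L[ℝ] HN => L w) h

/-- The local flow of a symmetry lifts to a local flow on `E` which preserves the canonical frame; the
generator of the lifted flow commutes with the frame. -/
theorem exists_isLiftField (hk : 3 ≤ k) {V : S.BundleField} (hV : ∀ p, IsCanonicalFieldNear V p)
    (p : S.Bundle) {Z : VField HN N} (hZ : S.IsInfSymmetryAt Z (foot p)) :
    ∃ Zt, IsLiftField V Z Zt p := by
  obtain ⟨hZs, φ, hφ0, hφ⟩ := hZ
  obtain ⟨ψ, σ, hp⟩ := exists_frameChart p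
  set e := frameChart ψ σ p
  have he : SmoothChart e := smoothChart_frameChart ψ σ p
  have hpe : p ∈ e.source := mem_frameChart_source_iff.2 hp
  have hes := he.smoothNear hpe
  have hec : ContinuousAt e p := hes.at.continuousAt
  have hss := he.smoothNear_symm (e.map_source hpe)
  have hsc : ContinuousAt e.symm (e p) := hss.at.continuousAt
  have hpp : e.symm (e p) = p := e.left_inv hpe
  have hB := isCanonical_frameTuple hk hV
  -- the flow consists of local automorphisms, which are lifted to the canonical bundle
  have hgood : ∀ᶠ z : ℝ × N in 𝓝 (0, foot p), Smooth[HN, HN] (φ z.1) z.2 ∧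
      ∀ᶠ y in 𝓝 z.2, S.PreservesAt S (φ z.1) y := by
    filter_upwards [hφ.eventually_nhds] with z hz
    have hc : Tendsto (fun y => (z.1, y)) (𝓝 z.2) (𝓝 z) :=
      (continuous_const.prodMk continuous_id).tendsto' _ _ rfl
    refine ⟨(hc.eventually hz).mono fun y hy => ?_, (hc.eventually hz).mono fun y hy => hy.2.2⟩
    exact hy.1.comp y (contMDiffAt_const.prodMk contMDiffAt_id)
  let G : ℝ × HE → S.Bundle := fun z => liftMap S (φ z.1) p (e.symm z.2)
  have hyc : Tendsto (fun z : ℝ × HE => (z.1, foot (e.symm z.2))) (𝓝 (0, e p)) (𝓝 (0, foot p)) := by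
    have h1 : ContinuousAt (fun z : ℝ × HE => e.symm z.2) (0, e p) :=
      ContinuousAt.comp (g := e.symm) hsc continuousAt_snd
    have h2 : ContinuousAt (fun z : ℝ × HE => foot (e.symm z.2)) (0, e p) :=
      ContinuousAt.comp (g := (foot : S.Bundle → N)) (continuousAt_foot _) h1
    have h3 := (continuousAt_fst.prodMk h2).tendsto
    simp only [hpp] at h3
    exact h3
  have hlift : ∀ᶠ z : ℝ × HE in 𝓝 (0, e p), Smooth[HN, HN] (φ z.1) (foot (e.symm z.2)) ∧
      ∀ᶠ q in 𝓝 (e.symm z.2), IsLiftAt (φ z.1) (liftMap S (φ z.1) p) q := by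
    filter_upwards [hyc.eventually hgood] with z hz
    exact ⟨hz.1, ((continuousAt_foot _).eventually hz.2).mono fun q hq => isLiftAt_liftMap hq⟩
  have htgt : ∀ᶠ z : ℝ × HE in 𝓝 (0, e p), z.2 ∈ e.target :=
    continuousAt_snd.eventually (e.open_target.mem_nhds (e.map_source hpe))
  have hG0 : ∀ᶠ u in 𝓝 (e p), G (0, u) = e.symm u := by
    have hc : Tendsto (fun u : HE => ((0 : ℝ), u)) (𝓝 (e p)) (𝓝 (0, e p)) :=
      (continuous_const.prodMk continuous_id).tendsto' _ _ rfl
    have h1 : ContinuousAt (fun u => foot (e.symm u)) (e p) :=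
      ContinuousAt.comp (g := (foot : S.Bundle → N)) (continuousAt_foot _) hsc
    have h2 : ∀ᶠ y in 𝓝 (foot (e.symm (e p))), ∀ᶠ y' in 𝓝 y, φ 0 y' = y' :=
      hpp.symm ▸ hφ0.eventually_nhds
    filter_upwards [hc.eventually hlift, h1.eventually h2] with u h3 h4
    exact isLiftAt_eq_self h3.2.self_of_nhds h4
  have hG0p : G (0, e p) = p := hG0.self_of_nhds.trans hpp
  have hfoot : ∀ᶠ z in 𝓝 (0, e p), foot (G z) = φ z.1 (foot (e.symm z.2)) :=
    hlift.mono fun z hz => hz.2.self_of_nhds.foot_eq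
  have hGfs : Smooth[ℝ × HE, HN] (fun z => foot (G z)) (0, e p) := by
    refine SmoothNear.congr (f := fun z : ℝ × HE => φ z.1 (foot (e.symm z.2))) ?_ hfoot
    filter_upwards [hyc.eventually hφ, htgt] with z h1 h2
    have h3 : CDAt[ℝ × HE, HN] (fun z : ℝ × HE => foot (e.symm z.2)) z :=
      (smoothNear_foot _).at.comp z ((he.smoothNear_symm h2).at.comp z contDiff_snd.contMDiff.contMDiffAt)
    exact ContMDiffAt.comp z (g := fun w : ℝ × N => φ w.1 w.2)
      (f := fun z : ℝ × HE => (z.1, foot (e.symm z.2))) h1.1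
      (contDiff_fst.contMDiff.contMDiffAt.prodMk h3)
  have hGs : Smooth[ℝ × HE, HE] G (0, e p) := by
    refine smoothNear_of_frameCoord (ψ := ψ) (σ := σ) (p₀ := p) (hG0p.symm ▸ hp) hGfs ?_
    refine smoothNear_clm_of_apply fun a => ?_
    obtain ⟨A, hA, hAa⟩ := exists_solder_eq (p := p) (smoothNear_const a)
    let g : S.Bundle → HE := fun q => tderiv e q (A q)
    have hg : Smooth[HE, HE] g p := hes.tderiv hA
    have hsnd : Smooth[ℝ × HE, HE] (fun z : ℝ × HE => g (e.symm z.2)) (0, e p) :=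
      SmoothNear.comp_map (f := fun u => g (e.symm u)) (π := fun z : ℝ × HE => z.2)
        (SmoothNear.comp_map (f := g) (π := e.symm) (hpp.symm ▸ hg) hss)
        (.of_forall fun z => contDiff_snd.contMDiff.contMDiffAt)
    have hσ : S.IsLocalSection σ (foot (G (0, e p))) := hG0p.symm ▸ hp.2.1
    refine smoothNear_frame_coeff (π := fun z => foot (G z)) (σ := σ)
      (W := fun z : ℝ × HE => ((0, g (e.symm z.2)) : ℝ × HE)) hσ.smoothFrameNear hGfs ?_ ?_
    · filter_upwards [hsnd] with z hz
      exact contMDiffAt_vectorSpace_iff_contDiffAt.2 (contDiffAt_const.prodMk hz.contDiffAt)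
    · have h3 : ∀ᶠ z : ℝ × HE in 𝓝 (0, e p), solder (e.symm z.2) (A (e.symm z.2)) = a :=
        (ContinuousAt.comp (g := e.symm) (f := Prod.snd) (x := ((0 : ℝ), e p)) hsc
          continuousAt_snd).eventually (hpp.symm ▸ hAa)
      filter_upwards [hlift, htgt, h3, hfoot.eventually_nhds, hGfs,
        hGfs.at.continuousAt.eventually hσ.near] with z h1 h2 h3 h4 h5 h6
      refine Eq.trans ?_ (apply_frameCoord (p := G z) h6 a).symm
      refine Eq.trans ?_ (h1.2.self_of_nhds.frame_eq a).symm
      refine (mfderiv_slice (t := z.1) (u := z.2) (h5.mdifferentiableAt (by simp)) _).symm.trans ?_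
      have hc : Tendsto (fun u : HE => (z.1, u)) (𝓝 z.2) (𝓝 z) :=
        (continuous_const.prodMk continuous_id).tendsto' _ _ rfl
      have e1 : (fun u : HE => foot (G (z.1, u))) =ᶠ[𝓝 z.2] (φ z.1) ∘ foot ∘ e.symm := hc.eventually h4
      have e2 := e1.mfderiv_eq (I := 𝓘(ℝ, HE)) (I' := 𝓡 (k + 1))
      have d1 := (he.smoothNear_symm h2).mdiff
      have d2 : MDAt[HE, HN] (foot : S.Bundle → N) (e.symm z.2) := (smoothNear_foot _).mdiff
      have e3 := mfderiv_comp z.2 (I := 𝓘(ℝ, HE)) (I' := 𝓡 (k + 1)) (I'' := 𝓡 (k + 1))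
        (g := φ z.1) (f := (foot : S.Bundle → N) ∘ e.symm) h1.1.mdiff
        (MDifferentiableAt.comp (I' := 𝓘(ℝ, HE)) z.2 d2 d1)
      have e4 := mfderiv_comp z.2 (I := 𝓘(ℝ, HE)) (I' := 𝓘(ℝ, HE)) (I'' := 𝓡 (k + 1))
        (g := (foot : S.Bundle → N)) (f := e.symm) d2 d1
      refine (congrArg (fun L : HE →L[ℝ] HN => L (g (e.symm z.2))) (e2.trans e3)).trans ?_
      refine congrArg (d[HN, HN] (φ z.1) (foot (e.symm z.2))) ?_
      refine (congrArg (fun L : HE →L[ℝ] HN => L (g (e.symm z.2))) e4).trans ?_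
      have e5 := he.symm_tderiv (e.map_target h2) (A (e.symm z.2))
      rw [e.right_inv h2] at e5
      exact (congrArg (dfoot (e.symm z.2)) e5).trans (solder_eq_iff.1 h3)
  have hFs : Smooth[ℝ × HE, HE] (fun z => e (G z)) (0, e p) :=
    SmoothNear.comp_map (f := e) (π := G) (hG0p.symm ▸ hes) hGs
  set F : ℝ × HE → HE := fun z => e (G z)
  have hFc : ∀ᶠ z in 𝓝 (0, e p), ContDiffAt ℝ ∞ F z := hFs.mono fun z hz => hz.contDiffAt
  let ζ : HE → HE := fun u => fderiv ℝ F (0, u) (1, 0)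
  have h0c : Tendsto (fun u : HE => ((0 : ℝ), u)) (𝓝 (e p)) (𝓝 (0, e p)) :=
    (continuous_const.prodMk continuous_id).tendsto' _ _ rfl
  have hζ : ∀ᶠ u in 𝓝 (e p), ContDiffAt ℝ ∞ ζ u := by
    filter_upwards [h0c.eventually hFc] with u hu
    have h1 : ContDiffAt ℝ ∞ (fderiv ℝ F) (0, u) := hu.fderiv_right (by simp)
    have h2 : ContDiffAt ℝ ∞ (fun v : HE => ((0 : ℝ), v)) u := by fun_prop
    exact (h1.comp u h2).clm_apply contDiffAt_const
  have hζs : Smooth[HE, HE] (fun q => ζ (e q)) p := SmoothNear.comp_space hζ hes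
  let Zt : S.BundleField := chartField e fun q => ζ (e q)
  have hZts : SmoothFieldNear Zt p := he.smoothFieldNear_chartField hpe hζs
  have hG0q : ∀ᶠ q in 𝓝 p, G (0, e q) = q := by
    filter_upwards [hec.eventually hG0, e.open_source.mem_nhds hpe] with q h1 h2
    rw [h1, e.left_inv h2]
  have hec0 : Tendsto (fun q => ((0 : ℝ), e q)) (𝓝 p) (𝓝 (0, e p)) := h0c.comp hec
  refine ⟨Zt, hZs, ⟨hZts, ?_⟩, ?_⟩
  · -- the lifted flow preserves the canonical frame
    have hmap : ∀ᶠ z in 𝓝 (0, e p), ∀ i, fderiv ℝ F z (0, tderiv e (e.symm z.2)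
        ((frameTuple V).field i (e.symm z.2))) = tderiv e (G z) ((frameTuple V).field i (G z)) := by
      filter_upwards [hlift, htgt, hFc, hGs.at.continuousAt.eventually
        (e.open_source.mem_nhds (hG0p.symm ▸ hpe : G (0, e p) ∈ e.source))] with z h1 h2 h3 h4 i
      have e1 := mapsFrameAt_lift hk h1.1 h1.2 hB hB i
      rw [← fderiv_slice_right (t := z.1) (u := z.2) (h3.differentiableAt (by simp))]
      have hL := (smoothNear_lift h1.1 h1.2).mdiff
      have e2 := tderiv_comp (f := e) (π := liftMap S (φ z.1) p) (x := e.symm z.2)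
        (he.smoothNear h4).mdiff hL ((frameTuple V).field i (e.symm z.2))
      have e5 := he.symm_tderiv (e.map_target h2) ((frameTuple V).field i (e.symm z.2))
      rw [e.right_inv h2] at e5
      let w : HE := tderiv e (e.symm z.2) ((frameTuple V).field i (e.symm z.2))
      have e6 := tderiv_comp (f := fun q => e (liftMap S (φ z.1) p q)) (π := e.symm) (x := z.2)
        (MDifferentiableAt.comp (I' := 𝓘(ℝ, HE)) (g := e) (e.symm z.2) (he.smoothNear h4).mdiff hL)
        (he.smoothNear_symm h2).mdiff w
      have e7 : fderiv ℝ (fun u : HE => F (z.1, u)) z.2 w =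
          tderiv (H := HE) (fun u : HE => F (z.1, u)) z.2 w :=
        congrArg (fun L : HE →L[ℝ] HE => L w) mfderiv_eq_fderiv.symm
      exact e7.trans ((e6.trans (congrArg (tderiv (fun q => e (liftMap S (φ z.1) p q))
        (e.symm z.2)) e5)).trans (e2.trans (congrArg (tderiv e (G z)) e1)))
    filter_upwards [hec0.eventually hmap.eventually_nhds, e.open_source.mem_nhds hpe, hZts,
      hG0q.eventually_nhds, hec.eventually hζ, hec0.eventually hFc,
      hec0.eventually (hGs.at.continuousAt.eventually_mem (e.open_source.mem_nhds
        (hG0p.symm ▸ hpe : G (0, e p) ∈ e.source))).eventually_nhds] with q h1 h2 h3 h4 h5 h6 h7 i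
    have hbs : SmoothFieldNear ((frameTuple V).field i) q := .of_forall fun q => hB.smooth i q
    refine he.tderiv_injective h2 ?_
    rw [tderiv_bracket (he.smoothNear h2) h3 hbs.self_of_nhds, tderiv_vzero, sub_eq_zero]
    let b : HE → HE := fun u => tderiv e (e.symm u) ((frameTuple V).field i (e.symm u))
    have hbd : Smooth[HE, HE] b (e q) :=
      SmoothNear.comp_map (f := fun q => tderiv e q ((frameTuple V).field i q)) (π := e.symm)
        ((e.left_inv h2).symm ▸ (he.smoothNear h2).tderiv hbs) (he.smoothNear_symm (e.map_source h2))
    have hs := he.smoothNear h2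
    have hbe : ∀ y ∈ e.source, b (e y) = tderiv e y ((frameTuple V).field i y) := fun y hy =>
      congrArg (fun y => tderiv e y ((frameTuple V).field i y)) (e.left_inv hy)
    have l1 : tderiv (fun y => tderiv e y ((frameTuple V).field i y)) q (Zt q) =
        fderiv ℝ b (e q) (ζ (e q)) := by
      have e2 := tderiv_comp_fderiv hbd.mdiff.differentiableAt hs.mdiff (Zt q)
      rw [he.tderiv_chartField h2] at e2
      refine Eq.trans (tderiv_congr ?_ _) e2
      filter_upwards [e.open_source.mem_nhds h2] with y hy using (hbe y hy).symm
    have l2 : tderiv (fun y => tderiv e y (Zt y)) q ((frameTuple V).field i q) =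
        fderiv ℝ ζ (e q) (b (e q)) := by
      have e2 := tderiv_comp_fderiv (h5.differentiableAt (by simp)) hs.mdiff ((frameTuple V).field i q)
      have e3 : b (e q) = tderiv e q ((frameTuple V).field i q) := hbe q h2
      rw [e3]
      refine Eq.trans (tderiv_congr ?_ _) e2
      filter_upwards [e.open_source.mem_nhds h2] with y hy using he.tderiv_chartField hy _
    rw [l1, l2]
    have htc : Tendsto (fun t : ℝ => (t, e q)) (𝓝 0) (𝓝 (0, e q)) :=
      (continuous_id.prodMk continuous_const).tendsto' _ _ rfl
    refine (fderiv_generator h6 (congrArg e h4.self_of_nhds) hbd.mdiff.differentiableAt ?_).symm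
    filter_upwards [htc.eventually h1, htc.eventually h7] with t ht ht'
    have := ht i
    exact this.trans (hbe _ ht').symm
  · -- the lifted flow projects to the flow
    have hfc : Tendsto (fun q : S.Bundle => ((0 : ℝ), foot q)) (𝓝 p) (𝓝 (0, foot p)) :=
      (continuous_const.prodMk continuous_id).continuousAt.comp (continuousAt_foot p)
    filter_upwards [near_frameChart hp, e.open_source.mem_nhds hpe, hfc.eventually hφ,
      hec0.eventually hFc, (continuousAt_foot p).eventually hφ0, hec0.eventually hfoot.eventually_nhds]
      with q h1 h2 h3 h4 h5 h6
    refine (smoothChart_of_mem_atlas ψ.2).tderiv_injective h1.1 ?_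
    rw [← (tderiv_frameChart h1 (Zt q)).1]
    have e1 : tderiv e q (Zt q) = ζ (e q) := he.tderiv_chartField h2 _
    refine (congrArg (fun v : HE => v.1.1) e1).trans ?_
    have htc : Tendsto (fun t : ℝ => (t, e q)) (𝓝 0) (𝓝 (0, e q)) :=
      (continuous_id.prodMk continuous_const).tendsto' _ _ rfl
    have d0 : HasDerivAt (fun t : ℝ => F (t, e q)) (ζ (e q)) 0 :=
      HasFDerivAt.comp_hasDerivAt (l := F) (l' := fderiv ℝ F (0, e q)) (f := fun t : ℝ => (t, e q))
        (f' := (1, 0)) (0 : ℝ) (h4.differentiableAt (by simp)).hasFDerivAt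
        ((hasDerivAt_id (0 : ℝ)).prodMk (hasDerivAt_const (0 : ℝ) (e q)))
    have d1 : HasDerivAt (fun t : ℝ => (F (t, e q)).1.1) (ζ (e q)).1.1 0 :=
      ((fst ℝ HN ℝ).comp (fst ℝ (HN × ℝ) (ℝ × ℝ × ℝ))).hasFDerivAt.comp_hasDerivAt (0 : ℝ) d0
    have hγ : MDAt[ℝ, HN] (fun t => φ t (foot q)) 0 :=
      (h3.1.comp (0 : ℝ) (contMDiffAt_id.prodMk contMDiffAt_const)).mdifferentiableAt (by simp)
    have hψ : foot q ∈ ψ.1.source := h1.1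
    have d2 := hasDerivAt_comp_curve (f := ψ.1) (γ := fun t => φ t (foot q)) (s := 0)
      (((smoothChart_of_mem_atlas ψ.2).smoothNear (h5.symm ▸ hψ)).mdiff) hγ
    have d3 := d1.unique (d2.congr_of_eventuallyEq (by
      filter_upwards [htc.eventually h6] with t ht
      have e2 : (F (t, e q)).1.1 = ψ.1 (foot (G (t, e q))) := rfl
      rw [e2, ht]
      simp only [e.left_inv h2]))
    refine d3.trans ((congrArg (tderiv ψ.1 _) h3.2.1).trans ?_)
    exact congrArg (fun y => tderiv ψ.1 y (Z y)) h5

section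

variable {V : S.BundleField} {p : S.Bundle}

/-! ### The algebra of lifted symmetries -/

theorem smooth_frameTuple (hV : ∀ p, IsCanonicalFieldNear V p) (i) (p : S.Bundle) :
    SmoothFieldNear ((frameTuple V).field i) p := by
  have hX := (isVerticalField_X (S := S)).smoothFieldNear p
  rcases i with j | r
  · fin_cases j
    · exact isVerticalField_G.smoothFieldNear p
    · exact isVerticalField_F₀.smoothFieldNear p
    · exact isVerticalField_F₁.smoothFieldNear p
    · exact hX
  · exact hX.adField (hV p).1 r

theorem solder_field_inr (hV : ∀ p, IsCanonicalFieldNear V p) (r : Fin (k + 1)) (p : S.Bundle) :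
    solder p ((frameTuple V).field (.inr r) p) = ladder k r :=
  (solder_adField (hV p).1 ((hV p).2.mono fun _ h => h.1) r).self_of_nhds

theorem isFrameNear_frameTuple (hV : ∀ p, IsCanonicalFieldNear V p) (p : S.Bundle) :
    IsFrameNear (frameTuple V).field p := by
  have h0 := fun p => (hV p).2.self_of_nhds.1
  refine ⟨fun i => smooth_frameTuple hV i p, .of_forall fun q =>
    linearIndependent_frameTuple (fun p => (hV p).1) h0 q, .of_forall fun q => ?_⟩
  refine eq_top_iff.2 fun w _ => ?_
  obtain ⟨c, hc⟩ := exists_eq_sum_frameTuple (fun p => (hV p).1) h0 w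
  rw [hc]
  exact Submodule.sum_mem _ fun i _ => Submodule.smul_mem _ _ (Submodule.subset_span ⟨i, rfl⟩)

/-- A vertical infinitesimal automorphism of the frame vanishes, because `gl(2)` acts effectively on
binary forms. -/
theorem CommutesNear.eq_zero_of_vertical (hV : ∀ p, IsCanonicalFieldNear V p) {W : S.BundleField}
    (hW : CommutesNear (frameTuple V).field W p) (h0 : ∀ᶠ q in 𝓝 p, solder q (W q) = 0) :
    ∀ᶠ q in 𝓝 p, W q = 0 := by
  obtain ⟨α, β, γ, δ, hα, hβ, hγ, hδ, h⟩ := exists_smooth_fundComb hW.1 h0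
  filter_upwards [h.eventually_nhds, hW.2, hα.near, hβ.near, hγ.near, hδ.near]
    with q h1 h2 h3 h4 h5 h6
  have e : opComb k (α q) (β q) (γ q) (δ q) = 0 := by
    have e1 : ∀ r : Fin (k + 1), opComb k (α q) (β q) (γ q) (δ q) (ladder k r) = 0 := fun r => by
      have e2 := solder_bracket_fundComb h3 h4 h5 h6 (smooth_frameTuple hV (.inr r) q)
        (.of_forall (solder_field_inr hV r))
      exact e2.symm.trans ((congrArg (solder q) ((bracket_congr h1 EventuallyEq.rfl).symm.trans
        (h2 (.inr r)))).trans (map_zero _))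
    ext1 a
    rw [← sum_ladderCoeff a, map_sum, zero_apply]
    exact Finset.sum_eq_zero fun r _ => by rw [map_smul, e1, smul_zero]
  refine h1.self_of_nhds.trans ?_
  have e3 := isVerticalField_fundComb (S := S) (α q) (β q) (γ q) (δ q)
  rw [e] at e3
  exact congrFun (e3.unique isVerticalField_zero) q

variable {Z Z' : ∀ y : N, TangentSpace (𝓡 (k + 1)) y} {Zt Zt' : S.BundleField}

theorem IsLiftField.add (h : IsLiftField V Z Zt p) (h' : IsLiftField V Z' Zt' p) :
    IsLiftField V (fun y => Z y + Z' y) (fun q => Zt q + Zt' q) p := by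
  refine ⟨h.smooth.add h'.smooth, h.commutes.add h'.commutes, ?_⟩
  filter_upwards [h.dfoot_eq, h'.dfoot_eq] with q h1 h2
  rw [map_add, h1, h2]
  rfl

theorem IsLiftField.smul (c : ℝ) (h : IsLiftField V Z Zt p) :
    IsLiftField V (fun y => c • Z y) (fun q => c • Zt q) p := by
  refine ⟨h.smooth.smul (smoothNear_const c), h.commutes.smul c, ?_⟩
  filter_upwards [h.dfoot_eq] with q h1
  rw [map_smul, h1]
  rfl

theorem IsLiftField.eq_of_eq (hV : ∀ p, IsCanonicalFieldNear V p) (h : IsLiftField V Z Zt p)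
    (h' : IsLiftField V Z' Zt' p) (he : ∀ᶠ y in 𝓝 (foot p), Z y = Z' y) : Zt p = Zt' p := by
  have h1 := (h.add (h'.smul (-1)))
  have h2 := CommutesNear.eq_zero_of_vertical hV h1.commutes (by
    filter_upwards [h1.dfoot_eq, (continuousAt_foot p).eventually he] with q h3 h4
    refine solder_eq_zero_iff.2 (h3.trans ?_)
    rw [h4, neg_one_smul, add_neg_cancel]
    rfl)
  have h3 := h2.self_of_nhds
  rw [neg_one_smul] at h3
  exact eq_of_sub_eq_zero ((sub_eq_add_neg _ _).trans h3)

theorem IsLiftField.eventually_eq (hV : ∀ p, IsCanonicalFieldNear V p) (h : IsLiftField V Z Zt p)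
    (h' : IsLiftField V Z' Zt' p) (he : Zt p = Zt' p) : ∀ᶠ y in 𝓝 (foot p), Z y = Z' y := by
  refine eventually_of_foot ?_
  filter_upwards [h.dfoot_eq, h'.dfoot_eq, h.commutes.eq_of_eq (isFrameNear_frameTuple hV p)
    h'.commutes he] with q h1 h2 h3
  rw [← h1, ← h2, h3]

theorem IsLiftField.bracket (hV : ∀ p, IsCanonicalFieldNear V p) (h : IsLiftField V Z Zt p)
    (h' : IsLiftField V Z' Zt' p) :
    IsLiftField V (lie[HN] Z Z') (lie[HE] Zt Zt') p := by
  refine ⟨h.smooth.bracket h'.smooth, h.commutes.bracket (isFrameNear_frameTuple hV p) h'.commutes, ?_⟩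
  filter_upwards [h.dfoot_eq.eventually_nhds, h'.dfoot_eq.eventually_nhds, h.commutes.1.near,
    h'.commutes.1.near, (continuousAt_foot p).eventually h.smooth.near,
    (continuousAt_foot p).eventually h'.smooth.near] with q h1 h2 h3 h4 h5 h6
  exact mfderiv_bracket_of_related (smoothNear_foot q) h3 h4 h5 h6 h1 h2

/-- Every element of the algebra of germs of infinitesimal symmetries has a lift. -/
theorem exists_isLiftField_of_mem (hk : 3 ≤ k) (hV : ∀ p, IsCanonicalFieldNear V p)
    {g : Germ (𝓝 (foot p)) HN} (hg : g ∈ S.symmetryGerms (foot p)) :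
    ∃ (Z : VField HN N) (Zt : S.BundleField),
      g = Germ.ofFun (fun y => (Z y : HN)) ∧ IsLiftField V Z Zt p := by
  induction hg using Submodule.span_induction with
  | mem g hg =>
    obtain ⟨Z, hZ, rfl⟩ := hg
    obtain ⟨Zt, h⟩ := exists_isLiftField hk hV p hZ
    exact ⟨Z, Zt, rfl, h⟩
  | zero =>
    refine ⟨fun _ => 0, fun _ => 0, rfl, smoothFieldNear_zero, ⟨smoothFieldNear_zero, ?_⟩, ?_⟩
    · refine .of_forall fun q i => ?_
      rw [bracket_swap, bracket_zero_right, neg_zero]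
    · exact .of_forall fun q => map_zero _
  | add g g' _ _ h h' =>
    obtain ⟨Z, Zt, rfl, h⟩ := h
    obtain ⟨Z', Zt', rfl, h'⟩ := h'
    exact ⟨_, _, rfl, h.add h'⟩
  | smul c g _ h =>
    obtain ⟨Z, Zt, rfl, h⟩ := h
    exact ⟨_, _, rfl, h.smul c⟩

/-- The value at `p` of the lift is a linear and injective function of the germ of a symmetry. -/
theorem exists_linearMap (hk : 3 ≤ k) (hV : ∀ p, IsCanonicalFieldNear V p) (p : S.Bundle) :
    ∃ Λ : S.symmetryGerms (foot p) →ₗ[ℝ] HE, Function.Injective Λ ∧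
      ∀ g : S.symmetryGerms (foot p), ∃ (Z : VField HN N) (Zt : S.BundleField),
        (g : Germ (𝓝 (foot p)) HN) = Germ.ofFun (fun y => (Z y : HN)) ∧ IsLiftField V Z Zt p ∧
        Λ g = Zt p := by
  choose Z Zt hg hZ using fun g : S.symmetryGerms (foot p) => exists_isLiftField_of_mem hk hV g.2
  let Λ : S.symmetryGerms (foot p) →ₗ[ℝ] HE :=
    { toFun := fun g => Zt g p
      map_add' := fun g g' => (hZ (g + g')).eq_of_eq hV ((hZ g).add (hZ g')) (Germ.coe_eq.1 (by
        exact (hg (g + g')).symm.trans (congrArg₂ (· + ·) (hg g) (hg g'))))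
      map_smul' := fun c g => (hZ (c • g)).eq_of_eq hV ((hZ g).smul c) (Germ.coe_eq.1 (by
        exact (hg (c • g)).symm.trans (congrArg (c • ·) (hg g)))) }
  refine ⟨Λ, fun g g' h => Subtype.ext ?_, fun g => ⟨Z g, Zt g, hg g, hZ g, rfl⟩⟩
  exact (hg g).trans ((Germ.coe_eq.2 ((hZ g).eventually_eq hV (hZ g') h)).trans (hg g').symm)

theorem finrank_bundleModel : Module.finrank ℝ HE = k + 5 := by
  simp [BundleModel]
  try omega

/-- If the algebra of germs has the maximal dimension, every tangent vector of the canonical bundle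
is a value of the lift of an element of the algebra. -/
theorem exists_lift_of_finrank (hk : 3 ≤ k) (hV : ∀ p, IsCanonicalFieldNear V p) (p : S.Bundle)
    (h : Module.finrank ℝ (S.symmetryGerms (foot p)) = k + 5) (w : T[HE] p) :
    ∃ (Z : VField HN N) (Zt : S.BundleField), IsLiftField V Z Zt p ∧ Zt p = w := by
  obtain ⟨Λ, hΛ, hg⟩ := exists_linearMap hk hV p
  have : FiniteDimensional ℝ (S.symmetryGerms (foot p)) := FiniteDimensional.of_injective Λ hΛ
  obtain ⟨g, rfl⟩ := ((LinearMap.injective_iff_surjective_of_finrank_eq_finrank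
    (h.trans finrank_bundleModel.symm)).1 hΛ) w
  obtain ⟨Z, Zt, -, h1, h2⟩ := hg g
  exact ⟨Z, Zt, h1, h2.symm⟩

/-- Finiteness is part of the claim, because `finrank` is zero in infinite dimension. -/
theorem finrank_symmetryGerms_le (hk : 3 ≤ k) (x : N) :
    FiniteDimensional ℝ (S.symmetryGerms x) ∧ Module.finrank ℝ (S.symmetryGerms x) ≤ k + 5 := by
  obtain ⟨p, rfl⟩ := exists_foot_eq S x
  obtain ⟨V, hV⟩ := exists_canonicalField (S := S) hk
  obtain ⟨Λ, hΛ, -⟩ := exists_linearMap hk hV p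
  exact ⟨FiniteDimensional.of_injective Λ hΛ,
    (LinearMap.finrank_le_finrank_of_injective hΛ).trans finrank_bundleModel.le⟩

end

section

variable {V : S.BundleField} {p : S.Bundle}

/-! ### Maximal symmetry -/

theorem eq_zero_of_commutesNear (hV : ∀ p, IsCanonicalFieldNear V p) {A : S.BundleField}
    (h : CommutesNear (frameTuple V).field A p) (h0 : A p = 0) : ∀ᶠ q in 𝓝 p, A q = 0 := by
  have h2 : Tendsto (fun y => (p, y)) (𝓝 p) (𝓝 (p, p)) :=
    (continuous_const.prodMk continuous_id).tendsto' _ _ rfl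
  exact (h2.eventually (h.eventually_zero (isFrameNear_frameTuple hV p))).mono fun q hq => hq h0

/-- The bracket at `p` with an infinitesimal automorphism whose value at `p` is that of `G`. -/
theorem exists_bracket_euler_eq (hV : ∀ p, IsCanonicalFieldNear V p) {g A : S.BundleField}
    (hg : CommutesNear (frameTuple V).field g p) (hgp : g p = fundG p)
    (hA : CommutesNear (frameTuple V).field A p) {c : Fin 4 ⊕ Fin (k + 1) → ℝ}
    (hc : A p = ∑ i, c i • (frameTuple V).field i p) :
    lie[HE] g A p = -lie[HE] fundG (fun q => ∑ i, c i • (frameTuple V).field i q) p := by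
  have h1 : ∀ q, fundG q = ∑ i, (Pi.single (Sum.inl 0) 1 : Fin 4 ⊕ Fin (k + 1) → ℝ) i •
      (frameTuple V).field i q := fun q => by
    rw [Finset.sum_eq_single (Sum.inl 0) (fun j _ hj => by rw [Pi.single_eq_of_ne hj, zero_smul])
      (by simp), Pi.single_eq_same, one_smul]
    rfl
  have h2 := hg.bracket_eq_neg (isFrameNear_frameTuple hV p) hA (hgp.trans (h1 p)) hc
  rwa [← (funext h1 : fundG = _)] at h2

/-- At `p`, the bracket with the Euler field acts by `-1` modulo vertical vectors, since the soldering
form is homogeneous of degree one under `G`. -/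
theorem solder_bracket_euler (hV : ∀ p, IsCanonicalFieldNear V p) {g A : S.BundleField}
    (hg : CommutesNear (frameTuple V).field g p) (hgp : g p = fundG p)
    (hA : CommutesNear (frameTuple V).field A p) :
    solder p (lie[HE] g A p) = -solder p (A p) := by
  have h0 := fun p => (hV p).2.self_of_nhds.1
  obtain ⟨c, hc⟩ := exists_eq_sum_frameTuple (fun p => (hV p).1) h0 (A p)
  have h1 : ∀ q, solder q (∑ i, c i • (frameTuple V).field i q) =
      ∑ r : Fin (k + 1), c (.inr r) • ladder k r := fun q => by
    rw [sum_frameTuple, map_add, solder_fundComb, zero_add,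
      solder_sum_adField (fun p => (hV p).1) h0 (fun r => c (.inr r))]
  have h2 : SmoothFieldNear (fun q => ∑ i, c i • (frameTuple V).field i q) p :=
    SmoothFieldNear.sum fun i _ => (smooth_frameTuple hV i p).smul (smoothNear_const _)
  rw [exists_bracket_euler_eq hV hg hgp hA hc, map_neg, isVerticalField_G.solder_bracket h2,
    tderiv_congr (.of_forall h1), tderiv_const, zero_add, hc]
  rfl

/-- The Euler field commutes with the lifts which are vertical at `p`, since `G` acts by scalars. -/
theorem bracket_euler_eq_zero (hV : ∀ p, IsCanonicalFieldNear V p) {g A : S.BundleField}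
    (hg : CommutesNear (frameTuple V).field g p) (hgp : g p = fundG p)
    (hA : CommutesNear (frameTuple V).field A p) (h0 : solder p (A p) = 0) :
    ∀ᶠ q in 𝓝 p, lie[HE] g A q = 0 := by
  refine eq_zero_of_commutesNear hV (hg.bracket (isFrameNear_frameTuple hV p) hA) ?_
  obtain ⟨α, β, γ, δ, h⟩ := exists_fundComb (A p) h0
  let c : Fin 4 ⊕ Fin (k + 1) → ℝ := Sum.elim ![β, γ, δ, α] 0
  have h1 : ∀ q : S.Bundle, ∑ i, c i • (frameTuple V).field i q = fundComb α β γ δ q := fun q => by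
    rw [sum_frameTuple]
    simp [c]
  rw [exists_bracket_euler_eq hV hg hgp hA (h.trans (h1 p).symm), (funext h1 : _ = fundComb α β γ δ)]
  have h2 := (isVerticalField_G (S := S)).bracket (isVerticalField_fundComb α β γ δ)
  rw [ContinuousLinearMap.comp_id, id_comp, sub_self] at h2
  rw [congrFun (h2.unique isVerticalField_zero) p, neg_zero]

/-- The bracket with the Euler field `g` has the eigenvalues `0` and `-1` on the algebra of lifts. -/
theorem bracket_bracket_euler (hV : ∀ p, IsCanonicalFieldNear V p) {g A : S.BundleField}
    (hg : CommutesNear (frameTuple V).field g p) (hgp : g p = fundG p)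
    (hA : CommutesNear (frameTuple V).field A p) :
    ∀ᶠ q in 𝓝 p, lie[HE] g (lie[HE] g A) q = -lie[HE] g A q := by
  have hgA := hg.bracket (isFrameNear_frameTuple hV p) hA
  filter_upwards [bracket_euler_eq_zero hV hg hgp (hgA.add hA) (by
    rw [map_add, solder_bracket_euler hV hg hgp hA, neg_add_cancel]), hgA.1, hA.1] with q h1 h2 h3
  rw [bracket_add_right h2 h3] at h1
  exact eq_neg_of_add_eq_zero_left h1

/-- The eigenfields of the Euler field for the eigenvalue `-1` commute: their brackets are in the
eigenspace of `-2`. -/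
theorem bracket_eigen_eq_zero (hV : ∀ p, IsCanonicalFieldNear V p) {g A A' : S.BundleField}
    (hg : CommutesNear (frameTuple V).field g p) (hgp : g p = fundG p)
    (hA : CommutesNear (frameTuple V).field A p) (hA' : CommutesNear (frameTuple V).field A' p)
    (h : ∀ᶠ q in 𝓝 p, lie[HE] g A q = -A q)
    (h' : ∀ᶠ q in 𝓝 p, lie[HE] g A' q = -A' q) :
    ∀ᶠ q in 𝓝 p, lie[HE] A A' q = 0 := by
  have hW := hA.bracket (isFrameNear_frameTuple hV p) hA'
  have h1 : ∀ᶠ q in 𝓝 p, lie[HE] g (lie[HE] A A') q =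
      (-2 : ℝ) • lie[HE] A A' q := by
    filter_upwards [h.eventually_nhds, h'.eventually_nhds, hg.1, hA.1, hA'.1] with q h1 h2 h3 h4 h5
    have e : ∀ {B B' : S.BundleField}, SmoothFieldAt B' q →
        lie[HE] B (fun q => -B' q) q = -lie[HE] B B' q := by
      intro B B' hB'
      have := bracket_const_smul_right (X := B) (-1) hB'
      simp only [neg_one_smul] at this
      exact this
    refine (bracket_jacobi h3 h4 h5).trans ((congrArg₂ (· + ·) (bracket_congr h1 EventuallyEq.rfl)
      (bracket_congr EventuallyEq.rfl h2)).trans ?_)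
    refine (congrArg₂ (· + ·) (bracket_swap.trans ((congrArg Neg.neg (e h4)).trans
      ((neg_neg _).trans bracket_swap))) (e h5)).trans ?_
    module
  filter_upwards [bracket_bracket_euler hV hg hgp hW, h1.eventually_nhds, hW.1] with q h2 h3 h4
  have h6 := (bracket_congr EventuallyEq.rfl h3).symm.trans h2
  rw [bracket_const_smul_right _ h4, h3.self_of_nhds, smul_smul, ← sub_eq_zero] at h6
  have h5 : (2 : ℝ) • lie[HE] A A' q = 0 := by
    rw [← h6]
    module
  exact (smul_eq_zero.1 h5).resolve_left two_ne_zero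

/-- The fields `-[g, A]`, with `g` the Euler field and `A` the lifts of symmetries, are eigenfields for
the eigenvalue `-1`; hence they commute. -/
theorem exists_commuting (hV : ∀ p, IsCanonicalFieldNear V p)
    (hs : ∀ w : T[HE] p, ∃ (Z : VField HN N)
      (Zt : S.BundleField), IsLiftField V Z Zt p ∧ Zt p = w) :
    ∃ (z : Fin (k + 1) → VField HN N) (Y : Fin (k + 1) → S.BundleField),
      (∀ i, IsLiftField V (z i) (Y i) p) ∧ (∀ i, solder p (Y i p) = Pi.single i 1) ∧
      ∀ i j, ∀ᶠ y in 𝓝 (foot p), lie[HN] (z i) (z j) y = 0 := by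
  obtain ⟨zg, g, hg, hgp⟩ := hs (fundG p)
  have h1 : ∀ i : Fin (k + 1), ∃ w : T[HE] p, solder p w = Pi.single i 1 := fun i => by
    obtain ⟨A, -, hA⟩ := exists_solder_eq (p := p) (smoothNear_const (Pi.single i 1 : BForm k))
    exact ⟨A p, hA.self_of_nhds⟩
  choose w hw using h1
  choose za A hA hAp using fun i => hs (w i)
  have hY := fun i => (hg.bracket hV (hA i)).smul (-1)
  have hgY : ∀ i, ∀ᶠ q in 𝓝 p, lie[HE] g
      (fun q => (-1 : ℝ) • lie[HE] g (A i) q) q =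
      -((-1 : ℝ) • lie[HE] g (A i) q) := fun i => by
    filter_upwards [bracket_bracket_euler hV hg.commutes hgp (hA i).commutes,
      (hg.commutes.bracket (isFrameNear_frameTuple hV p) (hA i).commutes).1] with q h1 h2
    rw [bracket_const_smul_right _ h2, h1, smul_neg]
  refine ⟨_, _, hY, fun i => ?_, fun i j => eventually_of_foot ?_⟩
  · rw [map_smul, solder_bracket_euler hV hg.commutes hgp (hA i).commutes, hAp, hw]
    simp
  · filter_upwards [bracket_eigen_eq_zero hV hg.commutes hgp (hY i).commutes (hY j).commutes (hgY i)
      (hgY j), ((hY i).bracket hV (hY j)).dfoot_eq] with q h1 h2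
    exact h2.symm.trans ((congrArg (dfoot q) h1).trans (map_zero _))

end

section

variable {V : S.BundleField} {p : S.Bundle}

/-! ### Flat coordinates -/

/-- The frame of `q` read in the coordinates `f` of `N`. -/
def coordFrame (f : N → HN) (q : S.Bundle) : End[k] :=
  ((EuclideanSpace.equiv (Fin (k + 1)) ℝ : HN →L[ℝ] BForm k).comp
    (d[HN, HN] f (foot q) : HN →L[ℝ] HN)).comp (frame q : BForm k →L[ℝ] HN)

theorem toLp_coordFrame (f : N → HN) (q : S.Bundle) (a : BForm k) :
    WithLp.toLp 2 (coordFrame f q a) = tderiv (H := HN) f (foot q) (frame q a) := rfl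

theorem toLp_coordFrame_solder {f : N → HN} (hf : Smooth[HN, HN] f (foot p))
    (w : T[HE] p) :
    WithLp.toLp 2 (coordFrame f p (solder p w)) = tderiv (fun q : S.Bundle => f (foot q)) p w := by
  rw [toLp_coordFrame, frame_solder]
  exact (tderiv_comp (f := f) (π := (foot : S.Bundle → N)) hf.mdiff (smoothNear_foot p).mdiff w).symm

theorem smoothNear_coordFrame {f : N → HN} (hf : Smooth[HN, HN] f (foot p)) :
    Smooth[HE, End[k]] (coordFrame (S := S) f) p := by
  refine smoothNear_clm_of_apply fun a => ?_
  obtain ⟨A, hA, hAa⟩ := exists_solder_eq (p := p) (smoothNear_const a)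
  have h1 := ((hf.comp_map (smoothNear_foot p)).tderiv hA).clm
    (EuclideanSpace.equiv (Fin (k + 1)) ℝ : HN →L[ℝ] BForm k)
  refine h1.congr ?_
  filter_upwards [hAa, (continuousAt_foot p).eventually hf.near] with q h2 h3
  rw [← toLp_coordFrame_solder h3, h2]
  rfl

/-- The derivative of the coordinate frame along a field on which the coordinates have constant
derivative. -/
theorem tderiv_coordFrame_ladder (hV : ∀ p, IsCanonicalFieldNear V p) {f : N → HN}
    (hf : Smooth[HN, HN] f (foot p)) {U : S.BundleField} (hU : SmoothFieldNear U p)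
    {c : HN} (hc : ∀ᶠ q in 𝓝 p, tderiv (fun q : S.Bundle => f (foot q)) q (U q) = c)
    (r : Fin (k + 1)) : tderiv (coordFrame f) p (U p) (ladder k r) = coordFrame f p
      (solder p (lie[HE] U ((frameTuple V).field (.inr r)) p)) := by
  have hb := smooth_frameTuple hV (.inr r) p
  have h1 := tderiv_bracket (hf.comp_map (smoothNear_foot p)) hU.self_of_nhds hb.self_of_nhds
  rw [tderiv_congr hc, tderiv_const, sub_zero, ← toLp_coordFrame_solder hf] at h1
  have h2 : (fun q => tderiv (fun q : S.Bundle => f (foot q)) q ((frameTuple V).field (.inr r) q))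
      =ᶠ[𝓝 p] fun q => (EuclideanSpace.equiv (Fin (k + 1)) ℝ).symm (coordFrame f q (ladder k r)) := by
    filter_upwards [(continuousAt_foot p).eventually hf.near] with q hq
    rw [← toLp_coordFrame_solder hq, solder_field_inr hV]
    rfl
  have hs := smoothNear_coordFrame (p := p) hf
  have h3 := (tderiv_congr h2 (U p)).symm.trans h1.symm
  have h4 := tderiv_clm (((EuclideanSpace.equiv (Fin (k + 1)) ℝ).symm : BForm k →L[ℝ] HN))
    (f := fun q => coordFrame f q (ladder k r))
    (hs.clm_apply (smoothNear_const (ladder k r))).mdiff (U p)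
  rw [tderiv_clm_apply_const hs] at h4
  exact (WithLp.toLp_injective 2) (h4.symm.trans h3)

theorem tderiv_coordFrame_eq_of_ladder {f : N → HN} {w : T[HE] p}
    {A : End[k]}
    (h : ∀ r : Fin (k + 1), tderiv (coordFrame f) p w (ladder k r) = A (ladder k r)) :
    tderiv (coordFrame f) p w = A := by
  ext1 a
  rw [← sum_ladderCoeff a, map_sum, map_sum]
  exact Finset.sum_congr rfl fun r _ => by rw [map_smul, map_smul, h]

theorem tderiv_coordFrame_fundComb (hV : ∀ p, IsCanonicalFieldNear V p) {f : N → HN}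
    (hf : Smooth[HN, HN] f (foot p)) (α β γ δ : ℝ) :
    tderiv (coordFrame f) p (fundComb α β γ δ p) = (coordFrame f p).comp (opComb k α β γ δ) := by
  refine tderiv_coordFrame_eq_of_ladder fun r => ?_
  rw [tderiv_coordFrame_ladder hV hf ((isVerticalField_fundComb α β γ δ).smoothFieldNear p) (c := 0)
    (by
      filter_upwards [(continuousAt_foot p).eventually hf.near] with q hq
      rw [← toLp_coordFrame_solder hq, solder_fundComb, map_zero]
      rfl) r, (isVerticalField_fundComb α β γ δ).solder_bracket (smooth_frameTuple hV (.inr r) p),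
    tderiv_congr (.of_forall (solder_field_inr hV r)), tderiv_const, zero_add,
    solder_field_inr hV]
  rfl

/-- If every tangent vector at `p` is a value of the lift of a symmetry, the structure is flat. -/
theorem isFlatAt_of_lifts (hV : ∀ p, IsCanonicalFieldNear V p)
    (hs : ∀ w : T[HE] p, ∃ (Z : VField HN N)
      (Zt : S.BundleField), IsLiftField V Z Zt p ∧ Zt p = w) : S.IsFlatAt (foot p) := by
  obtain ⟨z, Y, hY, hYp, hcomm⟩ := exists_commuting hV hs
  have hzp : ∀ a : BForm k, ∑ i, a i • z i (foot p) = frame p a := fun a => by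
    have h1 : ∀ i, z i (foot p) = frame p (Pi.single i 1) := fun i => by
      rw [← (hY i).dfoot_eq.self_of_nhds, ← hYp i, frame_solder]
    conv_rhs => rw [pi_eq_sum_univ' a]
    rw [map_sum]
    refine Finset.sum_congr rfl fun i _ => ?_
    rw [h1]
    exact (map_smul _ _ _).symm
  -- the coordinates whose coordinate fields are the commuting symmetries
  obtain ⟨f, hf, hfz⟩ := exists_tderiv_eq_const (H := HN) (x := foot p) (v := z) (fun i => (hY i).smooth)
    (by rw [funext hzp]; exact frame_bijective p) (eventually_all.2 fun i => eventually_all.2 (hcomm i))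
    ((EuclideanSpace.equiv (Fin (k + 1)) ℝ).symm : BForm k →L[ℝ] HN)
  have hbij : ∀ᶠ y in 𝓝 (foot p), Function.Bijective (d[HN, HN] f y) := by
    filter_upwards [hfz] with y hy
    have hsur : Function.Surjective (d[HN, HN] f y : HN →L[ℝ] HN) := fun v =>
      ⟨_, hy (EuclideanSpace.equiv (Fin (k + 1)) ℝ v)⟩
    have key : ∀ L : HN →L[ℝ] HN, Function.Surjective L → Function.Bijective L := fun L hL =>
      ⟨(LinearMap.injective_iff_surjective (f := L.toLinearMap)).2 hL, hL⟩
    exact key _ hsur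
  have hid : coordFrame f p = idV := by
    ext1 a
    refine WithLp.toLp_injective 2 ((toLp_coordFrame f p a).trans ?_)
    rw [← hzp]
    exact hfz.self_of_nhds a
  have hΨ := smoothNear_coordFrame (p := p) hf
  have hc := continuousAt_foot p
  have hYder : ∀ᶠ q in 𝓝 p, ∀ i, tderiv (coordFrame f) q (Y i q) = 0 := by
    refine eventually_all.2 fun i => ?_
    have h1 : ∀ᶠ q in 𝓝 p, tderiv (fun q : S.Bundle => f (foot q)) q (Y i q) =
        (EuclideanSpace.equiv (Fin (k + 1)) ℝ).symm (Pi.single i 1) := by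
      filter_upwards [(hY i).dfoot_eq, hc.eventually hfz, hc.eventually hf.near] with q h1 h2 h3
      have h4 := h2 (Pi.single i 1)
      rw [Finset.sum_eq_single i (fun j _ hj => by rw [Pi.single_eq_of_ne hj, zero_smul]) (by simp),
        Pi.single_eq_same, one_smul, ← h1] at h4
      refine Eq.trans ?_ h4
      exact tderiv_comp (f := f) (π := (foot : S.Bundle → N)) h3.mdiff (smoothNear_foot q).mdiff _
    filter_upwards [h1.eventually_nhds, (hY i).commutes.1.near, (hY i).commutes.2,
      hc.eventually hf.near] with q h1 h2 h3 h4
    refine tderiv_coordFrame_eq_of_ladder fun r => ?_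
    rw [tderiv_coordFrame_ladder hV h4 h2 h1 r, h3 (.inr r), map_zero, map_zero, zero_apply]
  -- the coordinates of the foot and the reading of the coordinate frame are coordinates of `E`
  let r : S.Bundle → ℝ × ℝ × ℝ × ℝ := fun q => readCoord k (coordFrame f q)
  let T : HN × (ℝ × ℝ × ℝ × ℝ) →L[ℝ] HE := ((fst ℝ _ _).prod
    ((fst ℝ _ _).comp (snd ℝ _ _))).prod
    ((snd ℝ _ _).comp (snd ℝ _ _))
  have hform : (coordFrame f p) (form₀ k) 0 ≠ 0 := by
    rw [hid]
    simp [form₀, linearPower]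
  have hrd : ∀ᶠ B in 𝓝 (coordFrame f p), ContDiffAt ℝ ∞ (readCoord k) B := by
    have h1 : Continuous fun B : End[k] => B (form₀ k) 0 := by fun_prop
    filter_upwards [h1.continuousAt.eventually_ne hform] with B hB using contDiffAt_readCoord hB
  have hr : Smooth[HE, ℝ × ℝ × ℝ × ℝ] r p := SmoothNear.comp_space hrd hΨ
  let Q₀ : S.Bundle → HE := fun q => T (f (foot q), r q)
  have hff : ∀ {q : S.Bundle}, Smooth[HN, HN] f (foot q) →
      Smooth[HE, HN] (fun q : S.Bundle => f (foot q)) q :=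
    fun h => h.comp_map (smoothNear_foot _)
  have hQs : Smooth[HE, HE] Q₀ p := ((hff hf).prodMk hr).clm T
  have hQd : ∀ {q : S.Bundle}, Smooth[HN, HN] f (foot q) →
      Smooth[HE, ℝ × ℝ × ℝ × ℝ] r q → ∀ w : T[HE] q, tderiv Q₀ q w =
        ((tderiv (fun q : S.Bundle => f (foot q)) q w, (tderiv r q w).1), (tderiv r q w).2) := by
    intro q h1 h2 w
    have h3 := tderiv_clm T ((hff h1).prodMk h2).mdiff w
    rw [tderiv_prodMk (hff h1).mdiff h2.mdiff] at h3
    exact h3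
  have hsol : ∀ {q : S.Bundle}, Smooth[HN, HN] f (foot q) →
      Function.Bijective (d[HN, HN] f (foot q)) → ∀ w : T[HE] q,
      tderiv (fun q : S.Bundle => f (foot q)) q w = 0 → solder q w = 0 := by
    intro q h1 h2 w h3
    rw [← toLp_coordFrame_solder h1] at h3
    exact (frame_bijective q).1 ((h2.1 (h3.trans (map_zero _).symm)).trans (map_zero _).symm)
  have hQinj : ∀ w : T[HE] p, tderiv Q₀ p w = 0 → w = 0 := by
    intro w hw
    rw [hQd hf hr] at hw
    have h1 : tderiv (fun q : S.Bundle => f (foot q)) p w = 0 := congrArg (fun v : HE => v.1.1) hw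
    have h2 : tderiv r p w = 0 :=
      Prod.ext (congrArg (fun v : HE => v.1.2) hw) (congrArg (fun v : HE => v.2) hw)
    obtain ⟨α, β, γ, δ, rfl⟩ := exists_fundComb w (hsol hf hbij.self_of_nhds w h1)
    have h3 := tderiv_comp_fderiv (hrd.self_of_nhds.differentiableAt (by simp)) hΨ.mdiff
      (fundComb α β γ δ p)
    rw [tderiv_coordFrame_fundComb hV hf, hid, id_comp] at h3
    have h4 := h3.symm.trans h2
    simp only [opComb, map_add, map_smul, fderiv_readCoord_opX, fderiv_readCoord_id,
      fderiv_readCoord_opF₀, fderiv_readCoord_opF₁, Prod.smul_mk, Prod.mk_add_mk, Prod.mk_eq_zero,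
      smul_eq_mul, mul_one, mul_zero, add_zero, zero_add, mul_neg, neg_eq_zero] at h4
    obtain ⟨rfl, rfl, rfl, h5⟩ := h4
    obtain rfl : δ = 0 := by simpa using h5
    simp [fundComb]
  have hQb : Function.Bijective (d[HE, HE] Q₀ p) := by
    have key : ∀ L : HE →L[ℝ] HE, (∀ w, L w = 0 → w = 0) → Function.Bijective L := fun L hL =>
      have h : Function.Injective L := (injective_iff_map_eq_zero L).2 hL
      ⟨h, (LinearMap.injective_iff_surjective (f := L.toLinearMap)).1 h⟩
    exact key _ hQinj
  obtain ⟨Q, hpQ, -, hQe, hQ1, hQ2⟩ := exists_openPartialHomeomorph hQs hQb univ_mem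
  have hQc := smoothChart_of_contMDiffOn hQ1 hQ2
  -- the coordinate frame is constant along the commuting fields
  let K : Submodule ℝ HE := LinearMap.ker (((snd ℝ HN ℝ).comp
    (fst ℝ (HN × ℝ) (ℝ × ℝ × ℝ))).prod
    (snd ℝ (HN × ℝ) (ℝ × ℝ × ℝ))).toLinearMap
  have hconst := eventually_eq_of_tderiv_eq_zero hQc hpQ hΨ K (by
    filter_upwards [Q.open_source.mem_nhds hpQ, hYder, hr.near, hc.eventually hf.near,
      hΨ.near, hc.eventually hbij, hc.eventually hfz, eventually_all.2 fun i => (hY i).dfoot_eq,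
      hQe.eventuallyEq_of_mem (Q.open_source.mem_nhds hpQ) |>.eventually_nhds,
      hΨ.at.continuousAt.eventually hrd] with q h1 h2 h3 h4 h5 h6 h7 h8 h9 h10 w hw
    rw [tderiv_congr h9] at hw
    have hw2 : tderiv r q w = 0 := by
      rw [hQd h4 h3] at hw
      have h := (LinearMap.mem_ker.1 hw : (_, _) = (0 : ℝ × ℝ × ℝ × ℝ))
      exact Prod.ext (congrArg Prod.fst h) (congrArg Prod.snd h)
    let c : BForm k := EuclideanSpace.equiv (Fin (k + 1)) ℝ (tderiv (fun q : S.Bundle => f (foot q)) q w)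
    let w' : T[HE] q := ∑ i, c i • Y i q
    have hw' : tderiv (coordFrame f) q w' = 0 := by
      rw [tderiv_vsum]
      exact Finset.sum_eq_zero fun i _ => by rw [tderiv_vsmul, h2 i, smul_zero]
    have h11 : tderiv (fun q : S.Bundle => f (foot q)) q w' =
        tderiv (fun q : S.Bundle => f (foot q)) q w := by
      have e1 := tderiv_comp (f := f) (π := (foot : S.Bundle → N)) h4.mdiff (smoothNear_foot q).mdiff w'
      have e2 : d[HE, HN] (foot : S.Bundle → N) q w' = ∑ i, c i • z i (foot q) := by
        refine (map_sum (dfoot q) _ _).trans (Finset.sum_congr rfl fun i _ => ?_)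
        rw [map_smul, h8 i]
        rfl
      exact e1.trans ((congrArg (tderiv f (foot q)) e2).trans (h7 c))
    have h12 : tderiv r q w' = 0 := by
      have e1 := tderiv_comp_fderiv (h10.differentiableAt (by simp)) h5.mdiff w'
      rw [hw', map_zero] at e1
      exact e1
    have h13 : w = w' := by
      refine hQc.tderiv_injective h1 ?_
      rw [tderiv_congr h9, tderiv_congr h9, hQd h4 h3, hQd h4 h3, h11, h12, hw2]
    rw [h13, hw'])
  obtain ⟨F, hxF, -, hFe, hF1, hF2⟩ := exists_openPartialHomeomorph (H := HN) (H' := HN) hf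
    hbij.self_of_nhds univ_mem
  have hFx : F (foot p) = f (foot p) := hFe hxF
  -- over the points near the foot, the frames which agree with the coordinate frames
  have hframes : ∀ᶠ y in 𝓝 (foot p), ∃ σ ∈ S.frames y, ∀ a,
      d[HN, HN] f y (σ a) = WithLp.toLp 2 a := by
    let s : N → S.Bundle := fun y => Q.symm ((f y, (Q p).1.2), (Q p).2)
    have hQp : Q p = ((f (foot p), (Q p).1.2), (Q p).2) := by
      have h1 : (Q p).1.1 = f (foot p) := congrArg (fun v : HE => v.1.1) (hQe hpQ)
      rw [← h1]
    have h0c : Tendsto (fun y => (((f y, (Q p).1.2), (Q p).2) : HE)) (𝓝 (foot p)) (𝓝 (Q p)) := by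
      have h1 : ContinuousAt (fun y => (((f y, (Q p).1.2), (Q p).2) : HE)) (foot p) :=
        (hf.at.continuousAt.prodMk continuousAt_const).prodMk continuousAt_const
      have h2 := h1.tendsto
      rwa [← hQp] at h2
    have hsc : Tendsto s (𝓝 (foot p)) (𝓝 p) := by
      have h1 : Tendsto Q.symm (𝓝 (Q p)) (𝓝 p) := by
        have := (Q.continuousAt_symm (Q.map_source hpQ)).tendsto
        rwa [Q.left_inv hpQ] at this
      exact h1.comp h0c
    have hpc : Tendsto (fun y => (p, s y)) (𝓝 (foot p)) (𝓝 (p, p)) := by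
      rw [nhds_prod_eq]
      exact tendsto_const_nhds.prodMk hsc
    filter_upwards [hpc.eventually hconst, h0c.eventually (Q.open_target.mem_nhds (Q.map_source hpQ)),
      F.open_source.mem_nhds hxF, (hc.tendsto.comp hsc).eventually (F.open_source.mem_nhds hxF)]
      with y h1 h2 h3 h4
    have h5 : Q (s y) = ((f y, (Q p).1.2), (Q p).2) := Q.right_inv h2
    have h6 : coordFrame f (s y) = idV := by
      refine (h1 ?_).symm.trans hid
      change Q (s y) - Q p ∈ K
      rw [h5]
      refine LinearMap.mem_ker.2 ?_
      change ((Q p).1.2 - (Q p).1.2, (Q p).2 - (Q p).2) = 0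
      rw [sub_self, sub_self]
      rfl
    have h7 : foot (s y) = y := by
      refine F.injOn h4 h3 ((hFe h4).trans (Eq.trans ?_ (hFe h3).symm))
      have h8 : (Q (s y)).1.1 = f (foot (s y)) := congrArg (fun v : HE => v.1.1) (hQe (Q.map_target h2))
      exact h8.symm.trans (congrArg (fun v : HE => v.1.1) h5)
    refine h7 ▸ ⟨frame (s y), frame_mem (s y), fun a => ?_⟩
    have h9 := toLp_coordFrame f (s y) a
    rw [h6] at h9
    exact h9.symm
  obtain ⟨U, hU, hUo, hxU⟩ := eventually_nhds_iff.1 hframes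
  let F' := F.restrOpen U hUo
  have hF's : F'.source = F.source ∩ U := F.restrOpen_source U hUo
  refine ⟨F', hF's ▸ ⟨hxF, hxU⟩, hF1.mono (hF's ▸ inter_subset_left), hF2.mono ?_, fun y hy => ?_⟩
  · exact fun v hv => hv.1
  · rw [hF's] at hy
    obtain ⟨σ, hσ, h1⟩ := hU y hy.2
    refine ⟨σ, hσ, fun a => ?_⟩
    have h2 : d[HN, HN] F' y = d[HN, HN] f y :=
      Filter.EventuallyEq.mfderiv_eq (hFe.eventuallyEq_of_mem (F.open_source.mem_nhds hy.1))
    exact (congrArg (fun L : HN →L[ℝ] HN => L (σ a)) h2).trans (h1 a)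

end

/-! ### Symmetries of flat structures -/

/-- A binary form as a vector of the Euclidean space of its coefficients. -/
def vec (k : ℕ) : BForm k →L[ℝ] EuclideanSpace ℝ (Fin (k + 1)) :=
  ((EuclideanSpace.equiv (Fin (k + 1)) ℝ).symm : (Fin (k + 1) → ℝ) →L[ℝ] _)

/-- The coefficients of a binary form. -/
def form (k : ℕ) : EuclideanSpace ℝ (Fin (k + 1)) →L[ℝ] BForm k :=
  (EuclideanSpace.equiv (Fin (k + 1)) ℝ : _ →L[ℝ] Fin (k + 1) → ℝ)

theorem form_vec (a : BForm k) : form k (vec k a) = a := rfl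

/-- In flat coordinates, a linear field of `gl(2)` or a constant field is an infinitesimal symmetry;
its flow is affine. -/
theorem isInfSymmetryAt_chartField {f : OpenPartialHomeomorph N HN} (hf : SmoothChart f) {x : N}
    (hx : x ∈ f.source)
    (hflat : ∀ y ∈ f.source, ∃ σ ∈ S.frames y, ∀ a, tderiv (H := HN) f y (σ a) = vec k a)
    {fl : ℝ → End[k]} {D : End[k]} (hfl : ContDiff ℝ ∞ fl)
    (h0 : fl 0 = ContinuousLinearMap.id ℝ _) (hD : HasDerivAt fl D 0) (hGL : ∀ t, IsGL2 (fl t))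
    (hadd : ∀ s t, fl (s + t) = (fl s).comp (fl t)) {c : BForm k} (hc : D c = 0) :
    S.IsInfSymmetryAt (chartField f fun y => vec k (c + D (form k (f y)))) x := by
  have hder : ∀ t, HasDerivAt fl (D.comp (fl t)) t := fun t => by
    have h1 : HasDerivAt (fun s => fl (s - t)) D t := by
      have h2 : HasDerivAt fl D (t - t) := by rwa [sub_self]
      exact h2.comp_sub_const t t
    have h3 := h1.clm_comp (hasDerivAt_const t (fl t))
    rw [ContinuousLinearMap.comp_zero, add_zero] at h3
    refine h3.congr_of_eventuallyEq (.of_forall fun s => ?_)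
    change fl s = (fl (s - t)).comp (fl t)
    rw [← hadd, sub_add_cancel]
  let P : ℝ × HN → HN := fun z => vec k (fl z.1 (form k z.2) + z.1 • c)
  have hP : ContDiff ℝ ∞ P := by
    have h1 : ContDiff ℝ ∞ fun z : ℝ × HN => fl z.1 := hfl.comp contDiff_fst
    have h2 : ContDiff ℝ ∞ fun z : ℝ × HN => form k z.2 := (form k).contDiff.comp contDiff_snd
    exact (vec k).contDiff.comp ((h1.clm_apply h2).add (contDiff_fst.smul contDiff_const))
  have hPt : ∀ t u, HasDerivAt (fun t => P (t, u)) (vec k (c + D (form k (P (t, u))))) t := fun t u => by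
    have h1 := ((hder t).clm_apply (hasDerivAt_const t (form k u))).add ((hasDerivAt_id t).smul_const c)
    have h2 := (vec k).hasFDerivAt.comp_hasDerivAt t h1
    have h3 : D (form k (P (t, u))) = D (fl t (form k u)) := by
      rw [form_vec, map_add, map_smul, hc, smul_zero, add_zero]
    have h4 : D (fl t (form k u)) + fl t 0 + (1 : ℝ) • c = c + D (form k (P (t, u))) := by
      rw [h3, map_zero, add_zero, one_smul, add_comm]
    exact h4 ▸ h2
  have hPu : ∀ t u, HasFDerivAt (fun u => P (t, u)) ((vec k).comp ((fl t).comp (form k))) u :=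
    fun t u => (vec k).hasFDerivAt.comp u (f := fun u => fl t (form k u) + t • c)
      (((fl t).hasFDerivAt.comp u (form k).hasFDerivAt).add_const _)
  have hP0 : ∀ u, P (0, u) = u := fun u => by
    change vec k (fl 0 (form k u) + (0 : ℝ) • c) = u
    rw [h0, zero_smul, add_zero]
    rfl
  have hfs : ∀ {y}, y ∈ f.source → Smooth[HN, HN] f y := fun hy => hf.smoothNear hy
  constructor
  · refine hf.smoothFieldNear_chartField hx ?_
    exact SmoothNear.comp_space (g := fun u => vec k (c + D (form k u)))
      (.of_forall fun u => by fun_prop) (hfs hx)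
  refine ⟨fun t y => f.symm (P (t, f y)), ?_, ?_⟩
  · filter_upwards [f.open_source.mem_nhds hx] with y hy
    rw [hP0, f.left_inv hy]
  have hcont : ContinuousAt (fun z : ℝ × N => P (z.1, f z.2)) (0, x) := by
    have h1 : ContinuousAt (fun z : ℝ × N => f z.2) (0, x) :=
      ContinuousAt.comp (g := f) (f := Prod.snd) (hfs hx).at.continuousAt continuousAt_snd
    exact ContinuousAt.comp (g := P) (hP.continuous.continuousAt) (continuousAt_fst.prodMk h1)
  have htgt : ∀ᶠ z : ℝ × N in 𝓝 (0, x), P (z.1, f z.2) ∈ f.target := by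
    refine hcont.eventually (f.open_target.mem_nhds ?_)
    change P (0, f x) ∈ f.target
    rw [hP0]
    exact f.map_source hx
  filter_upwards [htgt, continuousAt_snd.eventually (f.open_source.mem_nhds hx)] with z h1 h2
  obtain ⟨t, y⟩ := z
  change P (t, f y) ∈ f.target at h1
  change y ∈ f.source at h2
  have hy' : f.symm (P (t, f y)) ∈ f.source := f.map_target h1
  refine ⟨?_, ?_, ?_⟩
  · have h3 : ContMDiffAt (𝓘(ℝ, ℝ).prod (𝓡 (k + 1))) 𝓘(ℝ, HN) ∞ (fun w : ℝ × N => f w.2) (t, y) :=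
      ContMDiffAt.comp (t, y) (g := f) (f := Prod.snd) (hfs h2).at contMDiffAt_snd
    have h4 : ContMDiffAt (𝓘(ℝ, ℝ).prod (𝓡 (k + 1))) 𝓘(ℝ, ℝ × HN) ∞
        (fun w : ℝ × N => (w.1, f w.2)) (t, y) := contMDiffAt_fst.prodMk_space h3
    have h5 : ContMDiffAt (𝓘(ℝ, ℝ).prod (𝓡 (k + 1))) 𝓘(ℝ, HN) ∞
        (fun w : ℝ × N => P (w.1, f w.2)) (t, y) :=
      ContMDiffAt.comp (t, y) (g := P) (I' := 𝓘(ℝ, ℝ × HN)) hP.contMDiff.contMDiffAt h4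
    exact ContMDiffAt.comp (t, y) (g := f.symm) (hf.smoothNear_symm h1).at h5
  · have h3 : MDAt[ℝ, HN] (fun t => f.symm (P (t, f y))) t :=
      MDifferentiableAt.comp (I' := 𝓘(ℝ, HN)) (g := f.symm) t (hf.smoothNear_symm h1).mdiff
        (hPt t (f y)).differentiableAt.mdifferentiableAt
    refine hf.tderiv_injective hy' ?_
    rw [hf.tderiv_chartField hy']
    have h4 := hasDerivAt_comp_curve (f := f) (γ := fun t => f.symm (P (t, f y))) (s := t)
      (hfs hy').mdiff h3
    have h5 : (fun t => f (f.symm (P (t, f y)))) =ᶠ[𝓝 t] fun t => P (t, f y) := by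
      filter_upwards [(hPt t (f y)).continuousAt.eventually (f.open_target.mem_nhds h1)] with s hs
        using f.right_inv hs
    have h6 := h4.unique ((hPt t (f y)).congr_of_eventuallyEq h5)
    exact h6.trans (congrArg (fun u => vec k (c + D (form k u))) (f.right_inv h1).symm)
  · intro σ hσ
    obtain ⟨σ₀, hσ₀, e₀⟩ := hflat y h2
    obtain ⟨σ₁, hσ₁, e₁⟩ := hflat _ hy'
    obtain ⟨B, hB, rfl⟩ := (mem_frames_iff_isGL2 hσ₀).1 hσ
    have h3 : (d[HN, HN] (fun y => f.symm (P (t, f y))) y).comp (σ₀.comp B) =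
        σ₁.comp ((fl t).comp B) := by
      refine ContinuousLinearMap.ext fun a => hf.tderiv_injective hy' ?_
      refine Eq.trans ?_ (e₁ _).symm
      have e2 : DifferentiableAt ℝ (fun u => P (t, u)) (f y) := (hPu t (f y)).differentiableAt
      have e3 : MDAt[HN, HN] (fun y => f.symm (P (t, f y))) y :=
        MDifferentiableAt.comp (I' := 𝓘(ℝ, HN)) (g := f.symm) y (hf.smoothNear_symm h1).mdiff
          (mdifferentiableAt_space_comp (g := fun u => P (t, u)) e2 (hfs h2).mdiff)
      have e4 := tderiv_comp (f := f) (π := fun y => f.symm (P (t, f y))) (hfs hy').mdiff e3 (σ₀ (B a))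
      refine e4.symm.trans ?_
      have e5 : (fun y => f (f.symm (P (t, f y)))) =ᶠ[𝓝 y] fun y => P (t, f y) := by
        have h6 : ContinuousAt (fun y => P (t, f y)) y :=
          ContinuousAt.comp (g := fun u => P (t, u)) e2.continuousAt (hfs h2).at.continuousAt
        filter_upwards [h6.eventually (f.open_target.mem_nhds h1)] with s hs using f.right_inv hs
      rw [tderiv_congr e5, tderiv_comp_fderiv e2 (hfs h2).mdiff, (hPu t (f y)).fderiv, e₀]
      rfl
    exact h3 ▸ comp_mem_frames hσ₁ ((hGL t).comp hB)

theorem flX_add (s t : ℝ) : flX k (s + t) = (flX k s).comp (flX k t) := by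
  simp only [flX, linearSubst_comp]
  congr 1 <;> ring

theorem flG_add (s t : ℝ) : flG k (s + t) = (flG k s).comp (flG k t) := by
  simp only [flG, Real.exp_add, comp_smul, ContinuousLinearMap.comp_id, smul_smul]
  rw [mul_comm]

theorem flF₀_add (s t : ℝ) : flF₀ k (s + t) = (flF₀ k s).comp (flF₀ k t) := by
  simp only [flF₀, linearSubst_comp, neg_add, Real.exp_add]
  congr 1 <;> ring

theorem flF₁_add (s t : ℝ) : flF₁ k (s + t) = (flF₁ k s).comp (flF₁ k t) := by
  simp only [flF₁, linearSubst_comp]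
  congr 1 <;> ring

theorem opComb_eq_zero {α β γ δ : ℝ} (h : opComb k α β γ δ = 0) : α = 0 ∧ β = 0 ∧ γ = 0 ∧ δ = 0 := by
  have h1 := congrArg (fderiv ℝ (readCoord k) (ContinuousLinearMap.id ℝ _)) h
  simp only [opComb, map_add, map_smul, map_zero, fderiv_readCoord_opX, fderiv_readCoord_id,
    fderiv_readCoord_opF₀, fderiv_readCoord_opF₁, Prod.smul_mk, Prod.mk_add_mk, Prod.mk_eq_zero,
    smul_eq_mul, mul_one, mul_zero, add_zero, zero_add, mul_neg, neg_eq_zero] at h1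
  exact ⟨h1.1, h1.2.1, h1.2.2.1, by simpa using h1.2.2.2⟩

/-- The field of the coordinates `f` given by an affine map of the space of binary forms, with linear
part in `gl(2)`. -/
def affineField (f : OpenPartialHomeomorph N HN) (v : BForm k × ℝ × ℝ × ℝ × ℝ) (y : N) :
    T[HN] y :=
  chartField f (fun y => vec k (v.1 + opComb k v.2.1 v.2.2.1 v.2.2.2.1 v.2.2.2.2 (form k (f y)))) y

/-- The germ of the affine field, as a linear function of its parameters. -/
def affineGerm (f : OpenPartialHomeomorph N HN) (x : N) :
    BForm k × ℝ × ℝ × ℝ × ℝ →ₗ[ℝ] Germ (𝓝 x) HN where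
  toFun v := Germ.ofFun fun y => (affineField f v y : HN)
  map_add' v w := by
    refine congrArg Germ.ofFun (funext fun y => Eq.trans ?_ (map_add
      (d[HN, HN] f.symm (f y) : HN →L[ℝ] HN) _ _))
    refine congrArg (d[HN, HN] f.symm (f y) : HN →L[ℝ] HN) ?_
    refine Eq.trans (congrArg (vec k) ?_) (map_add (vec k) _ _)
    simp only [opComb, add_apply, smul_apply, Prod.fst_add, Prod.snd_add]
    module
  map_smul' c v := by
    refine congrArg Germ.ofFun (funext fun y => Eq.trans ?_ (map_smul
      (d[HN, HN] f.symm (f y) : HN →L[ℝ] HN) _ _))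
    refine congrArg (d[HN, HN] f.symm (f y) : HN →L[ℝ] HN) ?_
    refine Eq.trans (congrArg (vec k) ?_) (map_smul (vec k) _ _)
    simp only [opComb, add_apply, smul_apply, Prod.smul_fst, Prod.smul_snd, smul_eq_mul, RingHom.id_apply]
    module

theorem affineGerm_injective {f : OpenPartialHomeomorph N HN} (hf : SmoothChart f) {x : N}
    (hx : x ∈ f.source) : Function.Injective (affineGerm (k := k) f x) := by
  refine (injective_iff_map_eq_zero _).2 fun v hv => ?_
  obtain ⟨c, α, β, γ, δ⟩ := v
  have h1 : ∀ᶠ y in 𝓝 x, (affineField f (c, α, β, γ, δ) y : HN) = 0 := Germ.coe_eq.1 hv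
  have h2 : ∀ᶠ u in 𝓝 (f x), c + opComb k α β γ δ (form k u) = 0 := by
    have h3 : Tendsto f.symm (𝓝 (f x)) (𝓝 x) := by
      have := (f.continuousAt_symm (f.map_source hx)).tendsto
      rwa [f.left_inv hx] at this
    filter_upwards [h3.eventually h1, f.open_target.mem_nhds (f.map_source hx)] with u h4 h5
    have h6 := hf.tderiv_chartField (f.map_target h5)
      (fun y => vec k (c + opComb k α β γ δ (form k (f y))))
    have h7 := (congrArg (tderiv f (f.symm u)) h4).trans (tderiv_vzero _)
    have h8 := h6.symm.trans h7
    simp only [f.right_inv h5] at h8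
    exact congrArg (form k) h8
  have h3 : HasFDerivAt (fun u => c + opComb k α β γ δ (form k u)) ((opComb k α β γ δ).comp (form k)) (f x) :=
    ((opComb k α β γ δ).hasFDerivAt.comp (f x) (form k).hasFDerivAt).const_add c
  have h4 : (opComb k α β γ δ).comp (form k) = 0 :=
    h3.unique ((hasFDerivAt_const (0 : BForm k) (f x)).congr_of_eventuallyEq h2)
  have h5 : opComb k α β γ δ = 0 :=
    ContinuousLinearMap.ext fun a => congrArg (fun L : HN →L[ℝ] BForm k => L (vec k a)) h4
  obtain ⟨rfl, rfl, rfl, rfl⟩ := opComb_eq_zero h5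
  have h6 := h2.self_of_nhds
  rw [h5, zero_apply, add_zero] at h6
  rw [h6]
  rfl

theorem affineGerm_mem {f : OpenPartialHomeomorph N HN} (hf : SmoothChart f) {x : N} (hx : x ∈ f.source)
    (hflat : ∀ y ∈ f.source, ∃ σ ∈ S.frames y, ∀ a, tderiv (H := HN) f y (σ a) = vec k a)
    (v : BForm k × ℝ × ℝ × ℝ × ℝ) : affineGerm f x v ∈ S.symmetryGerms x := by
  obtain ⟨c, α, β, γ, δ⟩ := v
  have key : ∀ {fl : ℝ → End[k]} {D : End[k]} {c : BForm k}
      {α β γ δ : ℝ}, ContDiff ℝ ∞ fl → fl 0 = ContinuousLinearMap.id ℝ _ → HasDerivAt fl D 0 →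
      (∀ t, IsGL2 (fl t)) → (∀ s t, fl (s + t) = (fl s).comp (fl t)) → D c = 0 →
      opComb k α β γ δ = D → affineGerm f x (c, α, β, γ, δ) ∈ S.symmetryGerms x := by
    intro fl D c α β γ δ h1 h2 h3 h4 h5 h6 h7
    subst h7
    exact Submodule.subset_span ⟨_, isInfSymmetryAt_chartField hf hx hflat h1 h2 h3 h4 h5 h6, rfl⟩
  have e : ((c, α, β, γ, δ) : BForm k × ℝ × ℝ × ℝ × ℝ) = (c, 0, 0, 0, 0) + α • (0, 1, 0, 0, 0) +
      β • (0, 0, 1, 0, 0) + γ • (0, 0, 0, 1, 0) + δ • (0, 0, 0, 0, 1) := by simp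
  rw [e, map_add, map_add, map_add, map_add, map_smul, map_smul, map_smul, map_smul]
  refine add_mem (add_mem (add_mem (add_mem ?_ (Submodule.smul_mem _ _ ?_)) (Submodule.smul_mem _ _ ?_))
    (Submodule.smul_mem _ _ ?_)) (Submodule.smul_mem _ _ ?_)
  · exact key (fl := fun _ => ContinuousLinearMap.id ℝ _) contDiff_const rfl (hasDerivAt_const _ _)
      (fun _ => isGL2_id) (fun _ _ => rfl) rfl (by simp [opComb])
  · exact key contDiff_flX flX_zero hasDerivAt_flX isGL2_flX flX_add (map_zero _) (by simp [opComb])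
  · exact key contDiff_flG flG_zero hasDerivAt_flG isGL2_flG flG_add (map_zero _) (by simp [opComb])
  · exact key contDiff_flF₀ flF₀_zero hasDerivAt_flF₀ isGL2_flF₀ flF₀_add (map_zero _) (by simp [opComb])
  · exact key contDiff_flF₁ flF₁_zero hasDerivAt_flF₁ isGL2_flF₁ flF₁_add (map_zero _) (by simp [opComb])

theorem finrank_symmetryGerms_eq_iff (hk : 3 ≤ k) (x : N) :
    Module.finrank ℝ (S.symmetryGerms x) = k + 5 ↔ S.IsFlatAt x := by
  constructor
  · intro h
    obtain ⟨p, rfl⟩ := exists_foot_eq S x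
    obtain ⟨V, hV⟩ := exists_canonicalField (S := S) hk
    exact isFlatAt_of_lifts hV (exists_lift_of_finrank hk hV p h)
  · rintro ⟨f, hx, h1, h2, hflat⟩
    have hf := smoothChart_of_contMDiffOn h1 h2
    obtain ⟨hfin, hle⟩ := finrank_symmetryGerms_le (S := S) hk x
    refine le_antisymm hle ?_
    have h3 := LinearMap.finrank_le_finrank_of_injective
      (f := (affineGerm f x).codRestrict (S.symmetryGerms x) (affineGerm_mem hf hx hflat))
      fun v w h => affineGerm_injective hf hx (congrArg Subtype.val h)
    have h4 : Module.finrank ℝ (BForm k × ℝ × ℝ × ℝ × ℝ) = k + 5 := by simp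
    rwa [h4] at h3

/-! ### Global symmetries -/

theorem isInfSymmetryAt_germ_mem {Z : VField HN N} (hZ : Z ∈ S.symmetries)
    (x : N) : (Germ.ofFun fun y => (Z y : HN) : Germ (𝓝 x) HN) ∈ S.symmetryGerms x := by
  induction hZ using Submodule.span_induction with
  | mem Z hZ => exact Submodule.subset_span ⟨Z, hZ x, rfl⟩
  | zero => exact zero_mem _
  | add Z Z' _ _ h h' => exact add_mem h h'
  | smul c Z _ h => exact Submodule.smul_mem _ c h

/-- A global symmetry vanishing near a point vanishes: near every point, its lift vanishes as soon as
it has a zero. -/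
theorem eq_zero_of_eventually_eq_zero (hk : 3 ≤ k) [PreconnectedSpace N]
    {Z : VField HN N} (hZ : Z ∈ S.symmetries) {x : N}
    (hx : ∀ᶠ y in 𝓝 x, Z y = 0) : Z = 0 := by
  obtain ⟨V, hV⟩ := exists_canonicalField (S := S) hk
  let s : Set N := {y | ∀ᶠ y' in 𝓝 y, Z y' = 0}
  have hso : IsOpen s := isOpen_iff_mem_nhds.2 fun y hy => Filter.Eventually.eventually_nhds hy
  have hsc : IsClosed s := by
    refine isClosed_iff_frequently.2 fun y hy => ?_
    obtain ⟨p, rfl⟩ := exists_foot_eq S y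
    obtain ⟨Z', Zt, hZ', h⟩ := exists_isLiftField_of_mem hk hV (isInfSymmetryAt_germ_mem hZ (foot p))
    have hZZ : ∀ᶠ y in 𝓝 (foot p), Z y = Z' y := Germ.coe_eq.1 hZ'
    obtain ⟨τ, hτ, hτ', hfoot⟩ := exists_local_section p
    have hτc : Tendsto τ (𝓝 (foot p)) (𝓝 p) := by
      have := hτ'.at.continuousAt.tendsto
      rwa [hτ] at this
    have h1 := (h.commutes.eventually_zero (isFrameNear_frameTuple hV p))
    rw [nhds_prod_eq] at h1
    have h2 : ∀ᶠ q in 𝓝 p, (∀ᶠ y in 𝓝 (foot q), Z y = Z' y) ∧ CommutesNear (frameTuple V).field Zt q ∧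
        ∀ᶠ q' in 𝓝 q, dfoot q' (Zt q') = Z' (foot q') := by
      filter_upwards [(continuousAt_foot p).eventually hZZ.eventually_nhds, h.commutes.1.near,
        h.commutes.2.eventually_nhds, h.dfoot_eq.eventually_nhds] with q h3 h4 h5 h6
      exact ⟨h3, ⟨h4, h5⟩, h6⟩
    obtain ⟨y, hy, h3, h4, h5, h6, h7⟩ := (hy.and_eventually
      ((hτc.eventually h1.curry).and (hfoot.and (hτc.eventually h2)))).exists
    have h8 : Zt (τ y) = 0 := by
      refine (CommutesNear.eq_zero_of_vertical hV h6 ?_).self_of_nhds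
      have hy' : ∀ᶠ y' in 𝓝 (foot (τ y)), Z y' = 0 := h4.symm ▸ hy
      filter_upwards [(continuousAt_foot (τ y)).eventually h5,
        (continuousAt_foot (τ y)).eventually hy', h7] with q e1 e2 e3
      exact solder_eq_zero_iff.2 (e3.trans (e1.symm.trans e2))
    refine eventually_of_foot (P := fun y => Z y = 0) ?_
    filter_upwards [h3, (continuousAt_foot p).eventually hZZ, h.dfoot_eq] with q e1 e2 e3
    exact e2.trans (e3.symm.trans ((congrArg (dfoot q) (e1 h8)).trans (map_zero _)))
  have hs : s = univ := IsClopen.eq_univ ⟨hsc, hso⟩ ⟨x, hx⟩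
  funext y
  have hy : y ∈ s := hs ▸ mem_univ y
  exact mem_of_mem_nhds (s := {y | Z y = 0}) hy

/-- The global symmetries embed into the germs at `x`, whose dimension is at most `k + 5`. -/
theorem isFlatAt_of_finrank_symmetries (hk : 3 ≤ k) [PreconnectedSpace N]
    (h : Module.finrank ℝ S.symmetries = k + 5) (x : N) : S.IsFlatAt x := by
  obtain ⟨hfin, hle⟩ := finrank_symmetryGerms_le (S := S) hk x
  let ρ : S.symmetries →ₗ[ℝ] S.symmetryGerms x :=
    { toFun := fun Z => ⟨Germ.ofFun fun y => (Z.1 y : HN), isInfSymmetryAt_germ_mem Z.2 x⟩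
      map_add' := fun _ _ => rfl
      map_smul' := fun _ _ => rfl }
  have hρ : Function.Injective ρ := (injective_iff_map_eq_zero _).2 fun Z hZ =>
    Subtype.ext (eq_zero_of_eventually_eq_zero hk Z.2 (Germ.coe_eq.1 (congrArg Subtype.val hZ)))
  have h1 := LinearMap.finrank_le_finrank_of_injective hρ
  exact (finrank_symmetryGerms_eq_iff hk x).1 (le_antisymm hle (h ▸ h1))

end GL2Structure

end

theorem mainTheorem2 {k : ℕ} [NeZero k] (hk : 3 ≤ k)
    {N : Type*} [TopologicalSpace N] [T2Space N] [SecondCountableTopology N]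
    [ChartedSpace (EuclideanSpace ℝ (Fin (k + 1))) N] [IsManifold (𝓡 (k + 1)) ∞ N]
    (S : GL2Structure k N)
    {N' : Type*} [TopologicalSpace N'] [T2Space N'] [SecondCountableTopology N']
    [ChartedSpace (EuclideanSpace ℝ (Fin (k + 1))) N'] [IsManifold (𝓡 (k + 1)) ∞ N']
    (S' : GL2Structure k N') :
    S.pair.IsRegular k ∧
    (∃! B : CanonicalBundle.FrameTuple S.pair k, B.IsCanonical) ∧
    (∀ (B : CanonicalBundle.FrameTuple S.pair k) (B' : CanonicalBundle.FrameTuple S'.pair k),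
      B.IsCanonical → B'.IsCanonical →
      (S.Equivalent S' ↔ GL2Structure.FramesEquivalent B B') ∧
      (∀ x x', S.GermEquivalent S' x x' ↔
        ∃ (p : S.Bundle) (p' : S'.Bundle), p.base.base = x ∧ p'.base.base = x' ∧
          GL2Structure.FrameGermsEquivalent B B' p p')) ∧
    (∀ x, Module.finrank ℝ (S.symmetryGerms x) = k + 5 ↔ S.IsFlatAt x) ∧
    (PreconnectedSpace N → Module.finrank ℝ S.symmetries = k + 5 → ∀ x, S.IsFlatAt x) := by
  refine ⟨GL2Structure.CurveBundle.isRegular_pair, GL2Structure.existsUnique_isCanonical hk,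
    fun B B' hB hB' => ⟨GL2Structure.equivalent_iff hk hB hB',
      GL2Structure.germEquivalent_iff hk hB hB'⟩,
    GL2Structure.finrank_symmetryGerms_eq_iff hk, fun _ => GL2Structure.isFlatAt_of_finrank_symmetries hk⟩
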